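/- **Setting.** Write $\mathcal F f(\zeta)=\int f(z)e^{-iz\cdot\zeta}\,dz$; the space-time variables are $(x,y,t)$ with dual variables $(\xi,\mu,\tau)$, and $\omega(\xi,\mu)=\xi^3+\mu^2/\xi$ for $\xi\ne0$. Fix an even smooth function $\eta_0:\mathbb R\to[0,1]$ supported in $[-8/5,8/5]$ and equal to $1$ on $[-5/4,5/4]$. Let $\chi_k(s)=\eta_0(s/2^k)-\eta_0(s/2^{k-1})$ for $k\in\mathbb Z$, $\eta_j=\chi_j$ for $j\ge1$, $I_k=\{\xi:|\xi|\in[2^{k-1},2^{k+1}]\}$ and $k_+=\max(k,0)$. For $f\in L^2(\mathbb R^3)$ supported in $I_k\times\mathbb R\times\mathbb R$ let $$\|f\|_{X_k}=\sum_{j=0}^{2k_+-1}2^{j/2}\|\eta_j(\tau-\omega)f\|_{L^2}+\Big[\sum_{j\ge 2k_+}2^{2j-2k_+}\|\eta_j(\tau-\omega)f\|_{L^2}^2\Big]^{1/2}.$$ For $k\ge100$ and $f\in L^2(\mathbb R^3)$ supported in the set of $(\xi,\mu,\tau)$ with $\xi\in I_k$, $|\xi|\ge1$, $2^{-20}|\xi|^2\le|\mu|\le2^{20}|\xi|^2$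 and $|\tau-\omega(\xi,\mu)|\le|\xi|$ let $$\|f\|_{Y_k}=2^{-k/2}\big\|\mathcal F^{-1}[(\tau-\omega+i)f]\big\|_{L^1_yL^2_{x,t}},$$ and let $Y_k=\{0\}$ for $k\le99$. Let $\|f\|_{X_k+Y_k}=\inf_{f=f_1+f_2}(\|f_1\|_{X_k}+\|f_2\|_{Y_k})$ and, for $f\in L^2(\mathbb R^3)$ supported in $I_k\times\mathbb R\times\mathbb R$, $$\|f\|_{V_k}=\|(1+2^k+i\mu/2^k)f\|_{X_k+Y_k},\qquad \|f\|_{W_k}=\|(\partial_\mu+I)f\|_{X_k+Y_k},\qquad \|f\|_{V_k\cap W_k}=\|f\|_{V_k}+\|f\|_{W_k},$$ where $\partial_\mu$ is a weak derivative. All these norms are $+\infty$ outside of the respective spaces. Let $F$ be the space of all $w\in L^2(\mathbb R^3)$ supported in $\mathbb R^2\times[-2,2]$ with $$\|w\|_F=\Big(\sum_{k\in\mathbb Z}\|\chi_k(\xi)\,\mathcal F(w)\|_{V_k\cap W_k}^2\Big)^{1/2}<\infty,$$ and let $N$ be the space of all $u\in C(\mathbb R:H^{-2}(\mathbb R^2))$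 that are tempered distributions on $\mathbb R^3$, with $\mathcal F(u)$ equal to a locally integrable function on $\{\xi\neq0\}$ and $$\|u\|_N=\Big(\sum_{k\in\mathbb Z}\|\chi_k(\xi)(\tau-\omega(\xi,\mu)+i)^{-1}\mathcal F(u)\|_{V_k\cap W_k}^2\Big)^{1/2}<\infty.$$ For $\phi\in H^{-2}(\mathbb R^2)$ let $W\phi(t)\in H^{-2}(\mathbb R^2)$ be the free evolution, with spatial Fourier transform $e^{it\omega(\xi,\mu)}\widehat\phi(\xi,\mu)$. **Proposition 3.2.** There is a constant $C$, depending only on the choice of $\eta_0$, such that for every $u\in N$ the integral $\int_0^t[Wu(s)](t-s)\,ds$ converges in $H^{-2}(\mathbb R^2)$ for every $t\in\mathbb R$, the truncated Duhamel term $\eta_0(t)\int_0^t[Wu(s)](t-s)\,ds$ belongs to $F$, and $$\Big\|\eta_0(t)\int_0^t[Wu(s)](t-s)\,ds\Big\|_F\le C\,\|u\|_N .$$ -/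

import Mathlib

open MeasureTheory FourierTransform
open scoped ENNReal NNReal SchwartzMap ContDiff

noncomputable section

namespace KPI

/-! ### Points, frequencies, the dispersion relation -/

/-- The plane `ℝ²`, with coordinates `(x, y)` (index `0`, `1`), or `(ξ, μ)` on the frequency side. -/
abbrev Plane : Type := EuclideanSpace ℝ (Fin 2)

/-- Space-time `ℝ³`, with coordinates `(x, y, t)` (index `0`, `1`, `2`), or `(ξ, μ, τ)` on the
frequency side. -/
abbrev Spacetime : Type := EuclideanSpace ℝ (Fin 3)

/-- The dispersion function `ω(ξ, μ) = ξ³ + μ² / ξ` (its value at `ξ = 0` is irrelevant). -/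
def omega (ξ μ : ℝ) : ℝ := ξ ^ 3 + μ ^ 2 / ξ

/-- The modulation `τ - ω(ξ, μ)` of a space-time frequency. -/
def modulation (ζ : Spacetime) : ℝ := ζ 2 - omega (ζ 0) (ζ 1)

/-- The bump functions from which the Littlewood-Paley cutoffs are built: even, smooth, with values
in `[0, 1]`, supported in `[-8/5, 8/5]` and equal to `1` on `[-5/4, 5/4]`. -/
structure IsBump (η : ℝ → ℝ) : Prop where
  smooth : ContDiff ℝ ∞ η
  even : ∀ s, η (-s) = η s
  mem_Icc : ∀ s, η s ∈ Set.Icc (0 : ℝ) 1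
  support_subset : Function.support η ⊆ Set.Icc (-(8 / 5)) (8 / 5)
  eq_one : ∀ s ∈ Set.Icc (-(5 / 4) : ℝ) (5 / 4), η s = 1

/-- The homogeneous dyadic cutoffs `χ_k(s) = η(s / 2^k) - η(s / 2^(k-1))`, `k ∈ ℤ`. -/
def chi (η : ℝ → ℝ) (k : ℤ) (s : ℝ) : ℝ := η (s / 2 ^ k) - η (s / 2 ^ (k - 1))

/-- The inhomogeneous dyadic cutoffs: `η_0 = η` and `η_j = χ_j` for `j ≥ 1`. -/
def etaCut (η : ℝ → ℝ) (j : ℕ) (s : ℝ) : ℝ := if j = 0 then η s else chi η j s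

/-- The dyadic set `I_k = {ξ : |ξ| ∈ [2^(k-1), 2^(k+1)]}`. -/
def dyadic (k : ℤ) : Set ℝ := {ξ | (2 : ℝ) ^ (k - 1) ≤ |ξ| ∧ |ξ| ≤ (2 : ℝ) ^ (k + 1)}

/-- The region `R_KP-I`. -/
def regionKPI : Set Spacetime :=
  {ζ | 1 ≤ |ζ 0| ∧ |ζ 0| ^ 2 / 2 ^ 20 ≤ |ζ 1| ∧ |ζ 1| ≤ 2 ^ 20 * |ζ 0| ^ 2 ∧
    |modulation ζ| ≤ |ζ 0|}

/-! ### The Fourier transform, in the normalization `ℱ f(ζ) = ∫ f(z) e^{-i z·ζ} dz` -/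

/-- The dilation `z ↦ z / (2π)`, which passes between Mathlib's Fourier transform
`∫ f(z) e^{-2πi z·ζ} dz` and the normalization above. -/
def dilation (n : ℕ) : EuclideanSpace ℝ (Fin n) ≃L[ℝ] EuclideanSpace ℝ (Fin n) :=
  ContinuousLinearEquiv.smulLeft (Units.mk0 ((2 * Real.pi)⁻¹) (by positivity))

theorem dilation_apply (n : ℕ) (z : EuclideanSpace ℝ (Fin n)) :
    dilation n z = (2 * Real.pi)⁻¹ • z := rfl

/-- `ℱ φ` for a Schwartz function `φ`. -/
def schwartzFourier (n : ℕ) (φ : 𝓢(EuclideanSpace ℝ (Fin n), ℂ)) :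
    𝓢(EuclideanSpace ℝ (Fin n), ℂ) :=
  SchwartzMap.compCLMOfContinuousLinearEquiv ℂ (dilation n) (𝓕 φ)

theorem schwartzFourier_apply (n : ℕ) (φ : 𝓢(EuclideanSpace ℝ (Fin n), ℂ))
    (ζ : EuclideanSpace ℝ (Fin n)) :
    schwartzFourier n φ ζ = ∫ z, Complex.exp (-(Complex.I * (inner ℝ z ζ : ℝ))) * φ z := by
  have h : schwartzFourier n φ ζ = 𝓕 (φ : EuclideanSpace ℝ (Fin n) → ℂ) (dilation n ζ) := rfl
  rw [h, dilation_apply, Real.fourier_eq']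
  refine integral_congr_ae (Filter.Eventually.of_forall fun z => ?_)
  simp only [inner_smul_right, smul_eq_mul]
  congr 2
  push_cast
  field_simp

/-- `ℱ⁻¹ φ(z) = (2π)^{-n} ∫ φ(ζ) e^{i z·ζ} dζ` for a Schwartz function `φ`. -/
def schwartzFourierInv (n : ℕ) (φ : 𝓢(EuclideanSpace ℝ (Fin n), ℂ)) :
    𝓢(EuclideanSpace ℝ (Fin n), ℂ) :=
  (((2 * Real.pi) ^ n : ℝ) : ℂ)⁻¹ •
    SchwartzMap.compCLMOfContinuousLinearEquiv ℂ (dilation n) (𝓕⁻ φ)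

theorem schwartzFourierInv_apply (n : ℕ) (φ : 𝓢(EuclideanSpace ℝ (Fin n), ℂ))
    (z : EuclideanSpace ℝ (Fin n)) :
    schwartzFourierInv n φ z = (((2 * Real.pi) ^ n : ℝ) : ℂ)⁻¹ *
      ∫ ζ, Complex.exp (Complex.I * (inner ℝ ζ z : ℝ)) * φ ζ := by
  have h : schwartzFourierInv n φ z = (((2 * Real.pi) ^ n : ℝ) : ℂ)⁻¹ *
      𝓕⁻ (φ : EuclideanSpace ℝ (Fin n) → ℂ) (dilation n z) := by
    rw [← SchwartzMap.fourierInv_coe]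
    rfl
  rw [h, dilation_apply, Real.fourierInv_eq']
  congr 1
  refine integral_congr_ae (Filter.Eventually.of_forall fun ζ => ?_)
  simp only [inner_smul_right, smul_eq_mul]
  congr 2
  push_cast
  field_simp

/-- The space-time Fourier transform `ℱ w` of `w ∈ L²(ℝ³)` (Plancherel extension). -/
def l2Fourier (w : Lp ℂ 2 (volume : Measure Spacetime)) : Spacetime → ℂ :=
  fun ζ => (𝓕 w : Lp ℂ 2 (volume : Measure Spacetime)) (dilation 3 ζ)

/-- The inverse space-time Fourier transform `ℱ⁻¹ f` of `f ∈ L²(ℝ³)` (Plancherel extension). -/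
def l2FourierInv (f : Lp ℂ 2 (volume : Measure Spacetime)) : Spacetime → ℂ :=
  fun z => (((2 * Real.pi) ^ 3 : ℝ) : ℂ)⁻¹ *
    (𝓕⁻ f : Lp ℂ 2 (volume : Measure Spacetime)) (dilation 3 z)

/-! ### The dyadic spaces

The norms are defined on functions of `(ξ, μ, τ)`, with values in `[0, ∞]`; they depend only on the
almost everywhere class of the function, and the value is `∞` outside of the space. -/

/-- `f ∈ L²(ℝ³)` and `f` is supported in `I_k × ℝ × ℝ`. -/
def L2Dyadic (k : ℤ) (f : Spacetime → ℂ) : Prop :=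
  MemLp f 2 volume ∧ ∀ᵐ ζ : Spacetime, ζ 0 ∉ dyadic k → f ζ = 0

/-- The `L²` norm of `η_j(τ - ω(ξ, μ)) f`. -/
def modNorm (η : ℝ → ℝ) (j : ℕ) (f : Spacetime → ℂ) : ℝ≥0∞ :=
  eLpNorm (fun ζ => (etaCut η j (modulation ζ) : ℂ) * f ζ) 2 volume

/-- The norm of `X_k`, for `f ∈ L²` supported in `I_k × ℝ × ℝ`; here `k.toNat` is
`k_+ = max(k, 0)`. -/
def xNorm (η : ℝ → ℝ) (k : ℤ) (f : Spacetime → ℂ) : ℝ≥0∞ :=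
  ∑ j ∈ Finset.range (2 * k.toNat), (2 : ℝ≥0∞) ^ ((j : ℝ) / 2) * modNorm η j f +
    (∑' j : Set.Ici (2 * k.toNat),
      (2 : ℝ≥0∞) ^ (2 * (j : ℝ) - 2 * (k.toNat : ℝ)) * modNorm η j f ^ 2) ^ (1 / 2 : ℝ)

/-- The mixed norm of `L¹_y L²_{x,t}`. -/
def l1yL2xtNorm (G : Spacetime → ℂ) : ℝ≥0∞ :=
  ∫⁻ y : ℝ, (∫⁻ x : ℝ, ∫⁻ t : ℝ, ‖G !₂[x, y, t]‖ₑ ^ 2) ^ (1 / 2 : ℝ)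

/-- The functions in `L²(ℝ³)` which satisfy the support condition of `Y_k`; for `k ≤ 99` only `0`
is admitted. -/
def YCarrier (k : ℤ) (f : Spacetime → ℂ) : Prop :=
  MemLp f 2 volume ∧ (∀ᵐ ζ : Spacetime, ¬ (ζ ∈ regionKPI ∧ ζ 0 ∈ dyadic k) → f ζ = 0) ∧
    (k ≤ 99 → f =ᵐ[volume] 0)

/-- The norm of `Y_k`, `2^{-k/2} ‖ℱ⁻¹[(τ - ω(ξ, μ) + i) f]‖_{L¹_y L²_{x,t}}`. For `f` with the
support condition of `Y_k` the function `(τ - ω + i) f` is always in `L²`. -/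
def yNorm (k : ℤ) (f : Spacetime → ℂ) : ℝ≥0∞ :=
  ⨅ h : MemLp (fun ζ => ((modulation ζ : ℂ) + Complex.I) * f ζ) 2 volume,
    (2 : ℝ≥0∞) ^ (-(k : ℝ) / 2) * l1yL2xtNorm (l2FourierInv (h.toLp _))

/-- The norm of `X_k + Y_k`. -/
def xyNorm (η : ℝ → ℝ) (k : ℤ) (f : Spacetime → ℂ) : ℝ≥0∞ :=
  ⨅ (f₁ : Spacetime → ℂ) (f₂ : Spacetime → ℂ) (_ : L2Dyadic k f₁) (_ : YCarrier k f₂)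
    (_ : f =ᵐ[volume] f₁ + f₂), xNorm η k f₁ + yNorm k f₂

/-- The norm of `V_k`, `‖f · (1 + 2^k + i μ / 2^k)‖_{X_k + Y_k}`. -/
def vNorm (η : ℝ → ℝ) (k : ℤ) (f : Spacetime → ℂ) : ℝ≥0∞ :=
  ⨅ _ : L2Dyadic k f,
    xyNorm η k (fun ζ => f ζ * (1 + (2 : ℂ) ^ k + Complex.I * (ζ 1 : ℂ) / (2 : ℂ) ^ k))

/-- `g = ∂_μ f` in the sense of distributions on `ℝ³`. -/
def IsWeakDerivMu (f g : Spacetime → ℂ) : Prop :=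
  ∀ φ : Spacetime → ℂ, ContDiff ℝ ∞ φ → HasCompactSupport φ →
    ∫ ζ, f ζ * fderiv ℝ φ ζ (EuclideanSpace.single 1 1) = -∫ ζ, g ζ * φ ζ

/-- The norm of `W_k`, `‖(∂_μ + I) f‖_{X_k + Y_k}`. The weak derivative `g` is unique up to null
sets when it exists, and it is in `L²` whenever `(∂_μ + I) f ∈ X_k + Y_k`. -/
def wNorm (η : ℝ → ℝ) (k : ℤ) (f : Spacetime → ℂ) : ℝ≥0∞ :=
  ⨅ (_ : L2Dyadic k f) (g : Spacetime → ℂ) (_ : MemLp g 2 volume) (_ : IsWeakDerivMu f g),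
    xyNorm η k (g + f)

/-- The norm of `V_k ∩ W_k`. -/
def vwNorm (η : ℝ → ℝ) (k : ℤ) (f : Spacetime → ℂ) : ℝ≥0∞ := vNorm η k f + wNorm η k f

/-! ### The space `F` -/

/-- `‖w‖_F = (∑_k ‖χ_k(ξ) ℱ w‖²_{V_k ∩ W_k})^{1/2}`. -/
def fNorm (η : ℝ → ℝ) (w : Lp ℂ 2 (volume : Measure Spacetime)) : ℝ≥0∞ :=
  (∑' k : ℤ, vwNorm η k (fun ζ => (chi η k (ζ 0) : ℂ) * l2Fourier w ζ) ^ 2) ^ (1 / 2 : ℝ)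

/-- `w ∈ F`: a function in `L²(ℝ³)`, supported in `ℝ² × [-2, 2]`, of finite norm. -/
def MemF (η : ℝ → ℝ) (w : Lp ℂ 2 (volume : Measure Spacetime)) : Prop :=
  (∀ᵐ z : Spacetime, z 2 ∉ Set.Icc (-2 : ℝ) 2 → w z = 0) ∧ fNorm η w < ⊤

/-! ### The Sobolev space `H^{-2}(ℝ²)` and the free evolution -/

/-- The measure `(1 + |ζ|²)^{-2} dζ` on the frequency plane. -/
def sobolevMeasure : Measure Plane :=
  volume.withDensity fun ζ => ENNReal.ofReal (((1 + ‖ζ‖ ^ 2) ^ 2)⁻¹)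

/-- `H^{-2}(ℝ²)`: the tempered distributions `φ` whose Fourier transform is a function with
`‖φ‖² = ∫ |φ̂(ζ)|² (1 + |ζ|²)^{-2} dζ < ∞`. An element is recorded by its Fourier transform `φ̂`,
so that a term of this type, used as a function, is `φ̂`; the distribution itself is given by
`HNegTwo.pair`. -/
abbrev HNegTwo : Type := Lp ℂ 2 sobolevMeasure

/-- The value `⟨φ, g⟩ = ∫ φ̂ · ℱ⁻¹ g` of `φ ∈ H^{-2}(ℝ²)`, as a tempered distribution on `ℝ²`, at
the Schwartz function `g`. -/
def HNegTwo.pair (φ : HNegTwo) (g : 𝓢(Plane, ℂ)) : ℂ :=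
  ∫ ζ : Plane, φ ζ * schwartzFourierInv 2 g ζ

theorem memLp_freeEvolution (t : ℝ) (φ : HNegTwo) :
    MemLp (fun ζ : Plane => Complex.exp (Complex.I * ((t * omega (ζ 0) (ζ 1) : ℝ) : ℂ)) * φ ζ) 2
      sobolevMeasure := by
  refine (Lp.memLp φ).of_le ?_ (Filter.Eventually.of_forall fun ζ => ?_)
  · refine AEStronglyMeasurable.mul (Measurable.aestronglyMeasurable ?_)
      (Lp.aestronglyMeasurable φ)
    unfold omega
    fun_prop
  · rw [norm_mul, mul_comm Complex.I, Complex.norm_exp_ofReal_mul_I, one_mul]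

/-- The free evolution `W` at time `t` on `H^{-2}(ℝ²)`: the Fourier transform of
`(W φ)(t)` is `e^{i t ω(ξ, μ)} φ̂(ξ, μ)`. -/
def freeEvolution (t : ℝ) (φ : HNegTwo) : HNegTwo := (memLp_freeEvolution t φ).toLp _

/-- The Duhamel term `∫₀ᵗ [W u(s)](t - s) ds`, an integral of an `H^{-2}(ℝ²)`-valued function. -/
def duhamel (u : ℝ → HNegTwo) (t : ℝ) : HNegTwo := ∫ s in (0 : ℝ)..t, freeEvolution (t - s) (u s)

/-! ### Paths in `H^{-2}(ℝ²)` as distributions on `ℝ³`, and the space `N` -/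

/-- The embedding `(x, y) ↦ (x, y, t)`. -/
def atTime (t : ℝ) (p : Plane) : Spacetime := !₂[p 0, p 1, t]

theorem atTime_eq (t : ℝ) (p : Plane) :
    atTime t p = atTime 0 p + EuclideanSpace.single 2 t := by
  ext i
  fin_cases i <;> simp [atTime]

/-- The linear map `(x, y) ↦ (x, y, 0)`. -/
def atZero : Plane →L[ℝ] Spacetime :=
  LinearMap.toContinuousLinearMap
    { toFun := atTime 0
      map_add' := fun p q => by
        ext i
        fin_cases i <;> simp [atTime]
      map_smul' := fun c p => by
        ext i
        fin_cases i <;> simp [atTime] }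

theorem hasTemperateGrowth_atTime (t : ℝ) : (atTime t).HasTemperateGrowth := by
  have h : atTime t = fun p => atZero p + EuclideanSpace.single 2 t := funext (atTime_eq t)
  rw [h]
  exact atZero.hasTemperateGrowth.add (.const _)

theorem antilipschitz_atTime (t : ℝ) : AntilipschitzWith 1 (atTime t) := by
  refine AntilipschitzWith.of_le_mul_dist fun p q => ?_
  rw [EuclideanSpace.dist_eq, EuclideanSpace.dist_eq]
  simp [Fin.sum_univ_succ, atTime]

/-- The slice `Φ(·, ·, t)` of a Schwartz function `Φ` on `ℝ³`. -/
def slice (t : ℝ) (Φ : 𝓢(Spacetime, ℂ)) : 𝓢(Plane, ℂ) :=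
  SchwartzMap.compCLMOfAntilipschitz ℂ (hasTemperateGrowth_atTime t) (antilipschitz_atTime t) Φ

theorem slice_apply (t : ℝ) (Φ : 𝓢(Spacetime, ℂ)) (p : Plane) :
    slice t Φ p = Φ !₂[p 0, p 1, t] := rfl

/-- The tempered distribution `U` on `ℝ³` is the path `u : ℝ → H^{-2}(ℝ²)`, that is
`⟨U, Φ⟩ = ∫ ⟨u(t), Φ(·, ·, t)⟩ dt` for all test functions `Φ`. -/
def IsPath (u : ℝ → HNegTwo) (U : 𝓢'(Spacetime, ℂ)) : Prop :=
  ∀ Φ : 𝓢(Spacetime, ℂ), HasCompactSupport Φ → U Φ = ∫ t : ℝ, (u t).pair (slice t Φ)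

/-- The space-time Fourier transform `ℱ u` of the path `u : ℝ → H^{-2}(ℝ²)` (which is required to
be a tempered distribution on `ℝ³`) is equal to the function `G` on the set `{ξ ≠ 0}`. -/
def HasFourier (u : ℝ → HNegTwo) (G : Spacetime → ℂ) : Prop :=
  LocallyIntegrableOn G {ζ : Spacetime | ζ 0 ≠ 0} volume ∧
    ∃ U : 𝓢'(Spacetime, ℂ), IsPath u U ∧
      ∀ Φ : 𝓢(Spacetime, ℂ), HasCompactSupport Φ → tsupport Φ ⊆ {ζ : Spacetime | ζ 0 ≠ 0} →
        U (schwartzFourier 3 Φ) = ∫ ζ, G ζ * Φ ζ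

/-- `‖u‖_N = (∑_k ‖χ_k(ξ) (τ - ω(ξ, μ) + i)⁻¹ ℱ u‖²_{V_k ∩ W_k})^{1/2}`. All terms of the sum only
see `ℱ u` on `{ξ ≠ 0}`, and the function `G` is unique up to null sets when it exists. -/
def nNorm (η : ℝ → ℝ) (u : ℝ → HNegTwo) : ℝ≥0∞ :=
  ⨅ (G : Spacetime → ℂ) (_ : HasFourier u G),
    (∑' k : ℤ, vwNorm η k (fun ζ =>
      (chi η k (ζ 0) : ℂ) * ((modulation ζ : ℂ) + Complex.I)⁻¹ * G ζ) ^ 2) ^ (1 / 2 : ℝ)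

/-- `u ∈ N`: a path in `C(ℝ : H^{-2}(ℝ²))` of finite norm. -/
def MemN (η : ℝ → ℝ) (u : ℝ → HNegTwo) : Prop := Continuous u ∧ nNorm η u < ⊤

end KPI

end

noncomputable section

namespace KPI

open Filter Function Metric Set Topology Complex Real ComplexConjugate
open ENNReal hiding mul_pos sub_sub_cancel one_lt_two exists_mem_Ioc_zpow

local notation "Amp" => Spacetime → ℂ
local notation "L2" => Lp ℂ 2 (volume : Measure Spacetime)
local notation "κ " z:max => ((modulation z : ℂ) + I)
local notation "toE" => ENNReal.ofReal
local notation "½" => (1 / 2 : ℝ)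

variable {η : ℝ → ℝ} {f g G F : Amp} {p : Plane} {ρ : ℝ → ℂ}

lemma integral_congr {α E : Type*} [MeasurableSpace α] [NormedAddCommGroup E] [NormedSpace ℝ E]
    {μ : Measure α} {f g : α → E} (h : ∀ x, f x = g x) : ∫ x, f x ∂μ = ∫ x, g x ∂μ :=
  integral_congr_ae (.of_forall h)

/-! ### Coordinates -/

def splitAt (i : Fin 3) : Spacetime ≃ᵐ ℝ × Plane := ((MeasurableEquiv.toLp 2 (Fin 3 → ℝ)).symm.trans
    (MeasurableEquiv.piFinSuccAbove (fun _ => ℝ) i)).trans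
    (MeasurableEquiv.prodCongr (MeasurableEquiv.refl ℝ) (MeasurableEquiv.toLp 2 (Fin 2 → ℝ)))

lemma measurePreserving_splitAt (i : Fin 3) : MeasurePreserving (splitAt i) := by
  have h1 := EuclideanSpace.volume_preserving_symm_measurableEquiv_toLp (Fin 3)
  have h2 := volume_preserving_piFinSuccAbove (fun _ : Fin 3 => ℝ) i
  have h3 := (EuclideanSpace.volume_preserving_symm_measurableEquiv_toLp (Fin 2)).symm
  have h4 := (MeasurePreserving.id (volume : Measure ℝ)).prod h3
  exact h4.comp (h2.comp h1)

/-- The point of space-time with second coordinate `y` and remaining coordinates `p`. -/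
def ins (y : ℝ) (p : Plane) : Spacetime := !₂[p 0, y, p 1]

lemma splitAt_atTime (t : ℝ) (p : Plane) : splitAt 2 (atTime t p) = (t, p) := by
  apply Prod.ext
  · rfl
  · ext j; fin_cases j <;> rfl

lemma splitAt_ins (y : ℝ) (p : Plane) : splitAt 1 (ins y p) = (y, p) := by
  apply Prod.ext
  · rfl
  · ext j; fin_cases j <;> rfl

lemma splitAt_symm_two (q : ℝ × Plane) : (splitAt 2).symm q = atTime q.1 q.2 := by
  rw [MeasurableEquiv.symm_apply_eq, splitAt_atTime]

lemma splitAt_symm_one (q : ℝ × Plane) : (splitAt 1).symm q = ins q.1 q.2 := by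
  rw [MeasurableEquiv.symm_apply_eq, splitAt_ins]

lemma measurePreserving_atTime :
    MeasurePreserving (fun q : ℝ × Plane => atTime q.1 q.2) := by
  have h := (measurePreserving_splitAt 2).symm
  have e : ((splitAt 2).symm : ℝ × Plane → Spacetime) = fun q => atTime q.1 q.2 :=
    funext splitAt_symm_two
  rwa [e] at h

lemma measurableEmbedding_atTime :
    MeasurableEmbedding (fun q : ℝ × Plane => atTime q.1 q.2) := by
  have e : ((splitAt 2).symm : ℝ × Plane → Spacetime) = fun q => atTime q.1 q.2 :=
    funext splitAt_symm_two
  rw [← e]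
  exact (splitAt 2).symm.measurableEmbedding

lemma measurePreserving_ins :
    MeasurePreserving (fun q : ℝ × Plane => ins q.1 q.2) := by
  have h := (measurePreserving_splitAt 1).symm
  have e : ((splitAt 1).symm : ℝ × Plane → Spacetime) = fun q => ins q.1 q.2 :=
    funext splitAt_symm_one
  rwa [e] at h

lemma measurableEmbedding_ins :
    MeasurableEmbedding (fun q : ℝ × Plane => ins q.1 q.2) := by
  have e : ((splitAt 1).symm : ℝ × Plane → Spacetime) = fun q => ins q.1 q.2 :=
    funext splitAt_symm_one
  rw [← e]
  exact (splitAt 1).symm.measurableEmbedding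

@[fun_prop]
lemma measurable_atTime : Measurable (fun q : ℝ × Plane => atTime q.1 q.2) :=
  measurableEmbedding_atTime.measurable

@[fun_prop]
lemma measurable_ins : Measurable (fun q : ℝ × Plane => ins q.1 q.2) :=
  measurableEmbedding_ins.measurable

def pt (q : ℝ × ℝ) : Plane := !₂[q.1, q.2]

lemma measurePreserving_pt : MeasurePreserving pt := by
  have h1 := (volume_preserving_finTwoArrow ℝ).symm
  have h2 := (EuclideanSpace.volume_preserving_symm_measurableEquiv_toLp (Fin 2)).symm
  exact h2.comp h1

lemma measurableEmbedding_pt : MeasurableEmbedding pt :=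
  ((MeasurableEquiv.finTwoArrow (α := ℝ)).symm.trans
    (MeasurableEquiv.toLp 2 (Fin 2 → ℝ))).measurableEmbedding

@[fun_prop]
lemma measurable_pt : Measurable pt := measurableEmbedding_pt.measurable

lemma lintegral_plane {F : Plane → ℝ≥0∞} (hF : Measurable F) :
    ∫⁻ p, F p = ∫⁻ a : ℝ, ∫⁻ b : ℝ, F (pt (a, b)) := by
  rw [← measurePreserving_pt.lintegral_comp hF, Measure.volume_eq_prod]
  exact lintegral_prod _ (hF.comp measurable_pt).aemeasurable

lemma lintegral_atTime {F : Spacetime → ℝ≥0∞} (hF : Measurable F) :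
    ∫⁻ z, F z = ∫⁻ p : Plane, ∫⁻ t : ℝ, F (atTime t p) := by
  rw [← measurePreserving_atTime.lintegral_comp hF, Measure.volume_eq_prod]
  exact lintegral_prod_symm _ (hF.comp measurable_atTime).aemeasurable

lemma lintegral_ins {F : Spacetime → ℝ≥0∞} (hF : Measurable F) :
    ∫⁻ z, F z = ∫⁻ p : Plane, ∫⁻ y : ℝ, F (ins y p) := by
  rw [← measurePreserving_ins.lintegral_comp hF, Measure.volume_eq_prod]
  exact lintegral_prod_symm _ (hF.comp measurable_ins).aemeasurable

lemma integral_atTime (hF : Integrable F) :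
    ∫ z, F z = ∫ p : Plane, ∫ t : ℝ, F (atTime t p) := by
  rw [← measurePreserving_atTime.integral_comp measurableEmbedding_atTime, Measure.volume_eq_prod]
  refine integral_prod_symm _ ?_
  rw [← Measure.volume_eq_prod]
  exact measurePreserving_atTime.integrable_comp_of_integrable hF

lemma integrable_atTime_iff :
    Integrable (fun q : ℝ × Plane => F (atTime q.1 q.2)) ↔ Integrable F :=
  measurePreserving_atTime.integrable_comp_emb measurableEmbedding_atTime

lemma atTime_apply_zero (t : ℝ) (p : Plane) : atTime t p 0 = p 0 := rfl
lemma atTime_apply_one (t : ℝ) (p : Plane) : atTime t p 1 = p 1 := rfl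
lemma atTime_apply_two (t : ℝ) (p : Plane) : atTime t p 2 = t := rfl
lemma ins_apply_zero (y : ℝ) (p : Plane) : ins y p 0 = p 0 := rfl
lemma ins_apply_one (y : ℝ) (p : Plane) : ins y p 1 = y := rfl
lemma ins_apply_two (y : ℝ) (p : Plane) : ins y p 2 = p 1 := rfl

def proj (z : Spacetime) : Plane := !₂[z 0, z 1]

lemma proj_atTime (t : ℝ) (p : Plane) : proj (atTime t p) = p := by ext j; fin_cases j <;> rfl

lemma atTime_proj (z : Spacetime) : atTime (z 2) (proj z) = z := by ext j; fin_cases j <;> rfl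

@[fun_prop]
lemma measurable_proj : Measurable proj := by
  have : proj = fun z => (splitAt 2 z).2 := by
    funext z
    conv_rhs => rw [← atTime_proj z, splitAt_atTime]
  rw [this]
  fun_prop

lemma modulation_atTime (t : ℝ) (p : Plane) :
    modulation (atTime t p) = t - omega (p 0) (p 1) := rfl

@[fun_prop]
lemma measurable_omega : Measurable (fun q : ℝ × ℝ => omega q.1 q.2) := by unfold omega; fun_prop

@[fun_prop]
lemma measurable_omega_plane : Measurable (fun p : Plane => omega (p 0) (p 1)) := by
  unfold omega
  fun_prop

@[fun_prop]
lemma measurable_modulation : Measurable modulation := by unfold modulation omega; fun_prop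

lemma ae_atTime {P : Spacetime → Prop} (h : ∀ᵐ z, P z) :
    ∀ᵐ p : Plane, ∀ᵐ t : ℝ, P (atTime t p) := by
  have h1 : ∀ᵐ q : ℝ × Plane, P (atTime q.1 q.2) :=
    measurePreserving_atTime.quasiMeasurePreserving.ae h
  rw [Measure.volume_eq_prod] at h1
  exact Measure.ae_ae_of_ae_prod (Measure.measurePreserving_swap.quasiMeasurePreserving.ae h1)

lemma ae_of_ae_atTime {P : Plane → Prop} (h : ∀ᵐ p, P p) : ∀ᵐ z : Spacetime, P (proj z) := by
  have h1 : ∀ᵐ q : ℝ × Plane, P q.2 := Measure.quasiMeasurePreserving_snd.ae h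
  have h2 := (measurePreserving_splitAt 2).quasiMeasurePreserving.ae h1
  filter_upwards [h2] with z hz
  rw [← atTime_proj z, splitAt_atTime] at hz
  exact hz

/-! ### Square roots and `L²` norms in `[0, ∞]` -/

section

lemma ennreal_le_of_sq_le {a b : ℝ≥0∞} (h : a ^ 2 ≤ b ^ 2) : a ≤ b := by
  by_contra hc
  exact absurd h (not_le.2 (ENNReal.pow_lt_pow_left two_ne_zero (not_le.1 hc)))

lemma ennreal_sqrt_sq (a : ℝ≥0∞) : (a ^ ½) ^ 2 = a := by
  rw [← ENNReal.rpow_natCast, ← ENNReal.rpow_mul]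
  norm_num

lemma ennreal_sq_sqrt (a : ℝ≥0∞) : (a ^ 2) ^ ½ = a := by
  rw [← ENNReal.rpow_natCast, ← ENNReal.rpow_mul]
  norm_num

lemma ennreal_add_sq_le (a b : ℝ≥0∞) : (a + b) ^ 2 ≤ 2 * (a ^ 2 + b ^ 2) := by
  have := rpow_add_le_mul_rpow_add_rpow a b (p := 2) (by norm_num)
  norm_num at this
  exact this

variable {α β : Type*} [MeasurableSpace α] [MeasurableSpace β] {μ : Measure α} {ν : Measure β}

lemma eLpNorm_two_eq {E : Type*} [NormedAddCommGroup E] (f : α → E) :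
    eLpNorm f 2 μ = (∫⁻ x, ‖f x‖ₑ ^ 2 ∂μ) ^ ½ := by
  rw [eLpNorm_eq_lintegral_rpow_enorm_toReal two_ne_zero ofNat_ne_top]
  simp

lemma eLpNorm_two_sq {E : Type*} [NormedAddCommGroup E] (f : α → E) :
    eLpNorm f 2 μ ^ 2 = ∫⁻ x, ‖f x‖ₑ ^ 2 ∂μ := by
  rw [eLpNorm_two_eq, ennreal_sqrt_sq]

lemma lintegral_mul_sq_le {f g : α → ℝ≥0∞} (hf : AEMeasurable f μ) (hg : AEMeasurable g μ) :
    (∫⁻ x, f x * g x ∂μ) ^ 2 ≤ (∫⁻ x, f x ^ 2 ∂μ) * ∫⁻ x, g x ^ 2 ∂μ := by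
  have h := lintegral_mul_le_Lp_mul_Lq μ HolderConjugate.two_two hf hg
  have h2 := pow_le_pow_left' h 2
  simp only [Pi.mul_apply, ENNReal.rpow_two] at h2
  rwa [mul_pow, ennreal_sqrt_sq, ennreal_sqrt_sq] at h2

/-- Minkowski's integral inequality for the exponent `2`. -/
lemma lintegral_lintegral_sq_le [SFinite μ] [SFinite ν] {F : α → β → ℝ≥0∞}
    (hF : Measurable (uncurry F)) :
    (∫⁻ x, (∫⁻ y, F x y ∂ν) ^ 2 ∂μ) ^ ½ ≤ ∫⁻ y, (∫⁻ x, F x y ^ 2 ∂μ) ^ ½ ∂ν := by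
  have hN : AEMeasurable (fun y => (∫⁻ x, F x y ^ 2 ∂μ) ^ ½) ν := by fun_prop
  apply ennreal_le_of_sq_le
  calc _ = ∫⁻ x, ∫⁻ q, F x q.1 * F x q.2 ∂ν.prod ν ∂μ := by
        rw [ennreal_sqrt_sq]
        refine lintegral_congr fun x => ?_
        rw [sq, lintegral_prod_mul] <;> exact hF.of_uncurry_left.aemeasurable
    _ = ∫⁻ q, ∫⁻ x, F x q.1 * F x q.2 ∂μ ∂ν.prod ν :=
        lintegral_lintegral_swap ((hF.comp (measurable_fst.prodMk measurable_snd.fst)).mul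
          (hF.comp (measurable_fst.prodMk measurable_snd.snd))).aemeasurable
    _ ≤ ∫⁻ q, (∫⁻ x, F x q.1 ^ 2 ∂μ) ^ ½ * (∫⁻ x, F x q.2 ^ 2 ∂μ) ^ ½ ∂ν.prod ν := by
        refine lintegral_mono fun q => ennreal_le_of_sq_le ?_
        rw [mul_pow, ennreal_sqrt_sq, ennreal_sqrt_sq]
        exact lintegral_mul_sq_le hF.of_uncurry_right.aemeasurable hF.of_uncurry_right.aemeasurable
    _ = _ := by rw [lintegral_prod_mul hN hN, sq]

end

/-! ### The Fourier transform on `L¹ ∩ L²` -/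

section

variable {E : Type*} [NormedAddCommGroup E] [InnerProductSpace ℝ E] [FiniteDimensional ℝ E]
  [MeasurableSpace E] [BorelSpace E]

section

variable {f : E → ℂ} (h1 : Integrable f)
include h1

lemma continuous_fourier_of_integrable : Continuous (𝓕 f) :=
  VectorFourier.fourierIntegral_continuous continuous_fourierChar
    (by exact continuous_inner) h1

lemma coeFn_fourier_toLp (h2 : MemLp f 2) :
    ((𝓕 (h2.toLp f) : Lp ℂ 2 (volume : Measure E)) : E → ℂ) =ᵐ[volume] 𝓕 f := by
  refine ae_eq_of_integral_contDiff_smul_eq ((Lp.memLp _).locallyIntegrable (by norm_num))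
    (continuous_fourier_of_integrable h1).locallyIntegrable fun g hg hgc => ?_
  have hg₁ : HasCompactSupport (ofRealCLM ∘ g) := hgc.comp_left rfl
  have hg₂ : ContDiff ℝ ∞ (ofRealCLM ∘ g) := by fun_prop
  set G : 𝓢(E, ℂ) := hg₁.toSchwartzMap hg₂ with hG
  have h3 := DFunLike.congr_fun (Lp.fourier_toTemperedDistribution_eq (h2.toLp f)) G
  rw [Lp.toTemperedDistribution_apply, TemperedDistribution.fourier_apply,
    Lp.toTemperedDistribution_apply] at h3
  have h4 : ∫ x, G x • (𝓕 (h2.toLp f) : Lp ℂ 2 (volume : Measure E)) x =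
      ∫ x, g x • (𝓕 (h2.toLp f) : Lp ℂ 2 (volume : Measure E)) x := rfl
  rw [← h4, ← h3]
  have h5 : ∫ x, (𝓕 G) x • (h2.toLp f) x = ∫ x, 𝓕 (G : E → ℂ) x • f x := by
    refine integral_congr_ae ?_
    filter_upwards [h2.coeFn_toLp] with x hx
    rw [hx]
    rfl
  rw [h5]
  have h6 := VectorFourier.integral_fourierIntegral_smul_eq_flip (L := innerₗ E) (μ := volume)
    (ν := volume) continuous_fourierChar (by exact continuous_inner) G.integrable h1
  rw [flip_innerₗ] at h6
  exact h6

lemma eLpNorm_fourier (h2 : MemLp f 2) :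
    eLpNorm (𝓕 f) 2 = eLpNorm f 2 := by
  have h3 := Lp.norm_fourier_eq (h2.toLp f)
  rw [Lp.norm_def, Lp.norm_def, toReal_eq_toReal_iff' (Lp.eLpNorm_ne_top _)
    (Lp.eLpNorm_ne_top _), eLpNorm_congr_ae (coeFn_fourier_toLp h1 h2),
    eLpNorm_congr_ae h2.coeFn_toLp] at h3
  exact h3

end

lemma integral_fourier_conj_fourier {f g : E → ℂ} (hf1 : Integrable f) (hf2 : MemLp f 2)
    (hg1 : Integrable g) (hg2 : MemLp g 2) :
    ∫ x, 𝓕 f x * conj (𝓕 g x) = ∫ x, f x * conj (g x) := by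
  have h := Lp.inner_fourier_eq (hg2.toLp g) (hf2.toLp f)
  rw [L2.inner_def, L2.inner_def] at h
  have e1 : ∫ x, 𝓕 f x * conj (𝓕 g x) = ∫ x, inner ℂ
      ((𝓕 (hg2.toLp g) : Lp ℂ 2 (volume : Measure E)) x)
      ((𝓕 (hf2.toLp f) : Lp ℂ 2 (volume : Measure E)) x) := by
    refine integral_congr_ae ?_
    filter_upwards [coeFn_fourier_toLp hf1 hf2, coeFn_fourier_toLp hg1 hg2] with x hx hy
    rw [hx, hy]
    simp [RCLike.inner_apply]
  have e2 : ∫ x, f x * conj (g x) = ∫ x, inner ℂ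
      ((hg2.toLp g) x) ((hf2.toLp f) x) := by
    refine integral_congr_ae ?_
    filter_upwards [hf2.coeFn_toLp, hg2.coeFn_toLp] with x hx hy
    rw [hx, hy]
    simp [RCLike.inner_apply]
  rw [e1, e2, h]

end

/-! ### The Fourier transform `∫ f(t) e^{-itτ} dt` on the line -/

def ft (f : ℝ → ℂ) (τ : ℝ) : ℂ := ∫ t : ℝ, cexp (-(I * ((t * τ : ℝ) : ℂ))) * f t

lemma ft_eq (f : ℝ → ℂ) (τ : ℝ) : ft f τ = 𝓕 f ((2 * π)⁻¹ * τ) := by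
  rw [fourier_eq', ft]
  refine integral_congr fun t => ?_
  simp only [smul_eq_mul]
  congr 2
  simp
  field_simp

lemma continuous_ft {f : ℝ → ℂ} (h1 : Integrable f) : Continuous (ft f) := by
  have : ft f = fun τ => 𝓕 f ((2 * π)⁻¹ * τ) := funext (ft_eq f)
  rw [this]
  exact (continuous_fourier_of_integrable h1).comp (by fun_prop)

lemma lintegral_comp_two_pi_inv_mul (F : ℝ → ℝ≥0∞) :
    ∫⁻ τ : ℝ, F ((2 * π)⁻¹ * τ) = toE (2 * π) * ∫⁻ x, F x := by
  have hpi : (2 * π)⁻¹ ≠ 0 := by positivity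
  have h := (Homeomorph.mulLeft₀ _ hpi).measurableEmbedding.lintegral_map (μ := volume) F
  have h2 : Measure.map (Homeomorph.mulLeft₀ _ hpi) (volume : Measure ℝ) =
      toE (2 * π) • volume := by
    have := map_volume_mul_left hpi
    rw [inv_inv, abs_of_pos (by positivity)] at this
    exact this
  rw [h2, lintegral_smul_measure, smul_eq_mul] at h
  exact h.symm

/-- Plancherel's theorem on the line. -/
lemma lintegral_ft_sq {f : ℝ → ℂ} (h1 : Integrable f) (h2 : MemLp f 2) :
    ∫⁻ τ, ‖ft f τ‖ₑ ^ 2 = toE (2 * π) * ∫⁻ t, ‖f t‖ₑ ^ 2 := by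
  simp_rw [ft_eq]
  rw [lintegral_comp_two_pi_inv_mul (fun x => ‖𝓕 f x‖ₑ ^ 2), ← eLpNorm_two_sq, ← eLpNorm_two_sq,
    eLpNorm_fourier h1 h2]

lemma integral_ft_conj_ft {f g : ℝ → ℂ} (hf1 : Integrable f) (hf2 : MemLp f 2)
    (hg1 : Integrable g) (hg2 : MemLp g 2) :
    ∫ x, ft f x * conj (ft g x) = 2 * π * ∫ x, f x * conj (g x) := by
  rw [← integral_fourier_conj_fourier hf1 hf2 hg1 hg2]
  simp_rw [ft_eq]
  rw [Measure.integral_comp_mul_left (fun x => 𝓕 f x * conj (𝓕 g x)), inv_inv,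
    abs_of_pos (by positivity), real_smul]
  push_cast
  rfl

/-! ### Dyadic cutoffs -/

section

section

variable (hη : IsBump η)
include hη

lemma IsBump.continuous : Continuous η := hη.smooth.continuous

lemma IsBump.eq_zero {s : ℝ} (h : 8 / 5 < |s|) : η s = 0 := by
  by_contra hc
  have := hη.support_subset hc
  rw [Set.mem_Icc, ← abs_le] at this
  linarith

lemma IsBump.eq_one' {s : ℝ} (h : |s| ≤ 5 / 4) : η s = 1 := hη.eq_one s (abs_le.1 h)

lemma IsBump.abs_le_one (s : ℝ) : |η s| ≤ 1 := by
  have := hη.mem_Icc s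
  rw [abs_le]
  constructor <;> linarith [this.1, this.2]

lemma IsBump.hasCompactSupport : HasCompactSupport η :=
  HasCompactSupport.of_support_subset_isCompact isCompact_Icc hη.support_subset

end

lemma etaCut_zero (s : ℝ) : etaCut η 0 s = η s := by simp [etaCut]

lemma etaCut_succ (j : ℕ) (s : ℝ) : etaCut η (j + 1) s = η (s / 2 ^ (j + 1)) - η (s / 2 ^ j) := by
  rw [etaCut, if_neg (by omega), chi]
  congr 3
  push_cast
  rw [add_sub_cancel_right]
  norm_cast

lemma continuous_etaCut (hη : IsBump η) (j : ℕ) : Continuous (etaCut η j) := by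
  have hc := hη.continuous
  rcases j with _ | j
  · exact hc.congr fun s => (etaCut_zero s).symm
  · have : Continuous fun s => η (s / 2 ^ (j + 1)) - η (s / 2 ^ j) := by fun_prop
    exact this.congr fun s => (etaCut_succ j s).symm

lemma abs_etaCut_le (hη : IsBump η) (j : ℕ) (s : ℝ) : |etaCut η j s| ≤ 1 := by
  rcases j with _ | j
  · rw [etaCut_zero]; exact hη.abs_le_one s
  · rw [etaCut_succ, abs_le]
    have h1 := hη.mem_Icc (s / 2 ^ (j + 1))
    have h2 := hη.mem_Icc (s / 2 ^ j)
    constructor <;> linarith [h1.1, h1.2, h2.1, h2.2]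

lemma sum_etaCut (n : ℕ) (s : ℝ) : ∑ j ∈ Finset.range (n + 1), etaCut η j s = η (s / 2 ^ n) := by
  induction n with
  | zero => simp [etaCut_zero]
  | succ n ih => rw [Finset.sum_range_succ, ih, etaCut_succ]; ring

section

variable (hη : IsBump η)
include hη

lemma abs_le_of_etaCut_ne_zero {j : ℕ} {s : ℝ} (h : etaCut η j s ≠ 0) :
    |s| ≤ 8 / 5 * 2 ^ j := by
  by_contra! hc
  apply h
  have key : ∀ i ≤ j, η (s / 2 ^ i) = 0 := fun i hi => by
    refine hη.eq_zero ?_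
    rw [abs_div, abs_of_pos (by positivity : (0 : ℝ) < 2 ^ i), lt_div_iff₀ (by positivity)]
    refine lt_of_le_of_lt ?_ hc
    gcongr
    norm_num
  rcases j with _ | j
  · rw [etaCut_zero]; simpa using key 0 le_rfl
  · rw [etaCut_succ, key _ le_rfl, key j (by omega), sub_zero]

lemma le_abs_of_etaCut_ne_zero {j : ℕ} {s : ℝ} (h : etaCut η (j + 1) s ≠ 0) :
    5 / 4 * 2 ^ j ≤ |s| := by
  by_contra! hc
  apply h
  have key : ∀ i ≥ j, η (s / 2 ^ i) = 1 := fun i hi => by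
    refine hη.eq_one' ?_
    rw [abs_div, abs_of_pos (by positivity : (0 : ℝ) < 2 ^ i), div_le_iff₀ (by positivity)]
    refine hc.le.trans ?_
    gcongr
    norm_num
  rw [etaCut_succ, key _ (by omega), key j le_rfl, sub_self]

lemma exists_etaCut_pair (s : ℝ) :
    ∃ i : ℕ, ∀ j, etaCut η j s ≠ 0 → j = i ∨ j = i + 1 := by
  classical
  by_cases hex : ∃ i, etaCut η i s ≠ 0
  · refine ⟨Nat.find hex, fun j hj => ?_⟩
    have h1 := Nat.find_min' hex hj
    have h2 := abs_le_of_etaCut_ne_zero hη (Nat.find_spec hex)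
    by_contra! hc
    obtain ⟨m, rfl⟩ : ∃ m, j = m + 1 := ⟨j - 1, by omega⟩
    have h3 := le_abs_of_etaCut_ne_zero hη hj
    have h4 : (2 : ℝ) ^ (Nat.find hex + 1) ≤ 2 ^ m := by
      gcongr
      · norm_num
      · omega
    rw [pow_succ] at h4
    have h5 : (0 : ℝ) < 2 ^ Nat.find hex := by positivity
    linarith
  · push Not at hex; exact ⟨0, fun j hj => absurd (hex j) hj⟩

lemma exists_sum_etaCut_eq_one (s : ℝ) (M : ℕ) :
    ∃ N, M ≤ N ∧ ∑ j ∈ Finset.range N, etaCut η j s = 1 := by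
  obtain ⟨n, hn⟩ := pow_unbounded_of_one_lt |s| (by norm_num : (1 : ℝ) < 2)
  refine ⟨max n M + 1, by omega, ?_⟩
  rw [sum_etaCut]
  refine hη.eq_one' ?_
  rw [abs_div, abs_of_pos (by positivity : (0 : ℝ) < 2 ^ (max n M)), div_le_iff₀ (by positivity)]
  have : (2 : ℝ) ^ n ≤ 2 ^ (max n M) := by
    gcongr
    · norm_num
    · omega
  linarith [abs_nonneg s]

lemma two_pow_le_of_etaCut_ne_zero {j : ℕ} {s : ℝ} (h : etaCut η j s ≠ 0) :
    ((2 : ℝ) ^ j) ^ 2 ≤ 4 * (s ^ 2 + 1) := by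
  rcases j with _ | j
  · nlinarith [sq_nonneg s]
  · have h1 := le_abs_of_etaCut_ne_zero hη h
    have h2 : (2 : ℝ) ^ (j + 1) ≤ 2 * |s| := by
      rw [pow_succ]
      have : (0 : ℝ) < 2 ^ j := by positivity
      linarith
    calc ((2 : ℝ) ^ (j + 1)) ^ 2 ≤ (2 * |s|) ^ 2 := by gcongr
      _ = 4 * s ^ 2 := by rw [mul_pow, sq_abs]; ring
      _ ≤ _ := by nlinarith

lemma tail_sq_le (M : ℕ) (s c B : ℝ) (hc : ∀ j ≥ M, etaCut η j s ≠ 0 → |c| ≤ B * 2 ^ j) :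
    ∃ N, (c * (1 - ∑ j ∈ Finset.range M, etaCut η j s)) ^ 2 ≤
      2 * ∑ j ∈ Finset.Ico M N, (B * 2 ^ j * etaCut η j s) ^ 2 := by
  classical
  obtain ⟨N, hMN, hN⟩ := exists_sum_etaCut_eq_one hη s M
  obtain ⟨i, hi⟩ := exists_etaCut_pair hη s
  refine ⟨N, ?_⟩
  have e1 : 1 - ∑ j ∈ Finset.range M, etaCut η j s = ∑ j ∈ Finset.Ico M N, etaCut η j s := by
    rw [← hN, ← Finset.sum_range_add_sum_Ico _ hMN]; ring
  rw [e1]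
  set S := (Finset.Ico M N).filter (fun j => etaCut η j s ≠ 0) with hS
  have hcard : (S.card : ℝ) ≤ 2 := by
    have : S ⊆ {i, i + 1} := fun j hj => by
      have := hi j (Finset.mem_filter.1 hj).2
      simpa using this
    have := (Finset.card_le_card this).trans Finset.card_le_two
    exact_mod_cast this
  have e2 : ∑ j ∈ Finset.Ico M N, etaCut η j s = ∑ j ∈ S, etaCut η j s := by
    rw [hS, Finset.sum_filter_ne_zero]
  rw [e2, Finset.mul_sum]
  calc (∑ j ∈ S, c * etaCut η j s) ^ 2 ≤ S.card * ∑ j ∈ S, (c * etaCut η j s) ^ 2 :=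
        sq_sum_le_card_mul_sum_sq
    _ ≤ 2 * ∑ j ∈ S, (B * 2 ^ j * etaCut η j s) ^ 2 := by
        refine mul_le_mul hcard (Finset.sum_le_sum fun j hj => ?_) (by positivity) (by norm_num)
        rw [mul_pow, mul_pow _ (etaCut η j s)]
        refine mul_le_mul_of_nonneg_right ?_ (sq_nonneg _)
        have hj' := Finset.mem_filter.1 hj
        have := hc j (Finset.mem_Ico.1 hj'.1).1 hj'.2
        rw [← sq_abs c]
        gcongr
    _ ≤ _ := by gcongr; exact Finset.filter_subset _ _

end

end

/-! ### The norm of `X_k` -/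

section

def hNorm (F : Amp) : ℝ≥0∞ := eLpNorm (fun z => κ z * F z) 2 volume

lemma enorm_modulation_sq (z : Spacetime) :
    ‖(modulation z : ℂ) + I‖ₑ ^ 2 = toE (modulation z ^ 2 + 1) := by
  rw [← ofReal_norm, ← ENNReal.ofReal_pow (norm_nonneg _), ← normSq_eq_norm_sq]
  congr 1
  simp [normSq_apply]
  ring

lemma enorm_ofReal_sq (a : ℝ) : ‖(a : ℂ)‖ₑ ^ 2 = toE (a ^ 2) := by
  rw [← ofReal_norm, ← ENNReal.ofReal_pow (norm_nonneg _), norm_real, norm_eq_abs, sq_abs]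

lemma hNorm_sq (F : Amp) :
    hNorm F ^ 2 = ∫⁻ z, toE (modulation z ^ 2 + 1) * ‖F z‖ₑ ^ 2 := by
  rw [hNorm, eLpNorm_two_sq]
  simp_rw [enorm_mul, mul_pow, enorm_modulation_sq]

lemma modNorm_sq (j : ℕ) (F : Amp) :
    modNorm η j F ^ 2 = ∫⁻ z, toE (etaCut η j (modulation z) ^ 2) * ‖F z‖ₑ ^ 2 := by
  rw [modNorm, eLpNorm_two_sq]
  simp_rw [enorm_mul, mul_pow, enorm_ofReal_sq]

lemma modNorm_le (hη : IsBump η) (j : ℕ) (F : Amp) :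
    modNorm η j F ≤ eLpNorm F 2 volume := by
  refine eLpNorm_mono fun z => ?_
  rw [norm_mul, norm_real]
  exact mul_le_of_le_one_left (norm_nonneg _) (abs_etaCut_le hη j _)

lemma two_pow_mul_modNorm_le (hη : IsBump η) (j : ℕ) (F : Amp) :
    2 ^ j * modNorm η j F ≤ 2 * hNorm F := by
  apply ennreal_le_of_sq_le
  rw [mul_pow, mul_pow, modNorm_sq, hNorm_sq, ← lintegral_const_mul' _ _ (by simp),
    ← lintegral_const_mul' _ _ (by simp)]
  refine lintegral_mono fun z => ?_
  rw [← mul_assoc, ← mul_assoc]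
  refine mul_le_mul' ?_ le_rfl
  rw [show ((2 : ℝ≥0∞) ^ j) ^ 2 = toE (((2 : ℝ) ^ j) ^ 2) by
      rw [ENNReal.ofReal_pow (by positivity), ENNReal.ofReal_pow (by positivity)]; simp,
    show ((2 : ℝ≥0∞)) ^ 2 = toE (2 ^ 2) by rw [ENNReal.ofReal_pow (by positivity)]; simp,
    ← ENNReal.ofReal_mul (by positivity), ← ENNReal.ofReal_mul (by positivity)]
  apply ofReal_le_ofReal
  by_cases h0 : etaCut η j (modulation z) = 0
  · rw [h0]; nlinarith [sq_nonneg (modulation z)]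
  · have h1 := two_pow_le_of_etaCut_ne_zero hη h0
    have h2 : etaCut η j (modulation z) ^ 2 ≤ 1 := by
      rw [← sq_abs]
      have := abs_etaCut_le hη j (modulation z)
      nlinarith [abs_nonneg (etaCut η j (modulation z))]
    nlinarith [sq_nonneg ((2:ℝ) ^ j), sq_nonneg (modulation z)]

/-- The part of the norm of `X_k` with large modulation. -/
def xTail (η : ℝ → ℝ) (K : ℕ) (f : Amp) : ℝ≥0∞ := (∑' j : Ici (2 * K),
      (2 : ℝ≥0∞) ^ (2 * (j : ℝ) - 2 * (K : ℝ)) * modNorm η j f ^ 2) ^ ½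

lemma xNorm_eq (k : ℤ) (f : Amp) :
    xNorm η k f = ∑ j ∈ Finset.range (2 * k.toNat), (2 : ℝ≥0∞) ^ ((j : ℝ) / 2) * modNorm η j f +
      xTail η k.toNat f := rfl

lemma two_pow_mul_tailWeight (K j : ℕ) :
    ((2 : ℝ≥0∞) ^ K) ^ 2 * (2 : ℝ≥0∞) ^ (2 * (j : ℝ) - 2 * (K : ℝ)) = ((2 : ℝ≥0∞) ^ j) ^ 2 := by
  rw [← pow_mul, ← pow_mul, ← ENNReal.rpow_natCast, ← ENNReal.rpow_natCast,
    ← ENNReal.rpow_add _ _ two_ne_zero ofNat_ne_top]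
  congr 1
  push_cast
  ring

lemma xTail_sq (K : ℕ) (f : Amp) : (2 ^ K * xTail η K f) ^ 2 =
      ∑' j : Ici (2 * K), (2 ^ (j : ℕ) * modNorm η j f) ^ 2 := by
  rw [mul_pow, xTail, ennreal_sqrt_sq, ← ENNReal.tsum_mul_left]
  refine tsum_congr fun j => ?_
  rw [← mul_assoc, two_pow_mul_tailWeight, mul_pow]

lemma xTail_sq' (hη : IsBump η) (K : ℕ) (hf : AEStronglyMeasurable f) :
    (2 ^ K * xTail η K f) ^ 2 = ∫⁻ z, ∑' j : Ici (2 * K),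
      toE ((2 ^ (j : ℕ) * etaCut η j (modulation z)) ^ 2) * ‖f z‖ₑ ^ 2 := by
  rw [xTail_sq, lintegral_tsum]
  · refine tsum_congr fun j => ?_
    rw [mul_pow, modNorm_sq, ← lintegral_const_mul' _ _ (by simp)]
    refine lintegral_congr fun z => ?_
    rw [← mul_assoc, mul_pow, ENNReal.ofReal_mul (by positivity)]
    congr 2
    rw [ENNReal.ofReal_pow (by positivity), ENNReal.ofReal_pow (by positivity)]; simp
  · intro j
    refine AEMeasurable.mul (Measurable.aemeasurable ?_) (hf.enorm.pow_const 2)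
    have := (continuous_etaCut hη (j : ℕ)).measurable
    fun_prop

lemma tsum_etaCut_sq_le (hη : IsBump η) (M : ℕ) (s : ℝ) :
    ∑' j : Ici M, toE ((2 ^ (j : ℕ) * etaCut η j s) ^ 2) ≤ 8 * toE (s ^ 2 + 1) := by
  classical
  obtain ⟨i, hi⟩ := exists_etaCut_pair hη s
  have hterm : ∀ j : ℕ, toE ((2 ^ j * etaCut η j s) ^ 2) ≤ 4 * toE (s ^ 2 + 1) := fun j => by
    rw [show (4 : ℝ≥0∞) = toE 4 by simp, ← ENNReal.ofReal_mul (by norm_num)]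
    apply ofReal_le_ofReal
    by_cases h0 : etaCut η j s = 0
    · rw [h0]; nlinarith [sq_nonneg s]
    · have h1 := two_pow_le_of_etaCut_ne_zero hη h0
      have h2 : etaCut η j s ^ 2 ≤ 1 := by
        rw [← sq_abs]
        have := abs_etaCut_le hη j s
        nlinarith [abs_nonneg (etaCut η j s)]
      nlinarith [sq_nonneg ((2:ℝ) ^ j), sq_nonneg s]
  calc _ ≤ ∑' j : ℕ, toE ((2 ^ j * etaCut η j s) ^ 2) :=
        tsum_comp_le_tsum_of_injective Subtype.val_injective
          (fun j : ℕ => toE ((2 ^ j * etaCut η j s) ^ 2))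
    _ = ∑ j ∈ ({i, i + 1} : Finset ℕ), toE ((2 ^ j * etaCut η j s) ^ 2) := by
        refine tsum_eq_sum fun j hj => ?_
        have : etaCut η j s = 0 := by grind
        simp [this]
    _ ≤ ∑ j ∈ ({i, i + 1} : Finset ℕ), 4 * toE (s ^ 2 + 1) := Finset.sum_le_sum fun j _ => hterm j
    _ = 8 * toE (s ^ 2 + 1) := by
        rw [Finset.sum_const, Finset.card_pair (by omega), nsmul_eq_mul, ← mul_assoc]
        norm_num

lemma two_pow_mul_xTail_le (hη : IsBump η) (K : ℕ)
    (hf : AEStronglyMeasurable f) : 2 ^ K * xTail η K f ≤ 3 * hNorm f := by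
  apply ennreal_le_of_sq_le
  rw [xTail_sq' hη K hf, mul_pow, hNorm_sq, ← lintegral_const_mul' _ _ (by simp)]
  refine lintegral_mono fun z => ?_
  rw [ENNReal.tsum_mul_right, ← mul_assoc]
  gcongr
  refine (tsum_etaCut_sq_le hη _ _).trans ?_
  gcongr
  norm_num

/-- The part of `f` with modulation at least `2 ^ (2 K)`. -/
def highPart (η : ℝ → ℝ) (K : ℕ) (f : Amp) (z : Spacetime) : ℂ :=
  ((1 - ∑ j ∈ Finset.range (2 * K), etaCut η j (modulation z) : ℝ) : ℂ) * f z

lemma lintegral_highPart_le (hη : IsBump η) (K : ℕ)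
    (hf : AEStronglyMeasurable f) (c : ℝ → ℝ) {B : ℝ} (hB : 0 ≤ B)
    (hc : ∀ s, ∀ j ≥ 2 * K, etaCut η j s ≠ 0 → |c s| ≤ B * 2 ^ j) :
    eLpNorm (fun z => (c (modulation z) : ℂ) * highPart η K f z) 2 volume ≤
      toE (2 * B) * (2 ^ K * xTail η K f) := by
  apply ennreal_le_of_sq_le
  rw [eLpNorm_two_sq, mul_pow, xTail_sq' hη K hf,
    ← lintegral_const_mul' _ _ (pow_ne_top ofReal_ne_top)]
  refine lintegral_mono fun z => ?_
  obtain ⟨N, hN⟩ := tail_sq_le hη (2 * K) (modulation z) (c (modulation z)) B (hc _)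
  rw [ENNReal.tsum_mul_right, ← mul_assoc, highPart, ← mul_assoc, ← Complex.ofReal_mul, enorm_mul,
    mul_pow, enorm_ofReal_sq]
  gcongr
  refine (ofReal_le_ofReal hN).trans ?_
  have e : (2 : ℝ) * ∑ j ∈ Finset.Ico (2 * K) N, (B * 2 ^ j * etaCut η j (modulation z)) ^ 2 =
      2 * B ^ 2 * ∑ j ∈ Finset.Ico (2 * K) N, (2 ^ j * etaCut η j (modulation z)) ^ 2 := by
    rw [mul_assoc, Finset.mul_sum (Finset.Ico (2 * K) N) _ (B ^ 2)]
    congr 1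
    refine Finset.sum_congr rfl fun j _ => ?_
    ring
  rw [e, ENNReal.ofReal_mul (by positivity), ← ENNReal.ofReal_pow (by positivity)]
  refine mul_le_mul' (ofReal_le_ofReal (by nlinarith [sq_nonneg B])) ?_
  rw [ofReal_sum_of_nonneg (fun _ _ => sq_nonneg _)]
  have h1 : ∑ j ∈ Finset.Ico (2 * K) N, toE ((2 ^ j * etaCut η j (modulation z)) ^ 2) =
      ∑ j ∈ (Finset.Ico (2 * K) N).attach.map ⟨fun j => (⟨j.1, (Finset.mem_Ico.1 j.2).1⟩ :
        Ici (2 * K)), fun a b h => Subtype.ext (congrArg (fun x => x.1) h)⟩,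
      toE ((2 ^ (j : ℕ) * etaCut η j (modulation z)) ^ 2) := by
    rw [Finset.sum_map]
    exact (Finset.sum_attach _ _).symm
  rw [h1]
  exact ENNReal.sum_le_tsum _

end

attribute [fun_prop] IsBump.continuous continuous_etaCut

section

def rootTwo : ℝ≥0∞ := (2 : ℝ≥0∞) ^ ½

lemma rootTwo_eq : rootTwo = toE (Real.sqrt 2) := by
  rw [rootTwo, sqrt_eq_rpow, ← ofReal_rpow_of_pos (by norm_num)]
  simp

lemma rootTwo_sq : rootTwo ^ 2 = 2 := ennreal_sqrt_sq 2

lemma rootTwo_ne_zero : rootTwo ≠ 0 := by simp [rootTwo]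

lemma rootTwo_ne_top : rootTwo ≠ ⊤ := by rw [rootTwo_eq]; exact ofReal_ne_top

lemma rootTwo_pow (j : ℕ) : rootTwo ^ j = (2 : ℝ≥0∞) ^ ((j : ℝ) / 2) := by
  rw [rootTwo, ← ENNReal.rpow_natCast, ← ENNReal.rpow_mul]
  congr 1
  ring

lemma rootTwo_pow_two_mul (j : ℕ) : rootTwo ^ (2 * j) = 2 ^ j := by rw [pow_mul, rootTwo_sq]

lemma five_le_four_mul_rootTwo : 5 ≤ 4 * rootTwo := by
  rw [rootTwo_eq, show (4 : ℝ≥0∞) = toE 4 by simp, ← ENNReal.ofReal_mul (by norm_num),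
    show (5 : ℝ≥0∞) = toE 5 by simp]
  apply ofReal_le_ofReal
  have : (5 / 4 : ℝ) ≤ Real.sqrt 2 := le_sqrt_of_sq_le (by norm_num)
  linarith

lemma four_mul_rootTwo_inv_le : 4 * rootTwo⁻¹ ≤ 3 := by
  rw [rootTwo_eq, ← ofReal_inv_of_pos (by positivity),
    show (4 : ℝ≥0∞) = toE 4 by simp, ← ENNReal.ofReal_mul (by norm_num),
    show (3 : ℝ≥0∞) = toE 3 by simp]
  apply ofReal_le_ofReal
  have : (4 / 3 : ℝ) ≤ Real.sqrt 2 := le_sqrt_of_sq_le (by norm_num)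
  rw [← div_eq_mul_inv, div_le_iff₀ (by positivity)]
  linarith

lemma one_le_rootTwo : 1 ≤ rootTwo := by
  rw [rootTwo]
  exact ENNReal.one_le_rpow (by norm_num) (by norm_num)

lemma sum_rootTwo_pow_le (J : ℕ) : ∑ j ∈ Finset.range J, rootTwo ^ j ≤ 4 * rootTwo ^ J := by
  induction J with
  | zero => simp
  | succ J ih =>
    rw [Finset.sum_range_succ]
    calc _ ≤ 4 * rootTwo ^ J + rootTwo ^ J := by gcongr
      _ = 5 * rootTwo ^ J := by ring
      _ ≤ 4 * rootTwo * rootTwo ^ J := by gcongr; exact five_le_four_mul_rootTwo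
      _ = _ := by ring

lemma sum_rootTwo_inv_pow_le {J M : ℕ} (h : J ≤ M) :
    ∑ j ∈ Finset.Ico J M, rootTwo⁻¹ ^ j ≤ 4 * rootTwo⁻¹ ^ J := by
  suffices H : ∑ j ∈ Finset.Ico J M, rootTwo⁻¹ ^ j + 4 * rootTwo⁻¹ ^ M ≤ 4 * rootTwo⁻¹ ^ J from
    le_self_add.trans H
  induction M, h using Nat.le_induction with
  | base => simp
  | succ M hM ih =>
    rw [Finset.sum_Ico_succ_top hM]
    refine le_trans ?_ ih
    rw [add_assoc]
    gcongr
    calc rootTwo⁻¹ ^ M + 4 * rootTwo⁻¹ ^ (M + 1) = (1 + 4 * rootTwo⁻¹) * rootTwo⁻¹ ^ M := by ring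
      _ ≤ (1 + 3) * rootTwo⁻¹ ^ M := by gcongr; exact four_mul_rootTwo_inv_le
      _ = _ := by norm_num

lemma rootTwo_mul_inv_pow (j : ℕ) : rootTwo ^ j * rootTwo⁻¹ ^ j = 1 := by
  rw [← mul_pow, ENNReal.mul_inv_cancel rootTwo_ne_zero rootTwo_ne_top, one_pow]

/-- Interpolation between `L²` and the weighted space with norm `hNorm` controls `X_k`. -/
lemma xNorm_le (hη : IsBump η) {k : ℤ} {J : ℕ} (hJ : J ≤ 2 * k.toNat)
    (hF : AEStronglyMeasurable F) :
    xNorm η k F ≤ 11 * (rootTwo ^ J * eLpNorm F 2 volume + rootTwo⁻¹ ^ J * hNorm F) := by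
  rw [xNorm_eq, ← Finset.sum_range_add_sum_Ico _ hJ]
  simp_rw [← rootTwo_pow]
  have h1 : ∑ j ∈ Finset.range J, rootTwo ^ j * modNorm η j F ≤
      4 * rootTwo ^ J * eLpNorm F 2 volume := by
    calc _ ≤ ∑ j ∈ Finset.range J, rootTwo ^ j * eLpNorm F 2 volume := by
          gcongr with j
          exact modNorm_le hη j F
      _ ≤ _ := by rw [← Finset.sum_mul]; gcongr; exact sum_rootTwo_pow_le J
  have h2 : ∑ j ∈ Finset.Ico J (2 * k.toNat), rootTwo ^ j * modNorm η j F ≤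
      8 * rootTwo⁻¹ ^ J * hNorm F := by
    calc _ ≤ ∑ j ∈ Finset.Ico J (2 * k.toNat), rootTwo⁻¹ ^ j * (2 * hNorm F) := by
          refine Finset.sum_le_sum fun j _ => ?_
          refine le_trans (le_of_eq ?_) (mul_le_mul' le_rfl (two_pow_mul_modNorm_le hη j F))
          rw [← mul_assoc]
          congr 1
          rw [← rootTwo_pow_two_mul, two_mul, pow_add, ← mul_assoc, mul_comm (rootTwo⁻¹ ^ j),
            rootTwo_mul_inv_pow, one_mul]
      _ ≤ 4 * rootTwo⁻¹ ^ J * (2 * hNorm F) := by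
          rw [← Finset.sum_mul]
          gcongr
          exact sum_rootTwo_inv_pow_le hJ
      _ = _ := by ring
  have h3 : xTail η k.toNat F ≤ 3 * rootTwo⁻¹ ^ J * hNorm F := by
    have h4 := mul_le_mul' (le_refl (rootTwo⁻¹ ^ (2 * k.toNat)))
      (two_pow_mul_xTail_le hη k.toNat hF)
    rw [← mul_assoc, ← rootTwo_pow_two_mul, mul_comm (rootTwo⁻¹ ^ _), rootTwo_mul_inv_pow,
      one_mul] at h4
    refine h4.trans ?_
    rw [← mul_assoc, mul_comm _ (3 : ℝ≥0∞)]
    gcongr 3 * ?_ * _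
    exact pow_le_pow_right_of_le_one' (ENNReal.inv_le_one.2 one_le_rootTwo) hJ
  calc _ ≤ 4 * rootTwo ^ J * eLpNorm F 2 volume + 8 * rootTwo⁻¹ ^ J * hNorm F +
        3 * rootTwo⁻¹ ^ J * hNorm F := by gcongr
    _ = 4 * rootTwo ^ J * eLpNorm F 2 volume + 11 * (rootTwo⁻¹ ^ J * hNorm F) := by ring
    _ ≤ 11 * rootTwo ^ J * eLpNorm F 2 volume + 11 * (rootTwo⁻¹ ^ J * hNorm F) := by
        gcongr; norm_num
    _ = _ := by ring

lemma eLpNorm_le_hNorm (F : Amp) : eLpNorm F 2 volume ≤ hNorm F := by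
  apply ennreal_le_of_sq_le
  rw [eLpNorm_two_sq, hNorm_sq]
  refine lintegral_mono fun z => ?_
  refine le_mul_of_one_le_left' (one_le_ofReal.2 ?_)
  nlinarith [sq_nonneg (modulation z)]

section

variable (hη : IsBump η)
include hη

lemma xNorm_le_hNorm (k : ℤ) (hF : AEStronglyMeasurable F) :
    xNorm η k F ≤ 22 * hNorm F := by
  refine (xNorm_le hη (Nat.zero_le _) hF).trans ?_
  rw [pow_zero, pow_zero, one_mul, one_mul]
  calc _ ≤ 11 * (hNorm F + hNorm F) := by gcongr; exact eLpNorm_le_hNorm F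
    _ = _ := by ring

lemma modNorm_add_le (j : ℕ) (hf : AEStronglyMeasurable f)
    (hg : AEStronglyMeasurable g) : modNorm η j (f + g) ≤ modNorm η j f + modNorm η j g := by
  have hm : AEStronglyMeasurable (fun z => (etaCut η j (modulation z) : ℂ)) volume := by
    have := (continuous_etaCut hη j).measurable
    exact Measurable.aestronglyMeasurable (by fun_prop)
  refine le_trans (le_of_eq ?_) (eLpNorm_add_le (hm.mul hf) (hm.mul hg) (by norm_num))
  rw [modNorm]
  congr 1
  ext z
  simp [mul_add]

lemma xTail_add_le (K : ℕ) (hf : AEStronglyMeasurable f)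
    (hg : AEStronglyMeasurable g) : xTail η K (f + g) ≤ xTail η K f + xTail η K g := by
  set w : ℕ → ℝ≥0∞ := fun j => ((2 : ℝ≥0∞) ^ (2 * (j : ℝ) - 2 * (K : ℝ))) ^ ½ with hw
  have key : ∀ F : Amp, xTail η K F =
      (∫⁻ j : Ici (2 * K), (w j * modNorm η j F) ^ (2 : ℝ) ∂Measure.count) ^ ½ :=
    fun F => by
      rw [lintegral_count, xTail]
      congr 1
      refine tsum_congr fun j => ?_
      rw [ENNReal.rpow_two, mul_pow, hw, ennreal_sqrt_sq]
  rw [key, key, key]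
  refine le_trans ?_ (lintegral_Lp_add_le (measurable_of_countable _).aemeasurable
    (measurable_of_countable _).aemeasurable (by norm_num))
  gcongr with j
  simp only [Pi.add_apply, ← mul_add]
  gcongr
  exact modNorm_add_le hη j hf hg

lemma xNorm_add_le (k : ℤ) (hf : AEStronglyMeasurable f)
    (hg : AEStronglyMeasurable g) : xNorm η k (f + g) ≤ xNorm η k f + xNorm η k g := by
  rw [xNorm_eq, xNorm_eq, xNorm_eq]
  calc _ ≤ ∑ j ∈ Finset.range (2 * k.toNat), ((2 : ℝ≥0∞) ^ ((j : ℝ) / 2) * modNorm η j f +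
        (2 : ℝ≥0∞) ^ ((j : ℝ) / 2) * modNorm η j g) + (xTail η k.toNat f + xTail η k.toNat g) := by
        gcongr with j
        · rw [← mul_add]; gcongr; exact modNorm_add_le hη j hf hg
        · exact xTail_add_le hη _ hf hg
    _ = _ := by rw [Finset.sum_add_distrib]; ring

end

lemma modNorm_congr (j : ℕ) (h : f =ᵐ[volume] g) :
    modNorm η j f = modNorm η j g := by
  refine eLpNorm_congr_ae ?_
  filter_upwards [h] with z hz
  rw [hz]

lemma xNorm_congr (k : ℤ) (h : f =ᵐ[volume] g) :
    xNorm η k f = xNorm η k g := by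
  simp only [xNorm, modNorm_congr _ h]

lemma modNorm_const_smul (j : ℕ) (c : ℂ) (f : Amp) :
    modNorm η j (fun z => c * f z) = ‖c‖ₑ * modNorm η j f := by
  rw [modNorm, modNorm, ← eLpNorm_const_smul c]
  congr 1
  ext z
  simp
  ring

lemma xNorm_const_mul (k : ℤ) (c : ℂ) (f : Amp) :
    xNorm η k (fun z => c * f z) = ‖c‖ₑ * xNorm η k f := by
  simp only [xNorm, modNorm_const_smul]
  rw [mul_add, Finset.mul_sum]
  congr 1
  · grind
  · conv_rhs => rw [← ennreal_sq_sqrt ‖c‖ₑ]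
    rw [← mul_rpow_of_nonneg _ _ (by norm_num), ← ENNReal.tsum_mul_left]
    congr 1
    refine tsum_congr fun j => ?_
    ring

lemma eLpNorm_modulation_mul_highPart_le (hη : IsBump η) (K : ℕ) (hf : AEStronglyMeasurable f) :
    hNorm (highPart η K f) ≤ 6 * (2 ^ K * xTail η K f) := by
  have h := lintegral_highPart_le hη K hf (fun s => Real.sqrt (s ^ 2 + 1)) (B := 3) (by norm_num)
    (fun s j _ hj => by
      have h1 := abs_le_of_etaCut_ne_zero hη hj
      have h2 : (1 : ℝ) ≤ 2 ^ j := one_le_pow₀ (by norm_num)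
      rw [abs_of_nonneg (sqrt_nonneg _), sqrt_le_left (by positivity), ← sq_abs s]
      nlinarith [abs_nonneg s])
  norm_num at h
  refine le_trans (le_of_eq ?_) h
  rw [← ennreal_sq_sqrt (hNorm _), ← ennreal_sq_sqrt (eLpNorm _ _ _), hNorm_sq, eLpNorm_two_sq]
  congr 1
  refine lintegral_congr fun z => ?_
  rw [enorm_mul, mul_pow, enorm_ofReal_sq, sq_sqrt (by positivity)]

lemma two_pow_mul_eLpNorm_highPart_le (hη : IsBump η) (K : ℕ) (hf : AEStronglyMeasurable f) :
    2 ^ K * eLpNorm (highPart η K f) 2 volume ≤ 2 * xTail η K f := by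
  have h := lintegral_highPart_le hη K hf (fun _ => 2 ^ (2 * K)) (B := 1) (by norm_num)
    (fun s j hj _ => by
      rw [one_mul, abs_of_pos (by positivity)]
      exact pow_le_pow_right₀ (by norm_num) hj)
  have e : eLpNorm (fun z => (((2 : ℝ) ^ (2 * K) : ℝ) : ℂ) * highPart η K f z) 2 volume =
      2 ^ K * (2 ^ K * eLpNorm (highPart η K f) 2 volume) := by
    rw [show (fun z => (((2 : ℝ) ^ (2 * K) : ℝ) : ℂ) * highPart η K f z) =
      (((2 : ℝ) ^ (2 * K) : ℝ) : ℂ) • highPart η K f from rfl, eLpNorm_const_smul, ← mul_assoc]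
    congr 1
    rw [← ofReal_norm, norm_real, norm_eq_abs, abs_of_pos (by positivity),
      ENNReal.ofReal_pow (by norm_num), two_mul, pow_add]
    simp
  rw [e] at h
  have h0 : (2 : ℝ≥0∞) ^ K ≠ 0 := by simp
  have ht : (2 : ℝ≥0∞) ^ K ≠ ⊤ := by simp
  refine (ENNReal.mul_le_mul_iff_right h0 ht).1 (h.trans (le_of_eq ?_))
  norm_num
  ring

lemma sum_lowPart_add_highPart (K : ℕ) (f : Amp) :
    f = (∑ j ∈ Finset.range (2 * K), fun z => (etaCut η j (modulation z) : ℂ) * f z) +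
      highPart η K f := by
  ext z
  simp only [Pi.add_apply, Finset.sum_apply, highPart, ← Finset.sum_mul]
  push_cast
  ring

end

/-! ### Integrals over the fibers `{p} × ℝ` -/

section

/-- The mixed norm of `L²_{ξ,μ} L¹_τ`. -/
def mixNorm (f : Amp) : ℝ≥0∞ := (∫⁻ p : Plane, (∫⁻ τ : ℝ, ‖f (atTime τ p)‖ₑ) ^ 2) ^ ½

lemma mixNorm_sq (f : Amp) :
    mixNorm f ^ 2 = ∫⁻ p : Plane, (∫⁻ τ : ℝ, ‖f (atTime τ p)‖ₑ) ^ 2 := ennreal_sqrt_sq _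

lemma measurable_fiber (hf : Measurable f) (p : Plane) :
    Measurable fun τ : ℝ => f (atTime τ p) := by fun_prop

lemma measurable_fiber_prod (hf : Measurable f) :
    Measurable fun q : Plane × ℝ => f (atTime q.2 q.1) := by fun_prop

lemma measurable_lintegral_fiber (hf : Measurable f) :
    Measurable fun p : Plane => ∫⁻ τ : ℝ, ‖f (atTime τ p)‖ₑ := by fun_prop

lemma mixNorm_add_le (hf : Measurable f) (hg : Measurable g) :
    mixNorm (f + g) ≤ mixNorm f + mixNorm g := by
  have h := lintegral_Lp_add_le (p := 2) (μ := (volume : Measure Plane))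
    (measurable_lintegral_fiber hf).aemeasurable (measurable_lintegral_fiber hg).aemeasurable
    (by norm_num)
  simp only [ENNReal.rpow_two, Pi.add_apply] at h
  refine le_trans ?_ h
  rw [mixNorm]
  gcongr with p
  rw [← lintegral_add_left (measurable_fiber hf p).enorm]
  gcongr with τ
  exact enorm_add_le _ _

section

variable {ι : Type*} (S : Finset ι) {f : ι → Amp} (hf : ∀ i, Measurable (f i))
include S hf

lemma measurable_finset_sum : Measurable (∑ i ∈ S, f i) := by fun_prop

lemma mixNorm_sum_le : mixNorm (∑ i ∈ S, f i) ≤ ∑ i ∈ S, mixNorm (f i) := by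
  classical
  induction S using Finset.induction_on with
  | empty => simp [mixNorm]
  | insert a S ha ih =>
    rw [Finset.sum_insert ha, Finset.sum_insert ha]
    refine (mixNorm_add_le (hf a) (measurable_finset_sum _ hf)).trans ?_
    gcongr

end

lemma lintegral_inv_sq_add_sq {R : ℝ} (hR : 0 < R) (w : ℝ) :
    ∫⁻ τ : ℝ, toE ((R ^ 2 + (τ - w) ^ 2)⁻¹) = toE (π / R) := by
  have h1 : (fun τ : ℝ => (R ^ 2 + (τ - w) ^ 2)⁻¹) =
      fun τ => (fun x => (R ^ 2)⁻¹ * (1 + (x / R) ^ 2)⁻¹) (τ - w) := by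
    funext τ
    field_simp
  have hi : Integrable (fun x : ℝ => (R ^ 2)⁻¹ * (1 + (x / R) ^ 2)⁻¹) :=
    (integrable_inv_one_add_sq.comp_div hR.ne').const_mul _
  simp only [funext_iff] at h1
  simp_rw [h1]
  rw [← ofReal_integral_eq_lintegral_ofReal (hi.comp_sub_right w)
    (.of_forall fun τ => by positivity),
    integral_sub_right_eq_self (fun x => (R ^ 2)⁻¹ * (1 + (x / R) ^ 2)⁻¹), integral_const_mul,
    Measure.integral_comp_div (fun x => (1 + x ^ 2)⁻¹), integral_univ_inv_one_add_sq,
    abs_of_pos hR]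
  congr 1
  simp only [smul_eq_mul]
  field_simp

lemma mixNorm_sq_le (hf : Measurable f) {R : ℝ} (hR : 0 < R) :
    mixNorm f ^ 2 ≤ toE (π / R) * ∫⁻ z, toE (R ^ 2 + modulation z ^ 2) * ‖f z‖ₑ ^ 2 := by
  rw [mixNorm_sq, lintegral_atTime (by fun_prop), ← lintegral_const_mul' _ _ ofReal_ne_top]
  refine lintegral_mono fun p => ?_
  rw [← lintegral_inv_sq_add_sq hR (omega (p 0) (p 1))]
  have e : ∀ τ : ℝ, ‖f (atTime τ p)‖ₑ = toE (Real.sqrt ((R ^ 2 + (τ - omega (p 0) (p 1)) ^ 2)⁻¹)) *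
      (toE (Real.sqrt (R ^ 2 + (τ - omega (p 0) (p 1)) ^ 2)) * ‖f (atTime τ p)‖ₑ) := fun τ => by
    rw [← mul_assoc, ← ENNReal.ofReal_mul (sqrt_nonneg _), ← sqrt_mul (by positivity),
      inv_mul_cancel₀ (by positivity)]
    simp
  have hfm := measurable_fiber hf p
  rw [lintegral_congr e]
  refine (lintegral_mul_sq_le (by fun_prop) (by fun_prop)).trans (le_of_eq ?_)
  congr 1
  · refine lintegral_congr fun τ => ?_
    rw [← ENNReal.ofReal_pow (sqrt_nonneg _), sq_sqrt (by positivity)]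
  · refine lintegral_congr fun τ => ?_
    rw [mul_pow, ← ENNReal.ofReal_pow (sqrt_nonneg _), sq_sqrt (by positivity)]
    rfl

/-- The part of `f` with modulation comparable to `2 ^ j`. -/
def modPart (η : ℝ → ℝ) (j : ℕ) (f : Amp) (z : Spacetime) : ℂ :=
  (etaCut η j (modulation z) : ℂ) * f z

lemma eLpNorm_modPart (j : ℕ) (f : Amp) :
    eLpNorm (modPart η j f) 2 volume = modNorm η j f := rfl

lemma measurable_modPart (hη : IsBump η) (j : ℕ) (hf : Measurable f) :
    Measurable (modPart η j f) := by
  have := (continuous_etaCut hη j).measurable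
  unfold modPart
  fun_prop

lemma measurable_highPart (hη : IsBump η) (K : ℕ) (hf : Measurable f) :
    Measurable (highPart η K f) := by
  have := fun j => (continuous_etaCut hη j).measurable
  unfold highPart
  fun_prop

lemma sum_modPart_add_highPart (K : ℕ) (f : Amp) :
    f = (∑ j ∈ Finset.range (2 * K), modPart η j f) + highPart η K f :=
  sum_lowPart_add_highPart K f

section

variable (hη : IsBump η)
include hη

lemma lintegral_weight_modPart_le (j : ℕ) (f : Amp) :
    ∫⁻ z, toE ((2 ^ j) ^ 2 + modulation z ^ 2) * ‖modPart η j f z‖ₑ ^ 2 ≤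
      4 * (2 ^ j * modNorm η j f) ^ 2 := by
  rw [mul_pow, ← mul_assoc, ← eLpNorm_modPart, eLpNorm_two_sq,
    ← lintegral_const_mul' _ _ (by simp [mul_eq_top])]
  refine lintegral_mono fun z => ?_
  by_cases h0 : etaCut η j (modulation z) = 0
  · simp [modPart, h0]
  · refine mul_le_mul' ?_ le_rfl
    rw [show (4 : ℝ≥0∞) * (2 ^ j) ^ 2 = toE (4 * (2 ^ j) ^ 2) by
      rw [ENNReal.ofReal_mul (by norm_num), ENNReal.ofReal_pow (by positivity),
        ENNReal.ofReal_pow (by positivity)]; simp]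
    apply ofReal_le_ofReal
    have h1 := abs_le_of_etaCut_ne_zero hη h0
    have h2 : (0 : ℝ) < 2 ^ j := by positivity
    rw [← sq_abs (modulation z)]
    nlinarith [abs_nonneg (modulation z)]

lemma hNorm_modPart_le (j : ℕ) (f : Amp) :
    hNorm (modPart η j f) ≤ 2 * 2 ^ j * modNorm η j f := by
  apply ennreal_le_of_sq_le
  rw [hNorm_sq]
  have h := lintegral_weight_modPart_le hη j f
  calc _ ≤ ∫⁻ z, toE ((2 ^ j) ^ 2 + modulation z ^ 2) * ‖modPart η j f z‖ₑ ^ 2 := by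
        refine lintegral_mono fun z => mul_le_mul' (ofReal_le_ofReal ?_) le_rfl
        have : (1 : ℝ) ≤ (2 ^ j) ^ 2 := one_le_pow₀ (one_le_pow₀ (by norm_num))
        linarith
    _ ≤ _ := h
    _ = _ := by ring

lemma mixNorm_modPart_le (j : ℕ) (hf : Measurable f) :
    mixNorm (modPart η j f) ≤ 4 * (rootTwo ^ j * modNorm η j f) := by
  apply ennreal_le_of_sq_le
  refine (mixNorm_sq_le (measurable_modPart hη j hf) (R := 2 ^ j) (by positivity)).trans ?_
  refine (mul_le_mul' le_rfl (lintegral_weight_modPart_le hη j f)).trans ?_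
  rw [mul_pow, mul_pow, mul_pow, ← pow_mul rootTwo, mul_comm j 2, rootTwo_pow_two_mul]
  have h1 : toE (π / 2 ^ j) * 2 ^ j ≤ 4 := by
    rw [show (2 : ℝ≥0∞) ^ j = toE (2 ^ j) by
      rw [ENNReal.ofReal_pow (by positivity)]; simp, ← ENNReal.ofReal_mul (by positivity),
      div_mul_cancel₀ _ (by positivity), show (4 : ℝ≥0∞) = toE 4 by simp]
    exact ofReal_le_ofReal pi_le_four
  calc _ = 4 * (toE (π / 2 ^ j) * 2 ^ j) * (2 ^ j * modNorm η j f ^ 2) := by ring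
    _ ≤ 4 * 4 * (2 ^ j * modNorm η j f ^ 2) := by gcongr
    _ = _ := by norm_num

lemma mixNorm_highPart_le (K : ℕ) (hf : Measurable f) :
    mixNorm (highPart η K f) ≤ 13 * xTail η K f := by
  apply ennreal_le_of_sq_le
  refine (mixNorm_sq_le (measurable_highPart hη K hf) (R := 2 ^ K * 2 ^ K) (by positivity)).trans ?_
  set h := highPart η K f with hh
  have e : ∫⁻ z, toE ((2 ^ K * 2 ^ K) ^ 2 + modulation z ^ 2) * ‖h z‖ₑ ^ 2 ≤
      (2 ^ K * (2 ^ K * eLpNorm h 2 volume)) ^ 2 + hNorm h ^ 2 := by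
    rw [← mul_assoc, mul_pow (2 ^ K * 2 ^ K : ℝ≥0∞), hNorm_sq, eLpNorm_two_sq,
      ← lintegral_const_mul' _ _ (by simp [mul_eq_top]),
      ← lintegral_add_left' (by have := measurable_highPart hη K hf; fun_prop)]
    refine lintegral_mono fun z => ?_
    dsimp only
    rw [ENNReal.ofReal_add (by positivity) (by positivity), add_mul]
    refine add_le_add (mul_le_mul' (le_of_eq ?_) le_rfl)
      (mul_le_mul' (ofReal_le_ofReal ?_) le_rfl)
    · rw [ENNReal.ofReal_pow (by positivity), ENNReal.ofReal_mul (by positivity),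
        ENNReal.ofReal_pow (by positivity)]; simp
    · linarith
  have h1 := two_pow_mul_eLpNorm_highPart_le hη K hf.aestronglyMeasurable
  have h2 := eLpNorm_modulation_mul_highPart_le hη K hf.aestronglyMeasurable
  rw [← hh] at h1 h2
  calc _ ≤ toE (π / (2 ^ K * 2 ^ K)) *
        ((2 ^ K * (2 * xTail η K f)) ^ 2 + (6 * (2 ^ K * xTail η K f)) ^ 2) := by
        refine mul_le_mul' le_rfl (e.trans ?_)
        gcongr
    _ = 40 * (toE (π / (2 ^ K * 2 ^ K)) * (2 ^ K * 2 ^ K)) * xTail η K f ^ 2 := by ring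
    _ ≤ 40 * 4 * xTail η K f ^ 2 := by
        gcongr
        rw [show (2 : ℝ≥0∞) ^ K = toE (2 ^ K) by
          rw [ENNReal.ofReal_pow (by positivity)]; simp, ← ENNReal.ofReal_mul (by positivity),
          ← ENNReal.ofReal_mul (by positivity),
          div_mul_cancel₀ _ (by positivity), show (4 : ℝ≥0∞) = toE 4 by simp]
        exact ofReal_le_ofReal pi_le_four
    _ ≤ _ := by rw [mul_pow]; gcongr; norm_num

lemma mixNorm_le_xNorm (k : ℤ) (hf : Measurable f) :
    mixNorm f ≤ 13 * xNorm η k f := by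
  conv_lhs => rw [sum_modPart_add_highPart (η := η) k.toNat f]
  refine (mixNorm_add_le (measurable_finset_sum _ fun j => measurable_modPart hη j hf)
    (measurable_highPart hη _ hf)).trans ?_
  rw [xNorm_eq, mul_add, Finset.mul_sum]
  simp_rw [← rootTwo_pow]
  gcongr
  · refine (mixNorm_sum_le _ fun j => measurable_modPart hη j hf).trans ?_
    gcongr with j
    refine (mixNorm_modPart_le hη j hf).trans ?_
    gcongr
    norm_num
  · exact mixNorm_highPart_le hη _ hf

lemma eLpNorm_le_xNorm (k : ℤ) (hf : Measurable f) :
    eLpNorm f 2 volume ≤ 2 * xNorm η k f := by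
  conv_lhs => rw [sum_modPart_add_highPart (η := η) k.toNat f]
  refine (eLpNorm_add_le
    (measurable_finset_sum _ fun j => measurable_modPart hη j hf).aestronglyMeasurable
    (measurable_highPart hη _ hf).aestronglyMeasurable (by norm_num)).trans ?_
  rw [xNorm_eq, mul_add, Finset.mul_sum]
  simp_rw [← rootTwo_pow]
  gcongr
  · refine (eLpNorm_sum_le (fun j _ => (measurable_modPart hη j hf).aestronglyMeasurable)
      (by norm_num)).trans ?_
    gcongr with j
    rw [eLpNorm_modPart]
    calc modNorm η j f = 1 * (1 * modNorm η j f) := by ring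
      _ ≤ 2 * (rootTwo ^ j * modNorm η j f) := by
        gcongr
        · norm_num
        · exact one_le_pow₀ one_le_rootTwo
  · refine le_trans ?_ (two_pow_mul_eLpNorm_highPart_le hη _ hf.aestronglyMeasurable)
    exact le_mul_of_one_le_left' (one_le_pow₀ (by norm_num))

end

end

attribute [fun_prop] measurable_modPart measurable_highPart

/-! ### Convolution in `τ` -/

section

def convTau (ρ : ℝ → ℂ) (f : Amp) (z : Spacetime) : ℂ :=
  ∫ r : ℝ, ρ r * f (atTime (z 2 - r) (proj z))

lemma convTau_atTime (ρ : ℝ → ℂ) (f : Amp) (τ : ℝ) (p : Plane) :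
    convTau ρ f (atTime τ p) = ∫ r : ℝ, ρ r * f (atTime (τ - r) p) := by
  rw [convTau, proj_atTime, atTime_apply_two]

lemma measurable_shift (hf : Measurable f) :
    Measurable fun q : Spacetime × ℝ => f (atTime (q.1 2 - q.2) (proj q.1)) := by fun_prop

lemma measurable_convTau (hρ : Measurable ρ) (hf : Measurable f) : Measurable (convTau ρ f) := by
  have : StronglyMeasurable fun q : Spacetime × ℝ => ρ q.2 * f (atTime (q.1 2 - q.2) (proj q.1)) :=
    ((hρ.comp measurable_snd).mul (measurable_shift hf)).stronglyMeasurable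
  exact this.integral_prod_right'.measurable

lemma eLpNorm_convTau_le (hρ : Measurable ρ) (hf : Measurable f) :
    eLpNorm (convTau ρ f) 2 volume ≤ (∫⁻ r, ‖ρ r‖ₑ) * eLpNorm f 2 volume := by
  have hm : Measurable (uncurry fun (z : Spacetime) (r : ℝ) =>
      ‖ρ r‖ₑ * ‖f (atTime (z 2 - r) (proj z))‖ₑ) := by fun_prop
  calc eLpNorm (convTau ρ f) 2 volume
      ≤ (∫⁻ z : Spacetime, (∫⁻ r, ‖ρ r‖ₑ * ‖f (atTime (z 2 - r) (proj z))‖ₑ) ^ 2) ^ ½ := by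
        rw [eLpNorm_two_eq]
        gcongr with z
        refine (enorm_integral_le_lintegral_enorm _).trans (le_of_eq ?_)
        simp_rw [enorm_mul]
    _ ≤ ∫⁻ r, (∫⁻ z : Spacetime, (‖ρ r‖ₑ * ‖f (atTime (z 2 - r) (proj z))‖ₑ) ^ 2) ^
        ½ := lintegral_lintegral_sq_le hm
    _ = ∫⁻ r, ‖ρ r‖ₑ * eLpNorm f 2 volume := by
        refine lintegral_congr fun r => ?_
        simp_rw [mul_pow]
        have h1 : Measurable fun z : Spacetime => ‖f (atTime (z 2 - r) (proj z))‖ₑ ^ 2 := by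
          fun_prop
        rw [lintegral_const_mul _ h1, mul_rpow_of_nonneg _ _ (by norm_num),
          ennreal_sq_sqrt, eLpNorm_two_eq, lintegral_atTime h1,
          lintegral_atTime (hf.enorm.pow_const 2)]
        congr 2
        refine lintegral_congr fun p => ?_
        simp_rw [atTime_apply_two, proj_atTime]
        exact lintegral_sub_right_eq_self (fun t => ‖f (atTime t p)‖ₑ ^ 2) r
    _ = _ := lintegral_mul_const _ hρ.enorm

lemma memLp_fiber_ae (hf : Measurable f) (hf2 : MemLp f 2) :
    ∀ᵐ p : Plane, MemLp (fun τ : ℝ => f (atTime τ p)) 2 := by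
  have h := hf2.2
  have h1 : ∫⁻ z, ‖f z‖ₑ ^ 2 < ⊤ := by rw [← eLpNorm_two_sq]; exact pow_lt_top h
  rw [lintegral_atTime (hf.enorm.pow_const 2)] at h1
  have hm : Measurable fun p : Plane => ∫⁻ t : ℝ, ‖f (atTime t p)‖ₑ ^ 2 := by fun_prop
  filter_upwards [ae_lt_top hm h1.ne] with p hp
  refine ⟨(measurable_fiber hf p).aestronglyMeasurable, ?_⟩
  rw [eLpNorm_two_eq]
  exact rpow_lt_top_of_nonneg (by norm_num) hp.ne

lemma integrable_conv_fiber (hρ2 : MemLp ρ 2) {φ : ℝ → ℂ} (hφ : MemLp φ 2) (τ : ℝ) :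
    Integrable fun r : ℝ => ρ r * φ (τ - r) := by
  have h1 : MemLp (fun r : ℝ => φ (τ - r)) 2 :=
    hφ.comp_measurePreserving (Measure.measurePreserving_sub_left volume τ)
  exact MemLp.integrable_mul (p := 2) (q := 2) hρ2 h1

lemma convTau_add_ae (hρ2 : MemLp ρ 2) (hf : Measurable f)
    (hf2 : MemLp f 2) (hg : Measurable g) (hg2 : MemLp g 2) :
    convTau ρ (f + g) =ᵐ[volume] convTau ρ f + convTau ρ g := by
  filter_upwards [ae_of_ae_atTime (memLp_fiber_ae hf hf2), ae_of_ae_atTime (memLp_fiber_ae hg hg2)]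
    with z h1 h2
  rw [← atTime_proj z, Pi.add_apply, convTau_atTime, convTau_atTime, convTau_atTime,
    ← integral_add (integrable_conv_fiber hρ2 h1 _) (integrable_conv_fiber hρ2 h2 _)]
  simp [mul_add]

/-- Convolution in `τ` and multiplication by the modulation. -/
lemma modulation_mul_convTau_ae (hρ2 : MemLp ρ 2)
    (hρ3 : MemLp (fun r : ℝ => (r : ℂ) * ρ r) 2) (hf : Measurable f) (hf2 : MemLp f 2) :
    (fun z => κ z * convTau ρ f z) =ᵐ[volume]
      convTau ρ (fun z => κ z * f z) + convTau (fun r : ℝ => (r : ℂ) * ρ r) f := by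
  filter_upwards [ae_of_ae_atTime (memLp_fiber_ae hf hf2)] with z h1
  set p := proj z with hp
  rw [← atTime_proj z, ← hp, Pi.add_apply, convTau_atTime, convTau_atTime, convTau_atTime,
    ← integral_const_mul]
  have e : ∀ r : ℝ, ρ r * ((((modulation (atTime (z 2 - r) p) : ℝ) : ℂ) + I) *
      f (atTime (z 2 - r) p)) =
      ((modulation (atTime (z 2) p) : ℂ) + I) * (ρ r * f (atTime (z 2 - r) p)) -
      (r : ℂ) * ρ r * f (atTime (z 2 - r) p) := fun r => by
    rw [modulation_atTime, modulation_atTime]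
    push_cast
    ring
  simp_rw [e]
  rw [integral_sub ((integrable_conv_fiber hρ2 h1 _).const_mul _) (integrable_conv_fiber hρ3 h1 _)]
  ring

lemma hNorm_convTau_le (hρ : Measurable ρ) (hρ2 : MemLp ρ 2)
    (hρ3 : MemLp (fun r : ℝ => (r : ℂ) * ρ r) 2) (hf : Measurable f) (hf2 : MemLp f 2) :
    hNorm (convTau ρ f) ≤ (∫⁻ r, ‖ρ r‖ₑ) * hNorm f +
      (∫⁻ r : ℝ, ‖(r : ℂ) * ρ r‖ₑ) * eLpNorm f 2 volume := by
  have hρm : Measurable fun r : ℝ => (r : ℂ) * ρ r := by fun_prop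
  have hfm : Measurable fun z => κ z * f z := by fun_prop
  rw [hNorm, eLpNorm_congr_ae (modulation_mul_convTau_ae hρ2 hρ3 hf hf2)]
  refine (eLpNorm_add_le (measurable_convTau hρ hfm).aestronglyMeasurable
    (measurable_convTau hρm hf).aestronglyMeasurable (by norm_num)).trans ?_
  exact add_le_add (eLpNorm_convTau_le hρ hfm) (eLpNorm_convTau_le hρm hf)

lemma memLp_modPart (hη : IsBump η) (j : ℕ) (hf : Measurable f)
    (hf2 : MemLp f 2) : MemLp (modPart η j f) 2 :=
  ⟨(measurable_modPart hη j hf).aestronglyMeasurable, (modNorm_le hη j f).trans_lt hf2.2⟩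

lemma convTau_sum_ae (hρ2 : MemLp ρ 2) {ι : Type*} (S : Finset ι)
    {f : ι → Amp} (hf : ∀ i, Measurable (f i)) (hf2 : ∀ i, MemLp (f i) 2) :
    convTau ρ (∑ i ∈ S, f i) =ᵐ[volume] ∑ i ∈ S, convTau ρ (f i) := by
  classical
  induction S using Finset.induction_on with
  | empty =>
    refine .of_forall fun z => ?_
    simp [convTau]
  | insert a S ha ih =>
    rw [Finset.sum_insert ha, Finset.sum_insert ha]
    refine (convTau_add_ae hρ2 (hf a) (hf2 a) (measurable_finset_sum _ hf)
      (memLp_finsetSum' _ fun i _ => hf2 i)).trans ?_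
    filter_upwards [ih] with z hz
    rw [Pi.add_apply, Pi.add_apply, hz]

lemma xNorm_sum_le (hη : IsBump η) (k : ℤ) {ι : Type*} (S : Finset ι)
    {f : ι → Amp} (hf : ∀ i, Measurable (f i)) :
    xNorm η k (∑ i ∈ S, f i) ≤ ∑ i ∈ S, xNorm η k (f i) := by
  classical
  induction S using Finset.induction_on with
  | empty =>
    simp only [Finset.sum_empty, nonpos_iff_eq_zero]
    have := xNorm_const_mul (η := η) k 0 0
    simp only [zero_mul, enorm_zero] at this
    exact this
  | insert a S ha ih =>
    rw [Finset.sum_insert ha, Finset.sum_insert ha]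
    refine (xNorm_add_le hη k (hf a).aestronglyMeasurable
      (measurable_finset_sum _ hf).aestronglyMeasurable).trans ?_
    gcongr

/-- Convolution in `τ` is bounded on `X_k`. -/
lemma xNorm_convTau_le (hη : IsBump η) (k : ℤ) (hρ : Measurable ρ)
    (hρ2 : MemLp ρ 2) (hρ3 : MemLp (fun r : ℝ => (r : ℂ) * ρ r) 2)
    (hf : Measurable f) (hf2 : MemLp f 2) :
    xNorm η k (convTau ρ f) ≤
      11 * (8 * (∫⁻ r, ‖ρ r‖ₑ) + 2 * ∫⁻ r : ℝ, ‖(r : ℂ) * ρ r‖ₑ) * xNorm η k f := by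
  set c₀ := ∫⁻ r, ‖ρ r‖ₑ with hc₀
  set c₁ := ∫⁻ r : ℝ, ‖(r : ℂ) * ρ r‖ₑ with hc₁
  set K := k.toNat with hK
  have hlow2 := fun j => memLp_modPart hη j hf hf2
  have hlowm := fun j => measurable_modPart hη j hf
  have hhm := measurable_highPart hη K hf
  have hsum2 : MemLp (∑ j ∈ Finset.range (2 * K), modPart η j f) 2 :=
    memLp_finsetSum' _ fun i _ => hlow2 i
  have hh2 : MemLp (highPart η K f) 2 := by
    have : highPart η K f = f - ∑ j ∈ Finset.range (2 * K), modPart η j f := by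
      rw [eq_sub_iff_add_eq, add_comm]
      exact (sum_modPart_add_highPart K f).symm
    rw [this]
    exact hf2.sub hsum2
  have hdec : convTau ρ f =ᵐ[volume]
      (∑ j ∈ Finset.range (2 * K), convTau ρ (modPart η j f)) + convTau ρ (highPart η K f) := by
    conv_lhs => rw [sum_modPart_add_highPart (η := η) K f]
    refine (convTau_add_ae hρ2 (measurable_finset_sum _ hlowm) hsum2 hhm hh2).trans ?_
    filter_upwards [convTau_sum_ae hρ2 (Finset.range (2 * K)) hlowm hlow2] with z hz
    rw [Pi.add_apply, Pi.add_apply, hz]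
  rw [xNorm_congr k hdec]
  refine (xNorm_add_le hη k
    (measurable_finset_sum _ fun j => measurable_convTau hρ (hlowm j)).aestronglyMeasurable
    (measurable_convTau hρ hhm).aestronglyMeasurable).trans ?_
  rw [xNorm_eq k f, mul_add, Finset.mul_sum]
  refine add_le_add ((xNorm_sum_le hη k _ fun j => measurable_convTau hρ (hlowm j)).trans
    (Finset.sum_le_sum fun j hj => ?_)) ?_
  · refine (xNorm_le hη (J := j) (Finset.mem_range.1 hj).le
      (measurable_convTau hρ (hlowm j)).aestronglyMeasurable).trans ?_
    rw [← rootTwo_pow]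
    have h1 := eLpNorm_convTau_le hρ (hlowm j)
    have h2 := hNorm_convTau_le hρ hρ2 hρ3 (hlowm j) (hlow2 j)
    rw [eLpNorm_modPart] at h1 h2
    have h3 : rootTwo⁻¹ ^ j * hNorm (modPart η j f) ≤ 2 * (rootTwo ^ j * modNorm η j f) := by
      refine (mul_le_mul' le_rfl (hNorm_modPart_le hη j f)).trans (le_of_eq ?_)
      rw [← rootTwo_pow_two_mul, two_mul j, pow_add]
      calc _ = 2 * ((rootTwo ^ j * rootTwo⁻¹ ^ j) * (rootTwo ^ j * modNorm η j f)) := by ring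
        _ = _ := by rw [rootTwo_mul_inv_pow, one_mul]
    have h4 : rootTwo⁻¹ ^ j ≤ rootTwo ^ j :=
      pow_le_pow_left' ((ENNReal.inv_le_one.2 one_le_rootTwo).trans one_le_rootTwo) j
    calc _ ≤ 11 * (rootTwo ^ j * (c₀ * modNorm η j f) + rootTwo⁻¹ ^ j *
          (c₀ * hNorm (modPart η j f) + c₁ * modNorm η j f)) := by gcongr
      _ = 11 * (c₀ * (rootTwo ^ j * modNorm η j f) + (c₀ * (rootTwo⁻¹ ^ j *
          hNorm (modPart η j f)) + c₁ * (rootTwo⁻¹ ^ j * modNorm η j f))) := by ring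
      _ ≤ 11 * (c₀ * (rootTwo ^ j * modNorm η j f) + (c₀ * (2 * (rootTwo ^ j * modNorm η j f)) +
          c₁ * (rootTwo ^ j * modNorm η j f))) := by gcongr
      _ = 11 * (3 * c₀ + 1 * c₁) * (rootTwo ^ j * modNorm η j f) := by ring
      _ ≤ _ := by gcongr <;> norm_num
  · refine (xNorm_le hη (J := 2 * K) le_rfl
      (measurable_convTau hρ hhm).aestronglyMeasurable).trans ?_
    rw [rootTwo_pow_two_mul]
    have h1 := eLpNorm_convTau_le hρ hhm
    have h2 := hNorm_convTau_le hρ hρ2 hρ3 hhm hh2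
    have h3 := two_pow_mul_eLpNorm_highPart_le hη K hf.aestronglyMeasurable
    have h4 : rootTwo⁻¹ ^ (2 * K) * hNorm (highPart η K f) ≤ 6 * xTail η K f := by
      refine (mul_le_mul' le_rfl
        (eLpNorm_modulation_mul_highPart_le hη K hf.aestronglyMeasurable)).trans (le_of_eq ?_)
      rw [← rootTwo_pow_two_mul]
      calc _ = 6 * ((rootTwo ^ (2 * K) * rootTwo⁻¹ ^ (2 * K)) * xTail η K f) := by ring
        _ = _ := by rw [rootTwo_mul_inv_pow, one_mul]
    have h5 : rootTwo⁻¹ ^ (2 * K) ≤ 2 ^ K := by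
      rw [← rootTwo_pow_two_mul]
      exact pow_le_pow_left' ((ENNReal.inv_le_one.2 one_le_rootTwo).trans one_le_rootTwo) _
    calc _ ≤ 11 * (2 ^ K * (c₀ * eLpNorm (highPart η K f) 2 volume) + rootTwo⁻¹ ^ (2 * K) *
          (c₀ * hNorm (highPart η K f) + c₁ * eLpNorm (highPart η K f) 2 volume)) := by gcongr
      _ = 11 * (c₀ * (2 ^ K * eLpNorm (highPart η K f) 2 volume) + (c₀ * (rootTwo⁻¹ ^ (2 * K) *
          hNorm (highPart η K f)) + c₁ * (rootTwo⁻¹ ^ (2 * K) *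
          eLpNorm (highPart η K f) 2 volume))) := by ring
      _ ≤ 11 * (c₀ * (2 ^ K * eLpNorm (highPart η K f) 2 volume) + (c₀ * (6 * xTail η K f) +
          c₁ * (2 ^ K * eLpNorm (highPart η K f) 2 volume))) := by gcongr
      _ ≤ 11 * (c₀ * (2 * xTail η K f) + (c₀ * (6 * xTail η K f) +
          c₁ * (2 * xTail η K f))) := by gcongr
      _ = _ := by ring

end

/-! ### Fourier transforms of test functions -/

section

/-- The Fourier transform `∫ f(t) e^{-itτ} dt` of a Schwartz function, as a Schwartz function. -/
def ftSchwartz (ψ : 𝓢(ℝ, ℂ)) : 𝓢(ℝ, ℂ) := SchwartzMap.compCLMOfContinuousLinearEquiv ℂ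
    (ContinuousLinearEquiv.smulLeft (Units.mk0 ((2 * π)⁻¹ : ℝ) (by positivity))) (𝓕 ψ)

lemma ftSchwartz_apply (ψ : 𝓢(ℝ, ℂ)) (τ : ℝ) : ftSchwartz ψ τ = ft ψ τ := by rw [ft_eq]; rfl

lemma coe_ftSchwartz (ψ : 𝓢(ℝ, ℂ)) : (ftSchwartz ψ : ℝ → ℂ) = ft ψ := funext (ftSchwartz_apply ψ)

/-- Fourier inversion for Schwartz functions on the line. -/
lemma integral_exp_mul_ft (ψ : 𝓢(ℝ, ℂ)) (t : ℝ) :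
    ((2 * π : ℝ) : ℂ)⁻¹ * ∫ r : ℝ, cexp (I * ((r * t : ℝ) : ℂ)) * ft ψ r = ψ t := by
  have h1 : 𝓕⁻ (𝓕 (ψ : ℝ → ℂ)) t = ψ t := by
    rw [← SchwartzMap.fourier_coe, ← SchwartzMap.fourierInv_coe, FourierTransform.fourierInv_fourier_eq]
  rw [fourierInv_eq'] at h1
  rw [← h1]
  have h2 := Measure.integral_comp_mul_left (fun v : ℝ =>
    cexp (↑(2 * π * inner ℝ v t) * I) • 𝓕 (ψ : ℝ → ℂ) v) (2 * π)⁻¹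
  rw [inv_inv, abs_of_pos (by positivity), real_smul] at h2
  rw [← mul_right_inj' (a := ((2 * π : ℝ) : ℂ)) (by
    simp), ← h2, ← mul_assoc, mul_inv_cancel₀ (by
    simp), one_mul]
  refine integral_congr fun r => ?_
  simp only [smul_eq_mul, ft_eq]
  congr 2
  simp
  field_simp

lemma SchwartzMap_memLp_mul (ρ : 𝓢(ℝ, ℂ)) : MemLp (fun r : ℝ => (r : ℂ) * ρ r) 2 := by
  have h : (fun r : ℝ => (r : ℂ)).HasTemperateGrowth := ofRealCLM.hasTemperateGrowth
  have := (SchwartzMap.smulLeftCLM ℂ (fun r : ℝ => (r : ℂ)) ρ).memLp 2 (volume : Measure ℝ)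
  rw [SchwartzMap.smulLeftCLM_apply h] at this
  exact this

lemma SchwartzMap_integrable_mul (ρ : 𝓢(ℝ, ℂ)) : Integrable (fun r : ℝ => (r : ℂ) * ρ r) := by
  have h : (fun r : ℝ => (r : ℂ)).HasTemperateGrowth := ofRealCLM.hasTemperateGrowth
  have := (SchwartzMap.smulLeftCLM ℂ (fun r : ℝ => (r : ℂ)) ρ).integrable (μ := volume)
  rw [SchwartzMap.smulLeftCLM_apply h] at this
  exact this

end

attribute [fun_prop] measurable_convTau

/-! ### Bounded functions with bounded support -/

section

lemma memLp_of_bdd_supp {α : Type*} [MeasurableSpace α] {μ : Measure α} {f : α → ℂ}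
    (hf : AEStronglyMeasurable f μ) {S : Set α} (hSm : MeasurableSet S) (hS : μ S < ⊤) {M : ℝ}
    (hM : ∀ x, ‖f x‖ ≤ M) (hs : ∀ x, x ∉ S → f x = 0) (p : ℝ≥0∞) : MemLp f p μ := by
  have h : MemLp (S.indicator fun _ => M) p μ := memLp_indicator_const p hSm M (Or.inr hS.ne)
  refine h.mono hf (.of_forall fun x => ?_)
  by_cases hx : x ∈ S
  · rw [indicator_of_mem hx, norm_eq_abs]; exact (hM x).trans (le_abs_self M)
  · rw [hs x hx, norm_zero]; exact norm_nonneg _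

/-- A bounded measurable function on space-time, supported in a ball. -/
structure IsNice (G : Amp) (M R : ℝ) : Prop where
  meas : Measurable G
  bound : ∀ z, ‖G z‖ ≤ M
  supp : ∀ z, G z ≠ 0 → ‖z‖ ≤ R

variable {M R : ℝ}

lemma IsNice.memLp (hG : IsNice G M R) (p : ℝ≥0∞) : MemLp G p := by
  refine memLp_of_bdd_supp hG.meas.aestronglyMeasurable
    (isClosed_closedBall (x := (0 : Spacetime)) (ε := R)).measurableSet
    measure_closedBall_lt_top hG.bound (fun z hz => ?_) p
  by_contra hc
  exact hz (by simpa using hG.supp z hc)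

lemma IsNice.integrable (hG : IsNice G M R) : Integrable G := memLp_one_iff_integrable.1 (hG.memLp 1)

lemma IsNice.abs_le (hG : IsNice G M R) {z : Spacetime} (hz : G z ≠ 0) (i : Fin 3) : |z i| ≤ R :=
  (PiLp.norm_apply_le z i).trans (hG.supp z hz)

def pt3 (x y t : ℝ) : Spacetime := !₂[x, y, t]

lemma ins_pt (x y t : ℝ) : ins y (pt (x, t)) = pt3 x y t := rfl
lemma atTime_pt (x y t : ℝ) : atTime t (pt (x, y)) = pt3 x y t := rfl

lemma measurable_pt3 : Measurable fun q : ℝ × ℝ × ℝ => pt3 q.1 q.2.1 q.2.2 :=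
  measurable_ins.comp ((measurable_snd.comp measurable_id).fst.prodMk
    (measurable_pt.comp (measurable_fst.prodMk measurable_snd.snd)))

@[fun_prop]
lemma measurable_pt3' {α : Type*} [MeasurableSpace α] {f g h : α → ℝ} (hf : Measurable f)
    (hg : Measurable g) (hh : Measurable h) : Measurable fun a => pt3 (f a) (g a) (h a) :=
  measurable_pt3.comp (hf.prodMk (hg.prodMk hh))

def ftX (G : Amp) (y ξ t : ℝ) : ℂ := ft (fun x => G (pt3 x y t)) ξ

def ftXT (G : Amp) (y ξ τ : ℝ) : ℂ := ft (fun t => ftX G y ξ t) τ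

/-- The Fourier transform on space-time. -/
def ft3 (G : Amp) (ζ : Spacetime) : ℂ := ∫ z, cexp (-(I * (inner ℝ z ζ : ℝ))) * G z

lemma norm_exp_neg_I_mul (a : ℝ) : ‖cexp (-(I * (a : ℂ)))‖ = 1 := by
  rw [show -(I * (a : ℂ)) = ((-a : ℝ) : ℂ) * I by push_cast; ring, norm_exp_ofReal_mul_I]

lemma norm_exp_I_mul (a : ℝ) : ‖cexp (I * (a : ℂ))‖ = 1 := by simp

lemma enorm_exp_neg_I_mul (a : ℝ) : ‖cexp (-(I * (a : ℂ)))‖ₑ = 1 := by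
  rw [← ofReal_norm, norm_exp_neg_I_mul, ENNReal.ofReal_one]

lemma measurable_ft_of {α : Type*} [MeasurableSpace α] {F : α → ℝ → ℂ}
    (hF : Measurable (uncurry F)) {τ : α → ℝ} (hτ : Measurable τ) :
    Measurable fun a => ft (F a) (τ a) := by
  have : StronglyMeasurable (fun q : α × ℝ =>
      cexp (-(I * ((q.2 * τ q.1 : ℝ) : ℂ))) * F q.1 q.2) := by fun_prop
  exact this.integral_prod_right'.measurable

lemma measurable_ftX (hG : Measurable G) {α : Type*} [MeasurableSpace α] {f g h : α → ℝ}
    (hf : Measurable f) (hg : Measurable g) (hh : Measurable h) :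
    Measurable fun a => ftX G (f a) (g a) (h a) := by
  refine measurable_ft_of (F := fun a x => G (pt3 x (f a) (h a))) (hG.comp ?_) hg
  fun_prop

lemma measurable_ftXT (hG : Measurable G) {α : Type*} [MeasurableSpace α] {f g h : α → ℝ}
    (hf : Measurable f) (hg : Measurable g) (hh : Measurable h) :
    Measurable fun a => ftXT G (f a) (g a) (h a) := by
  refine measurable_ft_of (F := fun a t => ftX G (f a) (g a) t) ?_ hh
  exact measurable_ftX hG (hf.comp measurable_fst) (hg.comp measurable_fst) measurable_snd

lemma norm_ft_le_of_bdd {f : ℝ → ℂ} {M R : ℝ} (hR : 0 ≤ R)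
    (hM : ∀ x, ‖f x‖ ≤ M) (hs : ∀ x, f x ≠ 0 → |x| ≤ R) (τ : ℝ) : ‖ft f τ‖ ≤ M * (2 * R) := by
  have h0 : ∀ x, x ∉ Icc (-R) R → cexp (-(I * ((x * τ : ℝ) : ℂ))) * f x = 0 := fun x hx => by
      rw [mul_eq_zero]; right
      by_contra hc
      exact hx (abs_le.1 (hs x hc))
  rw [ft, ← setIntegral_eq_integral_of_forall_compl_eq_zero h0]
  have := norm_setIntegral_le_of_norm_le_const (μ := volume) (s := Icc (-R) R) (C := M)
    (f := fun x => cexp (-(I * ((x * τ : ℝ) : ℂ))) * f x) (by simp) (fun x _ => by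
      rw [norm_mul, norm_exp_neg_I_mul, one_mul]; exact hM x)
  refine this.trans (le_of_eq ?_)
  rw [Measure.real, volume_Icc, toReal_ofReal (by linarith)]
  ring

lemma ft_eq_zero {f : ℝ → ℂ} (h : ∀ x, f x = 0) (τ : ℝ) : ft f τ = 0 := by simp [ft, h]

section

variable {f : ℝ → ℂ} (hf : Measurable f) {M R : ℝ} (hM : ∀ x, ‖f x‖ ≤ M) (hs : ∀ x, f x ≠ 0 → |x| ≤ R)
include hf hM hs

lemma memLp_of_bdd_line (p : ℝ≥0∞) : MemLp f p := by
  refine memLp_of_bdd_supp hf.aestronglyMeasurable (measurableSet_Icc (a := -R) (b := R))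
    (by simp) hM (fun x hx => ?_) p
  by_contra hc
  exact hx (abs_le.1 (hs x hc))

lemma integrable_of_bdd_line : Integrable f :=
  memLp_one_iff_integrable.1 (memLp_of_bdd_line hf hM hs 1)

end

section

variable (hG : IsNice G M R)
include hG

lemma IsNice.measurable_line (y t : ℝ) : Measurable fun x => G (pt3 x y t) :=
  hG.meas.comp (measurable_pt3' measurable_id measurable_const measurable_const)

lemma IsNice.supp_line (y t x : ℝ) (h : G (pt3 x y t) ≠ 0) : |x| ≤ max R 0 :=
  (hG.abs_le h 0).trans (le_max_left _ _)

lemma IsNice.norm_ftX_le (y ξ t : ℝ) : ‖ftX G y ξ t‖ ≤ M * (2 * max R 0) :=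
  norm_ft_le_of_bdd (le_max_right _ _) (fun x => hG.bound _) (hG.supp_line y t) ξ

lemma IsNice.ftX_supp_y {y ξ t : ℝ} (h : ftX G y ξ t ≠ 0) : |y| ≤ max R 0 := by
  by_contra hc
  apply h
  refine ft_eq_zero (fun x => ?_) _
  by_contra hx
  exact hc ((hG.abs_le hx 1).trans (le_max_left _ _))

lemma IsNice.ftX_supp_t {y ξ t : ℝ} (h : ftX G y ξ t ≠ 0) : |t| ≤ max R 0 := by
  by_contra hc
  apply h
  refine ft_eq_zero (fun x => ?_) _
  by_contra hx
  exact hc ((hG.abs_le hx 2).trans (le_max_left _ _))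

lemma IsNice.measurable_ftX_line (y ξ : ℝ) : Measurable fun t => ftX G y ξ t :=
  measurable_ftX hG.meas measurable_const measurable_const measurable_id

lemma IsNice.norm_ftXT_le (y ξ τ : ℝ) : ‖ftXT G y ξ τ‖ ≤ M * (2 * max R 0) * (2 * max R 0) :=
  norm_ft_le_of_bdd (le_max_right _ _) (fun t => hG.norm_ftX_le y ξ t)
    (fun _ ht => hG.ftX_supp_t ht) τ

lemma IsNice.ftXT_supp_y {y ξ τ : ℝ} (h : ftXT G y ξ τ ≠ 0) : |y| ≤ max R 0 := by
  by_contra hc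
  apply h
  refine ft_eq_zero (fun x => ?_) _
  by_contra hx
  exact hc (hG.ftX_supp_y hx)

lemma IsNice.lintegral_ftX_sq (y t : ℝ) : ∫⁻ ξ, ‖ftX G y ξ t‖ₑ ^ 2 =
    toE (2 * π) * ∫⁻ x, ‖G (pt3 x y t)‖ₑ ^ 2 :=
  lintegral_ft_sq (integrable_of_bdd_line (hG.measurable_line y t) (fun x => hG.bound _)
    (hG.supp_line y t)) (memLp_of_bdd_line (hG.measurable_line y t) (fun x => hG.bound _)
    (hG.supp_line y t) 2)

lemma IsNice.lintegral_ftXT_sq (y ξ : ℝ) : ∫⁻ τ, ‖ftXT G y ξ τ‖ₑ ^ 2 =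
    toE (2 * π) * ∫⁻ t, ‖ftX G y ξ t‖ₑ ^ 2 :=
  lintegral_ft_sq (integrable_of_bdd_line (hG.measurable_ftX_line y ξ)
    (fun t => hG.norm_ftX_le y ξ t) (fun _ => hG.ftX_supp_t))
    (memLp_of_bdd_line (hG.measurable_ftX_line y ξ)
    (fun t => hG.norm_ftX_le y ξ t) (fun _ => hG.ftX_supp_t) 2)

lemma IsNice.lintegral_lintegral_ftX_sq (y : ℝ) : ∫⁻ ξ, ∫⁻ t, ‖ftX G y ξ t‖ₑ ^ 2 =
    toE (2 * π) * ∫⁻ x, ∫⁻ t, ‖G (pt3 x y t)‖ₑ ^ 2 := by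
  rw [lintegral_lintegral_swap]
  · simp_rw [hG.lintegral_ftX_sq]
    rw [lintegral_const_mul' _ _ ofReal_ne_top]
    congr 1
    refine lintegral_lintegral_swap ?_
    exact ((hG.meas.comp (measurable_pt3' measurable_snd measurable_const
      measurable_fst)).enorm.pow_const 2).aemeasurable
  · exact ((measurable_ftX hG.meas measurable_const measurable_fst
      measurable_snd).enorm.pow_const 2).aemeasurable

lemma IsNice.lintegral_lintegral_ftXT_sq (y : ℝ) : ∫⁻ ξ, ∫⁻ τ, ‖ftXT G y ξ τ‖ₑ ^ 2 =
    toE (2 * π) ^ 2 * ∫⁻ x, ∫⁻ t, ‖G (pt3 x y t)‖ₑ ^ 2 := by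
  simp_rw [hG.lintegral_ftXT_sq]
  rw [lintegral_const_mul' _ _ ofReal_ne_top, hG.lintegral_lintegral_ftX_sq]
  ring

lemma IsNice.lintegral_sqrt_ftXT : ∫⁻ y, (∫⁻ ξ, ∫⁻ τ, ‖ftXT G y ξ τ‖ₑ ^ 2) ^ ½ =
    toE (2 * π) * l1yL2xtNorm G := by
  simp_rw [hG.lintegral_lintegral_ftXT_sq]
  rw [l1yL2xtNorm, ← lintegral_const_mul' _ _ ofReal_ne_top]
  refine lintegral_congr fun y => ?_
  rw [mul_rpow_of_nonneg _ _ (by norm_num), ennreal_sq_sqrt]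
  rfl

lemma IsNice.integrable_exp_mul (ζ : Spacetime) :
    Integrable fun z => cexp (-(I * (inner ℝ z ζ : ℝ))) * G z := by
  refine hG.integrable.bdd_mul (c := 1) ?_ ?_
  · fun_prop
  · exact .of_forall fun z => (norm_exp_neg_I_mul _).le

end

end

/-! ### The space-time Fourier transform on `L²` -/

section

lemma integral_dilation {n : ℕ} (F : EuclideanSpace ℝ (Fin n) → ℂ) :
    ∫ z, F (dilation n z) = ((2 * π) ^ n : ℝ) * ∫ z, F z := by
  simp_rw [dilation_apply]
  rw [Measure.integral_comp_smul]
  simp only [finrank_euclideanSpace, Fintype.card_fin, inv_pow, inv_inv, real_smul]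
  rw [abs_of_pos (by positivity)]

lemma measurePreserving_dilation_smul : Measure.map (dilation 3) (volume : Measure Spacetime) =
    toE ((2 * π) ^ 3) • volume := by
  have h := Measure.map_addHaar_smul (volume : Measure Spacetime)
    (r := (2 * π)⁻¹) (by positivity)
  rw [finrank_euclideanSpace, Fintype.card_fin, inv_pow, inv_inv, abs_of_pos (by positivity)] at h
  exact h

lemma quasiMeasurePreserving_dilation :
    Measure.QuasiMeasurePreserving (dilation 3) (volume : Measure Spacetime) volume := by
  refine ⟨(dilation 3).continuous.measurable, ?_⟩
  rw [measurePreserving_dilation_smul]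
  exact Measure.smul_absolutelyContinuous

lemma eLpNorm_comp_dilation (hF : AEStronglyMeasurable F) :
    eLpNorm (fun z => F (dilation 3 z)) 2 = toE ((2 * π) ^ 3) ^ ½ * eLpNorm F 2 := by
  have h := eLpNorm_map_measure (p := 2) (μ := volume) (f := (dilation 3)) (g := F)
    (by rw [measurePreserving_dilation_smul]; exact hF.smul_measure _)
    (dilation 3).continuous.measurable.aemeasurable
  rw [show (fun z => F (dilation 3 z)) = F ∘ dilation 3 from rfl, ← h,
    measurePreserving_dilation_smul,
    eLpNorm_smul_measure_of_ne_zero (by simp; positivity), smul_eq_mul]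
  simp

lemma measurable_l2Fourier (w : L2) :
    Measurable (l2Fourier w) :=
  (Lp.stronglyMeasurable _).measurable.comp (dilation 3).continuous.measurable

lemma measurable_l2FourierInv (w : L2) :
    Measurable (l2FourierInv w) :=
  ((Lp.stronglyMeasurable _).measurable.comp (dilation 3).continuous.measurable).const_mul _

lemma eLpNorm_l2Fourier (w : L2) :
    eLpNorm (l2Fourier w) 2 = toE ((2 * π) ^ 3) ^ ½ * eLpNorm w 2 := by
  have h1 := eLpNorm_comp_dilation (Lp.aestronglyMeasurable (𝓕 w : L2))
  have h2 := Lp.norm_fourier_eq w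
  rw [Lp.norm_def, Lp.norm_def, toReal_eq_toReal_iff' (Lp.eLpNorm_ne_top _)
    (Lp.eLpNorm_ne_top _)] at h2
  rw [← h2, ← h1]
  rfl

lemma memLp_l2Fourier (w : L2) : MemLp (l2Fourier w) 2 := by
  refine ⟨(measurable_l2Fourier w).aestronglyMeasurable, ?_⟩
  rw [eLpNorm_l2Fourier]
  exact mul_lt_top (rpow_lt_top_of_nonneg (by norm_num) ofReal_ne_top)
    (Lp.eLpNorm_lt_top _)

lemma memLp_l2FourierInv (w : L2) :
    MemLp (l2FourierInv w) 2 := by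
  refine MemLp.const_mul ?_ _
  refine ⟨((Lp.stronglyMeasurable _).measurable.comp
    (dilation 3).continuous.measurable).aestronglyMeasurable, ?_⟩
  rw [eLpNorm_comp_dilation (Lp.aestronglyMeasurable _)]
  exact mul_lt_top (rpow_lt_top_of_nonneg (by norm_num) ofReal_ne_top)
    (Lp.eLpNorm_lt_top _)

lemma l2Fourier_sub (v w : L2) :
    l2Fourier (v - w) =ᵐ[volume] l2Fourier v - l2Fourier w := by
  have h : (𝓕 (v - w) : L2) = 𝓕 v - 𝓕 w := (Lp.fourierTransformₗᵢ Spacetime ℂ).map_sub v w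
  have h2 := quasiMeasurePreserving_dilation.ae
    (Lp.coeFn_sub (𝓕 v : L2) (𝓕 w))
  filter_upwards [h2] with z hz
  rw [l2Fourier, h, hz]
  rfl

lemma l2FourierInv_sub (v w : L2) :
    l2FourierInv (v - w) =ᵐ[volume] l2FourierInv v - l2FourierInv w := by
  have h : (𝓕⁻ (v - w) : L2) = 𝓕⁻ v - 𝓕⁻ w := (Lp.fourierTransformₗᵢ Spacetime ℂ).symm.map_sub v w
  have h2 := quasiMeasurePreserving_dilation.ae
    (Lp.coeFn_sub (𝓕⁻ v : L2) (𝓕⁻ w))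
  filter_upwards [h2] with z hz
  rw [l2FourierInv, h, hz]
  simp [l2FourierInv, mul_sub]

def undilate {n : ℕ} (φ : 𝓢(EuclideanSpace ℝ (Fin n), ℂ)) : 𝓢(EuclideanSpace ℝ (Fin n), ℂ) :=
  SchwartzMap.compCLMOfContinuousLinearEquiv ℂ (dilation n).symm φ

section

variable {n : ℕ} (φ : 𝓢(EuclideanSpace ℝ (Fin n), ℂ)) (z : EuclideanSpace ℝ (Fin n))
include φ z

lemma undilate_dilation :
    undilate φ (dilation n z) = φ z := by
  change φ ((dilation n).symm (dilation n z)) = φ z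
  rw [ContinuousLinearEquiv.symm_apply_apply]

lemma fourier_undilate : (((2 * π) ^ n : ℝ) : ℂ) * (𝓕 (undilate φ)) z = schwartzFourier n φ z := by
  rw [schwartzFourier_apply]
  have h : (𝓕 (undilate φ)) z = 𝓕 (undilate φ : EuclideanSpace ℝ (Fin n) → ℂ) z := rfl
  rw [h, fourier_eq', ← integral_dilation (fun v => cexp (↑(-2 * π * inner ℝ v z) * I) • undilate φ v)]
  refine integral_congr fun v => ?_
  simp only [undilate_dilation, smul_eq_mul]
  simp only [dilation_apply, inner_smul_left]
  congr 2
  simp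
  field_simp

lemma fourierInv_undilate : (𝓕⁻ (undilate φ)) z = schwartzFourierInv n φ z := by
  rw [schwartzFourierInv_apply]
  have h : (𝓕⁻ (undilate φ)) z = 𝓕⁻ (undilate φ : EuclideanSpace ℝ (Fin n) → ℂ) z := by
    rw [← SchwartzMap.fourierInv_coe]
  have hne : (((2 * π) ^ n : ℝ) : ℂ) ≠ 0 := by simp
  rw [h, fourierInv_eq', eq_inv_mul_iff_mul_eq₀ hne,
    ← integral_dilation (fun v => cexp (↑(2 * π * inner ℝ v z) * I) • undilate φ v)]
  refine integral_congr fun v => ?_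
  simp only [undilate_dilation, smul_eq_mul]
  simp only [dilation_apply, inner_smul_left]
  congr 2
  simp
  field_simp

end

lemma integral_l2Fourier_mul (w : L2) (φ : 𝓢(Spacetime, ℂ)) :
    ∫ ζ, l2Fourier w ζ * φ ζ = ∫ z, w z * schwartzFourier 3 φ z := by
  have h3 := DFunLike.congr_fun (Lp.fourier_toTemperedDistribution_eq w) (undilate φ)
  rw [Lp.toTemperedDistribution_apply, TemperedDistribution.fourier_apply,
    Lp.toTemperedDistribution_apply] at h3
  have h4 : ∫ ζ, l2Fourier w ζ * φ ζ = ∫ ζ, (fun v => undilate φ v •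
      (𝓕 w : L2) v) (dilation 3 ζ) := by
    refine integral_congr fun v => ?_
    simp only [undilate_dilation, smul_eq_mul, l2Fourier]
    ring
  rw [h4, integral_dilation (fun v => undilate φ v • (𝓕 w : L2) v), ← h3, ← integral_const_mul]
  refine integral_congr fun v => ?_
  simp only [smul_eq_mul]
  rw [← mul_assoc, fourier_undilate, mul_comm]

lemma integral_l2FourierInv_mul (w : L2) (φ : 𝓢(Spacetime, ℂ)) :
    ∫ z, l2FourierInv w z * φ z = ∫ ζ, w ζ * schwartzFourierInv 3 φ ζ := by
  have h3 := DFunLike.congr_fun (Lp.fourierInv_toTemperedDistribution_eq w) (undilate φ)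
  rw [Lp.toTemperedDistribution_apply, TemperedDistribution.fourierInv_apply,
    Lp.toTemperedDistribution_apply] at h3
  have hne : (((2 * π) ^ 3 : ℝ) : ℂ) ≠ 0 := by simp
  have h4 : ∫ ζ, l2FourierInv w ζ * φ ζ = (((2 * π) ^ 3 : ℝ) : ℂ)⁻¹ * ∫ ζ, (fun v => undilate φ v •
      (𝓕⁻ w : L2) v) (dilation 3 ζ) := by
    rw [← integral_const_mul]
    refine integral_congr fun v => ?_
    simp only [undilate_dilation, smul_eq_mul, l2FourierInv]
    ring
  rw [h4, integral_dilation (fun v => undilate φ v • (𝓕⁻ w : L2) v), ← h3, inv_mul_cancel_left₀ hne]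
  refine integral_congr fun v => ?_
  simp only [smul_eq_mul]
  rw [fourierInv_undilate, mul_comm]

lemma schwartzFourierInv_schwartzFourier {n : ℕ} (φ : 𝓢(EuclideanSpace ℝ (Fin n), ℂ)) :
    schwartzFourierInv n (schwartzFourier n φ) = φ := by
  ext z
  rw [← fourierInv_undilate]
  have : undilate (schwartzFourier n φ) = 𝓕 φ := by
    ext v
    change 𝓕 φ (dilation n ((dilation n).symm v)) = 𝓕 φ v
    rw [ContinuousLinearEquiv.apply_symm_apply]
  rw [this, FourierTransform.fourierInv_fourier_eq]

/-- A locally integrable function on space-time is determined by its integrals against Schwartz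
functions of compact support. -/
lemma ae_eq_of_integral_mul_schwartz (hf : LocallyIntegrable f) (hg : LocallyIntegrable g)
    (h : ∀ φ : 𝓢(Spacetime, ℂ), HasCompactSupport φ → ∫ z, f z * φ z = ∫ z, g z * φ z) :
    f =ᵐ[volume] g := by
  refine ae_eq_of_integral_contDiff_smul_eq hf hg fun c hc hcc => ?_
  have hg₁ : HasCompactSupport (ofRealCLM ∘ c) := hcc.comp_left rfl
  have hg₂ : ContDiff ℝ ∞ (ofRealCLM ∘ c) := by fun_prop
  have h1 := h (hg₁.toSchwartzMap hg₂) hg₁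
  have e : ∀ f : Amp, ∫ z, f z * hg₁.toSchwartzMap hg₂ z = ∫ z, c z • f z := by
    intro f
    refine integral_congr fun v => ?_
    change f v * (c v : ℂ) = c v • f v
    rw [real_smul, mul_comm]
  rwa [e, e] at h1

lemma l2Fourier_l2FourierInv (g w : L2)
    (hw : w =ᵐ[volume] l2FourierInv g) : l2Fourier w =ᵐ[volume] g := by
  refine ae_eq_of_integral_mul_schwartz ((memLp_l2Fourier w).locallyIntegrable (by norm_num))
    ((Lp.memLp g).locallyIntegrable (by norm_num)) fun φ _ => ?_
  rw [integral_l2Fourier_mul]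
  have : ∫ z, w z * schwartzFourier 3 φ z = ∫ z, l2FourierInv g z * schwartzFourier 3 φ z := by
    refine integral_congr_ae ?_
    filter_upwards [hw] with z hz
    rw [hz]
  rw [this, integral_l2FourierInv_mul, schwartzFourierInv_schwartzFourier]

lemma ft3_eq (G : Amp) (ζ : Spacetime) : ft3 G ζ = 𝓕 G (dilation 3 ζ) := by
  rw [dilation_apply, fourier_eq', ft3]
  refine integral_congr fun z => ?_
  simp only [inner_smul_right, smul_eq_mul]
  congr 2
  push_cast
  field_simp

lemma IsNice.continuous_ft3 {M R : ℝ} (hG : IsNice G M R) :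
    Continuous (ft3 G) := by
  have : ft3 G = fun z => 𝓕 G (dilation 3 z) := funext (ft3_eq G)
  rw [this]
  exact (continuous_fourier_of_integrable hG.integrable).comp (dilation 3).continuous

lemma IsNice.l2Fourier_toLp {M R : ℝ} (hG : IsNice G M R) :
    l2Fourier ((hG.memLp 2).toLp G) =ᵐ[volume] ft3 G := by
  filter_upwards [quasiMeasurePreserving_dilation.ae
    (coeFn_fourier_toLp hG.integrable (hG.memLp 2))] with z hz
  rw [l2Fourier, hz, ft3_eq]

lemma norm_ft3_le (G : Amp) (ζ : Spacetime) :
    ‖ft3 G ζ‖ ≤ ∫ z, ‖G z‖ := by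
  refine (norm_integral_le_integral_norm _).trans (le_of_eq ?_)
  refine integral_congr fun z => ?_
  simp only [norm_mul, norm_exp_neg_I_mul, one_mul]

lemma IsNice.schwartzFourierInv_mul {N : Amp} {M R : ℝ} (hN : IsNice N M R)
    (φ : 𝓢(Spacetime, ℂ)) : ∫ ζ, N ζ * schwartzFourierInv 3 φ ζ =
      ∫ z, ((((2 * π) ^ 3 : ℝ) : ℂ)⁻¹ * ft3 N (-z)) * φ z := by
  simp_rw [schwartzFourierInv_apply, ft3, ← integral_const_mul, ← integral_mul_const]
  rw [integral_integral_swap]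
  · refine integral_congr fun z => ?_
    refine integral_congr fun ζ => ?_
    simp only [inner_neg_right, real_inner_comm]
    push_cast
    ring_nf
  · have h := (hN.integrable.mul_prod (φ.integrable (μ := volume))).const_mul (((2 * π) ^ 3 : ℝ) : ℂ)⁻¹
    refine (h.bdd_mul (c := 1) (f := fun q : Spacetime × Spacetime =>
      cexp (I * (inner ℝ q.2 q.1 : ℝ))) ?_ ?_).congr ?_
    · fun_prop
    · simp
    · refine .of_forall fun q => ?_; simp only [uncurry]; ring

lemma IsNice.l2FourierInv_toLp {N : Amp} {M R : ℝ} (hN : IsNice N M R) :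
    l2FourierInv ((hN.memLp 2).toLp N) =ᵐ[volume]
      fun z => (((2 * π) ^ 3 : ℝ) : ℂ)⁻¹ * ft3 N (-z) := by
  refine ae_eq_of_integral_mul_schwartz ((memLp_l2FourierInv _).locallyIntegrable (by norm_num))
    (Continuous.locallyIntegrable ?_) fun φ _ => ?_
  · exact continuous_const.mul (hN.continuous_ft3.comp continuous_neg)
  · rw [integral_l2FourierInv_mul, ← hN.schwartzFourierInv_mul]
    refine integral_congr_ae ?_
    filter_upwards [(hN.memLp 2).coeFn_toLp] with z hz
    rw [hz]

end

attribute [fun_prop] measurable_l2Fourier measurable_l2FourierInv IsNice.continuous_ft3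

/-! ### Iterated integrals for the space-time Fourier transform -/

section

lemma integral_eq_iterated {e : ℝ × ℝ × ℝ → Spacetime} (he : MeasurePreserving e)
    (hm : MeasurableEmbedding e) (hF : Integrable F) :
    ∫ z, F z = ∫ a : ℝ, ∫ b : ℝ, ∫ c : ℝ, F (e (a, b, c)) := by
  have h1 : Integrable (fun q => F (e q)) := he.integrable_comp_of_integrable hF
  rw [← he.integral_comp hm, Measure.volume_eq_prod]
  rw [Measure.volume_eq_prod] at h1
  rw [integral_prod _ h1]
  refine integral_congr_ae ?_
  filter_upwards [h1.prod_right_ae] with a ha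
  rw [Measure.volume_eq_prod] at ha ⊢
  exact integral_prod _ ha

lemma measurePreserving_pt_swap : MeasurePreserving fun q : ℝ × ℝ => pt q.swap :=
  measurePreserving_pt.comp Measure.measurePreserving_swap

lemma measurableEmbedding_pt_swap : MeasurableEmbedding fun q : ℝ × ℝ => pt q.swap :=
  measurableEmbedding_pt.comp MeasurableEquiv.prodComm.measurableEmbedding

lemma inner_pt3 (x y t : ℝ) (z : Spacetime) :
    (inner ℝ (pt3 x y t) z : ℝ) = x * z 0 + y * z 1 + t * z 2 := by
  simp [pt3, EuclideanSpace.inner_eq_star_dotProduct, Fin.sum_univ_succ, dotProduct]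
  ring

lemma exp_split (a b c : ℝ) (z : ℂ) : cexp (-(I * ((a + b + c : ℝ) : ℂ))) * z =
    cexp (-(I * (b : ℂ))) * (cexp (-(I * (c : ℂ))) * (cexp (-(I * (a : ℂ))) * z)) := by
  rw [← mul_assoc, ← mul_assoc, ← Complex.exp_add, ← Complex.exp_add]
  congr 2
  push_cast
  ring

variable {M R : ℝ}

lemma IsNice.ft3_ins (hG : IsNice G M R) (p : Plane) (μ : ℝ) :
    ft3 G (ins μ p) = ft (fun y => ftXT G y (p 0) (p 1)) μ := by
  have he : MeasurePreserving fun q : ℝ × ℝ × ℝ => ins q.1 (pt q.2.swap) :=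
    measurePreserving_ins.comp ((MeasurePreserving.id volume).prod measurePreserving_pt_swap)
  have hm : MeasurableEmbedding fun q : ℝ × ℝ × ℝ => ins q.1 (pt q.2.swap) :=
    measurableEmbedding_ins.comp (MeasurableEmbedding.id.prodMap measurableEmbedding_pt_swap)
  rw [ft3, integral_eq_iterated he hm (hG.integrable_exp_mul _), ft]
  refine integral_congr fun y => ?_
  simp only [ftXT, ft, ftX, ← integral_const_mul]
  refine integral_congr fun t => ?_
  refine integral_congr fun x => ?_
  simp only [Prod.swap_prod_mk, ins_pt, inner_pt3, ins_apply_zero, ins_apply_one, ins_apply_two]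
  rw [exp_split]

/-- The Fourier transform in `x` and `y`, at the time `t`. -/
def ftXY (G : Amp) (p : Plane) (t : ℝ) : ℂ := ft (fun y => ftX G y (p 0) t) (p 1)

section

variable (hG : IsNice G M R)
include hG

lemma IsNice.ft3_atTime (p : Plane) (τ : ℝ) :
    ft3 G (atTime τ p) = ft (ftXY G p) τ := by
  have he : MeasurePreserving fun q : ℝ × ℝ × ℝ => atTime q.1 (pt q.2.swap) :=
    measurePreserving_atTime.comp ((MeasurePreserving.id volume).prod measurePreserving_pt_swap)
  have hm : MeasurableEmbedding fun q : ℝ × ℝ × ℝ => atTime q.1 (pt q.2.swap) :=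
    measurableEmbedding_atTime.comp (MeasurableEmbedding.id.prodMap measurableEmbedding_pt_swap)
  rw [ft3, integral_eq_iterated he hm (hG.integrable_exp_mul _), ft]
  refine integral_congr fun y => ?_
  simp only [ftXY, ft, ftX, ← integral_const_mul]
  refine integral_congr fun t => ?_
  refine integral_congr fun x => ?_
  simp only [Prod.swap_prod_mk, atTime_pt, inner_pt3, atTime_apply_zero, atTime_apply_one,
    atTime_apply_two]
  rw [show x * p 0 + t * p 1 + y * τ = x * p 0 + y * τ + t * p 1 by ring, exp_split]

lemma IsNice.ft3_pt3 (z : Spacetime) :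
    ft3 G z = ft (fun t => ft (fun x => ft (fun y => G (pt3 x y t)) (z 1)) (z 0)) (z 2) := by
  have he : MeasurePreserving fun q : ℝ × ℝ × ℝ => atTime q.1 (pt q.2) :=
    measurePreserving_atTime.comp ((MeasurePreserving.id volume).prod measurePreserving_pt)
  have hm : MeasurableEmbedding fun q : ℝ × ℝ × ℝ => atTime q.1 (pt q.2) :=
    measurableEmbedding_atTime.comp (MeasurableEmbedding.id.prodMap measurableEmbedding_pt)
  rw [ft3, integral_eq_iterated he hm (hG.integrable_exp_mul _), ft]
  refine integral_congr fun t => ?_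
  simp only [ft, ← integral_const_mul]
  refine integral_congr fun x => ?_
  refine integral_congr fun y => ?_
  simp only [atTime_pt, inner_pt3]
  rw [show x * z 0 + y * z 1 + t * z 2 = y * z 1 + t * z 2 + x * z 0 by ring, exp_split]

omit hG in
lemma enorm_ft_le (f : ℝ → ℂ) (τ : ℝ) : ‖ft f τ‖ₑ ≤ ∫⁻ t, ‖f t‖ₑ := by
  refine (enorm_integral_le_lintegral_enorm _).trans (le_of_eq (lintegral_congr fun t => ?_))
  rw [enorm_mul, enorm_exp_neg_I_mul, one_mul]

lemma IsNice.measurable_ftXY (p : Plane) : Measurable (ftXY G p) :=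
  measurable_ft_of (F := fun t y => ftX G y (p 0) t)
    (measurable_ftX hG.meas measurable_snd measurable_const measurable_fst) measurable_const

lemma IsNice.norm_ftXY_le (p : Plane) (t : ℝ) :
    ‖ftXY G p t‖ ≤ M * (2 * max R 0) * (2 * max R 0) :=
  norm_ft_le_of_bdd (le_max_right _ _) (fun y => hG.norm_ftX_le y (p 0) t)
    (fun _ hy => hG.ftX_supp_y hy) _

lemma IsNice.ftXY_supp {t : ℝ} (h : ftXY G p t ≠ 0) :
    |t| ≤ max R 0 := by
  by_contra hc
  apply h
  refine ft_eq_zero (fun y => ?_) _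
  by_contra hx
  exact hc (hG.ftX_supp_t hx)

lemma IsNice.integrable_ftXY (p : Plane) : Integrable (ftXY G p) :=
  integrable_of_bdd_line (hG.measurable_ftXY p) (hG.norm_ftXY_le p) (fun _ => hG.ftXY_supp)

lemma IsNice.memLp_ftXY (p : Plane) : MemLp (ftXY G p) 2 :=
  memLp_of_bdd_line (hG.measurable_ftXY p) (hG.norm_ftXY_le p) (fun _ => hG.ftXY_supp) 2

lemma IsNice.lintegral_sqrt_ftXT_plane :
    ∫⁻ y, (∫⁻ p : Plane, ‖ftXT G y (p 0) (p 1)‖ₑ ^ 2) ^ ½ = toE (2 * π) * l1yL2xtNorm G := by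
  rw [← hG.lintegral_sqrt_ftXT]
  refine lintegral_congr fun y => ?_
  rw [lintegral_plane]
  · rfl
  · exact ((measurable_ftXT hG.meas measurable_const (by fun_prop) (by fun_prop)).enorm).pow_const 2

/-- A weight which is square integrable in `μ` maps the Fourier transforms of `L¹_y L²_{x,t}`
to `L²`. -/
lemma IsNice.lintegral_weight_le {w : Spacetime → ℝ≥0∞} (hw : Measurable w)
    {A : ℝ≥0∞} (hA : ∀ p : Plane, ∫⁻ μ, w (ins μ p) ^ 2 ≤ A) :
    ∫⁻ z, (w z * ‖ft3 G z‖ₑ) ^ 2 ≤ A * (toE (2 * π) * l1yL2xtNorm G) ^ 2 := by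
  have hm : Measurable fun q : Plane × ℝ => ‖ftXT G q.2 (q.1 0) (q.1 1)‖ₑ :=
    (measurable_ftXT hG.meas measurable_snd (by fun_prop) (by fun_prop)).enorm
  have hF : Measurable fun z => (w z * ‖ft3 G z‖ₑ) ^ 2 := by fun_prop
  rw [lintegral_ins hF]
  calc ∫⁻ p : Plane, ∫⁻ μ, (w (ins μ p) * ‖ft3 G (ins μ p)‖ₑ) ^ 2
      ≤ ∫⁻ p : Plane, A * (∫⁻ y, ‖ftXT G y (p 0) (p 1)‖ₑ) ^ 2 := by
        refine lintegral_mono fun p => ?_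
        calc ∫⁻ μ, (w (ins μ p) * ‖ft3 G (ins μ p)‖ₑ) ^ 2
            ≤ ∫⁻ μ, w (ins μ p) ^ 2 * (∫⁻ y, ‖ftXT G y (p 0) (p 1)‖ₑ) ^ 2 := by
              refine lintegral_mono fun μ => ?_
              rw [mul_pow]
              refine mul_le_mul' le_rfl (pow_le_pow_left' ?_ 2)
              rw [hG.ft3_ins]
              exact enorm_ft_le _ _
          _ = (∫⁻ μ, w (ins μ p) ^ 2) * (∫⁻ y, ‖ftXT G y (p 0) (p 1)‖ₑ) ^ 2 := by
              refine lintegral_mul_const _ ?_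
              fun_prop
          _ ≤ _ := mul_le_mul' (hA p) le_rfl
    _ = A * ∫⁻ p : Plane, (∫⁻ y, ‖ftXT G y (p 0) (p 1)‖ₑ) ^ 2 :=
        lintegral_const_mul _ (hm.lintegral_prod_right'.pow_const 2)
    _ ≤ _ := by
        refine mul_le_mul' le_rfl ?_
        rw [← hG.lintegral_sqrt_ftXT_plane, ← ennreal_sqrt_sq (∫⁻ p : Plane, _)]
        refine pow_le_pow_left' ?_ 2
        exact lintegral_lintegral_sq_le (μ := (volume : Measure Plane)) hm

end

end

/-! ### The change of variables `μ ↦ ω(ξ, μ)` -/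

section

lemma hasDerivAt_omega (ξ μ : ℝ) : HasDerivAt (fun μ => omega ξ μ) (2 * μ / ξ) μ := by
  have := ((hasDerivAt_pow 2 μ).div_const ξ).const_add (ξ ^ 3)
  simpa [omega] using this

lemma setLIntegral_omega_le_aux {ξ a : ℝ} (hξ : ξ ≠ 0) (ha : 0 < a) {s : Set ℝ}
    (hs : MeasurableSet s) (hinj : InjOn (fun μ => omega ξ μ) s) (hsa : ∀ μ ∈ s, a ≤ |μ|)
    {φ : ℝ → ℝ≥0∞} (hφ : Measurable φ) :
    ∫⁻ μ in s, φ (omega ξ μ) ≤ toE (|ξ| / (2 * a)) * ∫⁻ w, φ w := by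
  have hξ' : 0 < |ξ| := abs_pos.2 hξ
  have h := lintegral_image_eq_lintegral_abs_deriv_mul hs
    (fun μ _ => (hasDerivAt_omega ξ μ).hasDerivWithinAt) hinj φ
  have hmeas : Measurable fun μ => φ (omega ξ μ) := by fun_prop
  calc ∫⁻ μ in s, φ (omega ξ μ)
      ≤ ∫⁻ μ in s, toE (|ξ| / (2 * a)) * (toE |2 * μ / ξ| * φ (omega ξ μ)) := by
        refine setLIntegral_mono' hs fun μ hμ => ?_
        rw [← mul_assoc, ← ENNReal.ofReal_mul (by positivity)]
        refine le_mul_of_one_le_left' ?_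
        rw [one_le_ofReal, abs_div, abs_mul, abs_two, div_mul_div_comm, one_le_div₀]
        · have := hsa μ hμ; nlinarith
        · positivity
    _ = toE (|ξ| / (2 * a)) * ∫⁻ μ in s, toE |2 * μ / ξ| * φ (omega ξ μ) :=
        lintegral_const_mul _ (by fun_prop)
    _ ≤ _ := by rw [← h]; exact mul_le_mul' le_rfl (setLIntegral_le_lintegral _ _)

lemma setLIntegral_omega_le {ξ a : ℝ} (hξ : ξ ≠ 0) (ha : 0 < a) {φ : ℝ → ℝ≥0∞} (hφ : Measurable φ) :
    ∫⁻ μ in {μ | a ≤ |μ|}, φ (omega ξ μ) ≤ toE (|ξ| / a) * ∫⁻ w, φ w := by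
  have hset : {μ : ℝ | a ≤ |μ|} = Ici a ∪ Iic (-a) := by grind
  have hsq : ∀ μ ν : ℝ, omega ξ μ = omega ξ ν → μ ^ 2 = ν ^ 2 := fun μ ν h => by
    have : μ ^ 2 / ξ = ν ^ 2 / ξ := by simpa [omega] using h
    field_simp at this
    exact this
  rw [hset]
  refine (lintegral_union_le _ _ _).trans ?_
  have h1 := setLIntegral_omega_le_aux hξ ha (s := Ici a) measurableSet_Ici
    (fun μ hμ ν hν h => by
      have := hsq μ ν h
      have h1 : a ≤ μ := hμ
      have h2 : a ≤ ν := hν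
      nlinarith) (fun μ hμ => le_trans hμ (le_abs_self μ)) hφ
  have h2 := setLIntegral_omega_le_aux hξ ha (s := Iic (-a)) measurableSet_Iic
    (fun μ hμ ν hν h => by
      have := hsq μ ν h
      have h1 : μ ≤ -a := hμ
      have h2 : ν ≤ -a := hν
      nlinarith) (fun μ hμ => by
        have h1 : μ ≤ -a := hμ
        rw [abs_of_nonpos (by linarith)]
        linarith) hφ
  refine (add_le_add h1 h2).trans (le_of_eq ?_)
  rw [← add_mul, ← ENNReal.ofReal_add (by positivity) (by positivity)]
  congr 2
  field_simp
  ring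

/-- The part of the frequency plane on which `|ξ| ∼ 2^k` and `|μ| ≳ ξ²`. -/
def widePlane (k : ℤ) : Set Plane := {p | p 0 ∈ dyadic k ∧ |p 0| ^ 2 / 2 ^ 21 ≤ |p 1|}

lemma measurableSet_dyadic (k : ℤ) : MeasurableSet (dyadic k) := by
  have : dyadic k = (fun ξ : ℝ => |ξ|) ⁻¹' Icc ((2 : ℝ) ^ (k - 1)) ((2 : ℝ) ^ (k + 1)) := rfl
  rw [this]
  exact (continuous_abs.measurable) measurableSet_Icc

lemma dyadic_ne_zero {k : ℤ} {ξ : ℝ} (h : ξ ∈ dyadic k) : ξ ≠ 0 := by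
  rintro rfl
  have h1 := h.1
  rw [abs_zero] at h1
  exact absurd h1 (not_le.2 (by positivity))

lemma measurableSet_widePlane (k : ℤ) : MeasurableSet (widePlane k) := by
  refine MeasurableSet.inter ?_ ?_
  · exact (by fun_prop : Measurable fun p : Plane => p 0) (measurableSet_dyadic k)
  · exact measurableSet_le (f := fun p : Plane => |p 0| ^ 2 / 2 ^ 21) (g := fun p : Plane => |p 1|)
      (by fun_prop) (by fun_prop)

lemma lintegral_widePlane_le {k : ℤ} (ξ : ℝ) {φ : ℝ → ℝ≥0∞} (hφ : Measurable φ) :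
    ∫⁻ μ, (widePlane k).indicator 1 (pt (ξ, μ)) * φ (omega ξ μ) ≤
      toE (2 ^ (22 - k)) * ∫⁻ w, φ w := by
  by_cases hξ : ξ ∈ dyadic k
  · have h0 := dyadic_ne_zero hξ
    have hp : 0 < |ξ| := abs_pos.2 h0
    have h := setLIntegral_omega_le h0 (a := |ξ| ^ 2 / 2 ^ 21) (by positivity) hφ
    calc ∫⁻ μ, (widePlane k).indicator 1 (pt (ξ, μ)) * φ (omega ξ μ)
        = ∫⁻ μ in {μ | |ξ| ^ 2 / 2 ^ 21 ≤ |μ|}, φ (omega ξ μ) := by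
          rw [← lintegral_indicator (measurableSet_le measurable_const (by fun_prop))]
          refine lintegral_congr fun μ => ?_
          by_cases hμ : |ξ| ^ 2 / 2 ^ 21 ≤ |μ|
          · rw [indicator_of_mem (show pt (ξ, μ) ∈ widePlane k from ⟨hξ, hμ⟩),
              indicator_of_mem (show μ ∈ {μ | |ξ| ^ 2 / 2 ^ 21 ≤ |μ|} from hμ)]
            simp
          · rw [indicator_of_notMem (fun h : pt (ξ, μ) ∈ widePlane k => hμ h.2),
              indicator_of_notMem (show μ ∉ {μ | |ξ| ^ 2 / 2 ^ 21 ≤ |μ|} from hμ), zero_mul]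
      _ ≤ _ := h
      _ ≤ _ := by
          refine mul_le_mul' (ofReal_le_ofReal ?_) le_rfl
          have e : |ξ| / (|ξ| ^ 2 / 2 ^ 21) = 2 ^ 21 / |ξ| := by field_simp
          rw [e, div_le_iff₀ hp]
          calc (2 : ℝ) ^ 21 = 2 ^ (22 - k) * 2 ^ (k - 1) := by
                rw [← zpow_add₀ (by norm_num)]
                norm_num
            _ ≤ _ := mul_le_mul_of_nonneg_left hξ.1 (by positivity)
  · have : ∀ μ, (widePlane k).indicator 1 (pt (ξ, μ)) * φ (omega ξ μ) = 0 := fun μ => by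
      rw [indicator_of_notMem (fun h : pt (ξ, μ) ∈ widePlane k => hξ h.1), zero_mul]
    simp [this]

end

/-! ### The integral of `(τ - w + i)⁻¹ ℱG` in `τ` -/

section

/-- The function `s ↦ e^{-s + i s w}` on the half line `s > 0`. -/
def halfExp (w : ℝ) : ℝ → ℂ := (Ioi 0).indicator fun s : ℝ => cexp ((-1 + I * w) * s)

lemma measurable_halfExp (w : ℝ) : Measurable (halfExp w) :=
  (Continuous.measurable (by fun_prop)).indicator measurableSet_Ioi

lemma integrable_halfExp (w : ℝ) : Integrable (halfExp w) := by
  refine (integrable_indicator_iff measurableSet_Ioi).2 ?_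
  exact integrableOn_exp_mul_complex_Ioi (by simp) 0

lemma norm_halfExp_le (w s : ℝ) : ‖halfExp w s‖ ≤ 1 := by
  unfold halfExp
  by_cases hs : s ∈ Ioi (0 : ℝ)
  · rw [indicator_of_mem hs, norm_exp, exp_le_one_iff]; have : (0 : ℝ) < s := hs; simp [this.le]
  · rw [indicator_of_notMem hs, norm_zero]; exact zero_le_one

lemma memLp_halfExp (w : ℝ) : MemLp (halfExp w) 2 := by
  refine (memLp_two_iff_integrable_sq_norm (measurable_halfExp w).aestronglyMeasurable).2 ?_
  refine (integrable_halfExp w).norm.mono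
    ((measurable_halfExp w).norm.pow_const 2).aestronglyMeasurable ?_
  refine .of_forall fun s => ?_
  rw [norm_of_nonneg (by positivity), norm_of_nonneg (by positivity)]
  have := norm_halfExp_le w s
  nlinarith [norm_nonneg (halfExp w s)]

lemma ft_halfExp (w τ : ℝ) : ft (halfExp w) τ = (1 + I * ((τ - w : ℝ) : ℂ))⁻¹ := by
  have h1 : ft (halfExp w) τ = ∫ s in Ioi (0 : ℝ), cexp ((-(1 + I * ((τ - w : ℝ) : ℂ))) * s) := by
    rw [← integral_indicator measurableSet_Ioi, ft]
    refine integral_congr fun s => ?_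
    by_cases hs : s ∈ Ioi (0 : ℝ)
    · simp only [halfExp, indicator_of_mem hs]
      rw [← Complex.exp_add]
      congr 1
      push_cast
      ring
    · simp only [halfExp, indicator_of_notMem hs, mul_zero]
  rw [h1, integral_exp_mul_complex_Ioi (by simp)]
  rw [Complex.ofReal_zero, mul_zero, Complex.exp_zero, neg_div_neg_eq, one_div]

def damp (G : Amp) (z : Spacetime) : ℂ := conj (halfExp 0 (z 2)) * G z

variable {M R : ℝ}

lemma IsNice.mul_time (hG : IsNice G M R) {h : ℝ → ℂ} (hm : Measurable h)
    (hb : ∀ s, ‖h s‖ ≤ 1) : IsNice (fun z => h (z 2) * G z) M R where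
  meas := (hm.comp (by fun_prop)).mul hG.meas
  bound z := by
    rw [norm_mul]
    exact (mul_le_of_le_one_left (norm_nonneg _) (hb _)).trans (hG.bound z)
  supp z hz := hG.supp z (right_ne_zero_of_mul hz)

lemma l1yL2xtNorm_mono (h : ∀ z, ‖F z‖ ≤ ‖G z‖) :
    l1yL2xtNorm F ≤ l1yL2xtNorm G := by
  refine lintegral_mono fun y => ENNReal.rpow_le_rpow ?_ (by norm_num)
  refine lintegral_mono fun x => lintegral_mono fun t => pow_le_pow_left' ?_ 2
  exact enorm_le_iff_norm_le.2 (h _)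

lemma l1yL2xtNorm_mul_time_le {h : ℝ → ℂ} (hb : ∀ s, ‖h s‖ ≤ 1) (G : Amp) :
    l1yL2xtNorm (fun z => h (z 2) * G z) ≤ l1yL2xtNorm G := by
  refine l1yL2xtNorm_mono fun z => ?_
  rw [norm_mul]
  exact mul_le_of_le_one_left (norm_nonneg _) (hb _)

lemma ft_const_mul (c : ℂ) (f : ℝ → ℂ) (τ : ℝ) : ft (fun t => c * f t) τ = c * ft f τ := by
  rw [ft, ft, ← integral_const_mul]
  refine integral_congr fun t => ?_
  ring

lemma ftXY_mul_time (h : ℝ → ℂ) (G : Amp) (p : Plane) (t : ℝ) :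
    ftXY (fun z => h (z 2) * G z) p t = h t * ftXY G p t := by
  have h1 : ∀ y, ftX (fun z => h (z 2) * G z) y (p 0) t = h t * ftX G y (p 0) t := fun y =>
    ft_const_mul (h t) (fun x => G (pt3 x y t)) (p 0)
  rw [ftXY, funext h1, ft_const_mul]
  rfl

lemma IsNice.damp (hG : IsNice G M R) : IsNice (damp G) M R :=
  hG.mul_time (h := fun s => conj (halfExp 0 s))
    (continuous_conj.measurable.comp (measurable_halfExp 0))
    (fun s => by rw [RCLike.norm_conj]; exact norm_halfExp_le 0 s)

lemma l1yL2xtNorm_damp_le (G : Amp) : l1yL2xtNorm (damp G) ≤ l1yL2xtNorm G :=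
  l1yL2xtNorm_mul_time_le (h := fun s => conj (halfExp 0 s))
    (fun s => by rw [RCLike.norm_conj]; exact norm_halfExp_le 0 s) G

lemma IsNice.integral_resolvent (hG : IsNice G M R) (p : Plane) (w : ℝ) :
    ∫ τ : ℝ, (((τ - w : ℝ) : ℂ) + I)⁻¹ * ft3 G (atTime τ p) =
      -(2 * π * I) * ft3 (KPI.damp G) (atTime w p) := by
  have h := integral_ft_conj_ft (hG.integrable_ftXY p) (hG.memLp_ftXY p) (integrable_halfExp w)
    (memLp_halfExp w)
  have e1 : ∫ τ : ℝ, (((τ - w : ℝ) : ℂ) + I)⁻¹ * ft3 G (atTime τ p) =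
      -I * ∫ τ, ft (ftXY G p) τ * conj (ft (halfExp w) τ) := by
    rw [← integral_const_mul]
    refine integral_congr fun τ => ?_
    simp only [hG.ft3_atTime, ft_halfExp, map_inv₀, map_add, map_one, map_mul, conj_I, conj_ofReal]
    have : (((τ - w : ℝ) : ℂ) + I) = I * (1 + -I * ((τ - w : ℝ) : ℂ)) := by ring_nf; simp
    rw [this, mul_inv, inv_I]
    ring
  rw [e1, h, hG.damp.ft3_atTime, ft]
  rw [show -I * (2 * π * ∫ x, ftXY G p x * conj (halfExp w x)) =
    -(2 * π * I) * ∫ x, ftXY G p x * conj (halfExp w x) by ring]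
  congr 1
  refine integral_congr fun s => ?_
  have hd : ftXY (KPI.damp G) p s = conj (halfExp 0 s) * ftXY G p s :=
    ftXY_mul_time (fun s => conj (halfExp 0 s)) G p s
  simp only [hd]
  by_cases hs : s ∈ Ioi (0 : ℝ)
  · simp only [halfExp, indicator_of_mem hs, ← exp_conj]
    rw [← mul_assoc, ← Complex.exp_add, mul_comm]
    congr 2
    simp
    ring
  · simp [halfExp, indicator_of_notMem hs]

lemma IsNice.lintegral_widePlane_ft3_le (hG : IsNice G M R) (k : ℤ) :
    ∫⁻ p in widePlane k, ‖ft3 G (atTime (omega (p 0) (p 1)) p)‖ₑ ^ 2 ≤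
      toE (2 ^ (22 - k)) * (toE (2 * π) * l1yL2xtNorm G) ^ 2 := by
  have hm : Measurable fun q : Plane × ℝ => (widePlane k).indicator 1 q.1 *
      ‖ftXT G q.2 (q.1 0) (omega (q.1 0) (q.1 1))‖ₑ := by
    refine Measurable.mul ?_ (measurable_ftXT hG.meas measurable_snd (by fun_prop) ?_).enorm
    · exact (measurable_one.indicator (measurableSet_widePlane k)).comp measurable_fst
    · fun_prop
  have hind : ∀ p : Plane, ((widePlane k).indicator 1 p : ℝ≥0∞) ^ 2 = (widePlane k).indicator 1 p :=
    fun p => by by_cases hp : p ∈ widePlane k <;> simp [hp]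
  rw [← lintegral_indicator (measurableSet_widePlane k)]
  calc ∫⁻ p, (widePlane k).indicator (fun p : Plane =>
        ‖ft3 G (atTime (omega (p 0) (p 1)) p)‖ₑ ^ 2) p
      ≤ ∫⁻ p : Plane, (∫⁻ y, (widePlane k).indicator 1 p *
          ‖ftXT G y (p 0) (omega (p 0) (p 1))‖ₑ) ^ 2 := by
        refine lintegral_mono fun p => ?_
        by_cases hp : p ∈ widePlane k
        · simp only [indicator_of_mem hp, Pi.one_apply, one_mul]
          refine pow_le_pow_left' ?_ 2
          have e : atTime (omega (p 0) (p 1)) p = ins (p 1) (pt (p 0, omega (p 0) (p 1))) := by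
            ext j
            fin_cases j <;> rfl
          rw [e, hG.ft3_ins]
          exact enorm_ft_le _ _
        · simp [hp]
    _ ≤ (∫⁻ y, (∫⁻ p : Plane, ((widePlane k).indicator 1 p *
          ‖ftXT G y (p 0) (omega (p 0) (p 1))‖ₑ) ^ 2) ^ ½) ^ 2 := by
        rw [← ennreal_sqrt_sq (∫⁻ p : Plane, (∫⁻ y, _) ^ 2)]
        exact pow_le_pow_left' (lintegral_lintegral_sq_le (μ := (volume : Measure Plane)) hm) 2
    _ ≤ (∫⁻ y, toE (2 ^ (22 - k)) ^ ½ * (∫⁻ p : Plane, ‖ftXT G y (p 0) (p 1)‖ₑ ^ 2) ^ ½) ^ 2 := by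
        refine pow_le_pow_left' (lintegral_mono fun y => ?_) 2
        rw [← mul_rpow_of_nonneg _ _ (by norm_num)]
        refine ENNReal.rpow_le_rpow ?_ (by norm_num)
        have hq : Measurable fun p : Plane => ‖ftXT G y (p 0) (p 1)‖ₑ ^ 2 :=
          (measurable_ftXT hG.meas measurable_const (by fun_prop) (by fun_prop)).enorm.pow_const 2
        have hr : Measurable fun p : Plane => ((widePlane k).indicator 1 p *
            ‖ftXT G y (p 0) (omega (p 0) (p 1))‖ₑ) ^ 2 :=
          (hm.comp (measurable_id.prodMk (measurable_const (a := y)))).pow_const 2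
        rw [lintegral_plane hq, lintegral_plane hr, ← lintegral_const_mul _ (by
            exact (hq.comp measurable_pt).lintegral_prod_right')]
        refine lintegral_mono fun ξ => ?_
        refine le_trans (le_of_eq (lintegral_congr fun μ => ?_))
          (lintegral_widePlane_le ξ (φ := fun w => ‖ftXT G y ξ w‖ₑ ^ 2)
          ((measurable_ftXT hG.meas measurable_const measurable_const measurable_id).enorm.pow_const 2))
        simp only [mul_pow, hind]
        rfl
    _ = _ := by
        rw [lintegral_const_mul' _ _ (rpow_ne_top_of_nonneg (by norm_num)
          ofReal_ne_top), hG.lintegral_sqrt_ftXT_plane, mul_pow, ennreal_sqrt_sq]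

lemma IsNice.lintegral_resolvent_le (hG : IsNice G M R) (k : ℤ) :
    ∫⁻ p in widePlane k, ‖∫ τ : ℝ, (((τ - omega (p 0) (p 1) : ℝ) : ℂ) + I)⁻¹ *
        ft3 G (atTime τ p)‖ₑ ^ 2 ≤
      toE (2 ^ (22 - k)) * (toE (2 * π) ^ 2 * l1yL2xtNorm G) ^ 2 := by
  have e : ∀ p : Plane, ‖∫ τ : ℝ, (((τ - omega (p 0) (p 1) : ℝ) : ℂ) + I)⁻¹ *
      ft3 G (atTime τ p)‖ₑ ^ 2 =
      toE (2 * π) ^ 2 * ‖ft3 (KPI.damp G) (atTime (omega (p 0) (p 1)) p)‖ₑ ^ 2 := by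
    intro p
    rw [hG.integral_resolvent, enorm_mul, mul_pow]
    congr 2
    rw [← ofReal_norm]
    congr 1
    simp [abs_of_pos pi_pos]
  simp_rw [e]
  rw [lintegral_const_mul' _ _ (by finiteness)]
  refine (mul_le_mul' le_rfl (hG.damp.lintegral_widePlane_ft3_le k)).trans ?_
  have := pow_le_pow_left' (l1yL2xtNorm_damp_le G) 2
  calc _ = toE (2 ^ (22 - k)) * (toE (2 * π) ^ 4 *
        l1yL2xtNorm (KPI.damp G) ^ 2) := by ring
    _ ≤ toE (2 ^ (22 - k)) * (toE (2 * π) ^ 4 *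
        l1yL2xtNorm G ^ 2) := mul_le_mul' le_rfl (mul_le_mul' le_rfl this)
    _ = _ := by ring

end

attribute [fun_prop] measurable_halfExp

/-! ### Approximation in `L¹_y L²_{x,t}` -/

section

lemma exists_truncation (hG : Measurable G) (hG2 : MemLp G 2) {ε : ℝ≥0∞}
    (hε : ε ≠ 0) : ∃ (H : Amp) (M R : ℝ), IsNice H M R ∧ (∀ z, ‖H z‖ ≤ ‖G z‖) ∧
      eLpNorm (G - H) 2 ≤ ε := by
  let S : ℕ → Set Spacetime := fun n => {z | ‖G z‖ ≤ n ∧ ‖z‖ ≤ n}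
  have hS : ∀ n, MeasurableSet (S n) := fun n =>
    (measurableSet_le hG.norm measurable_const).inter (measurableSet_le measurable_norm
      measurable_const)
  have hle : ∀ n z, ‖(S n).indicator G z‖ ≤ ‖G z‖ := fun n z => norm_indicator_le_norm_self _ _
  have hlim : Tendsto (fun n => ∫⁻ z, ‖(G - (S n).indicator G) z‖ₑ ^ 2) atTop
      (nhds (∫⁻ _ : Spacetime, (0 : ℝ≥0∞))) := by
    refine tendsto_lintegral_of_dominated_convergence (fun z => ‖G z‖ₑ ^ 2) (fun n => ?_)
      (fun n => .of_forall fun z => ?_) ?_ (.of_forall fun z => ?_)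
    · exact ((hG.sub (hG.indicator (hS n))).enorm).pow_const 2
    · refine pow_le_pow_left' ?_ 2; by_cases hz : z ∈ S n <;> simp [hz]
    · rw [← eLpNorm_two_sq]; exact (pow_lt_top hG2.2).ne
    · obtain ⟨n, hn⟩ := exists_nat_ge (max ‖G z‖ ‖z‖)
      refine tendsto_const_nhds.congr' ?_
      filter_upwards [eventually_ge_atTop n] with m hm
      have hmn : (n : ℝ) ≤ m := by exact_mod_cast hm
      have hz : z ∈ S m := ⟨(le_max_left _ _).trans (hn.trans hmn),
        (le_max_right _ _).trans (hn.trans hmn)⟩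
      simp [hz]
  rw [lintegral_zero] at hlim
  have hε2 : (0 : ℝ≥0∞) < ε ^ 2 := by positivity
  obtain ⟨n, hn⟩ := (hlim.eventually (ge_mem_nhds hε2)).exists
  refine ⟨(S n).indicator G, n, n, ⟨hG.indicator (hS n), fun z => ?_, fun z hz => ?_⟩, hle n, ?_⟩
  · by_cases hz : z ∈ S n
    · rw [indicator_of_mem hz]; exact hz.1
    · simp [hz]
  · exact (mem_of_indicator_ne_zero hz).2
  · apply ennreal_le_of_sq_le; rw [eLpNorm_two_sq]; exact hn

set_option maxHeartbeats 800000 in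
lemma exists_nice_approx (g : L2) {ε : ℝ≥0∞} (hε : ε ≠ 0) :
    ∃ (H : Amp) (M R : ℝ), IsNice H M R ∧ l1yL2xtNorm H ≤ l1yL2xtNorm (l2FourierInv g) ∧
      eLpNorm (⇑g - ft3 H) 2 ≤ ε := by
  set c : ℝ≥0∞ := toE ((2 * π) ^ 3) ^ ½ with hc
  have hct : c ≠ ⊤ := rpow_ne_top_of_nonneg (by norm_num) ofReal_ne_top
  have hG := memLp_l2FourierInv g
  obtain ⟨H, M, R, hH, hle, hε'⟩ := exists_truncation (measurable_l2FourierInv g) hG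
    (ε := ε / c) (ENNReal.div_ne_zero.2 ⟨hε, hct⟩)
  refine ⟨H, M, R, hH, l1yL2xtNorm_mono hle, ?_⟩
  have h1 : (⇑g - ft3 H) =ᵐ[volume] l2Fourier (hG.toLp _ - (hH.memLp 2).toLp H) := by
    filter_upwards [l2Fourier_l2FourierInv g _ hG.coeFn_toLp, hH.l2Fourier_toLp,
      l2Fourier_sub (hG.toLp _) ((hH.memLp 2).toLp H)] with z h1 h2 h3
    rw [h3, Pi.sub_apply, Pi.sub_apply, h1, h2]
  rw [eLpNorm_congr_ae h1, eLpNorm_l2Fourier, ← MemLp.toLp_sub, eLpNorm_congr_ae (MemLp.coeFn_toLp _)]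
  exact (mul_le_mul' le_rfl hε').trans mul_div_le

lemma l1yL2xtNorm_eq (hG : Measurable G) :
    l1yL2xtNorm G = ∫⁻ y : ℝ, eLpNorm (fun p : Plane => G (ins y p)) 2 := by
  refine lintegral_congr fun y => ?_
  rw [eLpNorm_two_eq]
  have h : Measurable fun p : Plane => ‖G (ins y p)‖ₑ ^ 2 := by fun_prop
  rw [lintegral_plane h]
  rfl

lemma lintegral_ins' {F : Spacetime → ℝ≥0∞} (hF : Measurable F) :
    ∫⁻ z, F z = ∫⁻ y : ℝ, ∫⁻ p : Plane, F (ins y p) := by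
  rw [lintegral_ins hF]
  exact lintegral_lintegral_swap (hF.comp (measurable_ins.comp measurable_swap)).aemeasurable

lemma measurable_eLpNorm_ins (hG : Measurable G) :
    Measurable fun y : ℝ => eLpNorm (fun p : Plane => G (ins y p)) 2 := by
  simp_rw [eLpNorm_two_eq]
  refine Measurable.pow_const ?_ _
  fun_prop

lemma eLpNorm_ins_le_add {H : Amp} (hF : Measurable F) (hH : Measurable H) (y : ℝ) :
    eLpNorm (fun p : Plane => F (ins y p)) 2 ≤ eLpNorm (fun p : Plane => H (ins y p)) 2 +
      eLpNorm (fun p : Plane => (F - H) (ins y p)) 2 := by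
  have hm : Measurable fun p : Plane => ins y p := by fun_prop
  have h := eLpNorm_add_le (p := 2) (μ := volume) (hH.comp hm).aestronglyMeasurable
    ((hF.sub hH).comp hm).aestronglyMeasurable (by norm_num)
  rw [show (H ∘ fun p : Plane => ins y p) + ((F - H) ∘ fun p : Plane => ins y p) =
    fun p : Plane => F (ins y p) from funext fun p => by simp] at h
  exact h

lemma setLIntegral_eLpNorm_ins_le (hG : Measurable G) (s : Set ℝ) :
    ∫⁻ y in s, eLpNorm (fun p : Plane => G (ins y p)) 2 ≤ (volume s) ^ ½ * eLpNorm G 2 := by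
  apply ennreal_le_of_sq_le
  have hcs := lintegral_mul_sq_le (μ := volume.restrict s) (f := fun _ : ℝ => (1 : ℝ≥0∞))
    aemeasurable_const (measurable_eLpNorm_ins hG).aemeasurable
  simp only [one_mul, one_pow, lintegral_const, Measure.restrict_apply_univ] at hcs
  refine hcs.trans ?_
  rw [mul_pow, ennreal_sqrt_sq, eLpNorm_two_sq, lintegral_ins' (hG.enorm.pow_const 2)]
  refine mul_le_mul' le_rfl ((setLIntegral_le_lintegral _ _).trans (le_of_eq ?_))
  exact lintegral_congr fun y => eLpNorm_two_sq _

/-- Lower semicontinuity of the norm of `L¹_y L²_{x,t}` under convergence in `L²`. -/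
lemma l1yL2xtNorm_le_of_approx (hF : Measurable F) {B : ℝ≥0∞}
    (h : ∀ ε : ℝ≥0∞, ε ≠ 0 → ∃ H : Amp, Measurable H ∧ l1yL2xtNorm H ≤ B ∧
      eLpNorm (F - H) 2 ≤ ε) : l1yL2xtNorm F ≤ B := by
  rw [l1yL2xtNorm_eq hF]
  refine lintegral_le_of_forall_fin_meas_le B fun s hs hsf => ?_
  refine ENNReal.le_of_forall_pos_le_add fun ε hε _ => ?_
  have hvt : (volume s) ^ ½ ≠ ⊤ := rpow_ne_top_of_nonneg (by norm_num) hsf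
  have hε0 : (ε : ℝ≥0∞) ≠ 0 := by simpa using hε.ne'
  obtain ⟨H, hH, hHB, hHF⟩ := h _ (ENNReal.div_ne_zero.2 ⟨hε0, hvt⟩)
  have h1 : ∫⁻ y in s, eLpNorm (fun p : Plane => H (ins y p)) 2 ≤ B := by
    refine (setLIntegral_le_lintegral _ _).trans ?_
    rwa [← l1yL2xtNorm_eq hH]
  have h2 : ∫⁻ y in s, eLpNorm (fun p : Plane => (F - H) (ins y p)) 2 ≤ ε :=
    (setLIntegral_eLpNorm_ins_le (hF.sub hH) s).trans
      ((mul_le_mul' le_rfl hHF).trans mul_div_le)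
  refine le_trans (lintegral_mono fun y => eLpNorm_ins_le_add hF hH y) ?_
  rw [lintegral_add_left (measurable_eLpNorm_ins hH)]
  exact add_le_add h1 h2

end

/-! ### Estimates for functions of finite `Y_k` norm -/

section

lemma ofReal_pi_le : toE π ≤ 4 := by
  rw [show (4 : ℝ≥0∞) = toE 4 by simp]
  exact ofReal_le_ofReal pi_le_four

lemma ofReal_two_pi_le : toE (2 * π) ≤ 8 := by
  rw [show (8 : ℝ≥0∞) = toE 8 by simp]
  exact ofReal_le_ofReal (by linarith [pi_le_four])

lemma rootTwo_inv_pow_sq (K : ℕ) : (rootTwo⁻¹ ^ K) ^ 2 = (2 ^ K)⁻¹ := by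
  rw [← pow_mul, mul_comm, ← ENNReal.inv_pow, rootTwo_pow_two_mul]

lemma ofReal_two_zpow_eq (K : ℕ) :
    toE (2 ^ (22 - (K : ℤ))) = 2 ^ 22 * (rootTwo⁻¹ ^ K) ^ 2 := by
  rw [rootTwo_inv_pow_sq, zpow_sub₀ (by norm_num), div_eq_mul_inv,
    ENNReal.ofReal_mul (by positivity), zpow_natCast, ofReal_inv_of_pos (by positivity),
    ENNReal.ofReal_pow (by norm_num)]
  have h22 : toE ((2 : ℝ) ^ (22 : ℤ)) = 2 ^ 22 := by simp
  rw [h22]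
  simp

/-- The support properties of the functions in `Y_k` that are used in the estimates. -/
def YSupp (k : ℤ) (f : Amp) : Prop :=
  ∀ᵐ z : Spacetime, f z ≠ 0 → proj z ∈ widePlane k ∧ |modulation z| ≤ |z 0| ∧ z ∈ regionKPI

lemma YCarrier.ySupp {k : ℤ} (hf : YCarrier k f) : YSupp k f := by
  filter_upwards [hf.2.1] with z hz h0
  have h : z ∈ regionKPI ∧ z 0 ∈ dyadic k := by by_contra hc; exact h0 (hz hc)
  refine ⟨⟨h.2, le_trans ?_ h.1.2.1⟩, h.1.2.2.2, h.1⟩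
  change |z 0| ^ 2 / 2 ^ 21 ≤ |z 0| ^ 2 / 2 ^ 20
  gcongr
  · norm_num
  · norm_num

lemma eLpNorm_weight_le (g : L2) {m : Amp} (hm : Measurable m) (hm1 : ∀ z, ‖m z‖ ≤ 1) {A : ℝ≥0∞}
    (hA : ∀ p : Plane, ∫⁻ μ, ‖m (ins μ p)‖ₑ ^ 2 ≤ A ^ 2) :
    eLpNorm (fun z => m z * g z) 2 ≤ A * (toE (2 * π) * l1yL2xtNorm (l2FourierInv g)) := by
  refine ENNReal.le_of_forall_pos_le_add fun ε hε _ => ?_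
  obtain ⟨H, M, R, hH, hL, hd⟩ := exists_nice_approx g (ε := ε) (by simpa using hε.ne')
  have e : (fun z => m z * g z) = (fun z => m z * ft3 H z) + fun z => m z * (⇑g - ft3 H) z := by
    funext z
    simp only [Pi.add_apply, Pi.sub_apply]
    ring
  have hsub : AEStronglyMeasurable (⇑g - ft3 H) (volume : Measure Spacetime) := by fun_prop
  rw [e]
  refine (eLpNorm_add_le (hm.mul hH.continuous_ft3.measurable).aestronglyMeasurable
    (hm.aestronglyMeasurable.mul hsub) (by norm_num)).trans (add_le_add ?_ ?_)
  · apply ennreal_le_of_sq_le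
    rw [eLpNorm_two_sq, mul_pow]
    simp only [Pi.mul_apply, enorm_mul]
    refine (hH.lintegral_weight_le hm.enorm hA).trans ?_
    gcongr
  · refine le_trans (eLpNorm_mono fun z => ?_) hd
    rw [Pi.mul_apply, norm_mul]
    exact mul_le_of_le_one_left (norm_nonneg _) (hm1 z)

variable {k : ℤ}

lemma one_le_norm_modulation_add_I (z : Spacetime) : 1 ≤ ‖(modulation z : ℂ) + I‖ := by
  have h := abs_im_le_norm (κ z)
  simpa using h

lemma modulation_add_I_ne_zero (z : Spacetime) : (modulation z : ℂ) + I ≠ 0 := by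
  intro h
  have := one_le_norm_modulation_add_I z
  rw [h, norm_zero] at this
  linarith

lemma enorm_resolvent_sq (z : Spacetime) :
    ‖(κ z)⁻¹‖ₑ ^ 2 = toE ((1 + modulation z ^ 2)⁻¹) := by
  rw [enorm_inv (modulation_add_I_ne_zero z), ← ENNReal.inv_pow, enorm_modulation_sq,
    ofReal_inv_of_pos (by positivity), add_comm]

def wideInd (k : ℤ) (z : Spacetime) : ℂ := (proj ⁻¹' widePlane k).indicator 1 z

lemma measurable_wideInd (k : ℤ) : Measurable (wideInd k) :=
  measurable_one.indicator (measurable_proj (measurableSet_widePlane k))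

lemma norm_wideInd_le (k : ℤ) (z : Spacetime) : ‖wideInd k z‖ ≤ 1 := by
  unfold wideInd
  by_cases h : z ∈ proj ⁻¹' widePlane k <;> simp [h]

lemma enorm_wideInd_sq (k : ℤ) (z : Spacetime) :
    ‖wideInd k z‖ₑ ^ 2 = (widePlane k).indicator 1 (proj z) := by
  unfold wideInd
  by_cases h : proj z ∈ widePlane k
  · rw [indicator_of_mem (show z ∈ proj ⁻¹' widePlane k from h), indicator_of_mem h]; simp
  · rw [indicator_of_notMem (show z ∉ proj ⁻¹' widePlane k from h), indicator_of_notMem h]; simp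

lemma measurable_resolvent : Measurable fun z => (κ z)⁻¹ := by fun_prop

lemma norm_resolvent_le (z : Spacetime) : ‖(κ z)⁻¹‖ ≤ 1 := by
  rw [norm_inv]
  exact inv_le_one_of_one_le₀ (one_le_norm_modulation_add_I z)

lemma proj_ins (μ : ℝ) (p : Plane) : proj (ins μ p) = pt (p 0, μ) := rfl

lemma modulation_ins (μ : ℝ) (p : Plane) : modulation (ins μ p) = p 1 - omega (p 0) μ := rfl

lemma sq_mul_rearrange_le {a b c d : ℝ≥0∞} {N : ℕ} (h1 : a ≤ 2 ^ N * b ^ 2)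
    (h2 : c ≤ d) (h3 : 2 ^ N * d = (2 ^ 12) ^ 2) : a * c ≤ (2 ^ 12 * b) ^ 2 := by
  refine (mul_le_mul' h1 h2).trans (le_of_eq ?_)
  rw [mul_right_comm, h3, mul_pow]

lemma eLpNorm_le_of_ySupp (K : ℕ) (hs : YSupp K f) (h : MemLp (fun z => κ z * f z) 2) :
    eLpNorm f 2 ≤ 2 ^ 15 * (rootTwo⁻¹ ^ K * l1yL2xtNorm (l2FourierInv (h.toLp _))) := by
  have e : f =ᵐ[volume] fun z => (wideInd K z * (κ z)⁻¹) * h.toLp _ z := by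
    filter_upwards [h.coeFn_toLp, hs] with z h1 h2
    rw [h1]
    by_cases h0 : f z = 0
    · simp [h0]
    · rw [wideInd, indicator_of_mem (show z ∈ proj ⁻¹' widePlane K from (h2 h0).1)]
      have := modulation_add_I_ne_zero z
      simp only [Pi.one_apply]
      field_simp
  rw [eLpNorm_congr_ae e]
  refine (eLpNorm_weight_le _ ((measurable_wideInd K).mul measurable_resolvent)
    (A := 2 ^ 12 * rootTwo⁻¹ ^ K) (fun z => ?_) (fun p => ?_)).trans ?_
  · rw [Pi.mul_apply, norm_mul]
    exact mul_le_one₀ (norm_wideInd_le _ _) (norm_nonneg _) (norm_resolvent_le z)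
  · have hr : ∀ μ, ‖wideInd K (ins μ p) * (κ (ins μ p))⁻¹‖ₑ ^ 2 =
        (widePlane K).indicator 1 (pt (p 0, μ)) *
          (fun w : ℝ => toE ((1 ^ 2 + (p 1 - w) ^ 2)⁻¹)) (omega (p 0) μ) := fun μ => by
      rw [enorm_mul, mul_pow, enorm_wideInd_sq, enorm_resolvent_sq, proj_ins, modulation_ins, one_pow]
    refine (lintegral_congr hr).le.trans ((lintegral_widePlane_le (p 0) (φ := fun w : ℝ =>
      toE ((1 ^ 2 + (p 1 - w) ^ 2)⁻¹)) (by fun_prop)).trans ?_)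
    have hi : ∫⁻ w : ℝ, toE ((1 ^ 2 + (p 1 - w) ^ 2)⁻¹) ≤ 4 := by
      have := lintegral_inv_sq_add_sq (R := 1) one_pos (p 1)
      rw [div_one] at this
      refine le_trans (le_of_eq ?_) ofReal_pi_le
      rw [← this]
      refine lintegral_congr fun w => ?_
      rw [← neg_sub w, neg_sq]
    exact sq_mul_rearrange_le (N := 22) (ofReal_two_zpow_eq K).le hi (by norm_num)
  · calc _ ≤ 2 ^ 12 * rootTwo⁻¹ ^ K * (8 * l1yL2xtNorm (l2FourierInv (h.toLp _))) :=
        mul_le_mul' le_rfl (mul_le_mul' ofReal_two_pi_le le_rfl)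
      _ = _ := by ring

lemma lintegral_Icc_indicator (a r : ℝ) :
    ∫⁻ w : ℝ, (Icc (a - r) (a + r)).indicator (1 : ℝ → ℝ≥0∞) w = toE (2 * r) := by
  rw [lintegral_indicator_one measurableSet_Icc, volume_Icc]
  congr 1
  ring

lemma lintegral_band_le (K : ℕ) (p : Plane) : ∫⁻ μ, (widePlane K).indicator 1 (pt (p 0, μ)) *
    (Icc (p 1 - 2 ^ (K + 1)) (p 1 + 2 ^ (K + 1))).indicator (1 : ℝ → ℝ≥0∞) (omega (p 0) μ) ≤
      (2 ^ 12) ^ 2 := by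
  refine (lintegral_widePlane_le (p 0) (measurable_one.indicator measurableSet_Icc)).trans ?_
  rw [lintegral_Icc_indicator, ofReal_two_zpow_eq, rootTwo_inv_pow_sq]
  have : toE (2 * 2 ^ (K + 1)) = 4 * 2 ^ K := by
    rw [show (2 : ℝ) * 2 ^ (K + 1) = ((4 * 2 ^ K : ℕ) : ℝ) by push_cast; ring,
      ENNReal.ofReal_natCast]
    push_cast
    ring
  rw [this]
  calc (2 : ℝ≥0∞) ^ 22 * (2 ^ K)⁻¹ * (4 * 2 ^ K) = 2 ^ 22 * 4 * ((2 ^ K)⁻¹ * 2 ^ K) := by ring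
    _ ≤ _ := by rw [ENNReal.inv_mul_cancel (by simp) (by finiteness)]; norm_num

lemma hNorm_le_of_ySupp (K : ℕ) (hs : YSupp K f) (h : MemLp (fun z => κ z * f z) 2) :
    hNorm f ≤ 2 ^ 15 * l1yL2xtNorm (l2FourierInv (h.toLp _)) := by
  set S : Set Spacetime := {z | |modulation z| ≤ 2 ^ (K + 1)} with hS
  have hSm : MeasurableSet S := measurableSet_le measurable_modulation.abs measurable_const
  have e : (fun z => κ z * f z) =ᵐ[volume] fun z =>
      (wideInd K z * S.indicator 1 z) * h.toLp _ z := by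
    filter_upwards [h.coeFn_toLp, hs] with z h1 h2
    rw [h1]
    by_cases h0 : f z = 0
    · simp [h0]
    · have hb : z ∈ S := by
        have := (h2 h0).1.1.2
        refine (h2 h0).2.1.trans ?_
        have e2 : ((2 : ℝ) ^ ((K : ℤ) + 1)) = 2 ^ (K + 1) := by norm_cast
        rw [e2] at this
        exact this
      rw [wideInd, indicator_of_mem (show z ∈ proj ⁻¹' widePlane K from (h2 h0).1),
        indicator_of_mem hb]
      simp only [Pi.one_apply, one_mul]
  rw [hNorm, eLpNorm_congr_ae e]
  refine (eLpNorm_weight_le _ ((measurable_wideInd K).mul (measurable_one.indicator hSm))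
    (A := 2 ^ 12) (fun z => ?_) (fun p => ?_)).trans ?_
  · rw [Pi.mul_apply, norm_mul]
    refine mul_le_one₀ (norm_wideInd_le _ _) (norm_nonneg _) ?_
    by_cases hz : z ∈ S <;> simp [hz]
  · refine le_trans (le_of_eq (lintegral_congr fun μ => ?_)) (lintegral_band_le K p)
    rw [Pi.mul_apply, enorm_mul, mul_pow, enorm_wideInd_sq, proj_ins]
    congr 1
    have hiff : ins μ p ∈ S ↔ omega (p 0) μ ∈ Icc (p 1 - 2 ^ (K + 1)) (p 1 + 2 ^ (K + 1)) := by
      rw [hS, mem_ofPred_eq, modulation_ins, abs_le, mem_Icc]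
      constructor <;> rintro ⟨h1, h2⟩ <;> constructor <;> linarith
    by_cases hm : ins μ p ∈ S
    · rw [indicator_of_mem hm, indicator_of_mem (hiff.1 hm)]; simp
    · rw [indicator_of_notMem hm, indicator_of_notMem (fun h => hm (hiff.2 h))]; simp
  · calc _ ≤ 2 ^ 12 * (8 * l1yL2xtNorm (l2FourierInv (h.toLp _))) :=
        mul_le_mul' le_rfl (mul_le_mul' ofReal_two_pi_le le_rfl)
      _ = _ := by ring

def tauInt (f : Amp) (p : Plane) : ℂ := ∫ τ : ℝ, f (atTime τ p)

lemma measurable_tauInt (hf : Measurable f) : Measurable (tauInt f) :=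
  ((measurable_fiber_prod hf).stronglyMeasurable.integral_prod_right').measurable

lemma eLpNorm_tauInt_le (f : Amp) : eLpNorm (tauInt f) 2 ≤ mixNorm f := by
  apply ennreal_le_of_sq_le
  rw [eLpNorm_two_sq, mixNorm_sq]
  exact lintegral_mono fun p => pow_le_pow_left' (enorm_integral_le_lintegral_enorm _) 2

lemma mixNorm_resolvent_le {u : Amp} (hu : Measurable u) :
    mixNorm (fun z => (κ z)⁻¹ * u z) ≤ 2 * eLpNorm u 2 := by
  apply ennreal_le_of_sq_le
  refine (mixNorm_sq_le (measurable_resolvent.mul hu) one_pos).trans ?_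
  rw [div_one, mul_pow, eLpNorm_two_sq]
  refine mul_le_mul' (ofReal_pi_le.trans (by norm_num)) (lintegral_mono fun z => ?_)
  rw [Pi.mul_apply, enorm_mul, mul_pow, enorm_resolvent_sq, ← mul_assoc, ← ENNReal.ofReal_mul (by positivity),
    one_pow, mul_inv_cancel₀ (by positivity), ENNReal.ofReal_one, one_mul]

lemma memLp_resolvent_fiber (p : Plane) :
    MemLp (fun τ : ℝ => (κ (atTime τ p))⁻¹) 2 := by
  refine ⟨(measurable_fiber measurable_resolvent p).aestronglyMeasurable, ?_⟩
  rw [eLpNorm_two_eq]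
  refine rpow_lt_top_of_nonneg (by norm_num) ?_
  simp_rw [enorm_resolvent_sq, modulation_atTime]
  have := lintegral_inv_sq_add_sq (R := 1) one_pos (omega (p 0) (p 1))
  rw [one_pow] at this
  rw [this]
  exact ofReal_ne_top

lemma tauInt_resolvent_add {u v : Amp} (hu : Measurable u) (hu2 : MemLp u 2)
    (hv : Measurable v) (hv2 : MemLp v 2) :
    tauInt (fun z => (κ z)⁻¹ * (u + v) z) =ᵐ[volume]
      tauInt (fun z => (κ z)⁻¹ * u z) + tauInt (fun z => (κ z)⁻¹ * v z) := by
  filter_upwards [memLp_fiber_ae hu hu2, memLp_fiber_ae hv hv2] with p h1 h2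
  have i1 := (memLp_resolvent_fiber p).integrable_mul h1
  have i2 := (memLp_resolvent_fiber p).integrable_mul h2
  have i3 := integral_add i1 i2
  simp only [Pi.mul_apply] at i3
  simp only [tauInt, Pi.add_apply, mul_add]
  exact i3

lemma eLpNorm_tauInt_le_of_ySupp (K : ℕ) (hf : Measurable f) (hs : YSupp K f)
    (h : MemLp (fun z => κ z * f z) 2) :
    eLpNorm (tauInt f) 2 ≤ 2 ^ 17 * (rootTwo⁻¹ ^ K * l1yL2xtNorm (l2FourierInv (h.toLp _))) := by
  set g : Amp := fun z => κ z * f z with hg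
  have hgm : Measurable g := by fun_prop
  have hfg : f = fun z => (κ z)⁻¹ * g z := by
    funext z
    rw [hg, inv_mul_cancel_left₀ (modulation_add_I_ne_zero z)]
  have hrestr : eLpNorm (tauInt f) 2 = eLpNorm (tauInt f) 2 (volume.restrict (widePlane K)) := by
    rw [← eLpNorm_indicator_eq_eLpNorm_restrict (measurableSet_widePlane K)]
    refine eLpNorm_congr_ae ?_
    filter_upwards [ae_atTime hs] with p hp
    by_cases hw : p ∈ widePlane K
    · rw [indicator_of_mem hw]
    · rw [indicator_of_notMem hw, tauInt]
      refine integral_eq_zero_of_ae ?_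
      filter_upwards [hp] with τ hτ
      by_contra h0
      exact hw (by simpa [proj_atTime] using (hτ h0).1)
  rw [hrestr]
  refine ENNReal.le_of_forall_pos_le_add fun ε hε _ => ?_
  obtain ⟨H, M, R, hH, hL, hd⟩ := exists_nice_approx (h.toLp _) (ε := ε / 2)
    (by simpa using hε.ne')
  have hd' : eLpNorm (g - ft3 H) 2 ≤ ε / 2 := by
    refine le_trans (le_of_eq (eLpNorm_congr_ae ?_)) hd
    filter_upwards [h.coeFn_toLp] with z hz
    simp only [Pi.sub_apply, hz]
  have hH2 : MemLp (ft3 H) 2 := (memLp_l2Fourier _).ae_eq hH.l2Fourier_toLp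
  have hadd := tauInt_resolvent_add hH.continuous_ft3.measurable hH2
    (hgm.sub hH.continuous_ft3.measurable) (h.sub hH2)
  rw [add_sub_cancel, ← hfg] at hadd
  rw [eLpNorm_congr_ae (ae_restrict_of_ae hadd)]
  refine (eLpNorm_add_le (measurable_tauInt (measurable_resolvent.mul
    hH.continuous_ft3.measurable)).aestronglyMeasurable (measurable_tauInt (measurable_resolvent.mul
    (hgm.sub hH.continuous_ft3.measurable))).aestronglyMeasurable (by norm_num)).trans
    (add_le_add ?_ ?_)
  · apply ennreal_le_of_sq_le
    rw [eLpNorm_two_sq]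
    have h1 := hH.lintegral_resolvent_le K
    refine le_trans (le_of_eq ?_) (h1.trans ?_)
    · refine lintegral_congr fun p => ?_; rfl
    · rw [ofReal_two_zpow_eq]
      calc (2 : ℝ≥0∞) ^ 22 * (rootTwo⁻¹ ^ K) ^ 2 *
            (toE (2 * π) ^ 2 * l1yL2xtNorm H) ^ 2
          ≤ 2 ^ 22 * (rootTwo⁻¹ ^ K) ^ 2 * (8 ^ 2 * l1yL2xtNorm (l2FourierInv (h.toLp _))) ^ 2 := by
            refine mul_le_mul' le_rfl (pow_le_pow_left' (mul_le_mul' ?_ hL) 2)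
            exact pow_le_pow_left' ofReal_two_pi_le 2
        _ = _ := by ring
  · refine (eLpNorm_restrict_le _ _ _ _).trans ((eLpNorm_tauInt_le _).trans
      ((mixNorm_resolvent_le (hgm.sub hH.continuous_ft3.measurable)).trans ?_))
    refine (mul_le_mul' le_rfl hd').trans ?_
    exact mul_div_le

end

attribute [fun_prop] measurable_wideInd measurable_tauInt

/-! ### Smooth localization to the support of `Y_k` -/

section

section

variable (hη : IsBump η)
include hη

lemma IsBump.deriv_continuous : Continuous (deriv η) := hη.smooth.continuous_deriv (by simp)

lemma IsBump.hasDerivAt (s : ℝ) : HasDerivAt η (deriv η s) s :=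
  ((hη.smooth.differentiable (by simp)) s).hasDerivAt

lemma IsBump.deriv_ne_zero {s : ℝ} (h : deriv η s ≠ 0) :
    5 / 4 ≤ |s| ∧ |s| ≤ 8 / 5 := by
  constructor
  · by_contra hc
    apply h
    have : η =ᶠ[nhds s] fun _ => 1 := by
      filter_upwards [(continuous_abs.tendsto s).eventually (gt_mem_nhds (not_le.1 hc))] with x hx
      exact hη.eq_one' (le_of_lt hx)
    rw [this.deriv_eq, deriv_const]
  · by_contra hc
    apply h
    have : η =ᶠ[nhds s] fun _ => 0 := by
      filter_upwards [(continuous_abs.tendsto s).eventually (lt_mem_nhds (not_le.1 hc))] with x hx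
      exact hη.eq_zero hx
    rw [this.deriv_eq, deriv_const]

lemma IsBump.exists_deriv_bound : ∃ D : ℝ, 0 ≤ D ∧ ∀ s, |deriv η s| ≤ D := by
  obtain ⟨D, hD⟩ := hη.deriv_continuous.bounded_above_of_compact_support hη.hasCompactSupport.deriv
  exact ⟨D, (norm_nonneg _).trans (hD 0), hD⟩

end

/-- The factor of the localization which only depends on `ξ` and `μ`. -/
def muCut (η : ℝ → ℝ) (ξ μ : ℝ) : ℝ := η (μ / (2 ^ 20 * ξ ^ 2)) - η (2 ^ 21 * μ / ξ ^ 2)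

/-- A smooth localization to the support of `Y_k`. -/
def yCut (η : ℝ → ℝ) (k : ℤ) (z : Spacetime) : ℝ :=
  (dyadic k).indicator 1 (z 0) * (η (2 * modulation z / z 0) * muCut η (z 0) (z 1))

lemma measurable_yCut (hη : IsBump η) (k : ℤ) : Measurable (yCut η k) := by
  have h := hη.continuous.measurable
  have h1 : Measurable fun z : Spacetime => z 0 := by fun_prop
  unfold yCut muCut
  exact ((measurable_one.indicator (measurableSet_dyadic k)).comp h1).mul
    ((h.comp (by fun_prop)).mul ((h.comp (by fun_prop)).sub (h.comp (by fun_prop))))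

lemma abs_muCut_le (hη : IsBump η) (ξ μ : ℝ) : |muCut η ξ μ| ≤ 1 := by
  have h1 := hη.mem_Icc (μ / (2 ^ 20 * ξ ^ 2))
  have h2 := hη.mem_Icc (2 ^ 21 * μ / ξ ^ 2)
  rw [muCut, abs_le]
  constructor <;> linarith [h1.1, h1.2, h2.1, h2.2]

lemma abs_yCut_le (hη : IsBump η) (k : ℤ) (z : Spacetime) : |yCut η k z| ≤ 1 := by
  rw [yCut, abs_mul, abs_mul]
  refine mul_le_one₀ ?_ (by positivity) (mul_le_one₀ (hη.abs_le_one _) (abs_nonneg _)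
    (abs_muCut_le hη _ _))
  by_cases h : z 0 ∈ dyadic k <;> simp [h]

lemma two_pow_mul_abs (ξ μ : ℝ) : |2 ^ 21 * μ / ξ ^ 2| = 2 ^ 21 * (|μ| / |ξ| ^ 2) := by grind

lemma abs_div_two_pow (ξ μ : ℝ) : |μ / (2 ^ 20 * ξ ^ 2)| = |μ| / |ξ| ^ 2 / 2 ^ 20 := by grind

lemma muCut_ne_zero (hη : IsBump η) {ξ μ : ℝ} (hξ : ξ ≠ 0) (h : muCut η ξ μ ≠ 0) :
    |ξ| ^ 2 / 2 ^ 21 ≤ |μ| ∧ |μ| ≤ 2 ^ 21 * |ξ| ^ 2 := by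
  have hp : 0 < |ξ| ^ 2 := by positivity
  have hμ : |μ| = |μ| / |ξ| ^ 2 * |ξ| ^ 2 := by field_simp
  constructor
  · by_contra hc
    apply h
    have hr : |μ| / |ξ| ^ 2 < 1 / 2 ^ 21 := by rw [div_lt_iff₀ hp]; linarith [not_le.1 hc]
    rw [muCut, hη.eq_one' (by rw [abs_div_two_pow]; linarith),
      hη.eq_one' (by rw [two_pow_mul_abs]; linarith), sub_self]
  · by_contra hc
    apply h
    have hr : 2 ^ 21 < |μ| / |ξ| ^ 2 := by rw [lt_div_iff₀ hp]; exact not_le.1 hc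
    rw [muCut, hη.eq_zero (by rw [abs_div_two_pow]; linarith),
      hη.eq_zero (by rw [two_pow_mul_abs]; linarith), sub_self]

lemma muCut_eq_one (hη : IsBump η) {ξ μ : ℝ} (hξ : ξ ≠ 0) (h1 : |ξ| ^ 2 / 2 ^ 20 ≤ |μ|)
    (h2 : |μ| ≤ 2 ^ 20 * |ξ| ^ 2) : muCut η ξ μ = 1 := by
  have hp : 0 < |ξ| ^ 2 := by positivity
  have hr1 : 1 / 2 ^ 20 ≤ |μ| / |ξ| ^ 2 := by rw [le_div_iff₀ hp]; linarith
  have hr2 : |μ| / |ξ| ^ 2 ≤ 2 ^ 20 := by rw [div_le_iff₀ hp]; exact h2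
  rw [muCut, hη.eq_one' (by rw [abs_div_two_pow]; linarith),
    hη.eq_zero (by rw [two_pow_mul_abs]; linarith), sub_zero]

lemma two_mul_theta_le {θ ξ : ℝ} (hξ : ξ ≠ 0) (h : |2 * θ / ξ| ≤ 8 / 5) : |θ| ≤ |ξ| := by
  rw [abs_div, abs_mul, abs_two, div_le_iff₀ (abs_pos.2 hξ)] at h
  linarith [abs_nonneg ξ]

lemma yCut_ne_zero (hη : IsBump η) {k : ℤ} {z : Spacetime} (h : yCut η k z ≠ 0) :
    z 0 ∈ dyadic k ∧ |modulation z| ≤ |z 0| ∧ |z 0| ^ 2 / 2 ^ 21 ≤ |z 1| ∧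
      |z 1| ≤ 2 ^ 21 * |z 0| ^ 2 := by
  have h0 : z 0 ∈ dyadic k := by
    by_contra hc
    exact h (by rw [yCut, indicator_of_notMem hc, zero_mul])
  have hξ := dyadic_ne_zero h0
  have h1 := left_ne_zero_of_mul (right_ne_zero_of_mul h)
  have h2 := right_ne_zero_of_mul (right_ne_zero_of_mul h)
  refine ⟨h0, two_mul_theta_le hξ ?_, muCut_ne_zero hη hξ h2⟩
  by_contra hc
  exact h1 (hη.eq_zero (not_le.1 hc))

def yCutDeriv (η : ℝ → ℝ) (k : ℤ) (z : Spacetime) : ℝ :=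
  (dyadic k).indicator 1 (z 0) * (deriv η (2 * modulation z / z 0) * (-(4 * z 1) / z 0 ^ 2) *
    muCut η (z 0) (z 1) + η (2 * modulation z / z 0) *
      (deriv η (z 1 / (2 ^ 20 * z 0 ^ 2)) / (2 ^ 20 * z 0 ^ 2) -
        deriv η (2 ^ 21 * z 1 / z 0 ^ 2) * 2 ^ 21 / z 0 ^ 2))

lemma hasDerivAt_yCut (hη : IsBump η) (k : ℤ) (p : Plane) (μ : ℝ) :
    HasDerivAt (fun μ => yCut η k (ins μ p)) (yCutDeriv η k (ins μ p)) μ := by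
  have ha : HasDerivAt (fun μ => 2 * modulation (ins μ p) / p 0) (-(4 * μ) / p 0 ^ 2) μ := by
    have := (((hasDerivAt_omega (p 0) μ).const_sub (p 1)).const_mul 2).div_const (p 0)
    refine this.congr_deriv ?_
    rcases eq_or_ne (p 0) 0 with h | h
    · simp [h]
    · field_simp; ring
  have hb : HasDerivAt (fun μ => μ / (2 ^ 20 * p 0 ^ 2)) (1 / (2 ^ 20 * p 0 ^ 2)) μ :=
    (hasDerivAt_id μ).div_const _
  have hc : HasDerivAt (fun μ => 2 ^ 21 * μ / p 0 ^ 2) (2 ^ 21 * 1 / p 0 ^ 2) μ :=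
    ((hasDerivAt_id μ).const_mul _).div_const _
  have h := (((hη.hasDerivAt _).comp μ ha).mul (((hη.hasDerivAt _).comp μ hb).sub
    ((hη.hasDerivAt _).comp μ hc))).const_mul ((dyadic k).indicator 1 (p 0) : ℝ)
  refine h.congr_deriv ?_
  simp only [yCutDeriv, muCut, ins_apply_zero, ins_apply_one, Pi.sub_apply, comp_apply]
  ring

lemma yCutDeriv_ne_zero (hη : IsBump η) {k : ℤ} {z : Spacetime} (h : yCutDeriv η k z ≠ 0) :
    z 0 ∈ dyadic k ∧ |modulation z| ≤ |z 0| ∧ |z 0| ^ 2 / 2 ^ 21 ≤ |z 1| ∧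
      |z 1| ≤ 2 ^ 21 * |z 0| ^ 2 := by
  have h0 : z 0 ∈ dyadic k := by
    by_contra hc
    exact h (by rw [yCutDeriv, indicator_of_notMem hc, zero_mul])
  have hξ := dyadic_ne_zero h0
  have hp : 0 < |z 0| ^ 2 := by positivity
  refine ⟨h0, two_mul_theta_le hξ ?_, ?_⟩
  · by_contra hc
    apply h
    have h1 : deriv η (2 * modulation z / z 0) = 0 := by
      by_contra h1
      exact hc (hη.deriv_ne_zero h1).2
    rw [yCutDeriv, h1, hη.eq_zero (not_le.1 hc)]
    ring
  · by_contra hc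
    apply h
    have h1 : muCut η (z 0) (z 1) = 0 := by by_contra h1; exact hc (muCut_ne_zero hη hξ h1)
    have h2 : deriv η (z 1 / (2 ^ 20 * z 0 ^ 2)) = 0 := by
      by_contra h2
      have h3 := hη.deriv_ne_zero h2
      rw [abs_div_two_pow, div_div, le_div_iff₀ (by positivity), div_le_iff₀ (by positivity)] at h3
      exact hc ⟨by linarith [h3.1], by linarith [h3.2]⟩
    have h4 : deriv η (2 ^ 21 * z 1 / z 0 ^ 2) = 0 := by
      by_contra h2
      have h3 := hη.deriv_ne_zero h2
      rw [two_pow_mul_abs, mul_div_assoc', le_div_iff₀ (by positivity),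
        div_le_iff₀ (by positivity)] at h3
      exact hc ⟨by linarith [h3.1], by linarith [h3.2]⟩
    rw [yCutDeriv, h1, h2, h4]
    ring

lemma one_le_abs_of_dyadic {K : ℕ} (hK : 1 ≤ K) {ξ : ℝ} (h : ξ ∈ dyadic K) : 1 ≤ |ξ| := by
  refine le_trans ?_ h.1
  rw [show ((K : ℤ) - 1) = ((K - 1 : ℕ) : ℤ) by omega, zpow_natCast]
  exact one_le_pow₀ (by norm_num)

lemma abs_yCutDeriv_le (hη : IsBump η) {D : ℝ} (hD0 : 0 ≤ D) (hD : ∀ s, |deriv η s| ≤ D)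
    {K : ℕ} (hK : 1 ≤ K) (z : Spacetime) : |yCutDeriv η K z| ≤ 2 ^ 24 * D := by
  by_cases h : yCutDeriv η K z = 0
  · grind
  obtain ⟨h0, _, _, hμ⟩ := yCutDeriv_ne_zero hη h
  have hξ := one_le_abs_of_dyadic hK h0
  have hp : 1 ≤ |z 0| ^ 2 := one_le_pow₀ hξ
  rw [yCutDeriv, indicator_of_mem h0, Pi.one_apply, one_mul]
  have e1 : |-(4 * z 1) / z 0 ^ 2| ≤ 2 ^ 23 := by
    rw [abs_div, abs_neg, abs_mul, abs_pow, div_le_iff₀ (by positivity),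
      abs_of_pos (by norm_num : (0 : ℝ) < 4)]
    linarith
  have e2 : |deriv η (z 1 / (2 ^ 20 * z 0 ^ 2)) / (2 ^ 20 * z 0 ^ 2)| ≤ D := by
    have h20 : 1 ≤ 2 ^ 20 * |z 0| ^ 2 := by linarith
    rw [abs_div, abs_mul, abs_pow (z 0), abs_of_pos (by norm_num : (0 : ℝ) < 2 ^ 20),
      div_le_iff₀ (by linarith)]
    exact (hD _).trans (le_mul_of_one_le_right hD0 h20)
  have e3 : |deriv η (2 ^ 21 * z 1 / z 0 ^ 2) * 2 ^ 21 / z 0 ^ 2| ≤ 2 ^ 21 * D := by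
    rw [abs_div, abs_mul, abs_pow (z 0), div_le_iff₀ (by positivity),
      abs_of_pos (by norm_num : (0 : ℝ) < 2 ^ 21)]
    nlinarith [hD (2 ^ 21 * z 1 / z 0 ^ 2)]
  have t1 : |deriv η (2 * modulation z / z 0) * (-(4 * z 1) / z 0 ^ 2) * muCut η (z 0) (z 1)| ≤
      D * 2 ^ 23 * 1 := by
    rw [abs_mul, abs_mul]
    exact mul_le_mul (mul_le_mul (hD _) e1 (abs_nonneg _) hD0) (abs_muCut_le hη _ _)
      (abs_nonneg _) (by positivity)
  have t2 : |η (2 * modulation z / z 0) * (deriv η (z 1 / (2 ^ 20 * z 0 ^ 2)) / (2 ^ 20 * z 0 ^ 2) -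
      deriv η (2 ^ 21 * z 1 / z 0 ^ 2) * 2 ^ 21 / z 0 ^ 2)| ≤ 1 * (D + 2 ^ 21 * D) := by
    rw [abs_mul]
    exact mul_le_mul (hη.abs_le_one _) ((abs_sub _ _).trans (add_le_add e2 e3)) (abs_nonneg _)
      zero_le_one
  refine (abs_add_le _ _).trans ?_
  linarith

lemma continuous_yCutDeriv_ins (hη : IsBump η) (k : ℤ) (p : Plane) :
    Continuous fun μ => yCutDeriv η k (ins μ p) := by
  have h1 := hη.deriv_continuous
  have h2 := hη.continuous
  have hω : Continuous fun μ => modulation (ins μ p) := by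
    simp only [modulation_ins, omega]
    fun_prop
  simp only [yCutDeriv, muCut, ins_apply_zero, ins_apply_one]
  fun_prop

end

/-! ### A weighted Plancherel identity -/

section

variable {ψ ψ' : ℝ → ℂ} (hd : ∀ x, HasDerivAt ψ (ψ' x) x) (h1 : Integrable ψ)
include hd h1

lemma ft_deriv (h1' : Integrable ψ') (y : ℝ) : ft ψ' y = I * y * ft ψ y := by
  have he : deriv ψ = ψ' := funext fun x => (hd x).deriv
  rw [ft_eq, ft_eq, ← he, fourier_deriv h1 (fun x => (hd x).differentiableAt) (he ▸ h1')]
  simp only [smul_eq_mul]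
  have : (2 * π * I * (((2 * π)⁻¹ * y : ℝ) : ℂ)) = I * y := by
    push_cast
    have : (π : ℂ) ≠ 0 := by exact_mod_cast pi_ne_zero
    field_simp
  rw [this]

lemma lintegral_one_add_sq_ft (h2 : MemLp ψ 2) (h1' : Integrable ψ') (h2' : MemLp ψ' 2) :
    ∫⁻ y : ℝ, toE (1 + y ^ 2) * ‖ft ψ y‖ₑ ^ 2 =
      toE (2 * π) * ((∫⁻ x, ‖ψ x‖ₑ ^ 2) + ∫⁻ x, ‖ψ' x‖ₑ ^ 2) := by
  rw [mul_add, ← lintegral_ft_sq h1 h2, ← lintegral_ft_sq h1' h2', ← lintegral_add_left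
    ((continuous_ft h1).measurable.enorm.pow_const 2)]
  refine lintegral_congr fun y => ?_
  rw [ft_deriv hd h1 h1', ENNReal.ofReal_add zero_le_one (by positivity), ENNReal.ofReal_one, add_mul,
    one_mul, enorm_mul, mul_pow, enorm_mul, mul_pow, enorm_ofReal_sq,
    show ‖I‖ₑ = 1 by rw [← ofReal_norm, norm_I, ENNReal.ofReal_one]]
  simp

end

section

lemma integrable_memLp_of_band {ψ : ℝ → ℝ} (hψ : Measurable ψ) {M R : ℝ} (hM : ∀ x, |ψ x| ≤ M)
    (hs : ∀ x, ψ x ≠ 0 → |x| ≤ R) :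
    Integrable (fun x => (ψ x : ℂ)) ∧ MemLp (fun x => (ψ x : ℂ)) 2 := by
  have hm : Measurable fun x => (ψ x : ℂ) := by fun_prop
  have h1 : ∀ x, ‖(ψ x : ℂ)‖ ≤ M := fun x => by rw [norm_real]; exact hM x
  have h2 : ∀ x, (ψ x : ℂ) ≠ 0 → |x| ≤ R := fun x hx => hs x (by exact_mod_cast hx)
  exact ⟨integrable_of_bdd_line hm h1 h2, memLp_of_bdd_line hm h1 h2 2⟩

lemma lintegral_sq_le_of_band {K : ℕ} (p : Plane) {ψ : Spacetime → ℝ} {M : ℝ}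
    (hM : ∀ z, |ψ z| ≤ M) (hs : ∀ z, ψ z ≠ 0 → z 0 ∈ dyadic K ∧ |modulation z| ≤ |z 0| ∧
      |z 0| ^ 2 / 2 ^ 21 ≤ |z 1| ∧ |z 1| ≤ 2 ^ 21 * |z 0| ^ 2) :
    ∫⁻ μ, ‖(ψ (ins μ p) : ℂ)‖ₑ ^ 2 ≤ toE (M ^ 2) * (2 ^ 12) ^ 2 := by
  refine le_trans ?_ (mul_le_mul' le_rfl (lintegral_band_le K p))
  rw [← lintegral_const_mul' _ _ ofReal_ne_top]
  refine lintegral_mono fun μ => ?_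
  by_cases h : ψ (ins μ p) = 0
  · simp [h]
  · obtain ⟨h0, h1, h2, -⟩ := hs _ h
    have hb : |p 0| ≤ 2 ^ (K + 1) := by
      have := h0.2
      have e2 : ((2 : ℝ) ^ ((K : ℤ) + 1)) = 2 ^ (K + 1) := by norm_cast
      rw [e2] at this
      exact this
    have h1' := abs_le.1 (h1.trans hb)
    rw [modulation_ins] at h1'
    have hm : omega (p 0) μ ∈ Icc (p 1 - 2 ^ (K + 1)) (p 1 + 2 ^ (K + 1)) :=
      ⟨by linarith [h1'.2], by linarith [h1'.1]⟩
    rw [indicator_of_mem (show pt (p 0, μ) ∈ widePlane K from ⟨h0, h2⟩),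
      indicator_of_mem hm, Pi.one_apply, Pi.one_apply, mul_one, mul_one, enorm_ofReal_sq]
    refine ofReal_le_ofReal ?_
    rw [← sq_abs (ψ _)]
    exact pow_le_pow_left₀ (abs_nonneg _) (hM _) 2

def kernelConst (D : ℝ) : ℝ≥0∞ := 8 * (2 ^ 24 + toE ((2 ^ 24 * D) ^ 2) * 2 ^ 24)

lemma lintegral_ft_yCut_le (hη : IsBump η) {D : ℝ} (hD0 : 0 ≤ D) (hD : ∀ s, |deriv η s| ≤ D)
    {K : ℕ} (hK : 1 ≤ K) (p : Plane) :
    ∫⁻ y : ℝ, toE (1 + y ^ 2) * ‖ft (fun μ => (yCut η K (ins μ p) : ℂ)) y‖ₑ ^ 2 ≤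
      kernelConst D := by
  have hins : Measurable fun μ : ℝ => ins μ p := by fun_prop
  have h1 := integrable_memLp_of_band (R := 2 ^ 21 * |p 0| ^ 2)
    (ψ := fun μ => yCut η K (ins μ p)) ((measurable_yCut hη K).comp hins)
    (fun μ => abs_yCut_le hη K (ins μ p)) (fun μ hμ => (yCut_ne_zero hη hμ).2.2.2)
  have h2 := integrable_memLp_of_band (R := 2 ^ 21 * |p 0| ^ 2) (continuous_yCutDeriv_ins hη K p).measurable
    (fun μ => abs_yCutDeriv_le hη hD0 hD hK (ins μ p)) (fun μ hμ => (yCutDeriv_ne_zero hη hμ).2.2.2)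
  have e := lintegral_one_add_sq_ft (fun μ => (hasDerivAt_yCut hη K p μ).ofReal_comp) h1.1 h1.2
    h2.1 h2.2
  refine (le_of_eq e).trans (mul_le_mul' ofReal_two_pi_le (add_le_add ?_ ?_))
  · refine (lintegral_sq_le_of_band p (abs_yCut_le hη K) (fun z => yCut_ne_zero hη)).trans ?_
    norm_num
  · refine (lintegral_sq_le_of_band p (abs_yCutDeriv_le hη hD0 hD hK)
      (fun z => yCutDeriv_ne_zero hη)).trans ?_
    rw [← pow_mul]

lemma norm_le_sum_abs (z : Spacetime) : ‖z‖ ≤ |z 0| + |z 1| + |z 2| := by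
  rw [EuclideanSpace.norm_eq]
  refine sqrt_le_iff.2 ⟨by positivity, ?_⟩
  rw [Fin.sum_univ_three]
  simp only [norm_eq_abs]
  nlinarith [abs_nonneg (z 0), abs_nonneg (z 1), abs_nonneg (z 2),
    mul_nonneg (abs_nonneg (z 0)) (abs_nonneg (z 1)),
    mul_nonneg (abs_nonneg (z 0)) (abs_nonneg (z 2)),
    mul_nonneg (abs_nonneg (z 1)) (abs_nonneg (z 2))]

lemma exists_yCut_supp (hη : IsBump η) {K : ℕ} (hK : 1 ≤ K) :
    ∃ R : ℝ, ∀ z, yCut η K z ≠ 0 → ‖z‖ ≤ R := by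
  set B : ℝ := 2 ^ (K + 1) with hB
  refine ⟨B + 2 ^ 21 * B ^ 2 + (B + B ^ 3 + (2 ^ 21 * B ^ 2) ^ 2), fun z hz => ?_⟩
  obtain ⟨h0, h1, -, h2⟩ := yCut_ne_zero hη hz
  have hb : |z 0| ≤ B := by
    have := h0.2
    have e2 : ((2 : ℝ) ^ ((K : ℤ) + 1)) = 2 ^ (K + 1) := by norm_cast
    rw [e2] at this
    exact this
  have hξ := one_le_abs_of_dyadic hK h0
  have hμ : |z 1| ≤ 2 ^ 21 * B ^ 2 := h2.trans (by gcongr)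
  have hω : |omega (z 0) (z 1)| ≤ B ^ 3 + (2 ^ 21 * B ^ 2) ^ 2 := by
    rw [omega]
    refine (abs_add_le _ _).trans (add_le_add ?_ ?_)
    · rw [abs_pow]; gcongr
    · rw [abs_div, abs_pow]; refine (div_le_self (by positivity) hξ).trans ?_; gcongr
  have hτ : |z 2| ≤ B + (B ^ 3 + (2 ^ 21 * B ^ 2) ^ 2) := by
    have : z 2 = modulation z + omega (z 0) (z 1) := by rw [modulation]; ring
    rw [this]
    exact (abs_add_le _ _).trans (add_le_add (h1.trans hb) hω)
  refine (norm_le_sum_abs z).trans ?_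
  linarith

lemma IsNice.yCut_mul_ft3 {M R : ℝ} (hG : IsNice G M R) (hη : IsBump η)
    {K : ℕ} (hK : 1 ≤ K) : ∃ M' R' : ℝ, IsNice (fun ζ => (yCut η K ζ : ℂ) * ft3 G ζ) M' R' := by
  obtain ⟨R', hR'⟩ := exists_yCut_supp hη hK
  refine ⟨∫ z, ‖G z‖, R', ?_, fun z => ?_, fun z hz => ?_⟩
  · exact (Complex.measurable_ofReal.comp (measurable_yCut hη K)).mul hG.continuous_ft3.measurable
  · rw [norm_mul, norm_real]
    exact (mul_le_of_le_one_left (norm_nonneg _) (abs_yCut_le hη K z)).trans (norm_ft3_le G z)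
  · exact hR' z (by exact_mod_cast left_ne_zero_of_mul hz)

end

/-! ### Multipliers on `L¹_y L²_{x,t}` -/

section

lemma ft_mul_ft {ψ a : ℝ → ℂ} (hψ : Integrable ψ) (ha : Integrable a) (v : ℝ) :
    ft (fun μ => ψ μ * ft a μ) v = ∫ y, a y * ft ψ (v + y) := by
  simp only [ft, ← integral_const_mul]
  rw [integral_integral_swap]
  · refine integral_congr fun y => ?_
    refine integral_congr fun μ => ?_
    rw [show -(I * ((μ * (v + y) : ℝ) : ℂ)) = -(I * ((μ * v : ℝ) : ℂ)) +
      -(I * ((y * μ : ℝ) : ℂ)) by push_cast; ring, Complex.exp_add]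
    ring
  · have h := hψ.mul_prod ha
    refine (h.bdd_mul (c := 1) (f := fun q : ℝ × ℝ => cexp (-(I *
      ((q.1 * v + q.2 * q.1 : ℝ) : ℂ)))) ?_ ?_).congr ?_
    · fun_prop
    · exact .of_forall fun q => (norm_exp_neg_I_mul _).le
    · refine .of_forall fun q => ?_
      simp only [uncurry]
      rw [show -(I * ((q.1 * v + q.2 * q.1 : ℝ) : ℂ)) = -(I * ((q.1 * v : ℝ) : ℂ)) +
        -(I * ((q.2 * q.1 : ℝ) : ℂ)) by push_cast; ring, Complex.exp_add]
      ring

lemma l1yL2xtNorm_comp_neg (F : Amp) :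
    l1yL2xtNorm (fun z => F (-z)) = l1yL2xtNorm F := by
  have e : ∀ x y t : ℝ, -(!₂[x, y, t] : Spacetime) = !₂[-x, -y, -t] := fun x y t => by
    ext j
    fin_cases j <;> simp
  simp only [l1yL2xtNorm, e]
  rw [← lintegral_neg_eq_self (μ := (volume : Measure ℝ)) (fun y : ℝ => (∫⁻ x : ℝ, ∫⁻ t : ℝ,
    ‖F !₂[x, y, t]‖ₑ ^ 2) ^ ½)]
  refine lintegral_congr fun y => ?_
  congr 1
  rw [← lintegral_neg_eq_self (μ := (volume : Measure ℝ)) (fun x : ℝ => ∫⁻ t : ℝ,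
    ‖F !₂[x, -y, t]‖ₑ ^ 2)]
  refine lintegral_congr fun x => ?_
  rw [← lintegral_neg_eq_self (μ := (volume : Measure ℝ)) (fun t : ℝ => ‖F !₂[-x, -y, t]‖ₑ ^ 2)]

lemma l1yL2xtNorm_const_mul (c : ℂ) (F : Amp) :
    l1yL2xtNorm (fun z => c * F z) = ‖c‖ₑ * l1yL2xtNorm F := by
  simp only [l1yL2xtNorm, enorm_mul, mul_pow]
  rw [← lintegral_const_mul' _ _ (by finiteness)]
  refine lintegral_congr fun y => ?_
  have : ∀ x : ℝ, ∫⁻ t : ℝ, ‖c‖ₑ ^ 2 * ‖F !₂[x, y, t]‖ₑ ^ 2 =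
      ‖c‖ₑ ^ 2 * ∫⁻ t : ℝ, ‖F !₂[x, y, t]‖ₑ ^ 2 := fun x =>
    lintegral_const_mul' _ _ (by finiteness)
  simp_rw [this]
  rw [lintegral_const_mul' _ _ (by finiteness), mul_rpow_of_nonneg _ _ (by norm_num),
    ennreal_sq_sqrt]

lemma IsNice.l1yL2xtNorm_ft3 {N : Amp} {M R : ℝ} (hN : IsNice N M R) :
    l1yL2xtNorm (ft3 N) = toE (2 * π) *
      ∫⁻ y, (∫⁻ p : Plane, ‖ft (fun μ => N (ins μ p)) y‖ₑ ^ 2) ^ ½ := by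
  rw [l1yL2xtNorm, ← lintegral_const_mul' _ _ ofReal_ne_top]
  refine lintegral_congr fun y => ?_
  have hmeas : Measurable fun p : Plane => ft (fun μ => N (ins μ p)) y :=
    measurable_ft_of (F := fun p μ => N (ins μ p)) (hN.meas.comp
      (measurable_ins.comp measurable_swap)) measurable_const
  have hsupp : ∀ p μ, N (ins μ p) ≠ 0 → |μ| ≤ max R 0 := fun p μ h =>
    (hN.abs_le h 1).trans (le_max_left _ _)
  set G : Amp := fun z => (Icc (-1 : ℝ) 1).indicator 1 (z 1) *
    ft (fun μ => N (ins μ (pt (z 0, z 2)))) y with hG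
  have hnice : IsNice G (M * (2 * max R 0)) (max R 0 + 1 + max R 0) := by
    refine ⟨?_, fun z => ?_, fun z hz => ?_⟩
    · refine Measurable.mul ((measurable_one.indicator measurableSet_Icc).comp (by fun_prop)) ?_
      exact hmeas.comp (measurable_pt.comp (by fun_prop))
    · rw [hG, norm_mul]
      refine (mul_le_of_le_one_left (norm_nonneg _) ?_).trans (norm_ft_le_of_bdd (le_max_right _ _)
        (fun μ => hN.bound _) (hsupp _) y)
      by_cases h : z 1 ∈ Icc (-1 : ℝ) 1 <;> simp [h]
    · have h1 : |z 1| ≤ 1 := by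
        by_contra hc
        refine hz ?_
        rw [hG]
        simp only
        rw [indicator_of_notMem (fun h : z 1 ∈ Icc (-1 : ℝ) 1 => hc (_root_.abs_le.2 h)), zero_mul]
      have h2 : ∃ μ, N (ins μ (pt (z 0, z 2))) ≠ 0 := by
        by_contra hc
        push Not at hc
        exact hz (by simp only [hG]; rw [ft_eq_zero hc, mul_zero])
      obtain ⟨μ, hμ⟩ := h2
      have h3 := hN.abs_le hμ 0
      have h4 := hN.abs_le hμ 2
      refine (norm_le_sum_abs z).trans (add_le_add (add_le_add ?_ h1) ?_)
      · exact le_trans h3 (le_max_left _ _)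
      · exact le_trans h4 (le_max_left _ _)
  have hG0 : ∀ x t, G (pt3 x 0 t) = ft (fun μ => N (ins μ (pt (x, t)))) y := fun x t => by
    have : (pt3 x 0 t) 1 ∈ Icc (-1 : ℝ) 1 := ⟨by simp [pt3], by simp [pt3]⟩
    simp only [hG]
    rw [indicator_of_mem this]
    simp [pt3]
  have e1 : ∀ x t : ℝ, ft3 N !₂[x, y, t] = ftXT G 0 x t := fun x t => by
    rw [hN.ft3_pt3, ftXT]
    simp only [ftX, hG0]
    rfl
  simp_rw [e1]
  rw [hnice.lintegral_lintegral_ftXT_sq 0, mul_rpow_of_nonneg _ _ (by norm_num),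
    ennreal_sq_sqrt, lintegral_plane (hmeas.enorm.pow_const 2)]
  simp_rw [hG0]

lemma lintegral_mul_shift_le {A B : Plane → ℝ → ℝ≥0∞} (hA : Measurable (uncurry A))
    (hB : Measurable (uncurry B)) {Q : ℝ≥0∞} (hQ : ∀ p, ∫⁻ u : ℝ, toE (1 + u ^ 2) * B p u ^ 2 ≤ Q) :
    ∫⁻ y : ℝ, (∫⁻ p : Plane, (∫⁻ y' : ℝ, A p y' * B p (y + y')) ^ 2) ^ ½ ≤
      (4 * Q) ^ ½ * ∫⁻ y' : ℝ, (∫⁻ p : Plane, A p y' ^ 2) ^ ½ := by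
  let N : ℝ × ℝ → ℝ≥0∞ := fun q => (∫⁻ p : Plane, (A p q.1 * B p q.2) ^ 2) ^ ½
  have hN : Measurable N := by fun_prop
  have h4 : ∫⁻ u : ℝ, toE ((1 + u ^ 2)⁻¹) ≤ 4 := by
    have := lintegral_inv_sq_add_sq (R := 1) one_pos 0
    simp only [one_pow, sub_zero, div_one] at this
    exact this.trans_le ofReal_pi_le
  have hle : ∀ y', ∫⁻ u, N (y', u) ≤ (4 * Q) ^ ½ * (∫⁻ p, A p y' ^ 2) ^ ½ := by
    intro y'
    apply ennreal_le_of_sq_le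
    have hsplit : ∀ u : ℝ, N (y', u) = toE ((1 + u ^ 2)⁻¹) ^ ½ *
        (toE (1 + u ^ 2) ^ ½ * N (y', u)) := fun u => by
      rw [← mul_assoc, ← mul_rpow_of_nonneg _ _ (by norm_num), ← ENNReal.ofReal_mul (by positivity),
        inv_mul_cancel₀ (by positivity), ENNReal.ofReal_one, ENNReal.one_rpow, one_mul]
    rw [mul_pow, ennreal_sqrt_sq, ennreal_sqrt_sq, lintegral_congr hsplit, mul_assoc]
    refine (lintegral_mul_sq_le (by fun_prop) (by fun_prop)).trans ?_
    simp only [mul_pow, ennreal_sqrt_sq, N]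
    refine mul_le_mul' h4 ?_
    calc _ = ∫⁻ u : ℝ, ∫⁻ p : Plane, toE (1 + u ^ 2) * (A p y' ^ 2 * B p u ^ 2) :=
          lintegral_congr fun u => (lintegral_const_mul' _ _ ofReal_ne_top).symm
      _ = ∫⁻ p : Plane, ∫⁻ u : ℝ, A p y' ^ 2 * (toE (1 + u ^ 2) * B p u ^ 2) := by
          rw [lintegral_lintegral_swap (by fun_prop)]
          exact lintegral_congr fun p => lintegral_congr fun u => mul_left_comm _ _ _
      _ ≤ ∫⁻ p : Plane, A p y' ^ 2 * Q := lintegral_mono fun p => by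
          rw [lintegral_const_mul _ (by fun_prop)]
          exact mul_le_mul' le_rfl (hQ p)
      _ = _ := by rw [lintegral_mul_const _ (by fun_prop), mul_comm]
  calc _ ≤ ∫⁻ y : ℝ, ∫⁻ y' : ℝ, N (y', y + y') := lintegral_mono fun y =>
        lintegral_lintegral_sq_le (F := fun p y' => A p y' * B p (y + y')) (by fun_prop)
    _ = ∫⁻ y' : ℝ, ∫⁻ y : ℝ, N (y', y + y') := lintegral_lintegral_swap (by fun_prop)
    _ ≤ _ := lintegral_mono fun y' =>
        (lintegral_add_right_eq_self (fun u => N (y', u)) y').trans_le (hle y')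
    _ = _ := lintegral_const_mul _ (((hA.comp measurable_swap).pow_const
        2).lintegral_prod_right'.pow_const _)

/-- The localization `yCut` is a bounded multiplier on `L¹_y L²_{x,t}`. -/
lemma IsNice.l1yL2xtNorm_yCut_le {M R : ℝ} (hG : IsNice G M R)
    (hη : IsBump η) {D : ℝ} (hD0 : 0 ≤ D) (hD : ∀ s, |deriv η s| ≤ D) {K : ℕ} (hK : 1 ≤ K) :
    l1yL2xtNorm (ft3 fun z => (yCut η K z : ℂ) * ft3 G z) ≤
      64 * (4 * kernelConst D) ^ ½ * l1yL2xtNorm G := by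
  obtain ⟨M', R', hN⟩ := hG.yCut_mul_ft3 hη hK
  rw [hN.l1yL2xtNorm_ft3]
  have hψ : ∀ p, Integrable fun μ => (yCut η K (ins μ p) : ℂ) := fun p =>
    (integrable_memLp_of_band (R := 2 ^ 21 * |p 0| ^ 2) (ψ := fun μ => yCut η K (ins μ p))
      ((measurable_yCut hη K).comp (measurable_ins.comp
      (measurable_id.prodMk measurable_const)))
      (fun μ => abs_yCut_le hη K (ins μ p)) (fun μ hμ => (yCut_ne_zero hη hμ).2.2.2)).1
  have ha : ∀ p : Plane, Integrable fun y => ftXT G y (p 0) (p 1) := fun p =>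
    integrable_of_bdd_line (measurable_ftXT hG.meas measurable_id measurable_const measurable_const)
      (fun y => hG.norm_ftXT_le y (p 0) (p 1)) (fun y hy => hG.ftXT_supp_y hy)
  have hle : ∀ (y : ℝ) (p : Plane), ‖ft (fun μ => (yCut η K (ins μ p) : ℂ) * ft3 G (ins μ p)) y‖ₑ ≤
      ∫⁻ y' : ℝ, ‖ftXT G y' (p 0) (p 1)‖ₑ * ‖ft (fun μ => (yCut η K (ins μ p) : ℂ)) (y + y')‖ₑ := by
    intro y p
    have e : (fun μ => (yCut η K (ins μ p) : ℂ) * ft3 G (ins μ p)) = fun μ =>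
        (yCut η K (ins μ p) : ℂ) * ft (fun y => ftXT G y (p 0) (p 1)) μ :=
      funext fun μ => by rw [hG.ft3_ins]
    rw [e, ft_mul_ft (hψ p) (ha p)]
    refine (enorm_integral_le_lintegral_enorm _).trans (le_of_eq ?_)
    exact lintegral_congr fun y' => enorm_mul _ _
  have hA : Measurable (uncurry fun (p : Plane) (y : ℝ) => ‖ftXT G y (p 0) (p 1)‖ₑ) :=
    (measurable_ftXT hG.meas measurable_snd (by fun_prop) (by fun_prop)).enorm
  have hB : Measurable (uncurry fun (p : Plane) (u : ℝ) =>
      ‖ft (fun μ => (yCut η K (ins μ p) : ℂ)) u‖ₑ) := by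
    refine (measurable_ft_of (F := fun (q : Plane × ℝ) μ => (yCut η K (ins μ q.1) : ℂ)) ?_
      measurable_snd).enorm
    exact Complex.measurable_ofReal.comp ((measurable_yCut hη K).comp (measurable_ins.comp
      (f := fun r : (Plane × ℝ) × ℝ => (r.2, r.1.1)) (by fun_prop)))
  calc _ ≤ toE (2 * π) * ((4 * kernelConst D) ^ ½ *
        (toE (2 * π) * l1yL2xtNorm G)) := by
        refine mul_le_mul' le_rfl ?_
        rw [← hG.lintegral_sqrt_ftXT_plane]
        refine le_trans ?_ (lintegral_mul_shift_le hA hB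
          (fun p => lintegral_ft_yCut_le hη hD0 hD hK p))
        refine lintegral_mono fun y => ENNReal.rpow_le_rpow (lintegral_mono fun p => ?_) (by norm_num)
        exact pow_le_pow_left' (hle y p) 2
    _ ≤ 8 * ((4 * kernelConst D) ^ ½ * (8 * l1yL2xtNorm G)) :=
        mul_le_mul' ofReal_two_pi_le (mul_le_mul' le_rfl (mul_le_mul' ofReal_two_pi_le le_rfl))
    _ = _ := by ring

end

attribute [fun_prop] IsBump.deriv_continuous measurable_yCut

/-! ### The time cutoff on the Fourier side -/

section

def IsBump.schwartz (hη : IsBump η) : 𝓢(ℝ, ℂ) :=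
  HasCompactSupport.toSchwartzMap (f := ofRealCLM ∘ η) (hη.hasCompactSupport.comp_left rfl)
    (by have := hη.smooth; fun_prop)

lemma IsBump.schwartz_apply (hη : IsBump η) (t : ℝ) : hη.schwartz t = (η t : ℂ) := rfl

/-- The kernel of the multiplication with `η(t)` on the Fourier side. -/
def IsBump.kernel (hη : IsBump η) : 𝓢(ℝ, ℂ) := ((2 * π : ℝ) : ℂ)⁻¹ • ftSchwartz hη.schwartz

lemma IsBump.kernel_apply (hη : IsBump η) (r : ℝ) :
    hη.kernel r = ((2 * π : ℝ) : ℂ)⁻¹ * ft hη.schwartz r := by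
  rw [kernel, smul_apply, coe_ftSchwartz, smul_eq_mul]

lemma IsBump.integral_kernel (hη : IsBump η) (t : ℝ) :
    ∫ r : ℝ, hη.kernel r * cexp (I * ((r * t : ℝ) : ℂ)) = η t := by
  rw [← hη.schwartz_apply, ← integral_exp_mul_ft, ← integral_const_mul]
  refine integral_congr fun r => ?_
  simp only [hη.kernel_apply]
  ring

lemma IsBump.integral_kernel_mul_ft (hη : IsBump η) {β : ℝ → ℂ} (hβ : Integrable β) (τ : ℝ) :
    ∫ r : ℝ, hη.kernel r * ft β (τ - r) = ft (fun t => (η t : ℂ) * β t) τ := by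
  simp only [ft, ← integral_const_mul]
  rw [integral_integral_swap]
  · refine integral_congr fun t => ?_
    rw [← hη.integral_kernel t, ← integral_mul_const, ← integral_const_mul]
    refine integral_congr fun r => ?_
    rw [show -(I * ((t * (τ - r) : ℝ) : ℂ)) = -(I * ((t * τ : ℝ) : ℂ)) +
      I * ((r * t : ℝ) : ℂ) by push_cast; ring, Complex.exp_add]
    ring
  · have h := (hη.kernel.integrable (μ := volume)).mul_prod hβ
    refine (h.bdd_mul (c := 1) (f := fun q : ℝ × ℝ => cexp (-(I *
      ((q.2 * (τ - q.1) : ℝ) : ℂ)))) ?_ ?_).congr ?_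
    · fun_prop
    · exact .of_forall fun q => (norm_exp_neg_I_mul _).le
    · refine .of_forall fun q => ?_; simp only [uncurry]; ring

lemma IsNice.convTau_ft3 {M R : ℝ} (hG : IsNice G M R) (hη : IsBump η)
    (hG' : IsNice (fun z => (η (z 2) : ℂ) * G z) M R) :
    convTau hη.kernel (ft3 G) = ft3 fun z => (η (z 2) : ℂ) * G z := by
  funext ζ
  rw [← atTime_proj ζ, convTau_atTime, hG'.ft3_atTime]
  simp only [hG.ft3_atTime]
  rw [hη.integral_kernel_mul_ft (hG.integrable_ftXY _)]
  congr 1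
  funext t
  rw [ftXY_mul_time (fun t => (η t : ℂ))]

lemma IsBump.norm_ofReal_le (hη : IsBump η) (s : ℝ) : ‖(η s : ℂ)‖ ≤ 1 := by
  rw [norm_real]
  exact hη.abs_le_one s

def IsBump.kernelNorm (hη : IsBump η) : ℝ≥0∞ := ∫⁻ r, ‖hη.kernel r‖ₑ

/-- The `L¹` norm of the kernel, with the weight `|r|`. -/
def IsBump.kernelNorm' (hη : IsBump η) : ℝ≥0∞ := ∫⁻ r : ℝ, ‖(r : ℂ) * hη.kernel r‖ₑ

section

variable (hη : IsBump η)
include hη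

lemma IsBump.kernelNorm_ne_top : hη.kernelNorm ≠ ⊤ := (hη.kernel.integrable (μ := volume)).2.ne

lemma IsBump.kernelNorm'_ne_top : hη.kernelNorm' ≠ ⊤ := (SchwartzMap_integrable_mul hη.kernel).2.ne

lemma IsBump.measurable_kernel : Measurable hη.kernel := by fun_prop

lemma IsBump.measurable_kernel' : Measurable fun r : ℝ => (r : ℂ) * hη.kernel r := by fun_prop

lemma IsBump.memLp_kernel : MemLp hη.kernel 2 := hη.kernel.memLp 2

end

lemma exists_l2FourierInv_bound : ∃ c : ℝ≥0∞, c ≠ ⊤ ∧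
    ∀ w : L2, eLpNorm (l2FourierInv w) 2 ≤ c * eLpNorm w 2 := by
  refine ⟨‖(((2 * π) ^ 3 : ℝ) : ℂ)⁻¹‖ₑ * toE ((2 * π) ^ 3) ^ ½, ?_, fun w => ?_⟩
  · exact mul_ne_top enorm_ne_top
      (rpow_ne_top_of_nonneg (by norm_num) ofReal_ne_top)
  · have h2 := (Lp.fourierTransformₗᵢ Spacetime ℂ).symm.norm_map w
    rw [Lp.norm_def, Lp.norm_def, toReal_eq_toReal_iff' (Lp.eLpNorm_ne_top _)
      (Lp.eLpNorm_ne_top _)] at h2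
    have h3 : eLpNorm (𝓕⁻ w : L2) 2 = eLpNorm w 2 := h2
    have h4 := eLpNorm_comp_dilation
      (Lp.aestronglyMeasurable (𝓕⁻ w : L2))
    rw [h3] at h4
    rw [mul_assoc, ← h4]
    exact (eLpNorm_const_smul (((2 * π) ^ 3 : ℝ) : ℂ)⁻¹ (fun z => (𝓕⁻ w : Lp ℂ 2
      (volume : Measure Spacetime)) (dilation 3 z)) 2 volume).le

def cutConst (D : ℝ) : ℝ≥0∞ := 64 * (4 * kernelConst D) ^ ½

lemma cutConst_ne_top (D : ℝ) : cutConst D ≠ ⊤ := by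
  unfold cutConst kernelConst
  refine mul_ne_top (by simp) (rpow_ne_top_of_nonneg (by norm_num) ?_)
  finiteness

lemma convTau_sub_ae (hρ2 : MemLp ρ 2) (hf : Measurable f)
    (hf2 : MemLp f 2) (hg : Measurable g) (hg2 : MemLp g 2) :
    convTau ρ (f - g) =ᵐ[volume] convTau ρ f - convTau ρ g := by
  have h := convTau_add_ae hρ2 (hf.sub hg) (hf2.sub hg2) hg hg2
  rw [sub_add_cancel] at h
  filter_upwards [h] with z hz
  rw [Pi.sub_apply, hz, Pi.add_apply, add_sub_cancel_right]

/-- Multiplication with `η(t)`, followed by the localization `yCut`, on `L¹_y L²_{x,t}`. -/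
lemma l1yL2xtNorm_yCut_convTau_le (hη : IsBump η) {D : ℝ} (hD0 : 0 ≤ D)
    (hD : ∀ s, |deriv η s| ≤ D) {K : ℕ} (hK : 1 ≤ K) (hg : Measurable g)
    (hg2 : MemLp g 2) (h : MemLp (fun ζ => (yCut η K ζ : ℂ) * convTau hη.kernel g ζ) 2) :
    l1yL2xtNorm (l2FourierInv (h.toLp _)) ≤ cutConst D * l1yL2xtNorm (l2FourierInv (hg2.toLp g)) := by
  obtain ⟨c, hc, hcw⟩ := exists_l2FourierInv_bound
  refine l1yL2xtNorm_le_of_approx (measurable_l2FourierInv _) fun ε hε => ?_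
  have hct : c * hη.kernelNorm ≠ ⊤ := mul_ne_top hc hη.kernelNorm_ne_top
  obtain ⟨H, M, R, hH, hL, hd⟩ := exists_nice_approx (hg2.toLp g)
    (ENNReal.div_ne_zero.2 ⟨hε, hct⟩)
  have hd' : eLpNorm (g - ft3 H) 2 ≤ ε / (c * hη.kernelNorm) := by
    refine le_trans (le_of_eq (eLpNorm_congr_ae ?_)) hd
    filter_upwards [hg2.coeFn_toLp] with ζ hζ
    simp only [Pi.sub_apply, hζ]
  have hH' : IsNice (fun z => (η (z 2) : ℂ) * H z) M R :=
    hH.mul_time (h := fun s => (η s : ℂ)) (Complex.measurable_ofReal.comp hη.continuous.measurable)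
      hη.norm_ofReal_le
  obtain ⟨M', R', hN⟩ := hH'.yCut_mul_ft3 hη hK
  have hH2 : MemLp (ft3 H) 2 := (memLp_l2Fourier _).ae_eq hH.l2Fourier_toLp
  refine ⟨fun z => (((2 * π) ^ 3 : ℝ) : ℂ)⁻¹ * ft3 (fun ζ => (yCut η K ζ : ℂ) *
    ft3 (fun z => (η (z 2) : ℂ) * H z) ζ) (-z), ?_, ?_, ?_⟩
  · fun_prop
  · rw [l1yL2xtNorm_const_mul, l1yL2xtNorm_comp_neg]
    have h1 : ‖(((2 * π) ^ 3 : ℝ) : ℂ)⁻¹‖ₑ ≤ 1 := by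
      rw [← ofReal_norm, norm_inv, norm_real, norm_of_nonneg (by positivity), ofReal_le_one]
      refine inv_le_one_of_one_le₀ (one_le_pow₀ ?_)
      linarith [pi_gt_three]
    refine (mul_le_of_le_one_left' h1).trans ((hH'.l1yL2xtNorm_yCut_le hη hD0 hD hK).trans ?_)
    exact mul_le_mul' le_rfl ((l1yL2xtNorm_mul_time_le (h := fun s => (η s : ℂ))
      hη.norm_ofReal_le H).trans hL)
  · have e : (l2FourierInv (h.toLp _) - fun z => (((2 * π) ^ 3 : ℝ) : ℂ)⁻¹ *
        ft3 (fun ζ => (yCut η K ζ : ℂ) * ft3 (fun z => (η (z 2) : ℂ) * H z) ζ) (-z)) =ᵐ[volume]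
        l2FourierInv (h.toLp _ - (hN.memLp 2).toLp _) := by
      filter_upwards [hN.l2FourierInv_toLp, l2FourierInv_sub (h.toLp _) ((hN.memLp 2).toLp _)]
        with z h1 h2
      rw [h2, Pi.sub_apply, Pi.sub_apply, h1]
    rw [eLpNorm_congr_ae e]
    refine (hcw _).trans ?_
    rw [← MemLp.toLp_sub, eLpNorm_congr_ae (MemLp.coeFn_toLp _)]
    have h3 : eLpNorm ((fun ζ => (yCut η K ζ : ℂ) * convTau hη.kernel g ζ) - fun ζ =>
        (yCut η K ζ : ℂ) * ft3 (fun z => (η (z 2) : ℂ) * H z) ζ) 2 ≤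
        hη.kernelNorm * eLpNorm (g - ft3 H) 2 := by
      refine le_trans ?_ (eLpNorm_convTau_le hη.measurable_kernel
        (hg.sub hH.continuous_ft3.measurable))
      refine eLpNorm_mono_ae ?_
      filter_upwards [convTau_sub_ae hη.memLp_kernel hg hg2 hH.continuous_ft3.measurable hH2]
        with ζ hζ
      rw [hζ, Pi.sub_apply, Pi.sub_apply, hH.convTau_ft3 hη hH', ← mul_sub, norm_mul, norm_real]
      exact mul_le_of_le_one_left (norm_nonneg _) (abs_yCut_le hη K ζ)
    calc c * _ ≤ c * (hη.kernelNorm * (ε / (c * hη.kernelNorm))) :=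
          mul_le_mul' le_rfl (h3.trans (mul_le_mul' le_rfl hd'))
      _ = c * hη.kernelNorm * (ε / (c * hη.kernelNorm)) := by ring
      _ ≤ ε := mul_div_le

end

/-! ### Functions of finite `Y_k` norm -/

section

variable {k : ℤ}

lemma yNorm_eq (h : MemLp (fun z => κ z * f z) 2) (K : ℕ) :
    yNorm K f = rootTwo⁻¹ ^ K * l1yL2xtNorm (l2FourierInv (h.toLp _)) := by
  have : (2 : ℝ≥0∞) ^ (-((K : ℤ) : ℝ) / 2) = rootTwo⁻¹ ^ K := by
    rw [← ENNReal.inv_pow, rootTwo_pow, ← ENNReal.rpow_neg]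
    push_cast
    congr 1
    ring
  rw [yNorm, iInf_pos h, this]

lemma memLp_of_yNorm (h : yNorm k f ≠ ⊤) :
    MemLp (fun z => κ z * f z) 2 := by
  by_contra hc
  exact h (by rw [yNorm, iInf_neg hc])

lemma YCarrier.eLpNorm_le (hY : YCarrier k f) : eLpNorm f 2 ≤ 2 ^ 15 * yNorm k f := by
  rcases le_or_gt k 99 with hk | hk
  · rw [eLpNorm_congr_ae (hY.2.2 hk), eLpNorm_zero]; exact zero_le
  by_cases h : yNorm k f = ⊤
  · rw [h, mul_top (by simp)]; exact le_top
  · lift k to ℕ using by omega with K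
    rw [yNorm_eq (memLp_of_yNorm h)]
    exact eLpNorm_le_of_ySupp K hY.ySupp _

lemma YCarrier.eLpNorm_tauInt_le (hf : Measurable f) (hY : YCarrier k f) :
    eLpNorm (tauInt f) 2 ≤ 2 ^ 17 * yNorm k f := by
  rcases le_or_gt k 99 with hk | hk
  · have : tauInt f =ᵐ[volume] 0 := by
      filter_upwards [ae_atTime (hY.2.2 hk)] with p hp
      exact integral_eq_zero_of_ae hp
    rw [eLpNorm_congr_ae this, eLpNorm_zero]
    exact zero_le
  by_cases h : yNorm k f = ⊤
  · rw [h, mul_top (by simp)]; exact le_top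
  · lift k to ℕ using by omega with K
    rw [yNorm_eq (memLp_of_yNorm h)]
    exact eLpNorm_tauInt_le_of_ySupp K hf hY.ySupp _

/-- The projection to the frequency plane of the support condition of `Y_k`. -/
def yPlane (k : ℤ) : Set Plane :=
  {p | 1 ≤ |p 0| ∧ |p 0| ^ 2 / 2 ^ 20 ≤ |p 1| ∧ |p 1| ≤ 2 ^ 20 * |p 0| ^ 2 ∧ p 0 ∈ dyadic k}

lemma YCarrier.fiber_ae (hY : YCarrier k f) :
    ∀ᵐ p : Plane, p ∉ yPlane k → ∀ᵐ τ : ℝ, f (atTime τ p) = 0 := by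
  filter_upwards [ae_atTime hY.2.1] with p hp hpY
  filter_upwards [hp] with τ hτ
  refine hτ fun h => hpY ?_
  exact ⟨h.1.1, h.1.2.1, h.1.2.2.1, h.2⟩

lemma convTau_eq_zero_of_fiber
    (h : ∀ᵐ τ : ℝ, g (atTime τ p) = 0) (τ : ℝ) : convTau ρ g (atTime τ p) = 0 := by
  rw [convTau_atTime]
  refine integral_eq_zero_of_ae ?_
  have h2 := (quasiMeasurePreserving_sub_left (volume : Measure ℝ) τ).ae h
  filter_upwards [h2] with r hr
  rw [hr, mul_zero]
  rfl

lemma convTau_supp_ae {S : Set Plane} (h : ∀ᵐ p : Plane, p ∉ S → ∀ᵐ τ : ℝ, g (atTime τ p) = 0) :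
    ∀ᵐ z : Spacetime, convTau ρ g z ≠ 0 → proj z ∈ S := by
  filter_upwards [ae_of_ae_atTime h] with z hz hne
  by_contra hc
  apply hne
  rw [← atTime_proj z]
  exact convTau_eq_zero_of_fiber (hz hc) _

section

variable (hη : IsBump η)
include hη

lemma one_sub_yCut_ne_zero {z : Spacetime} (hp : proj z ∈ yPlane k)
    (h : 1 - yCut η k z ≠ 0) : 5 / 8 * |z 0| ≤ |modulation z| := by
  by_contra hc
  apply h
  have hξ : z 0 ≠ 0 := dyadic_ne_zero hp.2.2.2
  have h1 : |2 * modulation z / z 0| ≤ 5 / 4 := by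
    rw [abs_div, abs_mul, abs_two, div_le_iff₀ (abs_pos.2 hξ)]
    linarith [not_le.1 hc]
  rw [yCut, indicator_of_mem (show z 0 ∈ dyadic k from hp.2.2.2), hη.eq_one' h1,
    show muCut η (z 0) (z 1) = 1 from muCut_eq_one hη hξ hp.2.1 hp.2.2.1]
  simp

lemma norm_one_sub_yCut_le (K : ℤ) (z : Spacetime) :
    ‖(1 - yCut η K z : ℂ)‖ ≤ 1 := by
  have h : (1 - yCut η K z : ℂ) = ((1 - yCut η K z : ℝ) : ℂ) := by push_cast; rfl
  rw [h, norm_real, norm_eq_abs, abs_le]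
  have h2 : 0 ≤ yCut η K z := by
    by_cases hz : yCut η K z = 0
    · rw [hz]
    · rw [yCut, indicator_of_mem (yCut_ne_zero hη hz).1, Pi.one_apply, one_mul]
      refine mul_nonneg (hη.mem_Icc _).1 ?_
      rw [muCut, sub_nonneg]
      by_cases hc : |2 ^ 21 * z 1 / z 0 ^ 2| ≤ 8 / 5
      · rw [hη.eq_one' (s := z 1 / (2 ^ 20 * z 0 ^ 2))]
        · exact (hη.mem_Icc _).2
        · rw [two_pow_mul_abs] at hc
          rw [abs_div_two_pow]
          have : 0 ≤ |z 1| / |z 0| ^ 2 := by positivity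
          linarith
      · rw [hη.eq_zero (not_le.1 hc)]; exact (hη.mem_Icc _).1
  have h3 := (abs_le.1 (abs_yCut_le hη K z)).2
  constructor <;> linarith

lemma one_sub_yCut_decay {K : ℕ} {ζ : Spacetime} {z : ℂ} (hp : z ≠ 0 → proj ζ ∈ yPlane K) :
    ‖(1 - yCut η K ζ : ℂ) * (κ ζ)⁻¹ * z‖ ≤ 4 * (2 ^ K)⁻¹ * ‖z‖ := by
  by_cases h0 : (1 - yCut η K ζ : ℂ) * z = 0
  · rw [mul_right_comm, h0, zero_mul, norm_zero]; positivity
  · have hp := hp (right_ne_zero_of_mul h0)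
    have hθ := one_sub_yCut_ne_zero hη hp (by exact_mod_cast left_ne_zero_of_mul h0)
    have hξ : (2 : ℝ) ^ K / 2 ≤ |ζ 0| := by
      have := hp.2.2.2.1
      rw [zpow_sub₀ (by norm_num), zpow_natCast, zpow_one] at this
      exact this
    have hm : 4⁻¹ * 2 ^ K ≤ ‖(modulation ζ : ℂ) + I‖ := by
      have h3 := abs_re_le_norm (κ ζ)
      simp only [add_re, ofReal_re, I_re, add_zero] at h3
      linarith [abs_nonneg (ζ 0)]
    rw [norm_mul, norm_mul, norm_inv]
    refine mul_le_mul_of_nonneg_right ?_ (norm_nonneg _)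
    refine (mul_le_of_le_one_left (by positivity) (norm_one_sub_yCut_le hη K ζ)).trans ?_
    calc ‖(modulation ζ : ℂ) + I‖⁻¹ ≤ (4⁻¹ * 2 ^ K)⁻¹ := inv_anti₀ (by positivity) hm
      _ = _ := by rw [mul_inv, inv_inv]

lemma measurable_one_sub_yCut_mul (K : ℕ) {u : Amp}
    (hu : Measurable u) : Measurable fun z : Spacetime => (1 - yCut η K z : ℂ) * (κ z)⁻¹ * u z := by
  fun_prop

lemma hNorm_one_sub_yCut_mul_le (K : ℕ) (u : Amp) :
    hNorm (fun z : Spacetime => (1 - yCut η K z : ℂ) * (κ z)⁻¹ * u z) ≤ eLpNorm u 2 := by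
  refine eLpNorm_mono fun z => ?_
  have : κ z * ((1 - yCut η K z : ℂ) * (κ z)⁻¹ * u z) = (1 - yCut η K z : ℂ) * u z := by
    have := modulation_add_I_ne_zero z
    field_simp
  rw [this, norm_mul]
  exact mul_le_of_le_one_left (norm_nonneg _) (norm_one_sub_yCut_le hη K z)

end

lemma four_mul_rootTwo_inv_pow_sq (K : ℕ) :
    (4 : ℝ≥0∞) * (rootTwo⁻¹ ^ K) ^ 2 = toE (4 * (2 ^ K)⁻¹) := by
  rw [rootTwo_inv_pow_sq, ENNReal.ofReal_mul (by norm_num), ofReal_inv_of_pos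
    (by positivity), ENNReal.ofReal_pow (by norm_num)]
  simp

lemma eLpNorm_one_sub_yCut_mul_le (hη : IsBump η) (K : ℕ) {u : Amp}
    (hs : ∀ᵐ z : Spacetime, u z ≠ 0 → proj z ∈ yPlane K) :
    eLpNorm (fun z : Spacetime => (1 - yCut η K z : ℂ) * (κ z)⁻¹ * u z) 2 ≤
      4 * (rootTwo⁻¹ ^ K) ^ 2 * eLpNorm u 2 := by
  rw [four_mul_rootTwo_inv_pow_sq]
  refine eLpNorm_le_mul_eLpNorm_of_ae_le_mul ?_ 2
  filter_upwards [hs] with z hz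
  exact one_sub_yCut_decay hη hz

lemma rootTwo_interpolation (K : ℕ) {a b c : ℝ≥0∞} (h1 : a ≤ c)
    (h2 : b ≤ 4 * (rootTwo⁻¹ ^ K) ^ 2 * c) :
    11 * (rootTwo ^ K * b + rootTwo⁻¹ ^ K * a) ≤ 55 * (rootTwo⁻¹ ^ K * c) := by
  have h := rootTwo_mul_inv_pow K
  generalize rootTwo ^ K = r at *
  generalize rootTwo⁻¹ ^ K = s at *
  calc 11 * (r * b + s * a) ≤ 11 * (r * (4 * s ^ 2 * c) + s * c) := by gcongr
    _ = 11 * (4 * (r * s) * (s * c) + s * c) := by ring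
    _ = _ := by rw [h]; ring

lemma xNorm_off_diagonal_le (hη : IsBump η) (K : ℕ) {u : Amp}
    (hu : Measurable u) (hs : ∀ᵐ z : Spacetime, u z ≠ 0 → proj z ∈ yPlane K) :
    xNorm η K (fun z => (1 - yCut η K z : ℂ) * (κ z)⁻¹ * u z) ≤
      55 * (rootTwo⁻¹ ^ K * eLpNorm u 2) :=
  (xNorm_le hη (J := K) (by simp; omega)
    (measurable_one_sub_yCut_mul hη K hu).aestronglyMeasurable).trans
      (rootTwo_interpolation K (hNorm_one_sub_yCut_mul_le hη K u)
        (eLpNorm_one_sub_yCut_mul_le hη K hs))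

lemma memLp_of_norm_le (hf : Measurable f) (hg : MemLp g 2) (h : ∀ z, ‖f z‖ ≤ ‖g z‖) : MemLp f 2 :=
  hg.mono hf.aestronglyMeasurable (.of_forall h)

lemma memLp_convTau (hρ : Measurable ρ) (hρ1 : ∫⁻ r, ‖ρ r‖ₑ ≠ ⊤) (hf : Measurable f)
    (hf2 : MemLp f 2) : MemLp (convTau ρ f) 2 :=
  ⟨(measurable_convTau hρ hf).aestronglyMeasurable, (eLpNorm_convTau_le hρ hf).trans_lt
    (mul_lt_top hρ1.lt_top hf2.2)⟩

/-- Multiplication with `η(t)` on `Y_k`. -/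
lemma exists_convTau_split (hη : IsBump η) : ∃ C : ℝ≥0, ∀ (K : ℕ) (f : Amp), 100 ≤ K →
    Measurable f → YCarrier K f → yNorm K f ≠ ⊤ → ∃ F₁ F₂ : Amp,
      Measurable F₁ ∧ Measurable F₂ ∧ L2Dyadic K F₁ ∧ YCarrier K F₂ ∧
      convTau hη.kernel f =ᵐ[volume] F₁ + F₂ ∧ xNorm η K F₁ + yNorm K F₂ ≤ C * yNorm K f := by
  obtain ⟨D, hD0, hD⟩ := hη.exists_deriv_bound
  set C : ℝ≥0∞ := 55 * hη.kernelNorm * 2 ^ 15 + 22 * hη.kernelNorm' * 2 ^ 15 + cutConst D with hC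
  have hCt : C ≠ ⊤ := by
    have h1 := hη.kernelNorm_ne_top
    have h2 := hη.kernelNorm'_ne_top
    have h3 := cutConst_ne_top D
    rw [hC]
    finiteness
  refine ⟨C.toNNReal, fun K f hK hf hY hfin => ?_⟩
  rw [ENNReal.coe_toNNReal hCt]
  have hK1 : 1 ≤ K := by omega
  have h := memLp_of_yNorm hfin
  set g : Amp := fun z => κ z * f z with hg
  have hgm : Measurable g := by fun_prop
  have hgs : ∀ᵐ p : Plane, p ∉ yPlane K → ∀ᵐ τ : ℝ, g (atTime τ p) = 0 := by
    filter_upwards [hY.fiber_ae] with p hp hpn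
    filter_upwards [hp hpn] with τ hτ
    simp only [hg, hτ, mul_zero]
  have hcg := memLp_convTau hη.measurable_kernel hη.kernelNorm_ne_top hgm h
  have hcgm := measurable_convTau hη.measurable_kernel hgm
  have hcf' := memLp_convTau hη.measurable_kernel' hη.kernelNorm'_ne_top hf hY.1
  have hcfm' := measurable_convTau hη.measurable_kernel' hf
  have hym : Measurable fun z => (yCut η K z : ℂ) := by fun_prop
  have hyn : ∀ z, ‖(yCut η K z : ℂ)‖ ≤ 1 := fun z => by rw [norm_real]; exact abs_yCut_le hη K z
  have hcs := convTau_supp_ae (ρ := hη.kernel) hgs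
  set F₂ : Amp := fun z => (κ z)⁻¹ * ((yCut η K z : ℂ) * convTau hη.kernel g z) with hF₂
  set Fa : Amp := fun z => (1 - yCut η K z : ℂ) * (κ z)⁻¹ * convTau hη.kernel g z with hFa
  set Fb : Amp := fun z => (κ z)⁻¹ * convTau (fun r : ℝ => (r : ℂ) * hη.kernel r) f z with hFb
  have hF₂m : Measurable F₂ := by fun_prop
  have hFam : Measurable Fa := by fun_prop
  have hFbm : Measurable Fb := by fun_prop
  have hyc : MemLp (fun z => (yCut η K z : ℂ) * convTau hη.kernel g z) 2 :=
    memLp_of_norm_le (hym.mul hcgm) hcg fun z => by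
      rw [norm_mul]; exact mul_le_of_le_one_left (norm_nonneg _) (hyn z)
  have hF₂2 : MemLp F₂ 2 := memLp_of_norm_le hF₂m hyc fun z => by
    rw [norm_mul]; exact mul_le_of_le_one_left (norm_nonneg _) (norm_resolvent_le z)
  have hFb2 : MemLp Fb 2 := memLp_of_norm_le hFbm hcf' fun z => by
    rw [norm_mul]; exact mul_le_of_le_one_left (norm_nonneg _) (norm_resolvent_le z)
  have hFa2 : MemLp Fa 2 := by
    have e : Fa = (fun z => (κ z)⁻¹ * convTau hη.kernel g z) - F₂ := by
      funext z
      simp only [hFa, hF₂, Pi.sub_apply]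
      ring
    rw [e]
    refine MemLp.sub (memLp_of_norm_le (measurable_resolvent.mul hcgm) hcg fun z => ?_) hF₂2
    rw [norm_mul]; exact mul_le_of_le_one_left (norm_nonneg _) (norm_resolvent_le z)
  have hsum : convTau hη.kernel f =ᵐ[volume] Fa + Fb + F₂ := by
    filter_upwards [modulation_mul_convTau_ae hη.memLp_kernel (SchwartzMap_memLp_mul hη.kernel) hf
      hY.1] with z hz
    have hne := modulation_add_I_ne_zero z
    rw [Pi.add_apply] at hz
    simp only [Pi.add_apply, hFa, hFb, hF₂]
    rw [← inv_mul_cancel_left₀ hne (convTau hη.kernel f z), hz]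
    ring
  have hdy : ∀ᵐ z : Spacetime, z 0 ∉ dyadic K → (Fa + Fb) z = 0 := by
    filter_upwards [hcs, convTau_supp_ae (ρ := fun r : ℝ => (r : ℂ) * hη.kernel r) hY.fiber_ae]
      with z h1 h2 hz
    have e1 : convTau hη.kernel g z = 0 := by by_contra hc; exact hz (h1 hc).2.2.2
    have e2 : convTau (fun r : ℝ => (r : ℂ) * hη.kernel r) f z = 0 := by
      by_contra hc
      exact hz (h2 hc).2.2.2
    simp only [Pi.add_apply, hFa, hFb, e1, e2, mul_zero, add_zero]
  have hYF : YCarrier K F₂ := by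
    refine ⟨hF₂2, ?_, fun hk => absurd hk (by omega)⟩
    filter_upwards [hcs] with z hz hn
    by_contra hne
    apply hn
    have h1 := right_ne_zero_of_mul hne
    have hp := hz (right_ne_zero_of_mul h1)
    have hy := yCut_ne_zero hη (z := z) (k := K) (by exact_mod_cast left_ne_zero_of_mul h1)
    exact ⟨⟨hp.1, hp.2.1, hp.2.2.1, hy.2.1⟩, hp.2.2.2⟩
  refine ⟨Fa + Fb, F₂, hFam.add hFbm, hF₂m, ⟨hFa2.add hFb2, hdy⟩, hYF, hsum, ?_⟩
  rw [yNorm_eq h K]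
  set L := l1yL2xtNorm (l2FourierInv (h.toLp g)) with hL
  have hx1 : xNorm η K Fa ≤ 55 * (rootTwo⁻¹ ^ K * (hη.kernelNorm * (2 ^ 15 * L))) := by
    refine (xNorm_off_diagonal_le hη K hcgm hcs).trans ?_
    refine mul_le_mul' le_rfl (mul_le_mul' le_rfl ((eLpNorm_convTau_le hη.measurable_kernel
      hgm).trans (mul_le_mul' le_rfl ?_)))
    exact hNorm_le_of_ySupp K hY.ySupp h
  have hx2 : xNorm η K Fb ≤ 22 * (hη.kernelNorm' * (2 ^ 15 * (rootTwo⁻¹ ^ K * L))) := by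
    refine (xNorm_le_hNorm hη K hFbm.aestronglyMeasurable).trans (mul_le_mul' le_rfl ?_)
    have e : hNorm Fb = eLpNorm (convTau (fun r : ℝ => (r : ℂ) * hη.kernel r) f) 2 := by
      rw [hNorm]
      congr 1
      funext z
      simp only [hFb]
      rw [mul_inv_cancel_left₀ (modulation_add_I_ne_zero z)]
    rw [e]
    refine (eLpNorm_convTau_le hη.measurable_kernel' hf).trans (mul_le_mul' le_rfl ?_)
    exact eLpNorm_le_of_ySupp K hY.ySupp h
  have hy2 : yNorm K F₂ ≤ rootTwo⁻¹ ^ K * (cutConst D * L) := by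
    have e : (fun z => κ z * F₂ z) = fun z => (yCut η K z : ℂ) * convTau hη.kernel g z := by
      funext z
      simp only [hF₂]
      rw [mul_inv_cancel_left₀ (modulation_add_I_ne_zero z)]
    have h' : MemLp (fun z => κ z * F₂ z) 2 := by rw [e]; exact hyc
    rw [yNorm_eq h' K]
    refine mul_le_mul' le_rfl ?_
    have := l1yL2xtNorm_yCut_convTau_le hη hD0 hD hK1 hgm h hyc
    refine le_trans (le_of_eq ?_) this
    congr 3
  calc xNorm η K (Fa + Fb) + yNorm K F₂
      ≤ (55 * (rootTwo⁻¹ ^ K * (hη.kernelNorm * (2 ^ 15 * L))) +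
        22 * (hη.kernelNorm' * (2 ^ 15 * (rootTwo⁻¹ ^ K * L)))) +
        rootTwo⁻¹ ^ K * (cutConst D * L) := by
        refine add_le_add ((xNorm_add_le hη K hFam.aestronglyMeasurable
          hFbm.aestronglyMeasurable).trans (add_le_add hx1 hx2)) hy2
    _ = C * (rootTwo⁻¹ ^ K * L) := by rw [hC]; ring

end

attribute [fun_prop] IsBump.measurable_kernel

/-! ### Truncated primitives in time -/

section

lemma measurable_primitive {X : Type*} [MeasurableSpace X] {F : X × ℝ → ℂ} (hF : Measurable F) :
    Measurable fun q : X × ℝ => ∫ s in (0 : ℝ)..q.2, F (q.1, s) := by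
  have e : (fun q : X × ℝ => ∫ s in (0 : ℝ)..q.2, F (q.1, s)) =
      fun q => (q.2 : ℂ) * ∫ r, F (q.1, q.2 * r) ∂(volume.restrict (Ioc (0 : ℝ) 1)) := by
    funext q
    have h := intervalIntegral.smul_integral_comp_mul_left (a := 0) (b := 1)
      (fun s => F (q.1, s)) q.2
    rw [mul_zero, mul_one] at h
    rw [← h, intervalIntegral.integral_of_le zero_le_one, real_smul]
  rw [e]
  have hm : Measurable fun z : (X × ℝ) × ℝ => F (z.1.1, z.1.2 * z.2) := by fun_prop
  have h1 : Measurable fun q : X × ℝ => (q.2 : ℂ) := by fun_prop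
  exact h1.mul hm.stronglyMeasurable.integral_prod_right'.measurable

lemma hasDerivAt_primitive {β : ℝ → ℂ} (hβ : Continuous β) (a : ℂ) (t : ℝ) :
    HasDerivAt (fun t => a + ∫ s in (0 : ℝ)..t, β s) (β t) t :=
  (hβ.integral_hasStrictDerivAt 0 t).hasDerivAt.const_add a

lemma enorm_primitive_sq_le {β : ℝ → ℂ} (hβ : Measurable β) (a : ℂ) {t : ℝ} (ht : |t| ≤ 2) :
    ‖a + ∫ s in (0 : ℝ)..t, β s‖ₑ ^ 2 ≤ 8 * (‖a‖ₑ ^ 2 + ∫⁻ s in Icc (-2 : ℝ) 2, ‖β s‖ₑ ^ 2) := by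
  have ht' := abs_le.1 ht
  have h1 : ‖∫ s in (0 : ℝ)..t, β s‖ₑ ≤ ∫⁻ s in Icc (-2 : ℝ) 2, ‖β s‖ₑ := by
    rw [← ofReal_norm, intervalIntegral.norm_intervalIntegral_eq, ofReal_norm]
    refine (enorm_integral_le_lintegral_enorm _).trans (lintegral_mono_set ?_)
    intro s hs
    rcases mem_uIoc.1 hs with h | h <;> constructor <;> linarith
  have h2 : (∫⁻ s in Icc (-2 : ℝ) 2, ‖β s‖ₑ) ^ 2 ≤ 4 * ∫⁻ s in Icc (-2 : ℝ) 2, ‖β s‖ₑ ^ 2 := by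
    have h := lintegral_mul_sq_le (μ := volume.restrict (Icc (-2 : ℝ) 2))
      (f := fun _ => 1) aemeasurable_const hβ.enorm.aemeasurable
    simp only [one_mul, one_pow, lintegral_one, Measure.restrict_apply_univ, volume_Icc] at h
    refine h.trans (le_of_eq ?_)
    norm_num
  calc ‖a + ∫ s in (0 : ℝ)..t, β s‖ₑ ^ 2
      ≤ (‖a‖ₑ + ∫⁻ s in Icc (-2 : ℝ) 2, ‖β s‖ₑ) ^ 2 := by
        gcongr
        exact (enorm_add_le _ _).trans (add_le_add le_rfl h1)
    _ ≤ 2 * (‖a‖ₑ ^ 2 + 4 * ∫⁻ s in Icc (-2 : ℝ) 2, ‖β s‖ₑ ^ 2) :=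
        (ennreal_add_sq_le _ _).trans (by gcongr)
    _ ≤ 2 * (4 * ‖a‖ₑ ^ 2 + 4 * ∫⁻ s in Icc (-2 : ℝ) 2, ‖β s‖ₑ ^ 2) := by
        gcongr
        exact le_mul_of_one_le_left (zero_le) (by norm_num)
    _ = _ := by ring

def primConst (D : ℝ) : ℝ≥0∞ := 8 * (32 + (2 * (toE D ^ 2 * 32) + 2))

lemma primConst_ne_top (D : ℝ) : primConst D ≠ ⊤ := by unfold primConst; finiteness

lemma lintegral_le_setLIntegral {F : ℝ → ℝ≥0∞} {H : ℝ → ℝ≥0∞}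
    (h0 : ∀ t, 2 < |t| → F t = 0) (h : ∀ t, |t| ≤ 2 → F t ≤ H t) :
    ∫⁻ t, F t ≤ ∫⁻ t in Icc (-2 : ℝ) 2, H t := by
  rw [← lintegral_indicator measurableSet_Icc]
  refine lintegral_mono fun t => ?_
  by_cases ht : |t| ≤ 2
  · rw [indicator_of_mem (mem_Icc.2 (abs_le.1 ht))]; exact h t ht
  · rw [h0 t (not_le.1 ht)]; exact zero_le

lemma volume_Icc_neg_two_two : volume (Icc (-2 : ℝ) 2) = 4 := by rw [volume_Icc]; norm_num

section

variable (hη : IsBump η)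
include hη

lemma IsBump.enorm_ofReal_le (s : ℝ) : ‖(η s : ℂ)‖ₑ ≤ 1 := by
  rw [← ofReal_norm, ofReal_le_one]
  exact hη.norm_ofReal_le s

lemma IsBump.eq_zero_of_two_lt {t : ℝ} (ht : 2 < |t|) : η t = 0 := hη.eq_zero (by linarith)

lemma IsBump.deriv_eq_zero_of_two_lt {t : ℝ} (ht : 2 < |t|) :
    deriv η t = 0 := by
  by_contra hc
  linarith [(hη.deriv_ne_zero hc).2]

lemma lintegral_bump_mul_sq_le {b : ℝ → ℂ} {Q : ℝ≥0∞}
    (hb : ∀ t, |t| ≤ 2 → ‖b t‖ₑ ^ 2 ≤ 8 * Q) : ∫⁻ t, ‖(η t : ℂ) * b t‖ₑ ^ 2 ≤ 32 * Q := by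
  refine (lintegral_le_setLIntegral (H := fun _ => 8 * Q) (fun t ht => ?_) fun t ht => ?_).trans
    (le_of_eq ?_)
  · rw [hη.eq_zero_of_two_lt ht]; simp
  · refine le_trans (pow_le_pow_left' ?_ 2) (hb t ht)
    rw [enorm_mul]
    exact mul_le_of_le_one_left zero_le (hη.enorm_ofReal_le t)
  · rw [setLIntegral_const, volume_Icc_neg_two_two]; ring

section

variable {D : ℝ} (hD : ∀ s, |deriv η s| ≤ D)
include hD

lemma lintegral_deriv_bump_mul_sq_le
    {b β : ℝ → ℂ} {Q : ℝ≥0∞} (hb : ∀ t, |t| ≤ 2 → ‖b t‖ₑ ^ 2 ≤ 8 * Q)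
    (hβ : ∫⁻ s in Icc (-2 : ℝ) 2, ‖β s‖ₑ ^ 2 ≤ Q) :
    ∫⁻ t, ‖((deriv η t : ℝ) : ℂ) * b t + (η t : ℂ) * β t‖ₑ ^ 2 ≤
      (2 * (toE D ^ 2 * 32) + 2) * Q := by
  refine (lintegral_le_setLIntegral (H := fun t => 2 * (toE D ^ 2 * (8 * Q)) +
    2 * ‖β t‖ₑ ^ 2) (fun t ht => ?_) fun t ht => ?_).trans ?_
  · rw [hη.eq_zero_of_two_lt ht, hη.deriv_eq_zero_of_two_lt ht]; simp
  · refine (pow_le_pow_left' (enorm_add_le _ _) 2).trans ((ennreal_add_sq_le _ _).trans ?_)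
    rw [mul_add, enorm_mul, enorm_mul, mul_pow]
    refine add_le_add (mul_le_mul' le_rfl (mul_le_mul' (pow_le_pow_left' ?_ 2) (hb t ht)))
      (mul_le_mul' le_rfl (pow_le_pow_left' ?_ 2))
    · rw [← ofReal_norm, norm_real]; exact ofReal_le_ofReal (hD t)
    · exact mul_le_of_le_one_left zero_le (hη.enorm_ofReal_le t)
  · rw [lintegral_add_left measurable_const, setLIntegral_const, volume_Icc_neg_two_two,
      lintegral_const_mul' _ _ (by simp), add_mul]
    exact add_le_add (le_of_eq (by ring)) (mul_le_mul' le_rfl hβ)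

lemma lintegral_ft_bump_mul_le
    {b β : ℝ → ℂ} {Q : ℝ≥0∞} (hbd : ∀ t, HasDerivAt b (β t) t) (hβ : Continuous β)
    (hb : ∀ t, |t| ≤ 2 → ‖b t‖ₑ ^ 2 ≤ 8 * Q) (hβQ : ∫⁻ s in Icc (-2 : ℝ) 2, ‖β s‖ₑ ^ 2 ≤ Q) :
    ∫⁻ y : ℝ, toE (1 + y ^ 2) * ‖ft (fun t => (η t : ℂ) * b t) y‖ₑ ^ 2 ≤ primConst D * Q := by
  have hbc : Continuous b := continuous_iff_continuousAt.2 fun t => (hbd t).continuousAt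
  have hd : ∀ t, HasDerivAt (fun t => (η t : ℂ) * b t)
      (((deriv η t : ℝ) : ℂ) * b t + (η t : ℂ) * β t) t := fun t =>
    (hη.hasDerivAt t).ofReal_comp.mul (hbd t)
  have hηc := hη.continuous
  have hdc := hη.deriv_continuous
  have c1 : Continuous fun t => (η t : ℂ) * b t := by fun_prop
  have c2 : Continuous fun t => ((deriv η t : ℝ) : ℂ) * b t + (η t : ℂ) * β t := by fun_prop
  have k1 : HasCompactSupport fun t => (η t : ℂ) * b t :=
    HasCompactSupport.intro isCompact_Icc (K := Icc (-2 : ℝ) 2) fun t ht => by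
      rw [hη.eq_zero_of_two_lt (not_le.1 fun h => ht (mem_Icc.2 (abs_le.1 h)))]
      simp
  have k2 : HasCompactSupport fun t => ((deriv η t : ℝ) : ℂ) * b t + (η t : ℂ) * β t :=
    HasCompactSupport.intro isCompact_Icc (K := Icc (-2 : ℝ) 2) fun t ht => by
      have := not_le.1 fun h => ht (mem_Icc.2 (abs_le.1 h))
      rw [hη.eq_zero_of_two_lt this, hη.deriv_eq_zero_of_two_lt this]
      simp
  rw [lintegral_one_add_sq_ft hd (c1.integrable_of_hasCompactSupport k1)
    (c1.memLp_of_hasCompactSupport k1) (c2.integrable_of_hasCompactSupport k2)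
    (c2.memLp_of_hasCompactSupport k2)]
  refine (mul_le_mul' ofReal_two_pi_le (add_le_add (lintegral_bump_mul_sq_le hη hb)
    (lintegral_deriv_bump_mul_sq_le hη hD hb hβQ))).trans (le_of_eq ?_)
  rw [primConst]
  ring

lemma lintegral_ft_primitive_le {β : ℝ → ℂ} (hβ : Continuous β) (a : ℂ) :
    ∫⁻ y : ℝ, toE (1 + y ^ 2) * ‖ft (fun t => (η t : ℂ) * (a + ∫ s in (0 : ℝ)..t, β s)) y‖ₑ ^ 2 ≤
      primConst D * (‖a‖ₑ ^ 2 + ∫⁻ s in Icc (-2 : ℝ) 2, ‖β s‖ₑ ^ 2) :=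
  lintegral_ft_bump_mul_le hη hD (hasDerivAt_primitive hβ a) hβ
    (fun _ ht => enorm_primitive_sq_le hβ.measurable a ht) le_add_self

lemma lintegral_ft_primitive_primitive_le {β : ℝ → ℂ} (hβ : Continuous β) (a : ℂ) :
    ∫⁻ y : ℝ, toE (1 + y ^ 2) *
      ‖ft (fun t => (η t : ℂ) * ∫ s in (0 : ℝ)..t, (a + ∫ r in (0 : ℝ)..s, β r)) y‖ₑ ^ 2 ≤
      32 * primConst D * (‖a‖ₑ ^ 2 + ∫⁻ s in Icc (-2 : ℝ) 2, ‖β s‖ₑ ^ 2) := by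
  obtain ⟨Q, hQ⟩ : ∃ Q, Q = ‖a‖ₑ ^ 2 + ∫⁻ s in Icc (-2 : ℝ) 2, ‖β s‖ₑ ^ 2 := ⟨_, rfl⟩
  have hc : Continuous fun t => a + ∫ s in (0 : ℝ)..t, β s := by fun_prop
  have h := lintegral_ft_primitive_le hη hD hc 0
  simp only [zero_add, enorm_zero, ne_eq, OfNat.ofNat_ne_zero, not_false_eq_true, zero_pow] at h
  refine h.trans ?_
  rw [mul_comm 32, mul_assoc]
  refine mul_le_mul' le_rfl ?_
  rw [← hQ]
  calc ∫⁻ s in Icc (-2 : ℝ) 2, ‖a + ∫ r in (0 : ℝ)..s, β r‖ₑ ^ 2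
      ≤ ∫⁻ s in Icc (-2 : ℝ) 2, 8 * Q := by
        refine setLIntegral_mono measurable_const fun s hs => ?_
        rw [hQ]
        exact enorm_primitive_sq_le hβ.measurable a (abs_le.2 hs)
    _ = 32 * Q := by rw [setLIntegral_const, volume_Icc_neg_two_two]; ring

end

end

end

/-! ### The Duhamel operator on the Fourier side -/

section

def phase (p : Plane) : ℝ := omega (p 0) (p 1)

@[fun_prop]
lemma measurable_phase : Measurable phase := measurable_omega_plane

lemma modulation_atTime' (τ : ℝ) (p : Plane) : modulation (atTime τ p) = τ - phase p := rfl

/-- The inverse Fourier transform in `τ`. -/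
def timeSlice (f : Amp) (t : ℝ) (p : Plane) : ℂ :=
  ((2 * π : ℝ) : ℂ)⁻¹ * ∫ τ : ℝ, cexp (I * ((t * τ : ℝ) : ℂ)) * f (atTime τ p)

/-- `timeSlice`, pulled back by the free evolution. -/
def profile (f : Amp) (t : ℝ) (p : Plane) : ℂ :=
  cexp (-(I * ((t * phase p : ℝ) : ℂ))) * timeSlice f t p

/-- The resolvent part of the Duhamel term, pulled back by the free evolution. -/
def freePart (f : Amp) (t : ℝ) (p : Plane) : ℂ := timeSlice f 0 p + ∫ s in (0 : ℝ)..t, profile f s p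

/-- The spatial Fourier transform of the Duhamel term with forcing `(τ - ω + i) f`. -/
def duhamelFt (f : Amp) (t : ℝ) (p : Plane) : ℂ := -I * timeSlice f t p +
    I * (cexp (I * ((t * phase p : ℝ) : ℂ)) * freePart f t p)

/-- The space-time Fourier transform of the truncated Duhamel term with forcing
`(τ - ω + i) f`. -/
def duhamelOp (η : ℝ → ℝ) (f : Amp) (z : Spacetime) : ℂ :=
  ft (fun t => (η t : ℂ) * duhamelFt f t (proj z)) (z 2)

/-- The contribution of `freePart` to `duhamelOp`. -/
def freeOp (η : ℝ → ℝ) (f : Amp) (z : Spacetime) : ℂ :=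
  ft (fun t => (η t : ℂ) * freePart f t (proj z)) (modulation z)

/-- The operator which appears in the commutator of `∂_μ` and `duhamelOp`. -/
def commOp (η : ℝ → ℝ) (f : Amp) (z : Spacetime) : ℂ :=
  ft (fun t => (η t : ℂ) * ∫ s in (0 : ℝ)..t, freePart f s (proj z)) (modulation z)

lemma timeSlice_zero (f : Amp) (p : Plane) :
    timeSlice f 0 p = ((2 * π : ℝ) : ℂ)⁻¹ * tauInt f p := by
  simp [timeSlice, tauInt]

lemma timeSlice_eq_ft (f : Amp) (t : ℝ) (p : Plane) :
    timeSlice f t p = ((2 * π : ℝ) : ℂ)⁻¹ * ft (fun τ => f (atTime τ p)) (-t) := by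
  rw [timeSlice, ft]
  congr 1
  refine integral_congr fun τ => ?_
  congr 2
  push_cast
  ring

lemma measurable_timeSlice (hf : Measurable f) :
    Measurable fun q : Plane × ℝ => timeSlice f q.2 q.1 := by
  simp_rw [timeSlice_eq_ft]
  refine Measurable.const_mul ?_ _
  refine measurable_ft_of (F := fun (q : Plane × ℝ) τ => f (atTime τ q.1)) ?_ (by fun_prop)
  fun_prop

lemma measurable_profile (hf : Measurable f) :
    Measurable fun q : Plane × ℝ => profile f q.2 q.1 := by
  refine Measurable.mul ?_ (measurable_timeSlice hf)
  fun_prop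

lemma measurable_freePart (hf : Measurable f) :
    Measurable fun q : Plane × ℝ => freePart f q.2 q.1 := by
  have h1 : Measurable fun q : Plane × ℝ => timeSlice f 0 q.1 :=
    Measurable.comp (g := fun q : Plane × ℝ => timeSlice f q.2 q.1)
      (f := fun q : Plane × ℝ => (q.1, (0 : ℝ))) (measurable_timeSlice hf) (by fun_prop)
  exact h1.add (measurable_primitive (F := fun q => profile f q.2 q.1) (measurable_profile hf))

lemma measurable_duhamelFt (hf : Measurable f) :
    Measurable fun q : Plane × ℝ => duhamelFt f q.2 q.1 := by
  have h1 : Measurable fun q : Plane × ℝ => cexp (I * ((q.2 * phase q.1 : ℝ) : ℂ)) := by fun_prop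
  exact ((measurable_timeSlice hf).const_mul _).add
    ((h1.mul (measurable_freePart hf)).const_mul _)

section

variable (hη : IsBump η)
include hη

lemma measurable_bump_mul {F : Plane × ℝ → ℂ} (hF : Measurable F) :
    Measurable (uncurry fun (z : Spacetime) (t : ℝ) => (η t : ℂ) * F (proj z, t)) := by
  have h1 : Measurable fun q : Spacetime × ℝ => (η q.2 : ℂ) :=
    Complex.measurable_ofReal.comp (hη.continuous.measurable.comp measurable_snd)
  fun_prop

lemma measurable_duhamelOp (hf : Measurable f) : Measurable (duhamelOp η f) :=
  measurable_ft_of (measurable_bump_mul hη (measurable_duhamelFt hf)) (by fun_prop)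

lemma measurable_freeOp (hf : Measurable f) : Measurable (freeOp η f) :=
  measurable_ft_of (measurable_bump_mul hη (measurable_freePart hf)) measurable_modulation

lemma measurable_commOp (hf : Measurable f) : Measurable (commOp η f) :=
  measurable_ft_of (measurable_bump_mul hη (measurable_primitive (measurable_freePart hf)))
    measurable_modulation

end

section

variable (hp : Integrable fun τ => f (atTime τ p))
include hp

lemma continuous_timeSlice :
    Continuous fun t => timeSlice f t p := by
  simp_rw [timeSlice_eq_ft]
  exact continuous_const.mul ((continuous_ft hp).comp continuous_neg)

lemma continuous_profile :
    Continuous fun t => profile f t p := by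
  have := continuous_timeSlice hp
  unfold profile
  fun_prop

lemma continuous_freePart :
    Continuous fun t => freePart f t p :=
  continuous_iff_continuousAt.2 fun t =>
    (hasDerivAt_primitive (continuous_profile hp) _ t).continuousAt

lemma continuous_duhamelFt :
    Continuous fun t => duhamelFt f t p := by
  have h1 := continuous_timeSlice hp
  have h2 := continuous_freePart hp
  unfold duhamelFt
  fun_prop

omit hp in
lemma enorm_profile (f : Amp) (t : ℝ) (p : Plane) :
    ‖profile f t p‖ₑ = ‖timeSlice f t p‖ₑ := by
  rw [profile, enorm_mul, enorm_exp_neg_I_mul, one_mul]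

omit hp in
lemma enorm_two_pi_inv_le : ‖((2 * π : ℝ) : ℂ)⁻¹‖ₑ ≤ 1 := by
  rw [← ofReal_norm, norm_inv, norm_real, norm_of_nonneg (by positivity), ofReal_le_one]
  exact inv_le_one_of_one_le₀ (by linarith [pi_gt_three])

omit hp in
lemma enorm_timeSlice_zero_le (f : Amp) (p : Plane) :
    ‖timeSlice f 0 p‖ₑ ≤ ‖tauInt f p‖ₑ := by
  rw [timeSlice_zero, enorm_mul]
  exact mul_le_of_le_one_left zero_le enorm_two_pi_inv_le

lemma lintegral_timeSlice_sq_le (hp2 : MemLp (fun τ => f (atTime τ p)) 2) :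
    ∫⁻ t, ‖timeSlice f t p‖ₑ ^ 2 ≤ 8 * ∫⁻ τ, ‖f (atTime τ p)‖ₑ ^ 2 := by
  calc ∫⁻ t, ‖timeSlice f t p‖ₑ ^ 2
      ≤ ∫⁻ t : ℝ, ‖ft (fun τ => f (atTime τ p)) (-t)‖ₑ ^ 2 := by
        refine lintegral_mono fun t => pow_le_pow_left' ?_ 2
        rw [timeSlice_eq_ft, enorm_mul]
        exact mul_le_of_le_one_left zero_le enorm_two_pi_inv_le
    _ = toE (2 * π) * ∫⁻ τ, ‖f (atTime τ p)‖ₑ ^ 2 := by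
        rw [lintegral_neg_eq_self (fun t => ‖ft (fun τ => f (atTime τ p)) t‖ₑ ^ 2),
          lintegral_ft_sq hp hp2]
    _ ≤ _ := mul_le_mul' ofReal_two_pi_le le_rfl

end

/-- The functions whose restrictions to almost all lines parallel to the `τ`-axis are integrable. -/
def FiberIntegrable (f : Amp) : Prop := ∀ᵐ p : Plane, Integrable fun τ => f (atTime τ p)

lemma hNorm_le_of_fiber {Ψ : Plane → ℝ → ℂ} (hF : Measurable F)
    (h : ∀ p τ, F (atTime τ p) = ft (Ψ p) (τ - phase p)) (hf : Measurable f) (hf2 : MemLp f 2)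
    (hi : FiberIntegrable f) {C : ℝ≥0∞} (hΨ : ∀ p, (Integrable fun τ => f (atTime τ p)) →
      ∫⁻ y : ℝ, toE (1 + y ^ 2) * ‖ft (Ψ p) y‖ₑ ^ 2 ≤
        C * (‖timeSlice f 0 p‖ₑ ^ 2 + ∫⁻ s in Icc (-2 : ℝ) 2, ‖profile f s p‖ₑ ^ 2)) :
    hNorm F ^ 2 ≤ C * (eLpNorm (tauInt f) 2 ^ 2 + 8 * eLpNorm f 2 ^ 2) := by
  have hm : Measurable fun z => toE (modulation z ^ 2 + 1) * ‖F z‖ₑ ^ 2 := by fun_prop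
  have hm2 : Measurable fun z => ‖f z‖ₑ ^ 2 := by fun_prop
  have hm3 : Measurable fun p => ‖tauInt f p‖ₑ ^ 2 := by fun_prop
  have hm4 : Measurable fun p => ∫⁻ τ, ‖f (atTime τ p)‖ₑ ^ 2 := by fun_prop
  rw [hNorm_sq, lintegral_atTime hm, eLpNorm_two_sq, eLpNorm_two_sq, lintegral_atTime hm2,
    ← lintegral_const_mul 8 hm4, ← lintegral_add_left hm3,
    ← lintegral_const_mul C (by fun_prop)]
  refine lintegral_mono_ae ?_
  filter_upwards [hi, memLp_fiber_ae hf hf2] with p hp hp2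
  calc ∫⁻ τ : ℝ, toE (modulation (atTime τ p) ^ 2 + 1) * ‖F (atTime τ p)‖ₑ ^ 2
      = ∫⁻ τ : ℝ, (fun y => toE (1 + y ^ 2) * ‖ft (Ψ p) y‖ₑ ^ 2) (τ + -phase p) := by
        refine lintegral_congr fun τ => ?_
        simp only [modulation_atTime', h, ← sub_eq_add_neg, add_comm (1 : ℝ)]
    _ = ∫⁻ y : ℝ, toE (1 + y ^ 2) * ‖ft (Ψ p) y‖ₑ ^ 2 :=
        lintegral_add_right_eq_self (fun y => toE (1 + y ^ 2) * ‖ft (Ψ p) y‖ₑ ^ 2) _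
    _ ≤ _ := (hΨ p hp).trans (mul_le_mul' le_rfl (add_le_add
        (pow_le_pow_left' (enorm_timeSlice_zero_le f p) 2) ?_))
  simp_rw [enorm_profile]
  exact (setLIntegral_le_lintegral _ _).trans (lintegral_timeSlice_sq_le hp hp2)

section

variable (hη : IsBump η)
include hη

section

variable {D : ℝ} (hD : ∀ s, |deriv η s| ≤ D) (hf : Measurable f) (hf2 : MemLp f 2) (hi : FiberIntegrable f)
include hD hf hf2 hi

lemma hNorm_freeOp_sq_le :
    hNorm (freeOp η f) ^ 2 ≤ primConst D * (eLpNorm (tauInt f) 2 ^ 2 + 8 * eLpNorm f 2 ^ 2) :=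
  hNorm_le_of_fiber (Ψ := fun p t => (η t : ℂ) * freePart f t p) (measurable_freeOp hη hf)
    (fun p τ => by rw [freeOp, proj_atTime, modulation_atTime']) hf hf2 hi
    fun _ hp => lintegral_ft_primitive_le hη hD (continuous_profile hp) _

lemma hNorm_commOp_sq_le :
    hNorm (commOp η f) ^ 2 ≤ 32 * primConst D * (eLpNorm (tauInt f) 2 ^ 2 + 8 * eLpNorm f 2 ^ 2) :=
  hNorm_le_of_fiber (Ψ := fun p t => (η t : ℂ) * ∫ s in (0 : ℝ)..t, freePart f s p)
    (measurable_commOp hη hf)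
    (fun p τ => by rw [commOp, proj_atTime, modulation_atTime']) hf hf2 hi
    fun _ hp => lintegral_ft_primitive_primitive_le hη hD (continuous_profile hp) _

end

lemma ft_bump_mul_timeSlice (hp : Integrable fun τ => f (atTime τ p)) (τ : ℝ) :
    ft (fun t => (η t : ℂ) * timeSlice f t p) τ = convTau hη.kernel f (atTime τ p) := by
  have hi : Integrable fun t => (η t : ℂ) := hη.schwartz.integrable
  have h := hi.mul_prod hp
  rw [convTau_atTime, ← integral_sub_left_eq_self _ _ τ]
  simp only [sub_sub_cancel, hη.kernel_apply, ft, timeSlice, ← integral_const_mul,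
    ← integral_mul_const]
  rw [integral_integral_swap]
  · refine integral_congr fun σ => ?_
    refine integral_congr fun t => ?_
    simp only [hη.schwartz_apply]
    rw [show -(I * ((t * (τ - σ) : ℝ) : ℂ)) = -(I * ((t * τ : ℝ) : ℂ)) +
      I * ((t * σ : ℝ) : ℂ) by push_cast; ring, Complex.exp_add]
    ring
  · refine ((h.bdd_mul (c := 1) (f := fun q : ℝ × ℝ => cexp (-(I *
      ((q.1 * (τ - q.2) : ℝ) : ℂ)))) ?_ ?_).const_mul ((2 * π : ℝ) : ℂ)⁻¹).congr ?_
    · fun_prop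
    · exact .of_forall fun q => (norm_exp_neg_I_mul _).le
    · refine .of_forall fun q => ?_
      simp only [uncurry]
      rw [show -(I * ((q.1 * (τ - q.2) : ℝ) : ℂ)) = -(I * ((q.1 * τ : ℝ) : ℂ)) +
        I * ((q.1 * q.2 : ℝ) : ℂ) by push_cast; ring, Complex.exp_add]
      ring

lemma integrable_exp_mul_bump {b : ℝ → ℂ} (hb : Continuous b) (τ : ℝ) :
    Integrable fun t : ℝ => cexp (-(I * ((t * τ : ℝ) : ℂ))) * ((η t : ℂ) * b t) := by
  have hc := hη.continuous
  refine Continuous.integrable_of_hasCompactSupport (by fun_prop) ?_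
  refine HasCompactSupport.intro isCompact_Icc (K := Icc (-2 : ℝ) 2) fun t ht => ?_
  rw [hη.eq_zero_of_two_lt (not_le.1 fun h => ht (mem_Icc.2 (abs_le.1 h)))]
  simp

lemma duhamelOp_atTime (hp : Integrable fun τ => f (atTime τ p))
    (τ : ℝ) : duhamelOp η f (atTime τ p) =
      -I * convTau hη.kernel f (atTime τ p) + I * freeOp η f (atTime τ p) := by
  rw [← ft_bump_mul_timeSlice hη hp, duhamelOp, freeOp, proj_atTime, modulation_atTime',
    atTime_apply_two, ft, ft, ft, ← integral_const_mul, ← integral_const_mul, ← integral_add]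
  · refine integral_congr fun t => ?_
    simp only [duhamelFt]
    rw [show -(I * ((t * (τ - phase p) : ℝ) : ℂ)) = -(I * ((t * τ : ℝ) : ℂ)) +
      I * ((t * phase p : ℝ) : ℂ) by push_cast; ring, Complex.exp_add]
    ring
  · exact (integrable_exp_mul_bump hη (continuous_timeSlice hp) _).const_mul _
  · exact (integrable_exp_mul_bump hη (continuous_freePart hp) _).const_mul _

lemma duhamelOp_ae (hi : FiberIntegrable f) :
    duhamelOp η f =ᵐ[volume] fun z => -I * convTau hη.kernel f z + I * freeOp η f z := by
  filter_upwards [ae_of_ae_atTime hi] with z hz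
  have := duhamelOp_atTime hη hz (z 2)
  rwa [atTime_proj] at this

end

end

attribute [fun_prop] measurable_duhamelOp measurable_freeOp measurable_commOp

/-! ### The Duhamel operator on `X_k + Y_k` -/

section

variable {k : ℤ}

lemma yNorm_congr (h : f =ᵐ[volume] g) : yNorm k f = yNorm k g := by
  have e : (fun z => κ z * f z) =ᵐ[volume]
      fun z => κ z * g z := by
    filter_upwards [h] with z hz
    rw [hz]
  have hL (hf : MemLp (fun z => κ z * f z) 2)
      (hg : MemLp (fun z => κ z * g z) 2) :
      hf.toLp _ = hg.toLp _ := MemLp.toLp_congr _ _ e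
  by_cases hf : MemLp (fun z => κ z * f z) 2
  · have hg := (memLp_congr_ae e).1 hf; rw [yNorm, yNorm, iInf_pos hf, iInf_pos hg, hL hf hg]
  · have hg := fun hg => hf ((memLp_congr_ae e).2 hg); rw [yNorm, yNorm, iInf_neg hf, iInf_neg hg]

lemma l2FourierInv_const_smul (c : ℂ) (w : L2) :
    l2FourierInv (c • w) =ᵐ[volume] fun z => c * l2FourierInv w z := by
  have h : (𝓕⁻ (c • w) : L2) = c • 𝓕⁻ w := (Lp.fourierTransformₗᵢ Spacetime ℂ).symm.map_smul c w
  have h2 := quasiMeasurePreserving_dilation.ae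
    (Lp.coeFn_smul c (𝓕⁻ w : L2))
  filter_upwards [h2] with z hz
  rw [l2FourierInv, h, hz]
  simp only [l2FourierInv, Pi.smul_apply, smul_eq_mul]
  ring

lemma l1yL2xtNorm_congr (hF : Measurable F) (hG : Measurable G)
    (h : F =ᵐ[volume] G) : l1yL2xtNorm F ≤ l1yL2xtNorm G := by
  refine l1yL2xtNorm_le_of_approx hF fun ε _ => ⟨G, hG, le_rfl, ?_⟩
  have : F - G =ᵐ[volume] 0 := by filter_upwards [h] with z hz; rw [Pi.sub_apply, hz, sub_self]; rfl
  rw [eLpNorm_congr_ae this, eLpNorm_zero]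
  exact zero_le

lemma yNorm_const_mul_le {c : ℂ} (hc : c ≠ 0) (f : Amp) :
    yNorm k (fun z => c * f z) ≤ ‖c‖ₑ * yNorm k f := by
  by_cases h : MemLp (fun z => κ z * f z) 2
  · have e : (fun z => κ z * (c * f z)) = c • fun z => κ z * f z := by
      funext z
      simp only [Pi.smul_apply, smul_eq_mul]
      ring
    have h' : MemLp (fun z => κ z * (c * f z)) 2 := by rw [e]; exact h.const_smul c
    have e2 : h'.toLp _ = c • h.toLp _ := by
      rw [← MemLp.toLp_const_smul]
      exact MemLp.toLp_congr _ _ (by rw [e])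
    rw [yNorm, yNorm, iInf_pos h, iInf_pos h', e2, mul_left_comm]
    refine mul_le_mul' le_rfl ?_
    rw [← l1yL2xtNorm_const_mul]
    exact l1yL2xtNorm_congr (measurable_l2FourierInv _) ((measurable_l2FourierInv _).const_mul _)
      (l2FourierInv_const_smul _ _)
  · rw [yNorm, yNorm, iInf_neg h, mul_top (by simpa using hc)]; exact le_top

lemma L2Dyadic.congr (hf : L2Dyadic k f) (h : f =ᵐ[volume] g) : L2Dyadic k g := by
  refine ⟨(memLp_congr_ae h).1 hf.1, ?_⟩
  filter_upwards [h, hf.2] with z h1 h2 h3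
  rw [← h1, h2 h3]

lemma YCarrier.congr (hf : YCarrier k f) (h : f =ᵐ[volume] g) : YCarrier k g := by
  refine ⟨(memLp_congr_ae h).1 hf.1, ?_, fun hk => h.symm.trans (hf.2.2 hk)⟩
  filter_upwards [h, hf.2.1] with z h1 h2 h3
  rw [← h1, h2 h3]

lemma YCarrier.const_mul (hf : YCarrier k f) (c : ℂ) : YCarrier k fun z => c * f z := by
  refine ⟨hf.1.const_mul c, ?_, fun hk => ?_⟩
  · filter_upwards [hf.2.1] with z h1 h2; rw [h1 h2, mul_zero]
  · filter_upwards [hf.2.2 hk] with z h; rw [h]; simp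

lemma YCarrier.l2Dyadic (hf : YCarrier k f) : L2Dyadic k f := by
  refine ⟨hf.1, ?_⟩
  filter_upwards [hf.2.1] with z h1 h2
  exact h1 fun h => h2 h.2

lemma L2Dyadic.add (hf : L2Dyadic k f) (hg : L2Dyadic k g) : L2Dyadic k (f + g) := by
  refine ⟨hf.1.add hg.1, ?_⟩
  filter_upwards [hf.2, hg.2] with z h1 h2 h3
  rw [Pi.add_apply, h1 h3, h2 h3, add_zero]

lemma L2Dyadic.const_mul (hf : L2Dyadic k f) (c : ℂ) : L2Dyadic k fun z => c * f z := by
  refine ⟨hf.1.const_mul c, ?_⟩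
  filter_upwards [hf.2] with z h1 h2
  rw [h1 h2, mul_zero]

lemma xyNorm_congr (h : f =ᵐ[volume] g) : xyNorm η k f = xyNorm η k g := by
  have e : ∀ F : Amp, f =ᵐ[volume] F ↔ g =ᵐ[volume] F := fun F =>
    ⟨fun h1 => h.symm.trans h1, fun h1 => h.trans h1⟩
  simp only [xyNorm, e]

lemma xyNorm_le_of_split {f₁ f₂ : Amp} (h1 : L2Dyadic k f₁) (h2 : YCarrier k f₂)
    (h : f =ᵐ[volume] f₁ + f₂) : xyNorm η k f ≤ xNorm η k f₁ + yNorm k f₂ :=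
  iInf_le_of_le f₁ (iInf_le_of_le f₂ (iInf_le_of_le h1 (iInf_le_of_le h2 (iInf_le_of_le h le_rfl))))

lemma le_mul_xyNorm {B C : ℝ≥0∞} (hC : C ≠ 0) (hCt : C ≠ ⊤)
    (h : ∀ f₁ f₂ : Amp, Measurable f₁ → Measurable f₂ → L2Dyadic k f₁ → YCarrier k f₂ →
      f =ᵐ[volume] f₁ + f₂ → xNorm η k f₁ ≠ ⊤ → yNorm k f₂ ≠ ⊤ →
      B ≤ C * (xNorm η k f₁ + yNorm k f₂)) : B ≤ C * xyNorm η k f := by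
  rw [← ENNReal.div_le_iff' hC hCt]
  refine le_iInf fun f₁ => le_iInf fun f₂ => le_iInf fun h1 => le_iInf fun h2 => le_iInf fun hs => ?_
  rw [ENNReal.div_le_iff' hC hCt]
  have e1 := h1.1.1.ae_eq_mk
  have e2 := h2.1.1.ae_eq_mk
  rw [xNorm_congr k e1, yNorm_congr e2]
  by_cases hx : xNorm η k (h1.1.1.mk f₁) = ⊤
  · rw [hx, top_add, mul_top hC]; exact le_top
  by_cases hy : yNorm k (h2.1.1.mk f₂) = ⊤
  · rw [hy, add_top, mul_top hC]; exact le_top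
  exact h _ _ h1.1.1.stronglyMeasurable_mk.measurable h2.1.1.stronglyMeasurable_mk.measurable
    (h1.congr e1) (h2.congr e2) (hs.trans (e1.add e2)) hx hy

lemma eLpNorm_le_xyNorm (hη : IsBump η) : eLpNorm f 2 ≤ 2 ^ 15 * xyNorm η k f := by
  refine le_mul_xyNorm (by simp) (by simp) fun f₁ f₂ hm1 hm2 _ h2 h _ _ => ?_
  rw [eLpNorm_congr_ae h, mul_add]
  refine (eLpNorm_add_le hm1.aestronglyMeasurable hm2.aestronglyMeasurable (by norm_num)).trans ?_
  refine add_le_add ((eLpNorm_le_xNorm hη k hm1).trans ?_) h2.eLpNorm_le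
  gcongr
  norm_num

lemma xyNorm_add_le (hη : IsBump η) (hg : L2Dyadic k g) :
    xyNorm η k (f + g) ≤ xyNorm η k f + xNorm η k g := by
  rw [← tsub_le_iff_right]
  refine le_iInf fun f₁ => le_iInf fun f₂ => le_iInf fun h1 => le_iInf fun h2 => le_iInf fun hs => ?_
  rw [tsub_le_iff_right]
  refine (xyNorm_le_of_split (h1.add hg) h2 ?_).trans ?_
  · filter_upwards [hs] with z hz; simp only [Pi.add_apply, hz]; ring
  · refine (add_le_add (xNorm_add_le hη k h1.1.1 hg.1.1) le_rfl).trans (le_of_eq ?_); ring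

lemma L2Dyadic.fiber_ae (hf : L2Dyadic k f) :
    ∀ᵐ p : Plane, p ∉ {p : Plane | p 0 ∈ dyadic k} → ∀ᵐ τ : ℝ, f (atTime τ p) = 0 := by
  filter_upwards [ae_atTime hf.2] with p hp hpn
  filter_upwards [hp] with τ hτ
  exact hτ hpn

lemma convTau_congr (h : f =ᵐ[volume] g) : convTau ρ f =ᵐ[volume] convTau ρ g := by
  filter_upwards [ae_of_ae_atTime (ae_atTime h)] with z hz
  refine integral_congr_ae ?_
  have h2 := (quasiMeasurePreserving_sub_left (volume : Measure ℝ) (z 2)).ae hz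
  filter_upwards [h2] with r hr
  simp only [hr]

lemma timeSlice_eq_zero (hp : ∀ᵐ τ : ℝ, f (atTime τ p) = 0) (t : ℝ) :
    timeSlice f t p = 0 := by
  rw [timeSlice, integral_eq_zero_of_ae, mul_zero]
  filter_upwards [hp] with τ hτ
  rw [hτ, mul_zero]
  rfl

lemma freePart_eq_zero (hp : ∀ᵐ τ : ℝ, f (atTime τ p) = 0) (t : ℝ) :
    freePart f t p = 0 := by
  simp [freePart, profile, timeSlice_eq_zero hp]

lemma ft_zero_fun (τ : ℝ) : ft (fun _ => 0) τ = 0 := by simp [ft]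

lemma freeOp_supp (hf : L2Dyadic k f) : ∀ᵐ z : Spacetime, z 0 ∉ dyadic k → freeOp η f z = 0 := by
  filter_upwards [ae_of_ae_atTime hf.fiber_ae] with z hz h
  simp only [freeOp, freePart_eq_zero (hz h), mul_zero, ft_zero_fun]

lemma commOp_supp (hf : L2Dyadic k f) : ∀ᵐ z : Spacetime, z 0 ∉ dyadic k → commOp η f z = 0 := by
  filter_upwards [ae_of_ae_atTime hf.fiber_ae] with z hz h
  simp only [commOp, freePart_eq_zero (hz h), intervalIntegral.integral_zero, mul_zero, ft_zero_fun]

lemma L2Dyadic.convTau (hρ : Measurable ρ) (hρ1 : ∫⁻ r, ‖ρ r‖ₑ ≠ ⊤)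
    (hm : Measurable f) (hf : L2Dyadic k f) : L2Dyadic k (convTau ρ f) := by
  refine ⟨memLp_convTau hρ hρ1 hm hf.1, ?_⟩
  filter_upwards [convTau_supp_ae (ρ := ρ) hf.fiber_ae] with z hz h
  by_contra hc
  exact h (hz hc)

lemma eLpNorm_tauInt_add_le {f₁ f₂ : Amp} (hm1 : Measurable f₁) (hm2 : Measurable f₂)
    (hi1 : FiberIntegrable f₁) (hi2 : FiberIntegrable f₂) (h : f =ᵐ[volume] f₁ + f₂) :
    eLpNorm (tauInt f) 2 ≤ eLpNorm (tauInt f₁) 2 + eLpNorm (tauInt f₂) 2 := by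
  have e : tauInt f =ᵐ[volume] tauInt f₁ + tauInt f₂ := by
    filter_upwards [ae_atTime h, hi1, hi2] with p hp h1 h2
    rw [Pi.add_apply, tauInt, tauInt, tauInt, ← integral_add h1 h2]
    exact integral_congr_ae hp
  rw [eLpNorm_congr_ae e]
  exact eLpNorm_add_le (measurable_tauInt hm1).aestronglyMeasurable
    (measurable_tauInt hm2).aestronglyMeasurable (by norm_num)

lemma mixNorm_mono_ae (h : ∀ᵐ z, ‖f z‖ₑ ≤ ‖g z‖ₑ) : mixNorm f ≤ mixNorm g := by
  refine ENNReal.rpow_le_rpow (lintegral_mono_ae ?_) (by norm_num)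
  filter_upwards [ae_atTime h] with p hp
  exact pow_le_pow_left' (lintegral_mono_ae hp) 2

lemma mixNorm_const_mul (c : ℂ) (f : Amp) :
    mixNorm (fun z => c * f z) = ‖c‖ₑ * mixNorm f := by
  have : ‖c‖ₑ ≠ ⊤ := enorm_ne_top
  simp only [mixNorm, enorm_mul]
  simp_rw [lintegral_const_mul' _ _ this, mul_pow]
  rw [lintegral_const_mul' _ _ (by finiteness), mul_rpow_of_nonneg _ _ (by norm_num),
    ennreal_sq_sqrt]

lemma fiberIntegrable_of_mixNorm (hf : Measurable f) (h : mixNorm f ≠ ⊤) : FiberIntegrable f := by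
  have h1 : ∫⁻ p : Plane, (∫⁻ τ : ℝ, ‖f (atTime τ p)‖ₑ) ^ 2 ≠ ⊤ := by
    rw [← mixNorm_sq]
    exact pow_ne_top h
  filter_upwards [ae_lt_top ((measurable_lintegral_fiber hf).pow_const 2) h1] with p hp
  refine ⟨(measurable_fiber hf p).aestronglyMeasurable, ?_⟩
  rw [HasFiniteIntegral]
  by_contra hc
  rw [not_lt, top_le_iff] at hc
  rw [hc] at hp
  simp at hp

lemma YCarrier.mixNorm_le (hm : Measurable f) (hf : YCarrier k f) :
    mixNorm f ≤ 4 * toE (2 ^ k) * eLpNorm f 2 := by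
  rcases le_or_gt k 99 with hk | hk
  · have h := hf.2.2 hk
    have : mixNorm f ≤ mixNorm (fun _ => 0) := mixNorm_mono_ae (by
      filter_upwards [h] with z hz
      rw [hz]; simp)
    refine this.trans ?_
    simp [mixNorm]
  have hR : (0 : ℝ) < 2 ^ (k + 1) := by positivity
  have h4 : (4 : ℝ) ≤ 2 ^ k := by
    have := zpow_le_zpow_right₀ (a := (2 : ℝ)) (by norm_num) (show (2 : ℤ) ≤ k by omega)
    norm_num at this ⊢
    exact this
  refine ennreal_le_of_sq_le ((mixNorm_sq_le hm hR).trans ?_)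
  calc toE (π / 2 ^ (k + 1)) *
        ∫⁻ z, toE ((2 ^ (k + 1)) ^ 2 + modulation z ^ 2) * ‖f z‖ₑ ^ 2
      ≤ toE (π / 2 ^ (k + 1)) * ∫⁻ z, toE (2 * (2 ^ (k + 1)) ^ 2) * ‖f z‖ₑ ^ 2 := by
        refine mul_le_mul' le_rfl (lintegral_mono_ae ?_)
        filter_upwards [hf.2.1] with z hz
        by_cases h0 : f z = 0
        · simp [h0]
        · have h1 := not_not.1 fun h => h0 (hz h)
          refine mul_le_mul' (ofReal_le_ofReal ?_) le_rfl
          have h2 : modulation z ^ 2 ≤ (2 ^ (k + 1)) ^ 2 :=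
            sq_le_sq' (by linarith [(abs_le.1 (h1.1.2.2.2.trans h1.2.2)).1])
              (abs_le.1 (h1.1.2.2.2.trans h1.2.2)).2
          linarith
    _ = toE (π / 2 ^ (k + 1) * (2 * (2 ^ (k + 1)) ^ 2)) * eLpNorm f 2 ^ 2 := by
        rw [lintegral_const_mul' _ _ ofReal_ne_top, eLpNorm_two_sq, ← mul_assoc,
          ← ENNReal.ofReal_mul (by positivity)]
    _ ≤ toE ((4 * 2 ^ k) ^ 2) * eLpNorm f 2 ^ 2 := by
        refine mul_le_mul' (ofReal_le_ofReal ?_) le_rfl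
        have e : π / 2 ^ (k + 1) * (2 * (2 ^ (k + 1)) ^ 2) = π * 4 * 2 ^ k := by
          rw [zpow_add₀ (by norm_num)]
          field_simp
          norm_num
        rw [e]
        nlinarith [pi_le_four, pi_pos]
    _ = _ := by
        rw [mul_pow (4 * _ : ℝ≥0∞), ENNReal.ofReal_pow (by positivity),
          ENNReal.ofReal_mul (by norm_num)]
        norm_num

lemma mixNorm_ne_top_of_xyNorm (hη : IsBump η) (h : xyNorm η k f ≠ ⊤) :
    mixNorm f ≠ ⊤ := by
  have hC : (13 + 4 * toE (2 ^ k) * 2 ^ 15 : ℝ≥0∞) ≠ ⊤ := by finiteness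
  refine ne_top_of_le_ne_top (mul_ne_top hC h)
    (le_mul_xyNorm (by simp) hC fun f₁ f₂ hm1 hm2 h1 h2 hs _ _ => ?_)
  have : mixNorm f ≤ mixNorm (f₁ + f₂) := mixNorm_mono_ae (by
    filter_upwards [hs] with z hz
    rw [hz])
  refine (this.trans (mixNorm_add_le hm1 hm2)).trans ?_
  rw [mul_add]
  refine add_le_add ((mixNorm_le_xNorm hη k hm1).trans (mul_le_mul' le_self_add le_rfl))
    ((h2.mixNorm_le hm2).trans ?_)
  refine (mul_le_mul' le_rfl h2.eLpNorm_le).trans ?_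
  rw [← mul_assoc]
  exact mul_le_mul' le_add_self le_rfl

end

/-! ### Bounds for the Duhamel operator -/

section

variable {k : ℤ}

def freeConst (D : ℝ) : ℝ≥0∞ := (1 + 32 * primConst D) * 2 ^ 18

lemma freeConst_ne_top (D : ℝ) : freeConst D ≠ ⊤ := by
  have := primConst_ne_top D
  unfold freeConst
  finiteness

lemma le_freeConst_mul {D : ℝ} {H P a b A : ℝ≥0∞} (hP : P ≤ 32 * primConst D)
    (h : H ^ 2 ≤ P * (a ^ 2 + 8 * b ^ 2)) (ha : a ≤ 2 ^ 17 * A) (hb : b ≤ 2 ^ 15 * A) :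
    H ≤ freeConst D * A := by
  refine ennreal_le_of_sq_le (h.trans ?_)
  calc P * (a ^ 2 + 8 * b ^ 2)
      ≤ (32 * primConst D) * ((2 ^ 17 * A) ^ 2 + 8 * (2 ^ 15 * A) ^ 2) := by gcongr
    _ = (32 * primConst D) * (2 ^ 34 + 2 ^ 33) * A ^ 2 := by ring
    _ ≤ (1 + 32 * primConst D) ^ 2 * 2 ^ 36 * A ^ 2 := by
        refine mul_le_mul' (mul_le_mul' ?_ (by norm_num)) le_rfl
        rw [sq]
        exact le_add_self.trans (le_mul_of_one_le_left zero_le le_self_add)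
    _ = _ := by rw [freeConst]; ring

lemma eLpNorm_le_split (hη : IsBump η) {f₁ f₂ : Amp} (h1 : L2Dyadic k f₁)
    (h2 : YCarrier k f₂) (h : f =ᵐ[volume] f₁ + f₂) :
    eLpNorm f 2 ≤ 2 ^ 15 * (xNorm η k f₁ + yNorm k f₂) :=
  (eLpNorm_le_xyNorm hη).trans (mul_le_mul' le_rfl (xyNorm_le_of_split h1 h2 h))

lemma fiberIntegrable_of_xNorm (hη : IsBump η) (hf : Measurable f) (h : xNorm η k f ≠ ⊤) :
    FiberIntegrable f :=
  fiberIntegrable_of_mixNorm hf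
    (ne_top_of_le_ne_top (mul_ne_top (by simp) h) (mixNorm_le_xNorm hη k hf))

lemma YCarrier.fiberIntegrable (hm : Measurable f) (hf : YCarrier k f) : FiberIntegrable f :=
  fiberIntegrable_of_mixNorm hm (ne_top_of_le_ne_top (mul_ne_top (by finiteness) hf.1.2.ne)
    (hf.mixNorm_le hm))

section

variable (hη : IsBump η)
include hη

lemma eLpNorm_tauInt_le_split {f₁ f₂ : Amp} (hm1 : Measurable f₁)
    (hm2 : Measurable f₂) (h2 : YCarrier k f₂) (h : f =ᵐ[volume] f₁ + f₂) (hx : xNorm η k f₁ ≠ ⊤) :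
    eLpNorm (tauInt f) 2 ≤ 2 ^ 17 * (xNorm η k f₁ + yNorm k f₂) := by
  refine (eLpNorm_tauInt_add_le hm1 hm2 (fiberIntegrable_of_xNorm hη hm1 hx)
    (h2.fiberIntegrable hm2) h).trans ?_
  rw [mul_add]
  refine add_le_add (((eLpNorm_tauInt_le f₁).trans (mixNorm_le_xNorm hη k hm1)).trans
    (mul_le_mul' (by norm_num) le_rfl)) (h2.eLpNorm_tauInt_le hm2)

section

variable {D : ℝ} (hD : ∀ s, |deriv η s| ≤ D) (hf : Measurable f) (hf2 : MemLp f 2) (hi : FiberIntegrable f)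
include hD hf hf2 hi

lemma hNorm_freeOp_le {f₁ f₂ : Amp}
    (hm1 : Measurable f₁) (hm2 : Measurable f₂) (h1 : L2Dyadic k f₁) (h2 : YCarrier k f₂)
    (h : f =ᵐ[volume] f₁ + f₂) (hx : xNorm η k f₁ ≠ ⊤) :
    hNorm (freeOp η f) ≤ freeConst D * (xNorm η k f₁ + yNorm k f₂) :=
  le_freeConst_mul (le_mul_of_one_le_left zero_le (by norm_num))
    (hNorm_freeOp_sq_le hη hD hf hf2 hi) (eLpNorm_tauInt_le_split hη hm1 hm2 h2 h hx)
    (eLpNorm_le_split hη h1 h2 h)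

lemma hNorm_commOp_le_xyNorm :
    hNorm (commOp η f) ≤ freeConst D * xyNorm η k f := by
  refine le_mul_xyNorm (by simp [freeConst]) (freeConst_ne_top D)
    fun f₁ f₂ hm1 hm2 h1 h2 h hx _ => ?_
  exact le_freeConst_mul le_rfl (hNorm_commOp_sq_le hη hD hf hf2 hi)
    (eLpNorm_tauInt_le_split hη hm1 hm2 h2 h hx) (eLpNorm_le_split hη h1 h2 h)

end

lemma L2Dyadic.freeOp (hm : Measurable f) (hf : L2Dyadic k f)
    (h : hNorm (freeOp η f) ≠ ⊤) : L2Dyadic k (freeOp η f) :=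
  ⟨⟨(measurable_freeOp hη hm).aestronglyMeasurable, (eLpNorm_le_hNorm _).trans_lt h.lt_top⟩,
    freeOp_supp hf⟩

end

lemma enorm_I : ‖I‖ₑ = 1 := by rw [← ofReal_norm, norm_I, ENNReal.ofReal_one]

lemma xNorm_zero : xNorm η k (fun _ => 0) = 0 := by
  have := xNorm_const_mul (η := η) k 0 (fun _ => 0)
  simpa using this

/-- Multiplication with `η(t)` on `Y_k`, with the two components separated. -/
lemma exists_convTau_split_of_yCarrier (hη : IsBump η) : ∃ C : ℝ≥0, ∀ (k : ℤ)
    (f : Amp), Measurable f → YCarrier k f → yNorm k f ≠ ⊤ → ∃ F₁ F₂ : Amp,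
      Measurable F₁ ∧ Measurable F₂ ∧ L2Dyadic k F₁ ∧ YCarrier k F₂ ∧
      convTau hη.kernel f =ᵐ[volume] F₁ + F₂ ∧ xNorm η k F₁ + yNorm k F₂ ≤ C * yNorm k f := by
  obtain ⟨C, hC⟩ := exists_convTau_split hη
  refine ⟨C + 1, fun k f hm hf hfin => ?_⟩
  rw [coe_add, coe_one, add_mul, one_mul]
  rcases le_or_gt k 99 with hk | hk
  · refine ⟨fun _ => 0, f, measurable_const, hm, ⟨MemLp.zero', by simp⟩, hf, ?_, ?_⟩
    · filter_upwards [convTau_congr (ρ := hη.kernel) (hf.2.2 hk), hf.2.2 hk] with z hz h0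
      rw [hz, Pi.add_apply, h0]
      simp [convTau]
    · rw [xNorm_zero, zero_add]; exact le_add_self
  · lift k to ℕ using by omega
    obtain ⟨F₁, F₂, h1, h2, h3, h4, h5, h6⟩ := hC k f (by omega) hm hf hfin
    exact ⟨F₁, F₂, h1, h2, h3, h4, h5, h6.trans le_self_add⟩

lemma exists_xyNorm_duhamelOp_le (hη : IsBump η) : ∃ C : ℝ≥0, ∀ (k : ℤ) (f : Amp),
    Measurable f → L2Dyadic k f → FiberIntegrable f →
      xyNorm η k (duhamelOp η f) ≤ C * xyNorm η k f := by
  obtain ⟨C, hC⟩ := exists_convTau_split_of_yCarrier hη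
  obtain ⟨D, hD0, hD⟩ := hη.exists_deriv_bound
  obtain ⟨E, hE⟩ : ∃ E, E = 11 * (8 * hη.kernelNorm + 2 * hη.kernelNorm') := ⟨_, rfl⟩
  have hEt : E ≠ ⊤ := by
    have h1 := hη.kernelNorm_ne_top
    have h2 := hη.kernelNorm'_ne_top
    rw [hE]
    finiteness
  obtain ⟨B, hB⟩ : ∃ B : ℝ≥0∞, B = 1 + (E + C) + 22 * freeConst D := ⟨_, rfl⟩
  have hBt : B ≠ ⊤ := by have := freeConst_ne_top D; rw [hB]; finiteness
  refine ⟨B.toNNReal, fun k f hm hf hi => ?_⟩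
  rw [ENNReal.coe_toNNReal hBt]
  refine le_mul_xyNorm (by simp [hB]) hBt fun f₁ f₂ hm1 hm2 h1 h2 h hx hy => ?_
  obtain ⟨F₁, F₂, hM1, hM2, hF1, hF2, hs, hb⟩ := hC k f₂ hm2 h2 hy
  have hfree := hNorm_freeOp_le hη hD hm hf.1 hi hm1 hm2 h1 h2 h hx
  have hA : xNorm η k f₁ + yNorm k f₂ ≠ ⊤ := add_ne_top.2 ⟨hx, hy⟩
  have hfd := hf.freeOp hη hm
    (ne_top_of_le_ne_top (mul_ne_top (freeConst_ne_top D) hA) hfree)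
  have hc1 : L2Dyadic k (KPI.convTau hη.kernel f₁) :=
    h1.convTau hη.measurable_kernel hη.kernelNorm_ne_top hm1
  have hxc : xNorm η k (KPI.convTau hη.kernel f₁) ≤ E * xNorm η k f₁ := by
    rw [hE]
    exact xNorm_convTau_le hη k hη.measurable_kernel hη.memLp_kernel
      (SchwartzMap_memLp_mul hη.kernel) hm1 h1.1
  have hsplit : duhamelOp η f =ᵐ[volume]
      ((fun z => -I * (KPI.convTau hη.kernel f₁ + F₁) z) +
        fun z => I * KPI.freeOp η f z) + fun z => -I * F₂ z := by
    filter_upwards [duhamelOp_ae hη hi, convTau_congr (ρ := hη.kernel) h,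
      convTau_add_ae hη.memLp_kernel hm1 h1.1 hm2 h2.1, hs] with z a1 a2 a3 a4
    rw [a1, a2, a3]
    simp only [Pi.add_apply] at a4 ⊢
    rw [a4]
    ring
  have nI : ‖-I‖ₑ = 1 := by rw [enorm_neg, enorm_I]
  refine (xyNorm_le_of_split (((hc1.add hF1).const_mul _).add (hfd.const_mul _))
    (hF2.const_mul _) hsplit).trans ?_
  have s1 : xNorm η k ((fun z => -I * (KPI.convTau hη.kernel f₁ + F₁) z) +
        fun z => I * KPI.freeOp η f z) ≤
      (E * xNorm η k f₁ + xNorm η k F₁) + 22 * (freeConst D * (xNorm η k f₁ + yNorm k f₂)) := by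
    refine (xNorm_add_le hη k ((hc1.add hF1).const_mul _).1.1 (hfd.const_mul _).1.1).trans ?_
    rw [xNorm_const_mul, xNorm_const_mul, nI, enorm_I, one_mul, one_mul]
    exact add_le_add ((xNorm_add_le hη k hc1.1.1 hF1.1.1).trans (add_le_add hxc le_rfl))
      ((xNorm_le_hNorm hη k hfd.1.1).trans (mul_le_mul' le_rfl hfree))
  have s2 : yNorm k (fun z => -I * F₂ z) ≤ yNorm k F₂ := by
    have := yNorm_const_mul_le (k := k) (neg_ne_zero.2 I_ne_zero) F₂
    rwa [nI, one_mul] at this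
  refine (add_le_add s1 s2).trans ?_
  rw [hB]
  generalize xNorm η k f₁ = x at *
  generalize yNorm k f₂ = y at *
  generalize xNorm η k F₁ = x' at *
  generalize yNorm k F₂ = y' at *
  generalize freeConst D = c at *
  calc E * x + x' + 22 * (c * (x + y)) + y' = E * x + (x' + y') + 22 * c * (x + y) := by ring
    _ ≤ E * (x + y) + C * (x + y) + 22 * c * (x + y) := by
        gcongr
        · exact le_self_add
        · exact hb.trans (mul_le_mul' le_rfl le_add_self)
    _ = (E + C + 22 * c) * (x + y) := by ring
    _ ≤ _ := mul_le_mul' (by rw [add_assoc 1, add_comm 1]; exact le_self_add) le_rfl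

end

/-! ### Weak derivatives on the plane -/

section

abbrev dirMu : Plane := EuclideanSpace.single 1 1

/-- `b = ∂_μ a` in the sense of distributions on the plane. -/
structure WeakDeriv (a b : Plane → ℂ) : Prop where
  left : LocallyIntegrable a
  right : LocallyIntegrable b
  eq : ∀ φ : Plane → ℂ, ContDiff ℝ ∞ φ → HasCompactSupport φ →
    ∫ p, a p * fderiv ℝ φ p dirMu = -∫ p, b p * φ p

lemma integrable_mul_of_compact {X : Type*} [TopologicalSpace X] [T2Space X] [MeasurableSpace X]
    [OpensMeasurableSpace X] {m : Measure X} {a : X → ℂ} (ha : LocallyIntegrable a m)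
    {φ : X → ℂ} (hφ : Continuous φ) (hc : HasCompactSupport φ) :
    Integrable (fun p => a p * φ p) m := by
  have h := (integrableOn_iff_integrable_of_support_subset (μ := m) (f := fun p => a p * φ p)
    (s := tsupport φ) (fun x hx => subset_tsupport _ (right_ne_zero_of_mul hx))).1
  refine h ?_
  have h2 := (ha.integrableOn_isCompact hc).mul_continuousOn hφ.continuousOn hc
  exact h2

lemma continuous_fderiv_dir {E : Type*} [NormedAddCommGroup E] [NormedSpace ℝ E] {φ : E → ℂ}
    (hφ : ContDiff ℝ ∞ φ) (v : E) : Continuous fun p => fderiv ℝ φ p v :=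
  (hφ.continuous_fderiv (by simp)).clm_apply continuous_const

lemma hasCompactSupport_fderiv_dir {E : Type*} [NormedAddCommGroup E] [NormedSpace ℝ E]
    {φ : E → ℂ} (hc : HasCompactSupport φ) (v : E) :
    HasCompactSupport fun p => fderiv ℝ φ p v :=
  hc.fderiv_apply ℝ v

variable {a b a' b' : Plane → ℂ}

lemma WeakDeriv.add (h : WeakDeriv a b) (h' : WeakDeriv a' b') :
    WeakDeriv (fun p => a p + a' p) fun p => b p + b' p where
  left := h.left.add h'.left
  right := h.right.add h'.right
  eq φ hφ hc := by
    have c1 := continuous_fderiv_dir hφ dirMu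
    have c2 := hasCompactSupport_fderiv_dir hc dirMu
    simp only [add_mul]
    rw [integral_add (integrable_mul_of_compact h.left c1 c2)
      (integrable_mul_of_compact h'.left c1 c2), integral_add
      (integrable_mul_of_compact h.right hφ.continuous hc)
      (integrable_mul_of_compact h'.right hφ.continuous hc), h.eq φ hφ hc, h'.eq φ hφ hc, neg_add]

lemma WeakDeriv.const_mul (c : ℂ) (h : WeakDeriv a b) :
    WeakDeriv (fun p => c * a p) fun p => c * b p where
  left := h.left.smul c
  right := h.right.smul c
  eq φ hφ hc := by
    simp only [mul_assoc]
    rw [integral_const_mul, integral_const_mul, h.eq φ hφ hc, mul_neg]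

lemma WeakDeriv.congr (h : WeakDeriv a b) (ha : a =ᵐ[volume] a') (hb : b =ᵐ[volume] b') :
    WeakDeriv a' b' where
  left := h.left.congr ha
  right := h.right.congr hb
  eq φ hφ hc := by
    have h1 : ∫ p, a' p * fderiv ℝ φ p dirMu = ∫ p, a p * fderiv ℝ φ p dirMu :=
      integral_congr_ae (by filter_upwards [ha] with p hp; rw [hp])
    have h2 : ∫ p, b' p * φ p = ∫ p, b p * φ p :=
      integral_congr_ae (by filter_upwards [hb] with p hp; rw [hp])
    rw [h1, h2, h.eq φ hφ hc]

lemma integrable_param_mul {X : Type*} [TopologicalSpace X] [T2Space X] [MeasurableSpace X]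
    [OpensMeasurableSpace X] {m : Measure X} [SFinite m] {ν : Measure ℝ} [SFinite ν]
    {a : ℝ → X → ℂ} (ha : Measurable (uncurry a))
    {c : ℝ → ℝ} (hc : Integrable c ν) {A : X → ℝ} (hA : LocallyIntegrable A m)
    (hb : ∀ t p, ‖a t p‖ ≤ c t * A p) {φ : X → ℂ} (hφ : Continuous φ) (hφc : HasCompactSupport φ) :
    Integrable (fun q : X × ℝ => a q.2 q.1 * φ q.1) (m.prod ν) := by
  have h1 := integrable_mul_of_compact (m := m) (a := fun p => (A p : ℂ)) (φ := φ)
    (fun x => (hA x).imp fun s hs => ⟨hs.1, hs.2.ofReal⟩) hφ hφc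
  refine Integrable.mono' (h1.norm.mul_prod hc.norm) ?_ (.of_forall fun q => ?_)
  · exact ((ha.comp measurable_swap).mul (hφ.measurable.comp measurable_fst)).aestronglyMeasurable
  · rw [norm_mul, norm_mul, norm_real]
    calc ‖a q.2 q.1‖ * ‖φ q.1‖ ≤ c q.2 * A q.1 * ‖φ q.1‖ :=
          mul_le_mul_of_nonneg_right (hb _ _) (norm_nonneg _)
      _ ≤ ‖c q.2 * A q.1‖ * ‖φ q.1‖ := mul_le_mul_of_nonneg_right (le_abs_self _) (norm_nonneg _)
      _ = _ := by rw [norm_mul]; ring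

lemma locallyIntegrable_integral {ν : Measure ℝ} [SFinite ν]
    {a : ℝ → Plane → ℂ} (ha : Measurable (uncurry a))
    {c : ℝ → ℝ} (hc : Integrable c ν) {A : Plane → ℝ} (hA : LocallyIntegrable A)
    (hb : ∀ t p, ‖a t p‖ ≤ c t * A p) : LocallyIntegrable fun p => ∫ t, a t p ∂ν := by
  have hm : Measurable fun q : Plane × ℝ => a q.2 q.1 := by fun_prop
  refine (hA.smul (∫ t, c t ∂ν)).mono
    hm.stronglyMeasurable.integral_prod_right'.aestronglyMeasurable
    (.of_forall fun p => ?_)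
  refine (norm_integral_le_of_norm_le (hc.mul_const (A p)) (.of_forall fun t => hb t p)).trans ?_
  rw [integral_mul_const]
  exact le_abs_self _

lemma WeakDeriv.integral {ν : Measure ℝ} [SFinite ν] {a b : ℝ → Plane → ℂ}
    (h : ∀ t, WeakDeriv (a t) (b t)) (ha : Measurable (uncurry a))
    (hb : Measurable (uncurry b)) {c : ℝ → ℝ} (hc : Integrable c ν) {A B : Plane → ℝ}
    (hA : LocallyIntegrable A) (hB : LocallyIntegrable B) (hcA : ∀ t p, ‖a t p‖ ≤ c t * A p)
    (hcB : ∀ t p, ‖b t p‖ ≤ c t * B p) :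
    WeakDeriv (fun p => ∫ t, a t p ∂ν) fun p => ∫ t, b t p ∂ν where
  left := locallyIntegrable_integral ha hc hA hcA
  right := locallyIntegrable_integral hb hc hB hcB
  eq φ hφ hφc := by
    simp only [← integral_mul_const]
    rw [integral_integral_swap (f := fun p t => a t p * fderiv ℝ φ p dirMu)
      (integrable_param_mul ha hc hA hcA (continuous_fderiv_dir hφ dirMu)
      (hasCompactSupport_fderiv_dir hφc dirMu)), integral_integral_swap
      (f := fun p t => b t p * φ p) (integrable_param_mul hb hc hB hcB hφ.continuous hφc),
      ← integral_neg]
    exact integral_congr fun t => (h t).eq φ hφ hφc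

lemma WeakDeriv.intervalIntegral {a b : ℝ → Plane → ℂ}
    (h : ∀ t, WeakDeriv (a t) (b t)) (ha : Measurable (uncurry a))
    (hb : Measurable (uncurry b)) {c : ℝ → ℝ} (hc : Continuous c) {A B : Plane → ℝ}
    (hA : LocallyIntegrable A) (hB : LocallyIntegrable B) (hcA : ∀ t p, ‖a t p‖ ≤ c t * A p)
    (hcB : ∀ t p, ‖b t p‖ ≤ c t * B p) (r : ℝ) :
    WeakDeriv (fun p => ∫ t in (0 : ℝ)..r, a t p) fun p => ∫ t in (0 : ℝ)..r, b t p := by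
  have hci : Integrable c (volume.restrict (uIoc 0 r)) :=
    (hc.integrableOn_uIcc (a := 0) (b := r)).mono_set uIoc_subset_uIcc
  have := (WeakDeriv.integral h ha hb hci hA hB hcA hcB).const_mul
    (if (0 : ℝ) ≤ r then 1 else -1)
  simp only [intervalIntegral.intervalIntegral_eq_integral_uIoc, real_smul]
  convert this using 3 <;> split_ifs <;> simp

/-- Multiplication with a function which is smooth near the support of `a`. -/
lemma WeakDeriv.mul (h : WeakDeriv a b) {m m' c : Plane → ℂ} (hm : ContDiff ℝ ∞ fun p => m p * c p)
    (hd : ∀ p, fderiv ℝ (fun p => m p * c p) p dirMu = m' p * c p)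
    (hac : ∀ᵐ p, a p ≠ 0 → c p = 1) (hbc : ∀ᵐ p, b p ≠ 0 → c p = 1) :
    WeakDeriv (fun p => m p * a p) fun p => m p * b p + m' p * a p := by
  have hd' : Continuous fun p => m' p * c p := by
    simp only [← hd]
    exact continuous_fderiv_dir hm dirMu
  have lmul {a : Plane → ℂ} (ha : LocallyIntegrable a) {ψ : Plane → ℂ} (hψ : Continuous ψ) :
      LocallyIntegrable fun p => ψ p * a p := by
    rw [locallyIntegrable_iff]
    intro K hK
    exact (ha.integrableOn_isCompact hK).continuousOn_mul hψ.continuousOn hK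
  have e1 : (fun p => m p * c p * a p) =ᵐ[volume] fun p => m p * a p := by
    filter_upwards [hac] with p hp
    by_cases h0 : a p = 0
    · rw [h0, mul_zero, mul_zero]
    · rw [hp h0, mul_one]
  have e2 : (fun p => m p * c p * b p + m' p * c p * a p) =ᵐ[volume]
      fun p => m p * b p + m' p * a p := by
    filter_upwards [hac, hbc] with p hp hp'
    by_cases h0 : a p = 0 <;> by_cases h1 : b p = 0 <;> simp_all
  suffices key : WeakDeriv (fun p => m p * c p * a p)
      fun p => m p * c p * b p + m' p * c p * a p from key.congr e1 e2
  refine ⟨lmul h.left hm.continuous,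
    (lmul h.right hm.continuous).add (lmul h.left hd'), fun φ hφ hφc => ?_⟩
  have h1 := h.eq (fun p => m p * c p * φ p) (hm.mul hφ) hφc.mul_left
  have hfd : ∀ p, fderiv ℝ (fun p => m p * c p * φ p) p dirMu =
      m p * c p * fderiv ℝ φ p dirMu + m' p * c p * φ p := fun p => by
    rw [fderiv_fun_mul (hm.differentiable (by simp) p) (hφ.differentiable (by simp) p)]
    simp only [add_apply, smul_apply, smul_eq_mul, hd]
    ring
  simp only [hfd] at h1
  have i1 : Integrable fun p => a p * (m p * c p * fderiv ℝ φ p dirMu) :=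
    integrable_mul_of_compact h.left (hm.continuous.mul (continuous_fderiv_dir hφ dirMu))
      (hasCompactSupport_fderiv_dir hφc dirMu).mul_left
  have i2 : Integrable fun p => a p * (m' p * c p * φ p) :=
    integrable_mul_of_compact h.left (hd'.mul hφ.continuous) hφc.mul_left
  have i3 : Integrable fun p => b p * (m p * c p * φ p) :=
    integrable_mul_of_compact h.right (hm.continuous.mul hφ.continuous) hφc.mul_left
  simp only [mul_add] at h1
  rw [integral_add i1 i2] at h1
  have h2 : ∫ p, (m p * c p * b p + m' p * c p * a p) * φ p =
      (∫ p, b p * (m p * c p * φ p)) + ∫ p, a p * (m' p * c p * φ p) := by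
    rw [← integral_add i3 i2]
    refine integral_congr fun p => ?_
    ring
  rw [h2, neg_add, ← h1, add_neg_cancel_right]
  refine integral_congr fun p => ?_
  ring

end

/-! ### The weak derivative of the Duhamel operator -/

section

variable {k : ℤ}

/-- The `L¹` norm of the restriction of `f` to a line parallel to the `τ`-axis. -/
def fiberMass (f : Amp) (p : Plane) : ℝ := (∫⁻ τ : ℝ, ‖f (atTime τ p)‖ₑ).toReal

lemma fiberMass_nonneg (f : Amp) (p : Plane) : 0 ≤ fiberMass f p := toReal_nonneg

lemma measurable_fiberMass (hf : Measurable f) : Measurable (fiberMass f) :=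
  (measurable_lintegral_fiber hf).ennreal_toReal

lemma eLpNorm_fiberMass_le (f : Amp) : eLpNorm (fiberMass f) 2 ≤ mixNorm f := by
  apply ennreal_le_of_sq_le
  rw [eLpNorm_two_sq, mixNorm_sq]
  refine lintegral_mono fun p => pow_le_pow_left' ?_ 2
  rw [enorm_of_nonneg (fiberMass_nonneg f p)]
  exact ofReal_toReal_le

lemma memLp_fiberMass (hf : Measurable f) (h : mixNorm f ≠ ⊤) : MemLp (fiberMass f) 2 :=
  ⟨(measurable_fiberMass hf).aestronglyMeasurable, (eLpNorm_fiberMass_le f).trans_lt h.lt_top⟩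

lemma norm_timeSlice_le (f : Amp) (t : ℝ) (p : Plane) :
    ‖timeSlice f t p‖ ≤ fiberMass f p := by
  have h1 : ‖((2 * π : ℝ) : ℂ)⁻¹‖ ≤ 1 := by
    rw [norm_inv, norm_real, norm_of_nonneg (by positivity)]
    exact inv_le_one_of_one_le₀ (by linarith [pi_gt_three])
  rw [timeSlice, norm_mul]
  refine (mul_le_of_le_one_left (norm_nonneg _) h1).trans
    ((norm_integral_le_lintegral_norm _).trans (le_of_eq ?_))
  simp only [norm_mul, norm_exp_I_mul, one_mul, ofReal_norm]
  rfl

lemma norm_profile_le (f : Amp) (t : ℝ) (p : Plane) :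
    ‖profile f t p‖ ≤ fiberMass f p := by
  rw [profile, norm_mul, norm_exp_neg_I_mul, one_mul]
  exact norm_timeSlice_le f t p

lemma norm_freePart_le (f : Amp) (t : ℝ) (p : Plane) :
    ‖freePart f t p‖ ≤ (1 + |t|) * fiberMass f p := by
  rw [add_mul, one_mul, mul_comm |t|]
  refine (norm_add_le _ _).trans (add_le_add (norm_timeSlice_le f 0 p) ?_)
  have := intervalIntegral.norm_integral_le_of_norm_le_const (a := 0) (b := t)
    (f := fun s => profile f s p) fun s _ => norm_profile_le f s p
  rwa [sub_zero] at this

lemma norm_duhamelFt_le (f : Amp) (t : ℝ) (p : Plane) :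
    ‖duhamelFt f t p‖ ≤ (2 + |t|) * fiberMass f p := by
  refine (norm_add_le _ _).trans ?_
  simp only [norm_mul, norm_neg, norm_I, one_mul, norm_exp_I_mul]
  linarith [norm_timeSlice_le f t p, norm_freePart_le f t p]

lemma norm_integral_freePart_le (f : Amp) (t : ℝ) (p : Plane) :
    ‖∫ s in (0 : ℝ)..t, freePart f s p‖ ≤ (|t| * (1 + |t|)) * fiberMass f p := by
  have := intervalIntegral.norm_integral_le_of_norm_le_const (a := 0) (b := t)
    (f := fun s => freePart f s p) (C := (1 + |t|) * fiberMass f p) fun s hs => by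
      refine (norm_freePart_le f s p).trans (mul_le_mul_of_nonneg_right ?_ (fiberMass_nonneg f p))
      have : |s| ≤ |t| := by grind
      linarith
  rw [sub_zero] at this
  linarith

lemma integrable_mul_proj (hf : Measurable f) (h : mixNorm f ≠ ⊤) {ψ : Plane → ℂ}
    (hψ : Measurable ψ) (hψ2 : MemLp ψ 2) : Integrable fun z => f z * ψ (proj z) := by
  have hm : Measurable fun z => f z * ψ (proj z) := by fun_prop
  refine ⟨hm.aestronglyMeasurable, ?_⟩
  rw [HasFiniteIntegral, lintegral_atTime hm.enorm]
  have h1 : ∀ p, ∫⁻ τ : ℝ, ‖f (atTime τ p) * ψ (proj (atTime τ p))‖ₑ =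
      (∫⁻ τ : ℝ, ‖f (atTime τ p)‖ₑ) * ‖ψ p‖ₑ := fun p => by
    simp only [proj_atTime, enorm_mul]
    rw [lintegral_mul_const' _ _ enorm_ne_top]
  simp only [h1]
  have h2 := lintegral_mul_sq_le (μ := (volume : Measure Plane))
    (measurable_lintegral_fiber hf).aemeasurable hψ.enorm.aemeasurable
  rw [← mixNorm_sq, ← eLpNorm_two_sq] at h2
  have h3 := h2.trans_lt (mul_lt_top (pow_lt_top h.lt_top) (pow_lt_top hψ2.2))
  by_contra hc
  rw [not_lt, top_le_iff] at hc
  rw [hc] at h3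
  simp at h3

lemma integral_mul_proj_mul_exp {ψ : Plane → ℂ}
    (hi : Integrable fun z => F z * ψ (proj z)) (s : ℝ) :
    ∫ z, F z * (ψ (proj z) * cexp (I * ((s * z 2 : ℝ) : ℂ))) =
      ((2 * π : ℝ) : ℂ) * ∫ p, timeSlice F s p * ψ p := by
  have hi' : Integrable fun z => F z * (ψ (proj z) * cexp (I * ((s * z 2 : ℝ) : ℂ))) := by
    refine (hi.bdd_mul (c := 1)
      (f := fun z : Spacetime => cexp (I * ((s * z 2 : ℝ) : ℂ))) ?_ ?_).congr ?_
    · fun_prop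
    · exact .of_forall fun q => (norm_exp_I_mul _).le
    · exact .of_forall fun q => by simp only; ring
  have hpi : ((2 * π : ℝ) : ℂ) ≠ 0 := by simp
  rw [integral_atTime hi', ← integral_const_mul]
  refine integral_congr fun p => ?_
  simp only [proj_atTime, atTime_apply_two, timeSlice]
  rw [← mul_assoc, mul_inv_cancel_left₀ hpi, ← integral_mul_const]
  refine integral_congr fun τ => ?_
  ring

/-- The test functions `e^{i s τ} η(τ / n)` in the variable `τ`. -/
def cutExp (η : ℝ → ℝ) (s : ℝ) (n : ℕ) (σ : ℝ) : ℂ :=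
  cexp (I * ((s * σ : ℝ) : ℂ)) * (η (σ / (n + 1)) : ℂ)

section

variable (hη : IsBump η)
include hη

lemma contDiff_cutExp (s : ℝ) (n : ℕ) : ContDiff ℝ ∞ (cutExp η s n) := by
  have h1 : ContDiff ℝ ∞ fun σ : ℝ => η (σ / (n + 1)) := hη.smooth.comp (by fun_prop)
  have h2 : ContDiff ℝ ∞ fun σ : ℝ => ((η (σ / (n + 1)) : ℝ) : ℂ) := ofRealCLM.contDiff.comp h1
  have h3 : ContDiff ℝ ∞ fun σ : ℝ => I * ((s * σ : ℝ) : ℂ) :=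
    contDiff_const.mul (ofRealCLM.contDiff.comp (contDiff_const.mul contDiff_id))
  exact h3.cexp.mul h2

lemma norm_cutExp_le (s : ℝ) (n : ℕ) (σ : ℝ) : ‖cutExp η s n σ‖ ≤ 1 := by
  rw [cutExp, norm_mul, norm_exp_I_mul, one_mul]
  exact hη.norm_ofReal_le _

lemma cutExp_eq_zero (s : ℝ) (n : ℕ) {σ : ℝ} (h : 2 * (n + 1) < |σ|) :
    cutExp η s n σ = 0 := by
  rw [cutExp, hη.eq_zero_of_two_lt, Complex.ofReal_zero, mul_zero]
  rw [abs_div, abs_of_pos (by positivity : (0 : ℝ) < n + 1), lt_div_iff₀ (by positivity)]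
  exact h

lemma tendsto_cutExp (s σ : ℝ) :
    Tendsto (fun n => cutExp η s n σ) atTop
      (nhds (cexp (I * ((s * σ : ℝ) : ℂ)))) := by
  refine tendsto_const_nhds.congr' ?_
  filter_upwards [eventually_ge_atTop ⌈|σ|⌉₊] with n hn
  rw [cutExp, hη.eq_one', Complex.ofReal_one, mul_one]
  have : |σ| ≤ n := (Nat.le_ceil _).trans (by exact_mod_cast hn)
  rw [abs_div, abs_of_pos (by positivity : (0 : ℝ) < n + 1), div_le_iff₀ (by positivity)]
  nlinarith [abs_nonneg σ]

lemma tendsto_integral_cutExp {ψ : Plane → ℂ} (hi : Integrable fun z => F z * ψ (proj z)) (s : ℝ) :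
    Tendsto (fun n => ∫ z, F z * (ψ (proj z) * cutExp η s n (z 2))) atTop
      (nhds (((2 * π : ℝ) : ℂ) * ∫ p, timeSlice F s p * ψ p)) := by
  rw [← integral_mul_proj_mul_exp hi s]
  refine tendsto_integral_of_dominated_convergence (fun z => ‖F z * ψ (proj z)‖) (fun n => ?_)
    hi.norm (fun n => .of_forall fun z => ?_)
    (.of_forall fun z => ?_)
  · have hc := (contDiff_cutExp hη s n).continuous
    have h2 : AEStronglyMeasurable (fun z : Spacetime => cutExp η s n (z 2)) volume := by fun_prop
    refine (hi.1.mul h2).congr (.of_forall fun z => ?_)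
    simp only [Pi.mul_apply]
    ring
  · rw [← mul_assoc, norm_mul]
    exact mul_le_of_le_one_right (norm_nonneg _) (norm_cutExp_le hη _ _ _)
  · exact ((tendsto_cutExp hη s (z 2)).const_mul _).const_mul _

end

def projL : Spacetime →L[ℝ] Plane := LinearMap.toContinuousLinearMap
    { toFun := proj
      map_add' := fun p q => by ext i; fin_cases i <;> simp [proj]
      map_smul' := fun c p => by ext i; fin_cases i <;> simp [proj] }

lemma projL_apply (z : Spacetime) : projL z = proj z := rfl

lemma continuous_proj : Continuous proj := projL.continuous

lemma continuous_atTime : Continuous fun q : ℝ × Plane => atTime q.1 q.2 := by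
  have : (fun q : ℝ × Plane => atTime q.1 q.2) =
      fun q => atZero q.2 + q.1 • EuclideanSpace.single 2 (1 : ℝ) := by
    funext q
    rw [atTime_eq]
    congr 1
    ext i
    fin_cases i <;> simp
  rw [this]
  fun_prop

lemma proj_single_one : proj (EuclideanSpace.single 1 1) = dirMu := by
  ext i
  fin_cases i <;> simp [proj, dirMu]

lemma fderiv_tensor {φ : Plane → ℂ} (hφ : ContDiff ℝ ∞ φ) {h : ℝ → ℂ} (hh : ContDiff ℝ ∞ h)
    (z : Spacetime) : fderiv ℝ (fun z : Spacetime => φ (proj z) * h (z 2)) z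
      (EuclideanSpace.single 1 1) = fderiv ℝ φ (proj z) dirMu * h (z 2) := by
  have h1 : HasFDerivAt (fun z => φ (proj z)) ((fderiv ℝ φ (proj z)).comp projL) z :=
    ((hφ.differentiable (by simp)) (proj z)).hasFDerivAt.comp z projL.hasFDerivAt
  have h2 : HasFDerivAt (fun z : Spacetime => h (z 2))
      ((fderiv ℝ h (z 2)).comp (EuclideanSpace.proj (𝕜 := ℝ) (2 : Fin 3))) z :=
    HasFDerivAt.comp (g := h) z ((hh.differentiable (by simp)) (z 2)).hasFDerivAt
      (EuclideanSpace.proj (𝕜 := ℝ) (2 : Fin 3)).hasFDerivAt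
  have h3 : HasFDerivAt (fun z : Spacetime => φ (proj z) * h (z 2)) _ z := h1.mul h2
  rw [h3.fderiv]
  simp [projL_apply, proj_single_one, mul_comm]

lemma contDiff_tensor {φ : Plane → ℂ} (hφ : ContDiff ℝ ∞ φ) {h : ℝ → ℂ} (hh : ContDiff ℝ ∞ h) :
    ContDiff ℝ ∞ fun z : Spacetime => φ (proj z) * h (z 2) :=
  (hφ.comp projL.contDiff).mul
    (hh.comp (EuclideanSpace.proj (𝕜 := ℝ) (2 : Fin 3)).contDiff)

lemma hasCompactSupport_tensor {φ : Plane → ℂ} (hφ : HasCompactSupport φ) {h : ℝ → ℂ} {R : ℝ}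
    (hh : ∀ σ, R < |σ| → h σ = 0) :
    HasCompactSupport fun z : Spacetime => φ (proj z) * h (z 2) := by
  refine HasCompactSupport.intro ((isCompact_Icc.prod hφ).image continuous_atTime)
    (K := (fun q : ℝ × Plane => atTime q.1 q.2) '' (Icc (-R) R ×ˢ tsupport φ)) fun z hz => ?_
  by_contra hc
  refine hz ⟨(z 2, proj z), ⟨abs_le.1 (not_lt.1 fun h1 => right_ne_zero_of_mul hc (hh _ h1)),
    subset_tsupport _ (left_ne_zero_of_mul hc)⟩, atTime_proj z⟩

lemma locallyIntegrable_timeSlice (hf : Measurable f) (h : mixNorm f ≠ ⊤) (s : ℝ) :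
    LocallyIntegrable (timeSlice f s) := by
  have hm : Measurable fun p => timeSlice f s p :=
    Measurable.comp (g := fun q : Plane × ℝ => timeSlice f q.2 q.1) (f := fun p : Plane => (p, s))
      (measurable_timeSlice hf) (by fun_prop)
  exact ((memLp_fiberMass hf h).locallyIntegrable (by norm_num)).mono hm.aestronglyMeasurable
    (.of_forall fun p => (norm_timeSlice_le f s p).trans (le_abs_self _))

lemma planeWeakDeriv_timeSlice (hη : IsBump η) (hf : Measurable f) (hf1 : mixNorm f ≠ ⊤)
    (hg : Measurable g) (hg1 : mixNorm g ≠ ⊤) (h : IsWeakDerivMu f g) (s : ℝ) :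
    WeakDeriv (timeSlice f s) (timeSlice g s) where
  left := locallyIntegrable_timeSlice hf hf1 s
  right := locallyIntegrable_timeSlice hg hg1 s
  eq φ hφ hc := by
    have c1 := continuous_fderiv_dir hφ dirMu
    have c2 := hasCompactSupport_fderiv_dir hc dirMu
    have t1 := tendsto_integral_cutExp hη (integrable_mul_proj hf hf1 c1.measurable
      (c1.memLp_of_hasCompactSupport c2)) s
    have t2 := tendsto_integral_cutExp hη (integrable_mul_proj hg hg1 hφ.continuous.measurable
      (hφ.continuous.memLp_of_hasCompactSupport hc)) s
    have e : ∀ n : ℕ, ∫ z, f z * (fderiv ℝ φ (proj z) dirMu * cutExp η s n (z 2)) =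
        -∫ z, g z * (φ (proj z) * cutExp η s n (z 2)) := fun n => by
      have := h _ (contDiff_tensor hφ (contDiff_cutExp hη s n))
        (hasCompactSupport_tensor hc (fun σ => cutExp_eq_zero hη s n))
      simp only [fderiv_tensor hφ (contDiff_cutExp hη s n)] at this
      exact this
    simp only [e] at t1
    have e2 := tendsto_nhds_unique t1 t2.neg
    rw [← mul_neg] at e2
    have hpi : ((2 * π : ℝ) : ℂ) ≠ 0 := by simp
    exact mul_left_cancel₀ hpi e2

end

attribute [fun_prop] measurable_fiberMass continuous_proj continuous_atTime

section

variable {k : ℤ}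

/-- The derivative `2 μ / ξ` of the dispersion relation in the variable `μ`. -/
def dphase (p : Plane) : ℝ := 2 * p 1 / p 0

@[fun_prop]
lemma measurable_dphase : Measurable dphase := by unfold dphase; fun_prop

/-- A cutoff in `ξ` which is equal to one on `I_k` and vanishes near `ξ = 0`. -/
def xiCut (η : ℝ → ℝ) (k : ℤ) (p : Plane) : ℂ := ((1 - η (p 0 / 2 ^ (k - 2)) : ℝ) : ℂ)

lemma xiCut_eq_one (hη : IsBump η) (hp : p 0 ∈ dyadic k) : xiCut η k p = 1 := by
  rw [xiCut, hη.eq_zero, sub_zero, Complex.ofReal_one]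
  rw [abs_div, abs_of_pos (by positivity : (0 : ℝ) < 2 ^ (k - 2)), lt_div_iff₀ (by positivity)]
  have h1 := hp.1
  rw [show k - 1 = (k - 2) + 1 by ring, zpow_add₀ (by norm_num), zpow_one] at h1
  have : (0 : ℝ) < 2 ^ (k - 2) := by positivity
  linarith

lemma xiCut_eq_zero (hη : IsBump η) (hp : |p 0| < 2 ^ (k - 2)) :
    xiCut η k p = 0 := by
  rw [xiCut, hη.eq_one', sub_self, Complex.ofReal_zero]
  rw [abs_div, abs_of_pos (by positivity : (0 : ℝ) < 2 ^ (k - 2)), div_le_iff₀ (by positivity)]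
  have : (0 : ℝ) < 2 ^ (k - 2) := by positivity
  linarith

lemma contDiff_xiCut (hη : IsBump η) : ContDiff ℝ ∞ (xiCut η k) := by
  have h0 : ContDiff ℝ ∞ fun p : Plane => p 0 := by fun_prop
  have h1 : ContDiff ℝ ∞ fun p : Plane => η (p 0 / 2 ^ (k - 2)) := hη.smooth.comp (h0.div_const _)
  exact ofRealCLM.contDiff.comp (contDiff_const.sub h1)

def evolve (s : ℝ) (p : Plane) : ℂ := cexp (I * ((s * phase p : ℝ) : ℂ))

lemma norm_evolve (s : ℝ) (p : Plane) : ‖evolve s p‖ = 1 := norm_exp_I_mul _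

lemma contDiffAt_evolve (s : ℝ) (hp : p 0 ≠ 0) : ContDiffAt ℝ ∞ (evolve s) p := by
  have h0 : ContDiff ℝ ∞ fun p : Plane => p 0 := by fun_prop
  have h1 : ContDiff ℝ ∞ fun p : Plane => p 1 := by fun_prop
  have h2 : ContDiffAt ℝ ∞ phase p :=
    ((h0.pow 3).contDiffAt).add ((h1.pow 2).contDiffAt.div h0.contDiffAt hp)
  have h3 : ContDiffAt ℝ ∞ (fun p => I * ((s * phase p : ℝ) : ℂ)) p :=
    contDiffAt_const.mul (ofRealCLM.contDiff.contDiffAt.comp p (contDiffAt_const.mul h2))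
  exact h3.cexp

lemma contDiff_evolve_mul (hη : IsBump η) (s : ℝ) :
    ContDiff ℝ ∞ fun p => evolve s p * xiCut η k p := by
  rw [contDiff_iff_contDiffAt]
  intro p
  by_cases hp : p 0 = 0
  · have hev : ∀ᶠ q : Plane in nhds p, |q 0| < 2 ^ (k - 2) := by
      have hc : Continuous fun q : Plane => |q 0| := by fun_prop
      refine hc.continuousAt.eventually_lt continuousAt_const ?_
      rw [hp, abs_zero]
      positivity
    refine (contDiffAt_const (c := (0 : ℂ))).congr_of_eventuallyEq ?_
    filter_upwards [hev] with q hq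
    rw [xiCut_eq_zero hη hq, mul_zero]
  · exact (contDiffAt_evolve s hp).mul (contDiff_xiCut hη).contDiffAt

lemma fderiv_evolve_mul (hη : IsBump η) (s : ℝ) (p : Plane) :
    fderiv ℝ (fun p => evolve s p * xiCut η k p) p dirMu =
      (I * ((s * dphase p : ℝ) : ℂ) * evolve s p) * xiCut η k p := by
  have h1 := ((contDiff_evolve_mul (k := k) hη s).differentiable (by simp) p).hasFDerivAt
  have hγ : HasDerivAt (fun r : ℝ => p + r • dirMu) dirMu 0 := by
    have := ((hasDerivAt_id (0 : ℝ)).smul_const dirMu).const_add p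
    simpa using this
  have h1' : HasFDerivAt (fun p => evolve s p * xiCut η k p)
      (fderiv ℝ (fun p => evolve s p * xiCut η k p) p) (p + (0 : ℝ) • dirMu) := by
    rw [zero_smul, add_zero]
    exact h1
  have h2 := h1'.comp_hasDerivAt 0 hγ
  refine h2.unique ?_
  have e : ((fun p => evolve s p * xiCut η k p) ∘ fun r : ℝ => p + r • dirMu) = fun r : ℝ =>
      cexp (I * ((s * omega (p 0) (p 1 + r) : ℝ) : ℂ)) * xiCut η k p := by
    funext r
    simp [evolve, phase, xiCut, dirMu]
  rw [e]
  by_cases hp : p 0 = 0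
  · rw [xiCut_eq_zero hη (by rw [hp, abs_zero]; positivity)]
    simpa using hasDerivAt_const (0 : ℝ) (0 : ℂ)
  · have h3 : HasDerivAt (fun r : ℝ => omega (p 0) (p 1 + r)) (dphase p) 0 := by
      have h4 := hasDerivAt_omega (p 0) (p 1 + 0)
      have := h4.comp_const_add (p 1) 0
      simpa [dphase] using this
    have h5 : HasDerivAt (fun r : ℝ => I * ((s * omega (p 0) (p 1 + r) : ℝ) : ℂ))
        (I * ((s * dphase p : ℝ) : ℂ)) 0 :=
      ((h3.const_mul s).ofReal_comp).const_mul _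
    have h6 := h5.cexp.mul_const (xiCut η k p)
    simp only [add_zero] at h6
    rw [mul_comm (I * _) (evolve s p)]
    exact h6

lemma WeakDeriv.evolve (hη : IsBump η) {a b : Plane → ℂ} (h : WeakDeriv a b)
    (ha : ∀ᵐ p : Plane, p 0 ∉ dyadic k → a p = 0) (hb : ∀ᵐ p : Plane, p 0 ∉ dyadic k → b p = 0)
    (s : ℝ) : WeakDeriv (fun p => KPI.evolve s p * a p)
      fun p => KPI.evolve s p * b p + I * ((s * dphase p : ℝ) : ℂ) * KPI.evolve s p * a p := by
  refine h.mul (contDiff_evolve_mul (k := k) hη s) (fderiv_evolve_mul hη s) ?_ ?_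
  · filter_upwards [ha] with p hp h0; exact xiCut_eq_one hη (not_not.1 fun hc => h0 (hp hc))
  · filter_upwards [hb] with p hp h0; exact xiCut_eq_one hη (not_not.1 fun hc => h0 (hp hc))

lemma integral_integral_eq {β : ℝ → ℂ} (hβ : Continuous β) (t : ℝ) :
    ∫ s in (0 : ℝ)..t, ∫ r in (0 : ℝ)..s, β r = ∫ s in (0 : ℝ)..t, ((t - s : ℝ) : ℂ) * β s := by
  have hv : ∀ s, HasDerivAt (fun s => ∫ r in (0 : ℝ)..s, β r) (β s) s := fun s => by
    simpa using hasDerivAt_primitive hβ 0 s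
  have hu : ∀ s : ℝ, HasDerivAt (fun s : ℝ => ((t - s : ℝ) : ℂ)) (-1) s := fun s => by
    have := ((hasDerivAt_id s).const_sub t).ofReal_comp
    simpa using this
  have := intervalIntegral.integral_mul_deriv_eq_deriv_mul (a := 0) (b := t)
    (fun s _ => hu s) (fun s _ => hv s) (by simp) (hβ.intervalIntegrable _ _)
  simp at this
  rw [← this]
  push_cast
  rfl

lemma integral_freePart (hp : Integrable fun τ => f (atTime τ p)) (t : ℝ) :
    ∫ s in (0 : ℝ)..t, freePart f s p =
      t * timeSlice f 0 p + ∫ s in (0 : ℝ)..t, ((t - s : ℝ) : ℂ) * profile f s p := by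
  have hc := continuous_profile hp
  have hc2 : Continuous fun s => ∫ r in (0 : ℝ)..s, profile f r p := by fun_prop
  simp only [freePart]
  rw [intervalIntegral.integral_add (by simp) (hc2.intervalIntegrable _ _),
    integral_integral_eq hc, intervalIntegral.integral_const, sub_zero, real_smul]

lemma evolve_mul_profile (f : Amp) (s t : ℝ) (p : Plane) :
    evolve t p * profile f s p = evolve (t - s) p * timeSlice f s p := by
  rw [evolve, evolve, profile, ← mul_assoc, ← Complex.exp_add]
  congr 2
  push_cast
  ring

lemma duhamelFt_eq (f : Amp) (t : ℝ) (p : Plane) :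
    duhamelFt f t p = -I * timeSlice f t p + I * (evolve t p * timeSlice f 0 p) +
      I * ∫ s in (0 : ℝ)..t, evolve (t - s) p * timeSlice f s p := by
  simp only [← evolve_mul_profile]
  rw [intervalIntegral.integral_const_mul, duhamelFt, freePart, evolve]
  ring

end

section

variable {k : ℤ}

lemma timeSlice_supp (hf : L2Dyadic k f) (t : ℝ) :
    ∀ᵐ p : Plane, p 0 ∉ dyadic k → timeSlice f t p = 0 := by
  filter_upwards [hf.fiber_ae] with p hp h
  exact timeSlice_eq_zero (hp h) t

lemma measurable_timeSlice_right (hf : Measurable f) (t : ℝ) :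
    Measurable fun p => timeSlice f t p :=
  Measurable.comp (g := fun q : Plane × ℝ => timeSlice f q.2 q.1) (f := fun p : Plane => (p, t))
    (measurable_timeSlice hf) (by fun_prop)

lemma measurable_evolve : Measurable fun q : Plane × ℝ => evolve q.2 q.1 := by
  unfold evolve
  fun_prop

lemma locallyIntegrable_dphase_mul (hf : Measurable f) (hf1 : mixNorm f ≠ ⊤)
    (h : L2Dyadic k f) : LocallyIntegrable fun p => |dphase p| * fiberMass f p := by
  rw [locallyIntegrable_iff]
  intro K hK
  obtain ⟨R, hR⟩ := hK.isBounded.exists_norm_le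
  have h1 := ((memLp_fiberMass hf hf1).locallyIntegrable (by norm_num)).integrableOn_isCompact hK
  refine (h1.const_mul (2 * R / 2 ^ (k - 1))).mono'
    (measurable_dphase.norm.mul (measurable_fiberMass hf)).aestronglyMeasurable ?_
  rw [ae_restrict_iff' hK.measurableSet]
  filter_upwards [h.fiber_ae] with p hp hpK
  by_cases hd : p 0 ∈ dyadic k
  · have hR' := hR p hpK
    have h2 : |p 1| ≤ R := (PiLp.norm_apply_le p 1).trans hR'
    have h0 : 0 ≤ R := (abs_nonneg _).trans h2
    have h3 : |dphase p| ≤ 2 * R / 2 ^ (k - 1) := by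
      rw [dphase, abs_div, abs_mul, abs_two]
      have := hd.1
      gcongr
    rw [norm_mul, norm_of_nonneg (fiberMass_nonneg f p), norm_abs_eq_norm]
    exact mul_le_mul_of_nonneg_right h3 (fiberMass_nonneg f p)
  · have : fiberMass f p = 0 := by
      rw [fiberMass, lintegral_congr_ae (g := fun _ => 0)]
      · simp
      · filter_upwards [hp hd] with τ hτ; rw [hτ, enorm_zero]
    simp [this]

/-- The weak derivative of the integrand of the Duhamel term. -/
def evolveDeriv (f g : Amp) (r s : ℝ) (p : Plane) : ℂ :=
  evolve r p * timeSlice g s p + I * ((r * dphase p : ℝ) : ℂ) * evolve r p * timeSlice f s p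

lemma norm_evolveDeriv_le (f g : Amp) (r s : ℝ) (p : Plane) :
    ‖evolveDeriv f g r s p‖ ≤ (1 + |r|) * (fiberMass g p + |dphase p| * fiberMass f p) := by
  have h1 := norm_timeSlice_le g s p
  have h2 := norm_timeSlice_le f s p
  have h0 := fiberMass_nonneg g p
  refine (norm_add_le _ _).trans ?_
  simp only [norm_mul, norm_evolve, norm_I, norm_real, norm_eq_abs, one_mul, mul_one]
  have h3 : |r| * |dphase p| * ‖timeSlice f s p‖ ≤ |r| * (|dphase p| * fiberMass f p) := by
    rw [mul_assoc]
    gcongr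
  have h4 : 0 ≤ |r| * fiberMass g p := by positivity
  have h5 : 0 ≤ |dphase p| * fiberMass f p := mul_nonneg (abs_nonneg _) (fiberMass_nonneg f p)
  nlinarith

lemma planeWeakDeriv_evolve (hη : IsBump η) (hf : Measurable f) (hf1 : mixNorm f ≠ ⊤)
    (hg : Measurable g) (hg1 : mixNorm g ≠ ⊤) (h : IsWeakDerivMu f g) (hdf : L2Dyadic k f)
    (hdg : L2Dyadic k g) (r s : ℝ) :
    WeakDeriv (fun p => evolve r p * timeSlice f s p) (evolveDeriv f g r s) :=
  (planeWeakDeriv_timeSlice hη hf hf1 hg hg1 h s).evolve hη (timeSlice_supp hdf s)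
    (timeSlice_supp hdg s) r

lemma measurable_swap_args {F : ℝ → Plane → ℂ} (h : Measurable fun q : Plane × ℝ => F q.2 q.1) :
    Measurable (uncurry F) :=
  Measurable.comp (g := fun q : Plane × ℝ => F q.2 q.1) (f := Prod.swap) h measurable_swap

lemma measurable_evolve_mul_timeSlice (hf : Measurable f) (t : ℝ) :
    Measurable (uncurry fun (s : ℝ) (p : Plane) => evolve (t - s) p * timeSlice f s p) := by
  refine measurable_swap_args (Measurable.mul ?_ (measurable_timeSlice hf))
  unfold evolve
  fun_prop

lemma measurable_evolveDeriv (hf : Measurable f) (hg : Measurable g) (t : ℝ) :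
    Measurable (uncurry fun (s : ℝ) (p : Plane) => evolveDeriv f g (t - s) s p) := by
  have h1 : Measurable fun q : Plane × ℝ => I * (((t - q.2) * dphase q.1 : ℝ) : ℂ) := by fun_prop
  have h2 : Measurable fun q : Plane × ℝ => evolve (t - q.2) q.1 := by unfold evolve; fun_prop
  exact measurable_swap_args ((h2.mul (measurable_timeSlice hg)).add
    ((h1.mul h2).mul (measurable_timeSlice hf)))

def duhamelDeriv (f g : Amp) (t : ℝ) (p : Plane) : ℂ :=
  duhamelFt g t p - dphase p * (evolve t p * ∫ s in (0 : ℝ)..t, freePart f s p)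

lemma evolveDeriv_sum_eq (hf : Integrable fun τ => f (atTime τ p))
    (hg : Integrable fun τ => g (atTime τ p)) (t : ℝ) :
    -I * timeSlice g t p + I * evolveDeriv f g t 0 p +
      I * ∫ s in (0 : ℝ)..t, evolveDeriv f g (t - s) s p = duhamelDeriv f g t p := by
  have e : ∀ s, evolveDeriv f g (t - s) s p = evolve (t - s) p * timeSlice g s p +
      I * dphase p * (evolve t p * (((t - s : ℝ) : ℂ) * profile f s p)) := fun s => by
    rw [mul_left_comm (evolve t p), evolve_mul_profile, evolveDeriv]
    push_cast
    ring
  have c1 : Continuous fun s => evolve (t - s) p * timeSlice g s p := by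
    have := continuous_timeSlice hg
    unfold evolve
    fun_prop
  have c2 : Continuous fun s : ℝ =>
      I * dphase p * (evolve t p * (((t - s : ℝ) : ℂ) * profile f s p)) := by
    have := continuous_profile hf
    fun_prop
  simp only [e]
  rw [intervalIntegral.integral_add (c1.intervalIntegrable _ _) (c2.intervalIntegrable _ _),
    duhamelDeriv, duhamelFt_eq, integral_freePart hf, intervalIntegral.integral_const_mul,
    intervalIntegral.integral_const_mul, evolveDeriv]
  push_cast
  linear_combination (dphase p * (evolve t p * (t * timeSlice f 0 p +
    ∫ s in (0 : ℝ)..t, ((t : ℂ) - s) * profile f s p))) * I_mul_I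

lemma planeWeakDeriv_duhamelFt (hη : IsBump η) (hf : Measurable f) (hf1 : mixNorm f ≠ ⊤)
    (hg : Measurable g) (hg1 : mixNorm g ≠ ⊤) (h : IsWeakDerivMu f g) (hdf : L2Dyadic k f)
    (hdg : L2Dyadic k g) (t : ℝ) :
    WeakDeriv (fun p => duhamelFt f t p) (duhamelDeriv f g t) := by
  have w1 := (planeWeakDeriv_timeSlice hη hf hf1 hg hg1 h t).const_mul (-I)
  have w2 := (planeWeakDeriv_evolve hη hf hf1 hg hg1 h hdf hdg t 0).const_mul I
  have hN := (memLp_fiberMass hf hf1).locallyIntegrable (by norm_num)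
  have hN' := ((memLp_fiberMass hg hg1).locallyIntegrable (by norm_num)).add
    (locallyIntegrable_dphase_mul hf hf1 hdf)
  have w3 := (WeakDeriv.intervalIntegral (c := fun s => 1 + |t - s|)
    (fun s => planeWeakDeriv_evolve hη hf hf1 hg hg1 h hdf hdg (t - s) s)
    (measurable_evolve_mul_timeSlice hf t) (measurable_evolveDeriv hf hg t) (by fun_prop) hN hN'
    (fun s p => by
      rw [norm_mul, norm_evolve, one_mul]
      have := fiberMass_nonneg f p
      nlinarith [norm_timeSlice_le f s p, abs_nonneg (t - s)])
    (fun s p => norm_evolveDeriv_le f g (t - s) s p) t).const_mul I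
  refine ((w1.add w2).add w3).congr (.of_forall fun p => ?_) ?_
  · simp only; rw [duhamelFt_eq]
  · filter_upwards [fiberIntegrable_of_mixNorm hf hf1, fiberIntegrable_of_mixNorm hg hg1]
      with p h1 h2
    exact evolveDeriv_sum_eq h1 h2 t

lemma measurable_duhamelDeriv (hf : Measurable f) (hg : Measurable g) :
    Measurable fun q : Plane × ℝ => duhamelDeriv f g q.2 q.1 := by
  have h1 : Measurable fun q : Plane × ℝ => (dphase q.1 : ℂ) := by fun_prop
  have h2 := measurable_primitive (F := fun q => freePart f q.2 q.1) (measurable_freePart hf)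
  exact (measurable_duhamelFt hg).sub (h1.mul (measurable_evolve.mul h2))

lemma norm_duhamelDeriv_le (f g : Amp) (t : ℝ) (p : Plane) :
    ‖duhamelDeriv f g t p‖ ≤
      ((2 + |t|) * (1 + |t|)) * (fiberMass g p + |dphase p| * fiberMass f p) := by
  have h1 := norm_duhamelFt_le g t p
  have h2 := norm_integral_freePart_le f t p
  have h3 := fiberMass_nonneg g p
  have h4 := fiberMass_nonneg f p
  refine (norm_sub_le _ _).trans ?_
  rw [norm_mul, norm_mul, norm_evolve, one_mul, norm_real, norm_eq_abs]
  have h5 : |dphase p| * ‖∫ s in (0 : ℝ)..t, freePart f s p‖ ≤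
      ((2 + |t|) * (1 + |t|)) * (|dphase p| * fiberMass f p) := by
    calc _ ≤ |dphase p| * (|t| * (1 + |t|) * fiberMass f p) := by gcongr
      _ ≤ |dphase p| * ((2 + |t|) * (1 + |t|) * fiberMass f p) := by gcongr; linarith
      _ = _ := by ring
  have h6 : ‖duhamelFt g t p‖ ≤ ((2 + |t|) * (1 + |t|)) * fiberMass g p := by
    refine h1.trans (mul_le_mul_of_nonneg_right ?_ h3)
    nlinarith [abs_nonneg t]
  linarith

def duhamelOpDeriv (η : ℝ → ℝ) (f g : Amp) (z : Spacetime) : ℂ :=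
  duhamelOp η g z - dphase (proj z) * commOp η f z

lemma ft_duhamelDeriv (hη : IsBump η) (hf : Integrable fun τ => f (atTime τ p))
    (hg : Integrable fun τ => g (atTime τ p)) (τ : ℝ) :
    ft (fun t => (η t : ℂ) * duhamelDeriv f g t p) τ = duhamelOpDeriv η f g (atTime τ p) := by
  have hc : Continuous fun t => ∫ s in (0 : ℝ)..t, freePart f s p :=
    continuous_iff_continuousAt.2 fun s => by
      simpa using (hasDerivAt_primitive (continuous_freePart hf) 0 s).continuousAt
  rw [duhamelOpDeriv, proj_atTime, duhamelOp, commOp, proj_atTime, modulation_atTime',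
    atTime_apply_two, ft, ft, ft, ← integral_const_mul, ← integral_sub
    (integrable_exp_mul_bump hη (continuous_duhamelFt hg) _)
    ((integrable_exp_mul_bump hη hc _).const_mul _)]
  refine integral_congr fun t => ?_
  simp only [duhamelDeriv, evolve]
  rw [show -(I * ((t * (τ - phase p) : ℝ) : ℂ)) = -(I * ((t * τ : ℝ) : ℂ)) +
    I * ((t * phase p : ℝ) : ℂ) by push_cast; ring, Complex.exp_add]
  ring

lemma planeWeakDeriv_duhamelOp (hη : IsBump η) (hf : Measurable f) (hf1 : mixNorm f ≠ ⊤)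
    (hg : Measurable g) (hg1 : mixNorm g ≠ ⊤) (h : IsWeakDerivMu f g) (hdf : L2Dyadic k f)
    (hdg : L2Dyadic k g) (τ : ℝ) :
    WeakDeriv (fun p => duhamelOp η f (atTime τ p))
      fun p => duhamelOpDeriv η f g (atTime τ p) := by
  have hηc := hη.continuous
  have hm : Measurable fun q : ℝ × Plane =>
      cexp (-(I * ((q.1 * τ : ℝ) : ℂ))) * (η q.1 : ℂ) := by fun_prop
  have hc : Integrable fun t => |η t| * ((2 + |t|) * (1 + |t|)) := by
    refine Continuous.integrable_of_hasCompactSupport (by fun_prop) ?_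
    exact HasCompactSupport.mul_right (hη.hasCompactSupport.norm)
  have hN := (memLp_fiberMass hf hf1).locallyIntegrable (by norm_num)
  have hN' := ((memLp_fiberMass hg hg1).locallyIntegrable (by norm_num)).add
    (locallyIntegrable_dphase_mul hf hf1 hdf)
  have m1 := measurable_swap_args (F := duhamelFt f) (measurable_duhamelFt hf)
  have m2 := measurable_swap_args (F := duhamelDeriv f g) (measurable_duhamelDeriv hf hg)
  have hn : ∀ t (z : ℂ) (A B : ℝ), ‖z‖ ≤ A * B → ‖cexp (-(I * ((t * τ : ℝ) : ℂ))) *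
      (η t : ℂ) * z‖ ≤ |η t| * A * B := fun t z A B hz => by
    rw [norm_mul, norm_mul, norm_exp_neg_I_mul, one_mul, norm_real, norm_eq_abs, mul_assoc]
    exact mul_le_mul_of_nonneg_left hz (abs_nonneg _)
  have w := WeakDeriv.integral (ν := volume)
    (fun t => (planeWeakDeriv_duhamelFt hη hf hf1 hg hg1 h hdf hdg t).const_mul
      (cexp (-(I * ((t * τ : ℝ) : ℂ))) * (η t : ℂ)))
    (hm.mul m1) (hm.mul m2) hc hN hN' (fun t p => hn _ _ _ _ ((norm_duhamelFt_le f t p).trans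
      (mul_le_mul_of_nonneg_right (le_mul_of_one_le_right (by positivity)
        (by linarith [abs_nonneg t])) (fiberMass_nonneg f p))))
    (fun t p => hn _ _ _ _ (norm_duhamelDeriv_le f g t p))
  refine w.congr (.of_forall fun p => ?_) ?_
  · simp only [duhamelOp, ft, proj_atTime, atTime_apply_two]
    refine integral_congr fun t => ?_
    ring
  · filter_upwards [fiberIntegrable_of_mixNorm hf hf1, fiberIntegrable_of_mixNorm hg hg1]
      with p h1 h2
    rw [← ft_duhamelDeriv hη h1 h2, ft]
    refine integral_congr fun t => ?_
    ring

lemma integral_atTime' (hF : Integrable F) :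
    ∫ z, F z = ∫ t : ℝ, ∫ p : Plane, F (atTime t p) := by
  rw [← measurePreserving_atTime.integral_comp measurableEmbedding_atTime, Measure.volume_eq_prod]
  refine integral_prod _ ?_
  rw [← Measure.volume_eq_prod]
  exact integrable_atTime_iff.2 hF

lemma fderiv_atTime {φ : Amp} (hφ : ContDiff ℝ ∞ φ) (τ : ℝ) (p : Plane) :
    fderiv ℝ (fun p => φ (atTime τ p)) p dirMu =
      fderiv ℝ φ (atTime τ p) (EuclideanSpace.single 1 1) := by
  have h0 : HasFDerivAt (atTime τ) atZero p := by
    have : atTime τ = fun p => atZero p + EuclideanSpace.single 2 τ := funext (atTime_eq τ)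
    rw [this]
    exact atZero.hasFDerivAt.add_const _
  have h1 := (((hφ.differentiable (by simp)) (atTime τ p)).hasFDerivAt).comp p h0
  have h2 : HasFDerivAt (fun p => φ (atTime τ p)) _ p := h1
  rw [h2.fderiv, ContinuousLinearMap.comp_apply]
  congr 1
  ext i
  fin_cases i <;> simp [atZero, atTime, dirMu]

lemma contDiff_atTime {φ : Amp} (hφ : ContDiff ℝ ∞ φ) (τ : ℝ) :
    ContDiff ℝ ∞ fun p => φ (atTime τ p) :=
  hφ.comp (hasTemperateGrowth_atTime τ).1

lemma hasCompactSupport_atTime {φ : Amp} (hφ : HasCompactSupport φ) (τ : ℝ) :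
    HasCompactSupport fun p => φ (atTime τ p) := by
  refine HasCompactSupport.intro (IsCompact.image hφ continuous_proj) (K := proj '' tsupport φ)
    fun p hp => ?_
  by_contra hc
  exact hp ⟨atTime τ p, subset_tsupport _ hc, proj_atTime τ p⟩

lemma isWeakDerivMu_of_slices (hF : LocallyIntegrable F) (hG : LocallyIntegrable G)
    (h : ∀ τ, WeakDeriv (fun p => F (atTime τ p)) fun p => G (atTime τ p)) :
    IsWeakDerivMu F G := by
  intro φ hφ hc
  have i1 := integrable_mul_of_compact hF
    (continuous_fderiv_dir hφ (EuclideanSpace.single (1 : Fin 3) (1 : ℝ)))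
    (hasCompactSupport_fderiv_dir hc _)
  have i2 := integrable_mul_of_compact hG hφ.continuous hc
  rw [integral_atTime' i1, integral_atTime' i2, ← integral_neg]
  refine integral_congr fun τ => ?_
  have := (h τ).eq _ (contDiff_atTime hφ τ) (hasCompactSupport_atTime hc τ)
  simp only [fderiv_atTime hφ] at this
  exact this

end

/-! ### The Duhamel operator on `V_k ∩ W_k` -/

section

variable {k : ℤ}

def vWeight (k : ℤ) (p : Plane) : ℂ := 1 + (2 : ℂ) ^ k + I * (p 1 : ℂ) / (2 : ℂ) ^ k

@[fun_prop]
lemma measurable_vWeight : Measurable (vWeight k) := by unfold vWeight; fun_prop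

lemma vWeight_eq (k : ℤ) (p : Plane) :
    vWeight k p = ((1 + 2 ^ k : ℝ) : ℂ) + ((p 1 / 2 ^ k : ℝ) : ℂ) * I := by
  rw [vWeight]
  push_cast
  ring

lemma one_add_le_norm_vWeight (k : ℤ) (p : Plane) : 1 + 2 ^ k ≤ ‖vWeight k p‖ := by
  have h := abs_re_le_norm (vWeight k p)
  have e : (vWeight k p).re = 1 + 2 ^ k := by
    rw [vWeight_eq, add_re, ofReal_re, re_ofReal_mul, I_re, mul_zero, add_zero]
  rw [e] at h
  exact (le_abs_self _).trans h

lemma one_le_norm_vWeight (k : ℤ) (p : Plane) : 1 ≤ ‖vWeight k p‖ := by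
  have := one_add_le_norm_vWeight k p
  have h2 : (0 : ℝ) < 2 ^ k := by positivity
  linarith

lemma vWeight_ne_zero (k : ℤ) (p : Plane) : vWeight k p ≠ 0 :=
  norm_pos_iff.1 (zero_lt_one.trans_le (one_le_norm_vWeight k p))

lemma abs_dphase_le_vWeight (hp : p 0 ∈ dyadic k) :
    |dphase p| ≤ 4 * ‖vWeight k p‖ := by
  have h := abs_im_le_norm (vWeight k p)
  have e : (vWeight k p).im = p 1 / 2 ^ k := by
    rw [vWeight_eq, add_im, ofReal_im, im_ofReal_mul, I_im, mul_one, zero_add]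
  rw [e, abs_div, abs_of_pos (by positivity : (0 : ℝ) < 2 ^ k)] at h
  have h1 := hp.1
  calc |dphase p| = 2 * |p 1| / |p 0| := by rw [dphase, abs_div, abs_mul, abs_two]
    _ ≤ 2 * |p 1| / 2 ^ (k - 1) := by gcongr
    _ = 4 * (|p 1| / 2 ^ k) := by rw [zpow_sub₀ (by norm_num), zpow_one]; field_simp; ring
    _ ≤ _ := by linarith

lemma timeSlice_mul (f : Amp) (c : Plane → ℂ) (t : ℝ) (p : Plane) :
    timeSlice (fun z => f z * c (proj z)) t p = timeSlice f t p * c p := by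
  simp only [timeSlice, proj_atTime]
  rw [mul_assoc, ← integral_mul_const]
  simp only [mul_assoc]

lemma freePart_mul (f : Amp) (c : Plane → ℂ) (t : ℝ) (p : Plane) :
    freePart (fun z => f z * c (proj z)) t p = freePart f t p * c p := by
  simp only [freePart, profile, timeSlice_mul]
  rw [add_mul, ← intervalIntegral.integral_mul_const]
  simp only [mul_assoc]

lemma duhamelFt_mul (f : Amp) (c : Plane → ℂ) (t : ℝ) (p : Plane) :
    duhamelFt (fun z => f z * c (proj z)) t p = duhamelFt f t p * c p := by
  simp only [duhamelFt, freePart_mul, timeSlice_mul]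
  ring

lemma duhamelOp_mul (f : Amp) (c : Plane → ℂ) (z : Spacetime) :
    duhamelOp η (fun z => f z * c (proj z)) z = duhamelOp η f z * c (proj z) := by
  simp only [duhamelOp, ft, duhamelFt_mul]
  rw [← integral_mul_const]
  simp only [mul_assoc]

lemma commOp_mul (f : Amp) (c : Plane → ℂ) (z : Spacetime) :
    commOp η (fun z => f z * c (proj z)) z = commOp η f z * c (proj z) := by
  simp only [commOp, ft, freePart_mul, intervalIntegral.integral_mul_const]
  rw [← integral_mul_const]
  simp only [mul_assoc]

lemma timeSlice_add (hf : Integrable fun τ => f (atTime τ p))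
    (hg : Integrable fun τ => g (atTime τ p)) (t : ℝ) :
    timeSlice (f + g) t p = timeSlice f t p + timeSlice g t p := by
  have h {F : Amp} (hF : Integrable fun τ => F (atTime τ p)) : Integrable fun τ : ℝ =>
      cexp (I * ((t * τ : ℝ) : ℂ)) * F (atTime τ p) :=
    hF.bdd_mul (c := 1) (Continuous.aestronglyMeasurable (by fun_prop))
      (.of_forall fun q => (norm_exp_I_mul _).le)
  simp only [timeSlice, Pi.add_apply, mul_add]
  rw [integral_add (h hf) (h hg), mul_add]

lemma duhamelFt_add (hf : Integrable fun τ => f (atTime τ p))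
    (hg : Integrable fun τ => g (atTime τ p)) (t : ℝ) :
    duhamelFt (f + g) t p = duhamelFt f t p + duhamelFt g t p := by
  have h : ∀ s, profile (f + g) s p = profile f s p + profile g s p := fun s => by
    rw [profile, timeSlice_add hf hg, mul_add]
    rfl
  simp only [duhamelFt, freePart, timeSlice_add hf hg, h]
  rw [intervalIntegral.integral_add ((continuous_profile hf).intervalIntegrable _ _)
    ((continuous_profile hg).intervalIntegrable _ _)]
  ring

lemma duhamelOp_add (hη : IsBump η) (hf : FiberIntegrable f) (hg : FiberIntegrable g) :
    duhamelOp η (f + g) =ᵐ[volume] duhamelOp η f + duhamelOp η g := by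
  filter_upwards [ae_of_ae_atTime hf, ae_of_ae_atTime hg] with z h1 h2
  simp only [Pi.add_apply, duhamelOp, ft, duhamelFt_add h1 h2, mul_add]
  have i1 := integrable_exp_mul_bump hη (continuous_duhamelFt h1) (z 2)
  have i2 := integrable_exp_mul_bump hη (continuous_duhamelFt h2) (z 2)
  exact integral_add i1 i2

lemma l2Dyadic_of_xyNorm (h : xyNorm η k f ≠ ⊤) : L2Dyadic k f := by
  by_contra hc
  refine h ?_
  refine iInf_eq_top.2 fun f₁ => iInf_eq_top.2 fun f₂ => iInf_eq_top.2 fun h1 =>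
    iInf_eq_top.2 fun h2 => iInf_eq_top.2 fun hs => ?_
  exact absurd ((h1.add h2.l2Dyadic).congr hs.symm) hc

lemma vNorm_eq (h : L2Dyadic k f) :
    vNorm η k f = xyNorm η k fun z => f z * vWeight k (proj z) := by
  rw [vNorm, iInf_pos h]
  rfl

lemma l2Dyadic_of_vNorm (h : vNorm η k f ≠ ⊤) : L2Dyadic k f := by
  by_contra hc
  exact h (by rw [vNorm, iInf_neg hc])

lemma eLpNorm_le_vNorm (hη : IsBump η) : eLpNorm f 2 ≤ 2 ^ 15 * vNorm η k f := by
  by_cases h : vNorm η k f = ⊤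
  · rw [h, mul_top (by simp)]; exact le_top
  rw [vNorm_eq (l2Dyadic_of_vNorm h)]
  refine le_trans (eLpNorm_mono fun z => ?_) (eLpNorm_le_xyNorm hη)
  rw [norm_mul]
  exact le_mul_of_one_le_right (norm_nonneg _) (one_le_norm_vWeight _ _)

lemma mixNorm_le_vNorm (hη : IsBump η) :
    mixNorm f ≤ 2 ^ 17 * vNorm η k f := by
  by_cases h : vNorm η k f = ⊤
  · rw [h, mul_top (by simp)]; exact le_top
  rw [vNorm_eq (l2Dyadic_of_vNorm h)]
  refine le_mul_xyNorm (by simp) (by simp) fun f₁ f₂ hm1 hm2 h1 h2 hs _ _ => ?_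
  have hi : Measurable fun z : Spacetime => (vWeight k (proj z))⁻¹ := by fun_prop
  have e : mixNorm f ≤ mixNorm ((fun z => (vWeight k (proj z))⁻¹ * f₁ z) +
      fun z => (vWeight k (proj z))⁻¹ * f₂ z) := mixNorm_mono_ae (by
    filter_upwards [hs] with z hz
    rw [Pi.add_apply, ← mul_add, ← Pi.add_apply f₁, ← hz, mul_comm (f z),
      inv_mul_cancel_left₀ (vWeight_ne_zero _ _)])
  refine (e.trans (mixNorm_add_le (hi.mul hm1) (hi.mul hm2))).trans ?_
  rw [mul_add]
  refine add_le_add ?_ ?_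
  · refine (mixNorm_mono_ae (g := f₁) (.of_forall fun z => ?_)).trans
      ((mixNorm_le_xNorm hη k hm1).trans (mul_le_mul' (by norm_num) le_rfl))
    rw [enorm_mul]
    refine mul_le_of_le_one_left zero_le ?_
    rw [← ofReal_norm, ofReal_le_one, norm_inv]
    exact inv_le_one_of_one_le₀ (one_le_norm_vWeight _ _)
  · have h3 : mixNorm (fun z => (vWeight k (proj z))⁻¹ * f₂ z) ≤
        mixNorm (fun z => (((2 : ℝ) ^ k : ℝ) : ℂ)⁻¹ * f₂ z) :=
      mixNorm_mono_ae (.of_forall fun z => by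
        rw [enorm_mul, enorm_mul]
        refine mul_le_mul' ?_ le_rfl
        rw [enorm_le_iff_norm_le, norm_inv, norm_inv, norm_real, norm_of_nonneg (by positivity)]
        have := one_add_le_norm_vWeight k (proj z)
        exact inv_anti₀ (by positivity) (by linarith))
    refine h3.trans ?_
    rw [mixNorm_const_mul]
    have h4 : ‖(((2 : ℝ) ^ k : ℝ) : ℂ)⁻¹‖ₑ * toE (2 ^ k) = 1 := by
      rw [← ofReal_norm, norm_inv, norm_real, norm_of_nonneg (by positivity),
        ← ENNReal.ofReal_mul (by positivity), inv_mul_cancel₀ (by positivity), ENNReal.ofReal_one]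
    calc _ ≤ ‖(((2 : ℝ) ^ k : ℝ) : ℂ)⁻¹‖ₑ *
          (4 * toE (2 ^ k) * (2 ^ 15 * yNorm k f₂)) := by
          gcongr
          exact (h2.mixNorm_le hm2).trans (mul_le_mul' le_rfl h2.eLpNorm_le)
      _ = (‖(((2 : ℝ) ^ k : ℝ) : ℂ)⁻¹‖ₑ * toE (2 ^ k)) * (2 ^ 17 * yNorm k f₂) := by ring
      _ = _ := by rw [h4, one_mul]

lemma IsWeakDerivMu.congr_right {g' : Amp} (h : IsWeakDerivMu f g)
    (hg : g =ᵐ[volume] g') : IsWeakDerivMu f g' := by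
  intro φ hφ hc
  rw [h φ hφ hc, integral_congr_ae]
  filter_upwards [hg] with z hz
  rw [hz]

lemma measurable_mul_vWeight (hf : Measurable f) :
    Measurable fun z => f z * vWeight k (proj z) := by
  fun_prop

lemma exists_vNorm_duhamelOp_le (hη : IsBump η) : ∃ C : ℝ≥0, ∀ (k : ℤ) (f : Amp),
    Measurable f → vNorm η k f ≠ ⊤ → vNorm η k (duhamelOp η f) ≤ C * vNorm η k f := by
  obtain ⟨C, hC⟩ := exists_xyNorm_duhamelOp_le hη
  refine ⟨C, fun k f hm hv => ?_⟩
  have hd := l2Dyadic_of_vNorm hv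
  have hv' := hv
  rw [vNorm_eq hd] at hv' ⊢
  have hm' := measurable_mul_vWeight (k := k) hm
  have h1 := hC k _ hm' (l2Dyadic_of_xyNorm hv')
    (fiberIntegrable_of_mixNorm hm' (mixNorm_ne_top_of_xyNorm hη hv'))
  have h2 := hC k f hm hd (fiberIntegrable_of_mixNorm hm
    (ne_top_of_le_ne_top (mul_ne_top (by simp) hv) (mixNorm_le_vNorm hη)))
  have e : (duhamelOp η fun z => f z * vWeight k (proj z)) =
      fun z => duhamelOp η f z * vWeight k (proj z) := funext fun z => duhamelOp_mul f _ z
  rw [e] at h1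
  have h3 : L2Dyadic k (duhamelOp η f) := by
    have h4 := l2Dyadic_of_xyNorm (ne_top_of_le_ne_top (mul_ne_top (by simp) hv') h1)
    refine ⟨h4.1.mono (measurable_duhamelOp hη hm).aestronglyMeasurable
      (.of_forall fun z => ?_), ?_⟩
    · rw [norm_mul]; exact le_mul_of_one_le_right (norm_nonneg _) (one_le_norm_vWeight _ _)
    · filter_upwards [h4.2] with z hz hn
      exact (mul_eq_zero.1 (hz hn)).resolve_right (vWeight_ne_zero _ _)
  rw [vNorm_eq h3]
  exact h1

lemma hNorm_mono_ae (h : ∀ᵐ z, ‖F z‖ ≤ ‖G z‖) : hNorm F ≤ hNorm G := by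
  refine eLpNorm_mono_ae ?_
  filter_upwards [h] with z hz
  rw [norm_mul, norm_mul]
  exact mul_le_mul_of_nonneg_left hz (norm_nonneg _)

lemma hNorm_const_mul (c : ℂ) (F : Amp) :
    hNorm (fun z => c * F z) = ‖c‖ₑ * hNorm F := by
  rw [hNorm, hNorm, ← eLpNorm_const_smul]
  congr 1
  funext z
  simp only [Pi.smul_apply, smul_eq_mul]
  ring

section

variable (hη : IsBump η)
include hη

lemma hNorm_dphase_commOp_le {D : ℝ} (hD : ∀ s, |deriv η s| ≤ D)
    (hm : Measurable f) (hv : vNorm η k f ≠ ⊤) :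
    hNorm (fun z => -(dphase (proj z) * commOp η f z)) ≤ 4 * (freeConst D * vNorm η k f) := by
  have hd := l2Dyadic_of_vNorm hv
  have hv' := hv
  rw [vNorm_eq hd] at hv' ⊢
  have hm' := measurable_mul_vWeight (k := k) hm
  have h1 := hNorm_commOp_le_xyNorm (k := k) hη hD hm' (l2Dyadic_of_xyNorm hv').1
    (fiberIntegrable_of_mixNorm hm' (mixNorm_ne_top_of_xyNorm hη hv'))
  have e4 : ‖(4 : ℂ)‖ₑ = 4 := by rw [← ofReal_norm]; simp
  refine le_trans (le_trans (hNorm_mono_ae (G := fun z =>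
    4 * commOp η (fun z => f z * vWeight k (proj z)) z) ?_)
    (le_of_eq (hNorm_const_mul 4 _))) (by rw [e4]; exact mul_le_mul' le_rfl h1)
  filter_upwards [commOp_supp (η := η) hd] with z hz
  rw [commOp_mul, norm_neg, norm_mul, norm_mul, norm_mul, norm_real, norm_eq_abs]
  by_cases h : z 0 ∈ dyadic k
  · have := abs_dphase_le_vWeight (p := proj z) h
    rw [Complex.norm_ofNat]
    have h0 := norm_nonneg (commOp η f z)
    nlinarith
  · rw [hz h]; simp

lemma mixNorm_ne_top_of_vNorm (hv : vNorm η k f ≠ ⊤) : mixNorm f ≠ ⊤ :=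
  ne_top_of_le_ne_top (mul_ne_top (by simp) hv) (mixNorm_le_vNorm hη)

lemma measurable_dphase_commOp (hm : Measurable f) :
    Measurable fun z => -(dphase (proj z) * commOp η f z : ℂ) := by
  have := measurable_commOp hη hm
  fun_prop

lemma l2Dyadic_dphase_commOp (hm : Measurable f) (hv : vNorm η k f ≠ ⊤) :
    L2Dyadic k fun z => -(dphase (proj z) * commOp η f z : ℂ) := by
  obtain ⟨D, -, hD⟩ := hη.exists_deriv_bound
  refine ⟨⟨(measurable_dphase_commOp hη hm).aestronglyMeasurable, (eLpNorm_le_hNorm _).trans_lt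
    ((hNorm_dphase_commOp_le hη hD hm hv).trans_lt ?_)⟩, ?_⟩
  · exact mul_lt_top (by simp) (mul_lt_top (freeConst_ne_top D).lt_top hv.lt_top)
  · filter_upwards [commOp_supp (η := η) (l2Dyadic_of_vNorm hv)] with z hz h
    rw [hz h, mul_zero, neg_zero]

lemma duhamelOpDeriv_add_ae (hf : FiberIntegrable f) (hg : FiberIntegrable g) :
    duhamelOpDeriv η f g + duhamelOp η f =ᵐ[volume]
      duhamelOp η (g + f) + fun z => -(dphase (proj z) * commOp η f z : ℂ) := by
  filter_upwards [duhamelOp_add hη hg hf] with z hz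
  simp only [Pi.add_apply] at hz ⊢
  rw [hz, duhamelOpDeriv]
  ring

lemma exists_wNorm_duhamelOp_le : ∃ C : ℝ≥0, ∀ (k : ℤ) (f : Amp),
    Measurable f → vNorm η k f ≠ ⊤ → wNorm η k f ≠ ⊤ →
      wNorm η k (duhamelOp η f) ≤ C * (wNorm η k f + vNorm η k f) := by
  obtain ⟨C, hC⟩ := exists_xyNorm_duhamelOp_le hη
  obtain ⟨C', hC'⟩ := exists_vNorm_duhamelOp_le hη
  obtain ⟨D, -, hD⟩ := hη.exists_deriv_bound
  obtain ⟨B, hB⟩ : ∃ B : ℝ≥0∞, B = 1 + (C + 88 * freeConst D) := ⟨_, rfl⟩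
  have hBt : B ≠ ⊤ := by have := freeConst_ne_top D; rw [hB]; finiteness
  have hB0 : B ≠ 0 := by simp [hB]
  refine ⟨B.toNNReal, fun k f hm hv hw => ?_⟩
  rw [ENNReal.coe_toNNReal hBt]
  have hd := l2Dyadic_of_vNorm hv
  have hf1 := mixNorm_ne_top_of_vNorm hη hv
  have hTd : L2Dyadic k (duhamelOp η f) := l2Dyadic_of_vNorm
    (ne_top_of_le_ne_top (mul_ne_top (by simp) hv) (hC' k f hm hv))
  rw [← ENNReal.div_le_iff' hB0 hBt, ← tsub_le_iff_right]
  conv_rhs => rw [wNorm, iInf_pos hd]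
  refine le_iInf fun g₀ => le_iInf fun hg₀ => le_iInf fun hw₀ => ?_
  rw [tsub_le_iff_right, ENNReal.div_le_iff' hB0 hBt]
  obtain ⟨g, hg, hgg⟩ : ∃ g : Amp, Measurable g ∧ g₀ =ᵐ[volume] g :=
    ⟨hg₀.1.mk g₀, hg₀.1.stronglyMeasurable_mk.measurable, hg₀.1.ae_eq_mk⟩
  rw [xyNorm_congr (hgg.add (EventuallyEq.refl _ f))]
  have hwd := hw₀.congr_right hgg
  have hg2 := (memLp_congr_ae hgg).1 hg₀
  by_cases hx : xyNorm η k (g + f) = ⊤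
  · rw [hx, top_add, mul_top hB0]; exact le_top
  have hgfd := l2Dyadic_of_xyNorm hx
  have hgd : L2Dyadic k g := by
    refine (hgfd.add (hd.const_mul (-1))).congr (.of_forall fun z => ?_)
    simp
  have hg1 : mixNorm g ≠ ⊤ := by
    have h1 := mixNorm_add_le (hg.add hm) (hm.const_mul (-1))
    rw [mixNorm_const_mul] at h1
    have e : (g + f) + (fun z => -1 * f z) = g := by funext z; simp
    rw [e] at h1
    exact ne_top_of_le_ne_top (add_ne_top.2 ⟨mixNorm_ne_top_of_xyNorm hη hx,
      mul_ne_top enorm_ne_top hf1⟩) h1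
  have hfi := fiberIntegrable_of_mixNorm hm hf1
  have hgi := fiberIntegrable_of_mixNorm hg hg1
  have hgfi : FiberIntegrable (g + f) := by filter_upwards [hfi, hgi] with p h1 h2; exact h2.add h1
  have b1 := hC k (g + f) (hg.add hm) hgfd hgfi
  have hcd := l2Dyadic_dphase_commOp hη hm hv
  have b2 : xNorm η k (fun z => -(dphase (proj z) * commOp η f z : ℂ)) ≤
      88 * freeConst D * vNorm η k f := by
    refine (xNorm_le_hNorm hη k hcd.1.1).trans
      ((mul_le_mul' le_rfl (hNorm_dphase_commOp_le hη hD hm hv)).trans (le_of_eq ?_))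
    ring
  have hae := duhamelOpDeriv_add_ae hη hfi hgi
  have b3 : xyNorm η k (duhamelOpDeriv η f g + duhamelOp η f) ≤
      C * xyNorm η k (g + f) + 88 * freeConst D * vNorm η k f := by
    rw [xyNorm_congr hae]
    exact (xyNorm_add_le hη hcd).trans (add_le_add b1 b2)
  have hGd : L2Dyadic k (duhamelOpDeriv η f g) := by
    have h1 : L2Dyadic k (duhamelOpDeriv η f g + duhamelOp η f) := l2Dyadic_of_xyNorm
      (ne_top_of_le_ne_top (add_ne_top.2 ⟨mul_ne_top (by simp) hx,
        mul_ne_top (mul_ne_top (by simp) (freeConst_ne_top D)) hv⟩) b3)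
    refine (h1.add (hTd.const_mul (-1))).congr (.of_forall fun z => ?_)
    simp
  have hweak : IsWeakDerivMu (duhamelOp η f) (duhamelOpDeriv η f g) :=
    isWeakDerivMu_of_slices (hTd.1.locallyIntegrable (by norm_num))
      (hGd.1.locallyIntegrable (by norm_num))
      fun τ => planeWeakDeriv_duhamelOp hη hm hf1 hg hg1 hwd hd hgd τ
  have key : wNorm η k (duhamelOp η f) ≤ xyNorm η k (duhamelOpDeriv η f g + duhamelOp η f) := by
    rw [wNorm, iInf_pos hTd]
    exact iInf_le_of_le (duhamelOpDeriv η f g)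
      (iInf_le_of_le hGd.1 (iInf_le_of_le hweak le_rfl))
  refine (key.trans b3).trans ?_
  rw [mul_add, hB]
  exact add_le_add (mul_le_mul' (le_self_add.trans le_add_self) le_rfl)
    (mul_le_mul' (le_add_self.trans le_add_self) le_rfl)

lemma exists_vwNorm_duhamelOp_le : ∃ C : ℝ≥0, ∀ (k : ℤ) (f : Amp),
    Measurable f → vwNorm η k f ≠ ⊤ → vwNorm η k (duhamelOp η f) ≤ C * vwNorm η k f := by
  obtain ⟨C, hC⟩ := exists_vNorm_duhamelOp_le hη
  obtain ⟨C', hC'⟩ := exists_wNorm_duhamelOp_le hη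
  refine ⟨C + C', fun k f hm h => ?_⟩
  have hv : vNorm η k f ≠ ⊤ := ne_top_of_le_ne_top h le_self_add
  have hw : wNorm η k f ≠ ⊤ := ne_top_of_le_ne_top h le_add_self
  rw [vwNorm, vwNorm, coe_add, add_mul]
  refine add_le_add ((hC k f hm hv).trans (mul_le_mul' le_rfl le_self_add))
    ((hC' k f hm hv hw).trans (le_of_eq ?_))
  rw [add_comm]

end

end

/-! ### Summation over the dyadic frequencies -/

section

variable {k : ℤ}

lemma vNorm_congr (h : f =ᵐ[volume] g) : vNorm η k f = vNorm η k g := by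
  by_cases hf : L2Dyadic k f
  · rw [vNorm_eq hf, vNorm_eq (hf.congr h)]
    exact xyNorm_congr (h.mono fun z hz => by simp only [hz])
  · have hg : ¬ L2Dyadic k g := fun hg => hf (hg.congr h.symm)
    rw [vNorm, vNorm, iInf_neg hf, iInf_neg hg]

lemma IsWeakDerivMu.congr_left {a : Amp} (h : IsWeakDerivMu f a)
    (hfg : f =ᵐ[volume] g) : IsWeakDerivMu g a := fun φ h1 h2 => by
  rw [← h φ h1 h2]
  exact integral_congr_ae (hfg.mono fun z hz => by simp only [hz])

lemma wNorm_le_of_ae (h : f =ᵐ[volume] g) : wNorm η k g ≤ wNorm η k f := by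
  refine le_iInf fun hf => le_iInf fun a => le_iInf fun ha => le_iInf fun hd => ?_
  have e : xyNorm η k (a + f) = xyNorm η k (a + g) :=
    xyNorm_congr (h.mono fun z hz => by rw [Pi.add_apply, Pi.add_apply, hz])
  rw [e, wNorm, iInf_pos (hf.congr h)]
  exact iInf_le_of_le a (iInf_le_of_le ha (iInf_le_of_le (hd.congr_left h) le_rfl))

lemma vwNorm_congr (h : f =ᵐ[volume] g) : vwNorm η k f = vwNorm η k g := by
  rw [vwNorm, vwNorm, vNorm_congr h, (wNorm_le_of_ae h).antisymm' (wNorm_le_of_ae h.symm)]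

lemma exists_half_le_chi (hη : IsBump η) {ξ : ℝ} (hξ : ξ ≠ 0) : ∃ k : ℤ, 1 / 2 ≤ |chi η k ξ| := by
  obtain ⟨m, h1, h2⟩ := exists_mem_Ioc_zpow (x := |ξ| * (4 / 5)) (y := (2 : ℝ))
    (mul_pos (abs_pos.2 hξ) (by norm_num)) one_lt_two
  have hm : (0 : ℝ) < 2 ^ m := by positivity
  have e1 : (2 : ℝ) ^ (m + 1) = 2 * 2 ^ m := by rw [zpow_add_one₀ two_ne_zero, mul_comm]
  have e2 : (2 : ℝ) ^ (m - 1) = 2 ^ m / 2 := by rw [zpow_sub_one₀ two_ne_zero, div_eq_mul_inv]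
  have a1 : η (ξ / 2 ^ (m + 1)) = 1 := hη.eq_one' <| by
    rw [abs_div, abs_of_pos (a := (2 : ℝ) ^ (m + 1)) (by positivity), div_le_iff₀ (by positivity)]
    linarith
  have a2 : η (ξ / 2 ^ (m - 1)) = 0 := hη.eq_zero <| by
    rw [abs_div, abs_of_pos (a := (2 : ℝ) ^ (m - 1)) (by positivity),
      lt_div_iff₀ (by positivity), e2]
    linarith
  have hs : chi η (m + 1) ξ + chi η m ξ = 1 := by rw [chi, chi, a1, a2, add_sub_cancel_right]; ring
  by_contra! hc
  have b1 := hc (m + 1)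
  have b2 := hc m
  have := abs_add_le (chi η (m + 1) ξ) (chi η m ξ)
  rw [hs, abs_one] at this
  linarith

lemma enorm_sq_le_tsum_chi (hη : IsBump η) {ξ : ℝ} (hξ : ξ ≠ 0) (a : ℝ≥0∞) :
    a ^ 2 ≤ 4 * ∑' k : ℤ, (‖(chi η k ξ : ℂ)‖ₑ * a) ^ 2 := by
  obtain ⟨k, hk⟩ := exists_half_le_chi hη hξ
  have h1 : 1 ≤ 2 * ‖(chi η k ξ : ℂ)‖ₑ := by
    rw [← ofReal_norm, norm_real, norm_eq_abs,
      show (2 : ℝ≥0∞) = toE 2 by simp, ← ENNReal.ofReal_mul (by norm_num),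
      one_le_ofReal]
    linarith
  calc a ^ 2 ≤ (2 * ‖(chi η k ξ : ℂ)‖ₑ * a) ^ 2 := pow_le_pow_left' (le_mul_of_one_le_left' h1) 2
    _ = 4 * (‖(chi η k ξ : ℂ)‖ₑ * a) ^ 2 := by ring
    _ ≤ _ := mul_le_mul' le_rfl (ENNReal.le_tsum k)

lemma ae_fst_ne_zero : ∀ᵐ p : Plane, p 0 ≠ 0 := by
  have h : ∀ᵐ q : ℝ × ℝ, (pt q) 0 ≠ 0 := by
    have h0 : ∀ᵐ x : ℝ, x ≠ 0 := by simp [ae_iff]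
    exact Measure.quasiMeasurePreserving_fst.ae h0
  have := measurableEmbedding_pt.ae_map_iff (μ := volume) (p := fun p : Plane => p 0 ≠ 0)
  rw [measurePreserving_pt.map_eq] at this
  exact this.2 h

section

variable (hη : IsBump η)
include hη

lemma measurable_chi (k : ℤ) : Measurable fun ξ : ℝ => (chi η k ξ : ℂ) := by
  have := hη.continuous
  unfold chi
  fun_prop

lemma measurable_chi_mul (hf : Measurable f) (k : ℤ) :
    Measurable fun z : Spacetime => (chi η k (z 0) : ℂ) * f z :=
  ((measurable_chi hη k).comp (by fun_prop)).mul hf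

lemma lintegral_sq_le_tsum_chi {X : Type*} [MeasureSpace X] {ξ : X → ℝ}
    (hm : Measurable ξ) (hξ : ∀ᵐ x, ξ x ≠ 0) {a : X → ℝ≥0∞} (ha : Measurable a) :
    ∫⁻ x, a x ^ 2 ≤ 4 * ∑' k : ℤ, ∫⁻ x, (‖(chi η k (ξ x) : ℂ)‖ₑ * a x) ^ 2 := by
  have hk : ∀ k : ℤ, Measurable fun x => (‖(chi η k (ξ x) : ℂ)‖ₑ * a x) ^ 2 := fun k =>
    ((((measurable_chi hη k).comp hm).enorm).mul ha).pow_const 2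
  rw [← lintegral_tsum fun k => (hk k).aemeasurable, ← lintegral_const_mul' _ _ (by simp)]
  refine lintegral_mono_ae ?_
  filter_upwards [hξ] with x hx
  exact enorm_sq_le_tsum_chi hη hx _

lemma eLpNorm_sq_le_tsum (hf : Measurable f) :
    eLpNorm f 2 ^ 2 ≤ 4 * ∑' k : ℤ, eLpNorm (fun z => (chi η k (z 0) : ℂ) * f z) 2 ^ 2 := by
  simp_rw [eLpNorm_two_sq, enorm_mul]
  exact lintegral_sq_le_tsum_chi hη (by fun_prop) (ae_of_ae_atTime ae_fst_ne_zero) hf.enorm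

lemma mixNorm_sq_le_tsum (hf : Measurable f) :
    mixNorm f ^ 2 ≤ 4 * ∑' k : ℤ, mixNorm (fun z => (chi η k (z 0) : ℂ) * f z) ^ 2 := by
  have hm : Measurable fun p : Plane => ∫⁻ τ : ℝ, ‖f (atTime τ p)‖ₑ := by fun_prop
  have e : ∀ (k : ℤ) (p : Plane), ∫⁻ τ : ℝ, ‖(chi η k (atTime τ p 0) : ℂ) * f (atTime τ p)‖ₑ =
      ‖(chi η k (p 0) : ℂ)‖ₑ * ∫⁻ τ : ℝ, ‖f (atTime τ p)‖ₑ := fun k p => by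
    simp_rw [enorm_mul, atTime_apply_zero]
    exact lintegral_const_mul' _ _ enorm_ne_top
  simp_rw [mixNorm_sq, e]
  exact lintegral_sq_le_tsum_chi hη (by fun_prop) ae_fst_ne_zero hm

end

/-- The square of the `ℓ²` sum of the dyadic norms. -/
def vwSum (η : ℝ → ℝ) (f : Amp) : ℝ≥0∞ :=
  ∑' k : ℤ, vwNorm η k (fun z => (chi η k (z 0) : ℂ) * f z) ^ 2

lemma vwSum_congr (h : f =ᵐ[volume] g) : vwSum η f = vwSum η g := by
  unfold vwSum
  refine tsum_congr fun k => ?_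
  rw [vwNorm_congr (g := fun z => (chi η k (z 0) : ℂ) * g z) (h.mono fun z hz => by simp only [hz])]

lemma ne_top_of_vwSum {a A : ℝ≥0∞} (hA : A ≠ ⊤) {b : ℤ → ℝ≥0∞} (h1 : a ^ 2 ≤ 4 * ∑' k, b k ^ 2)
    (hb : ∀ k, b k ≤ A * vwNorm η k fun z => (chi η k (z 0) : ℂ) * f z) (h : vwSum η f ≠ ⊤) :
    a ≠ ⊤ := by
  have h2 : a ^ 2 ≤ 4 * (A ^ 2 * vwSum η f) := by
    refine h1.trans (mul_le_mul' le_rfl ?_)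
    rw [vwSum, ← ENNReal.tsum_mul_left]
    refine ENNReal.tsum_le_tsum fun k => ?_
    rw [← mul_pow]
    exact pow_le_pow_left' (hb k) 2
  rintro rfl
  have h3 : 4 * (A ^ 2 * vwSum η f) ≠ ⊤ := by finiteness
  exact h3 (top_le_iff.1 (by simpa using h2))

lemma mixNorm_ne_top_of_vwSum (hη : IsBump η) (hf : Measurable f) (h : vwSum η f ≠ ⊤) :
    mixNorm f ≠ ⊤ :=
  ne_top_of_vwSum (A := 2 ^ 17) (by simp) (mixNorm_sq_le_tsum hη hf)
    (fun _ => (mixNorm_le_vNorm hη).trans (mul_le_mul' le_rfl le_self_add)) h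

lemma eLpNorm_ne_top_of_vwSum (hη : IsBump η) (hf : Measurable f) (h : vwSum η f ≠ ⊤) :
    eLpNorm f 2 ≠ ⊤ :=
  ne_top_of_vwSum (A := 2 ^ 15) (by simp) (eLpNorm_sq_le_tsum hη hf)
    (fun _ => (eLpNorm_le_vNorm hη).trans (mul_le_mul' le_rfl le_self_add)) h

lemma exists_vwSum_duhamelOp_le (hη : IsBump η) : ∃ C : ℝ≥0, 0 < C ∧ ∀ f : Amp,
    Measurable f → vwSum η f ≠ ⊤ → vwSum η (duhamelOp η f) ^ ½ ≤ C * vwSum η f ^ ½ := by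
  obtain ⟨C, hC⟩ := exists_vwNorm_duhamelOp_le hη
  refine ⟨C + 1, by positivity, fun f hf h => ?_⟩
  have h1 : vwSum η (duhamelOp η f) ≤ (C + 1 : ℝ≥0∞) ^ 2 * vwSum η f := by
    rw [vwSum, vwSum, ← ENNReal.tsum_mul_left]
    refine ENNReal.tsum_le_tsum fun k => ?_
    have hk : vwNorm η k (fun z => (chi η k (z 0) : ℂ) * f z) ≠ ⊤ := fun hc => h <|
      ENNReal.tsum_eq_top_of_eq_top ⟨k, by rw [hc]; simp⟩
    have e : (fun z : Spacetime => (chi η k (z 0) : ℂ) * duhamelOp η f z) =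
        duhamelOp η fun z => (chi η k (z 0) : ℂ) * f z := by
      funext z
      simp_rw [mul_comm ((chi η k _ : ℝ) : ℂ)]
      exact (duhamelOp_mul f (fun p => (chi η k (p 0) : ℂ)) z).symm
    rw [e, ← mul_pow]
    exact pow_le_pow_left' ((hC k _ (measurable_chi_mul hη hf k) hk).trans
      (mul_le_mul' le_self_add le_rfl)) 2
  refine (ENNReal.rpow_le_rpow h1 (by norm_num)).trans (le_of_eq ?_)
  rw [mul_rpow_of_nonneg _ _ (by norm_num), ennreal_sq_sqrt, coe_add, coe_one]

end

attribute [fun_prop] measurable_chi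

/-! ### Cutoffs and tensor products of Schwartz functions -/

section

lemma norm_iteratedFDeriv_comp_clm_le {E F : Type*} [NormedAddCommGroup E] [NormedSpace ℝ E]
    [NormedAddCommGroup F] [NormedSpace ℝ F] (L : E →L[ℝ] F) (hL : ‖L‖ ≤ 1) {f : F → ℂ}
    (hf : ContDiff ℝ ∞ f) (i : ℕ) (x : E) :
    ‖iteratedFDeriv ℝ i (fun x => f (L x)) x‖ ≤ ‖iteratedFDeriv ℝ i f (L x)‖ := by
  rw [show (fun x => f (L x)) = f ∘ L from rfl,
    L.iteratedFDeriv_comp_right hf x (i := i) (by exact_mod_cast le_top)]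
  refine (ContinuousMultilinearMap.norm_compContinuousLinearMap_le _ _).trans ?_
  refine mul_le_of_le_one_right (norm_nonneg _) ?_
  rw [Finset.prod_const]
  exact pow_le_one₀ (norm_nonneg _) hL

variable {E F : Type*} [NormedAddCommGroup E] [NormedSpace ℝ E] [NormedAddCommGroup F]
  [InnerProductSpace ℝ F]

/-- The function `1` near the origin, supported in a ball. -/
def ballCut (η : ℝ → ℝ) (y : F) : ℂ := (η (‖y‖ ^ 2) : ℂ)

lemma contDiff_ballCut (hη : IsBump η) : ContDiff ℝ ∞ (ballCut η : F → ℂ) :=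
  ofRealCLM.contDiff.comp (hη.smooth.comp (contDiff_norm_sq ℝ))

lemma ballCut_eq_zero (hη : IsBump η) {y : F} (hy : 2 < ‖y‖) : ballCut η y = 0 := by
  rw [ballCut, hη.eq_zero_of_two_lt, Complex.ofReal_zero]
  rw [abs_of_nonneg (by positivity)]
  nlinarith

lemma ballCut_eq_one (hη : IsBump η) {y : F} (hy : ‖y‖ < 1) : ballCut η y = 1 := by
  rw [ballCut, hη.eq_one', Complex.ofReal_one]
  rw [abs_of_nonneg (by positivity)]
  nlinarith [norm_nonneg y]

variable [FiniteDimensional ℝ F]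

lemma hasCompactSupport_ballCut (hη : IsBump η) : HasCompactSupport (ballCut η : F → ℂ) :=
  HasCompactSupport.of_support_subset_isCompact (isCompact_closedBall (0 : F) 2) fun y hy => by
    rw [mem_closedBall_zero_iff]
    by_contra! h
    exact hy (ballCut_eq_zero hη h)

lemma exists_iteratedFDeriv_ballCut_le (hη : IsBump η) (i : ℕ) : ∃ B : ℝ, 0 ≤ B ∧ ∀ y : F,
    ‖iteratedFDeriv ℝ i (fun y : F => 1 - ballCut η y) y‖ ≤ B * ‖y‖ := by
  have hc : ContDiff ℝ ∞ (fun y : F => 1 - ballCut η y) := contDiff_const.sub (contDiff_ballCut hη)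
  obtain ⟨B, hB⟩ : ∃ B : ℝ, ∀ y : F, ‖iteratedFDeriv ℝ i (fun y : F => 1 - ballCut η y) y‖ ≤ B := by
    obtain ⟨M, hM⟩ := (isCompact_closedBall (0 : F) 3).exists_bound_of_continuousOn
      (hc.continuous_iteratedFDeriv (m := i) (by exact_mod_cast le_top)).continuousOn
    refine ⟨max M 1, fun y => ?_⟩
    by_cases hy : ‖y‖ ≤ 3
    · exact (hM y (mem_closedBall_zero_iff.2 hy)).trans (le_max_left _ _)
    · have h1 : (fun y : F => 1 - ballCut η y) =ᶠ[nhds y] fun _ => 1 := by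
        filter_upwards [(isOpen_lt continuous_const continuous_norm).mem_nhds
          (show (2 : ℝ) < ‖y‖ by linarith)] with z hz
        rw [ballCut_eq_zero hη hz, sub_zero]
      rw [(h1.iteratedFDeriv ℝ i).self_of_nhds]
      refine le_trans ?_ (le_max_right _ _)
      rcases Nat.eq_zero_or_pos i with rfl | hi
      · simp
      · rw [iteratedFDeriv_const_of_ne hi.ne']; simp
  refine ⟨max B 0, le_max_right _ _, fun y => ?_⟩
  by_cases hy : ‖y‖ < 1
  · have h1 : (fun y : F => 1 - ballCut η y) =ᶠ[nhds y] fun _ => 0 := by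
      filter_upwards [(isOpen_lt continuous_norm continuous_const).mem_nhds hy] with z hz
      rw [ballCut_eq_one hη hz, sub_self]
    rw [(h1.iteratedFDeriv ℝ i).self_of_nhds]
    have : iteratedFDeriv ℝ i (fun _ : F => (0 : ℂ)) y = 0 := by simp
    rw [this, norm_zero]
    positivity
  · exact ((hB y).trans (le_max_left _ _)).trans
      (le_mul_of_one_le_right (le_max_right _ _) (not_lt.1 hy))

/-- Multiplication by the cutoff `ballCut` in some of the variables, at the scale `n + 1`. -/
def cutAt (η : ℝ → ℝ) (L : E →L[ℝ] F) (n : ℕ) (Φ : 𝓢(E, ℂ)) : 𝓢(E, ℂ) :=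
  SchwartzMap.smulLeftCLM ℂ (fun x => ballCut η (((n : ℝ) + 1)⁻¹ • L x)) Φ

lemma cutAt_apply (hη : IsBump η) (L : E →L[ℝ] F) (n : ℕ) (Φ : 𝓢(E, ℂ)) (x : E) :
    cutAt η L n Φ x = ballCut η (((n : ℝ) + 1)⁻¹ • L x) * Φ x := by
  have h : (fun x => ballCut η ((((n : ℝ) + 1)⁻¹ • L) x)).HasTemperateGrowth :=
    ((hasCompactSupport_ballCut hη).hasTemperateGrowth (contDiff_ballCut hη)).comp
      (((n : ℝ) + 1)⁻¹ • L).hasTemperateGrowth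
  exact SchwartzMap.smulLeftCLM_apply_apply h Φ x

lemma tendsto_cutAt (hη : IsBump η) (L : E →L[ℝ] F) (hL : ‖L‖ ≤ 1) (Φ : 𝓢(E, ℂ)) :
    Tendsto (fun n => cutAt η L n Φ) atTop (nhds Φ) := by
  rw [(schwartz_withSeminorms ℝ E ℂ).tendsto_nhds]
  rintro ⟨k, l⟩ ε hε
  choose B hB0 hB using exists_iteratedFDeriv_ballCut_le (F := F) hη
  have hb : ContDiff ℝ ∞ (fun y : F => 1 - ballCut η y) := contDiff_const.sub (contDiff_ballCut hη)
  let C : ℝ := ∑ i ∈ Finset.range (l + 1), (l.choose i : ℝ) * B i * SchwartzMap.seminorm ℝ (k + 1) (l - i) Φ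
  have hC : 0 ≤ C := Finset.sum_nonneg fun i _ => mul_nonneg (mul_nonneg (by positivity) (hB0 i)) (apply_nonneg _ _)
  have key : ∀ n : ℕ, SchwartzMap.seminorm ℝ k l (cutAt η L n Φ - Φ) ≤ ((n : ℝ) + 1)⁻¹ * C := by
    intro n
    have hn : (0 : ℝ) ≤ ((n : ℝ) + 1)⁻¹ := by positivity
    have hn1 : ((n : ℝ) + 1)⁻¹ ≤ 1 := inv_le_one_of_one_le₀ (by linarith [n.cast_nonneg (α := ℝ)])
    let L' : E →L[ℝ] F := ((n : ℝ) + 1)⁻¹ • L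
    have hL'2 : ‖L'‖ ≤ ((n : ℝ) + 1)⁻¹ := by
      rw [norm_smul, norm_of_nonneg hn]
      exact mul_le_of_le_one_right hn hL
    have hL' : ‖L'‖ ≤ 1 := hL'2.trans hn1
    refine SchwartzMap.seminorm_le_bound ℝ k l _ (by positivity) fun x => ?_
    have e : ⇑(cutAt η L n Φ - Φ) = fun x => -((1 - ballCut η (L' x)) * Φ x) := by
      funext x
      rw [sub_apply, cutAt_apply hη]
      change ballCut η (L' x) * Φ x - Φ x = _
      ring
    have hd : ∀ i, ‖iteratedFDeriv ℝ i (fun x => 1 - ballCut η (L' x)) x‖ ≤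
        B i * (((n : ℝ) + 1)⁻¹ * ‖x‖) := fun i =>
      (norm_iteratedFDeriv_comp_clm_le L' hL' hb i x).trans ((hB i _).trans
        (mul_le_mul_of_nonneg_left ((L'.le_opNorm x).trans
          (mul_le_mul_of_nonneg_right hL'2 (norm_nonneg x))) (hB0 i)))
    rw [e, show (fun x => -((1 - ballCut η (L' x)) * Φ x)) =
      -fun x => (1 - ballCut η (L' x)) * Φ x from rfl, iteratedFDeriv_neg, Pi.neg_apply, norm_neg]
    refine (mul_le_mul_of_nonneg_left (norm_iteratedFDeriv_mul_le (N := ∞)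
      (hb.comp L'.contDiff) Φ.smooth' x (n := l) (by exact_mod_cast le_top))
      (by positivity)).trans ?_
    rw [Finset.mul_sum, Finset.mul_sum]
    refine Finset.sum_le_sum fun i _ => ?_
    have h1 := SchwartzMap.le_seminorm ℝ (k + 1) (l - i) Φ x
    calc ‖x‖ ^ k * ((l.choose i : ℝ) * ‖iteratedFDeriv ℝ i (fun x => 1 - ballCut η (L' x)) x‖ *
          ‖iteratedFDeriv ℝ (l - i) Φ x‖)
        ≤ ‖x‖ ^ k * ((l.choose i : ℝ) * (B i * (((n : ℝ) + 1)⁻¹ * ‖x‖)) *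
          ‖iteratedFDeriv ℝ (l - i) Φ x‖) := by gcongr; exact hd i
      _ = ((n : ℝ) + 1)⁻¹ * ((l.choose i : ℝ) * B i * (‖x‖ ^ (k + 1) * ‖iteratedFDeriv ℝ (l - i) Φ x‖)) := by
          ring
      _ ≤ _ := mul_le_mul_of_nonneg_left (mul_le_mul_of_nonneg_left h1
          (mul_nonneg (by positivity) (hB0 i))) hn
  have ht : Tendsto (fun n : ℕ => ((n : ℝ) + 1)⁻¹ * C) atTop (nhds 0) := by
    have := (tendsto_one_div_add_atTop_nhds_zero_nat (𝕜 := ℝ)).mul_const C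
    simpa [one_div] using this
  filter_upwards [ht.eventually (gt_mem_nhds hε)] with n hn
  exact (key n).trans_lt hn

lemma norm_projL_le : ‖projL‖ ≤ 1 := by
  refine ContinuousLinearMap.opNorm_le_bound _ zero_le_one fun z => ?_
  rw [one_mul, projL_apply, EuclideanSpace.norm_eq, EuclideanSpace.norm_eq]
  refine sqrt_le_sqrt ?_
  simp [Fin.sum_univ_succ, proj]
  positivity

def timeL : Spacetime →L[ℝ] ℝ := EuclideanSpace.proj 2

lemma norm_timeL_le : ‖timeL‖ ≤ 1 := by
  refine ContinuousLinearMap.opNorm_le_bound _ zero_le_one fun z => ?_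
  rw [one_mul]
  exact PiLp.norm_apply_le z 2

lemma norm_le_proj_add (z : Spacetime) : ‖z‖ ≤ ‖proj z‖ + |z 2| := by
  have h : z = atZero (proj z) + EuclideanSpace.single 2 (z 2) := by
    conv_lhs => rw [← atTime_proj z, atTime_eq]
    rfl
  conv_lhs => rw [h]
  refine (norm_add_le _ _).trans (add_le_add (le_of_eq ?_) (by simp))
  rw [EuclideanSpace.norm_eq, EuclideanSpace.norm_eq]
  congr 1
  change ∑ i, ‖atTime 0 (proj z) i‖ ^ 2 = _
  simp [Fin.sum_univ_succ, atTime]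

lemma tensor_decay (φ : 𝓢(Plane, ℂ)) (h : 𝓢(ℝ, ℂ)) (k l : ℕ) : ∃ C : ℝ, ∀ z : Spacetime,
    ‖z‖ ^ k * ‖iteratedFDeriv ℝ l (fun z : Spacetime => φ (proj z) * h (z 2)) z‖ ≤ C := by
  have hb := fun i : ℕ => fun p => SchwartzMap.one_add_le_sup_seminorm_apply (𝕜 := ℝ)
    (m := (k, i)) le_rfl le_rfl φ p
  have hb' := fun i : ℕ => fun t => SchwartzMap.one_add_le_sup_seminorm_apply (𝕜 := ℝ)
    (m := (k, i)) le_rfl le_rfl h t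
  choose A hA using fun i => (⟨_, hb i⟩ : ∃ A : ℝ, ∀ p, (1 + ‖p‖) ^ k * ‖iteratedFDeriv ℝ i φ p‖ ≤ A)
  choose A' hA' using fun i => (⟨_, hb' i⟩ : ∃ A : ℝ, ∀ t, (1 + ‖t‖) ^ k * ‖iteratedFDeriv ℝ i h t‖ ≤ A)
  refine ⟨∑ i ∈ Finset.range (l + 1), (l.choose i : ℝ) * (A i * A' (l - i)), fun z => ?_⟩
  have h1 : ‖z‖ ^ k ≤ (1 + ‖proj z‖) ^ k * (1 + ‖z 2‖) ^ k := by
    rw [← mul_pow]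
    refine pow_le_pow_left₀ (norm_nonneg _) ((norm_le_proj_add z).trans ?_) k
    rw [norm_eq_abs]
    nlinarith [mul_nonneg (norm_nonneg (proj z)) (abs_nonneg (z 2))]
  refine (mul_le_mul h1 (norm_iteratedFDeriv_mul_le (N := ∞) (φ.smooth'.comp projL.contDiff)
    (h.smooth'.comp timeL.contDiff) z (n := l) (by exact_mod_cast le_top)) (norm_nonneg _)
    (by positivity)).trans ?_
  rw [Finset.mul_sum]
  refine Finset.sum_le_sum fun i _ => ?_
  have d1 := norm_iteratedFDeriv_comp_clm_le projL norm_projL_le φ.smooth' i z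
  have d2 := norm_iteratedFDeriv_comp_clm_le timeL norm_timeL_le h.smooth' (l - i) z
  have e1 := hA i (proj z)
  have e2 := hA' (l - i) (z 2)
  calc _ ≤ (1 + ‖proj z‖) ^ k * (1 + ‖z 2‖) ^ k * ((l.choose i : ℝ) *
        ‖iteratedFDeriv ℝ i φ (proj z)‖ * ‖iteratedFDeriv ℝ (l - i) h (z 2)‖) := by
        gcongr
        · exact d1
        · exact d2
    _ = (l.choose i : ℝ) * (((1 + ‖proj z‖) ^ k * ‖iteratedFDeriv ℝ i φ (proj z)‖) *
        ((1 + ‖z 2‖) ^ k * ‖iteratedFDeriv ℝ (l - i) h (z 2)‖)) := by ring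
    _ ≤ _ := by gcongr; exact (by positivity : (0 : ℝ) ≤ _).trans e1

/-- The Schwartz function `φ(x, y) h(t)`. -/
def tensor (φ : 𝓢(Plane, ℂ)) (h : 𝓢(ℝ, ℂ)) : 𝓢(Spacetime, ℂ) where
  toFun z := φ (proj z) * h (z 2)
  smooth' := contDiff_tensor φ.smooth' h.smooth'
  decay' := tensor_decay φ h

lemma tensor_apply (φ : 𝓢(Plane, ℂ)) (h : 𝓢(ℝ, ℂ)) (z : Spacetime) :
    tensor φ h z = φ (proj z) * h (z 2) := rfl

lemma inner_atTime (t : ℝ) (p : Plane) (z : Spacetime) :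
    inner ℝ (atTime t p) z = inner ℝ p (proj z) + t * z 2 := by
  simp [PiLp.inner_apply, Fin.sum_univ_succ, atTime, proj]
  ring

lemma schwartzFourier_tensor (φ : 𝓢(Plane, ℂ)) (h : 𝓢(ℝ, ℂ)) (ζ : Spacetime) :
    schwartzFourier 3 (tensor φ h) ζ = schwartzFourier 2 φ (proj ζ) * ft h (ζ 2) := by
  rw [schwartzFourier_apply, schwartzFourier_apply, integral_atTime, ← integral_mul_const]
  · refine integral_congr fun p => ?_
    rw [ft, ← integral_const_mul]
    refine integral_congr fun t => ?_
    simp only [tensor_apply, proj_atTime, atTime_apply_two, inner_atTime]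
    rw [show -(I * ((inner ℝ p (proj ζ) + t * ζ 2 : ℝ) : ℂ)) =
      -(I * (inner ℝ p (proj ζ) : ℝ)) + -(I * ((t * ζ 2 : ℝ) : ℂ)) by
        push_cast; ring, Complex.exp_add]
    ring
  · refine (tensor φ h).integrable.norm.mono' ?_ (.of_forall fun z => ?_)
    · fun_prop
    · rw [norm_mul, norm_exp_neg_I_mul, one_mul]

end

lemma integrable_mul {a b : ℝ → ℂ} (ha : Continuous a) (hb : Continuous b)
    (hc : HasCompactSupport a) : Integrable fun t => a t * b t :=
  (ha.mul hb).integrable_of_hasCompactSupport hc.mul_right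

/-! ### Pairing `H^{-2}` with test functions, and the free evolution -/

section

lemma continuous_schwartzFourier (n : ℕ) : Continuous (schwartzFourier n) :=
  (SchwartzMap.compCLMOfContinuousLinearEquiv ℂ (dilation n)).continuous.comp
    (FourierTransform.fourierCLM ℂ 𝓢(EuclideanSpace ℝ (Fin n), ℂ)).continuous

lemma continuous_schwartzFourierInv (n : ℕ) : Continuous (schwartzFourierInv n) :=
  ((SchwartzMap.compCLMOfContinuousLinearEquiv ℂ (dilation n)).continuous.comp
    (FourierTransform.fourierInvCLM ℂ 𝓢(EuclideanSpace ℝ (Fin n), ℂ)).continuous).const_smul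
      ((((2 * π) ^ n : ℝ) : ℂ)⁻¹)

lemma schwartzFourierInv_smul (n : ℕ) (c : ℂ) (g : 𝓢(EuclideanSpace ℝ (Fin n), ℂ))
    (z : EuclideanSpace ℝ (Fin n)) :
    schwartzFourierInv n (c • g) z = c * schwartzFourierInv n g z := by
  have e : ∀ ζ, (c • g) ζ = c * g ζ := fun _ => rfl
  simp only [schwartzFourierInv_apply, e, mul_left_comm _ c, integral_const_mul]

/-- The weight `1 + |z|²`. -/
def bracket (p : Plane) : ℂ := ((1 + ‖p‖ ^ 2 : ℝ) : ℂ)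

lemma hasTemperateGrowth_bracket : bracket.HasTemperateGrowth := by
  have h : (fun p : Plane => (1 + ‖p‖ ^ 2 : ℝ)).HasTemperateGrowth :=
    (HasTemperateGrowth.const 1).add (hasTemperateGrowth_norm_sq Plane)
  exact (ofRealCLM.hasTemperateGrowth).comp h

lemma measurable_bracket : Measurable bracket := Complex.measurable_ofReal.comp (by fun_prop)

lemma enorm_bracket_sq (p : Plane) : ‖bracket p‖ₑ ^ 2 = toE ((1 + ‖p‖ ^ 2) ^ 2) := by
  rw [bracket, ← ofReal_norm, norm_real, norm_of_nonneg (by positivity),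
    ENNReal.ofReal_pow (by positivity)]

/-- The weighted `L²` class dual to `H^{-2}`. -/
def weightL2 : 𝓢(Plane, ℂ) →L[ℂ] Lp ℂ 2 (volume : Measure Plane) :=
  (SchwartzMap.toLpCLM ℂ ℂ 2 volume).comp (SchwartzMap.smulLeftCLM ℂ bracket)

lemma enorm_weightL2_sq (h : 𝓢(Plane, ℂ)) :
    ‖weightL2 h‖ₑ ^ 2 = ∫⁻ p, ‖bracket p‖ₑ ^ 2 * ‖h p‖ₑ ^ 2 := by
  have e : weightL2 h = (SchwartzMap.smulLeftCLM ℂ bracket h).toLp 2 := rfl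
  rw [e, Lp.enorm_def, eLpNorm_congr_ae (SchwartzMap.coeFn_toLp _ _ _), eLpNorm_two_sq]
  refine lintegral_congr fun p => ?_
  rw [SchwartzMap.smulLeftCLM_apply_apply hasTemperateGrowth_bracket, smul_eq_mul, enorm_mul,
    mul_pow]

lemma lintegral_hNegTwo_sq (v : HNegTwo) :
    ∫⁻ p, toE (((1 + ‖p‖ ^ 2) ^ 2)⁻¹) * ‖v p‖ₑ ^ 2 = ‖v‖ₑ ^ 2 := by
  rw [Lp.enorm_def, eLpNorm_two_sq]
  exact (lintegral_withDensity_eq_lintegral_mul volume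
    (f := fun p : Plane => toE (((1 + ‖p‖ ^ 2) ^ 2)⁻¹)) (by fun_prop)
    (g := fun p => ‖v p‖ₑ ^ 2) ((Lp.stronglyMeasurable v).measurable.enorm.pow_const 2)).symm

section

variable (v : HNegTwo) (h : 𝓢(Plane, ℂ))
include v h

lemma lintegral_hNegTwo_mul_le :
    ∫⁻ p, ‖v p * h p‖ₑ ≤ ‖v‖ₑ * ‖weightL2 h‖ₑ := by
  refine ennreal_le_of_sq_le ?_
  rw [mul_pow, ← lintegral_hNegTwo_sq, enorm_weightL2_sq]
  have hw : ∀ p : Plane, toE (((1 + ‖p‖ ^ 2) ^ 2)⁻¹) * ‖bracket p‖ₑ ^ 2 = 1 := fun p => by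
    rw [enorm_bracket_sq, ← ENNReal.ofReal_mul (by positivity), inv_mul_cancel₀ (by positivity),
      ENNReal.ofReal_one]
  have hb : ∀ p : Plane, ‖bracket p‖ₑ⁻¹ ^ 2 = toE (((1 + ‖p‖ ^ 2) ^ 2)⁻¹) := fun p => by
    rw [ofReal_inv_of_pos (by positivity), ← enorm_bracket_sq, ENNReal.inv_pow]
  have hne : ∀ p : Plane, ‖bracket p‖ₑ ≠ 0 := fun p hc => by
    have := hw p
    rw [hc] at this
    simp at this
  have h1 := lintegral_mul_sq_le (μ := (volume : Measure Plane))
    (f := fun p => ‖bracket p‖ₑ⁻¹ * ‖v p‖ₑ) (g := fun p => ‖bracket p‖ₑ * ‖h p‖ₑ)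
    (measurable_bracket.enorm.inv.mul (Lp.stronglyMeasurable v).measurable.enorm).aemeasurable
    (measurable_bracket.enorm.mul h.continuous.measurable.enorm).aemeasurable
  simp_rw [mul_pow, hb] at h1
  refine le_trans (le_of_eq ?_) h1
  congr 1
  refine lintegral_congr fun p => ?_
  rw [enorm_mul, mul_mul_mul_comm, ENNReal.inv_mul_cancel (hne p) enorm_ne_top, one_mul]

lemma integrable_hNegTwo_mul :
    Integrable fun p => v p * h p :=
  ⟨((Lp.stronglyMeasurable v).measurable.mul h.continuous.measurable).aestronglyMeasurable,
    (lintegral_hNegTwo_mul_le v h).trans_lt (mul_lt_top (by simp) (by simp))⟩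

lemma norm_integral_hNegTwo_mul_le :
    ‖∫ p, v p * h p‖ ≤ ‖weightL2 h‖ * ‖v‖ := by
  have h1 : ‖∫ p, v p * h p‖ₑ ≤ ‖v‖ₑ * ‖weightL2 h‖ₑ :=
    (enorm_integral_le_lintegral_enorm _).trans (lintegral_hNegTwo_mul_le v h)
  rw [← ofReal_norm, ← ofReal_norm, ← ofReal_norm, ← ENNReal.ofReal_mul (norm_nonneg _),
    ofReal_le_ofReal_iff (by positivity)] at h1
  rwa [mul_comm]

end

lemma volume_absolutelyContinuous_sobolev : (volume : Measure Plane) ≪ sobolevMeasure :=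
  withDensity_absolutelyContinuous' (by fun_prop) (.of_forall fun p => by
    rw [Ne, ENNReal.ofReal_eq_zero, not_le]
    positivity)

/-- The functional `φ ↦ ∫ φ̂ h` on `H^{-2}`. -/
def testL (h : 𝓢(Plane, ℂ)) : HNegTwo →L[ℂ] ℂ := LinearMap.mkContinuous
    { toFun := fun v => ∫ p, v p * h p
      map_add' := fun v w => by
        rw [← integral_add (integrable_hNegTwo_mul v h) (integrable_hNegTwo_mul w h)]
        refine integral_congr_ae ((volume_absolutelyContinuous_sobolev.ae_eq
          (Lp.coeFn_add v w)).mono fun p hp => ?_)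
        simp only [hp, Pi.add_apply, add_mul]
      map_smul' := fun c v => by
        rw [smul_eq_mul, ← integral_const_mul]
        refine integral_congr_ae ((volume_absolutelyContinuous_sobolev.ae_eq
          (Lp.coeFn_smul c v)).mono fun p hp => ?_)
        simp only [hp, Pi.smul_apply, smul_eq_mul, mul_assoc, RingHom.id_apply] }
    ‖weightL2 h‖ fun v => norm_integral_hNegTwo_mul_le v h

lemma testL_apply (h : 𝓢(Plane, ℂ)) (v : HNegTwo) : testL h v = ∫ p, v p * h p := rfl

lemma pair_eq (v : HNegTwo) (g : 𝓢(Plane, ℂ)) : v.pair g = testL (schwartzFourierInv 2 g) v := rfl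

lemma pair_smul (v : HNegTwo) (c : ℂ) (g : 𝓢(Plane, ℂ)) : v.pair (c • g) = c * v.pair g := by
  rw [pair_eq, pair_eq, testL_apply, testL_apply, ← integral_const_mul]
  refine integral_congr fun p => ?_
  simp only [schwartzFourierInv_smul]
  ring

lemma testL_sub (h h' : 𝓢(Plane, ℂ)) (v : HNegTwo) : testL (h - h') v = testL h v - testL h' v := by
  rw [testL_apply, testL_apply, testL_apply,
    ← integral_sub (integrable_hNegTwo_mul v h) (integrable_hNegTwo_mul v h')]
  refine integral_congr fun p => ?_
  simp only [sub_apply, mul_sub]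

lemma tendsto_integral_testL {u : ℝ → HNegTwo} (hu : Continuous u) {b : ℝ → ℂ}
    (hb : Continuous b) (hbc : HasCompactSupport b) {h : ℕ → 𝓢(Plane, ℂ)} {h₀ : 𝓢(Plane, ℂ)}
    (hh : Tendsto h atTop (nhds h₀)) :
    Tendsto (fun n => ∫ t, b t * testL (h n) (u t)) atTop
      (nhds (∫ t, b t * testL h₀ (u t))) := by
  have hi : ∀ h : 𝓢(Plane, ℂ), Integrable fun t => b t * testL h (u t) := fun h =>
    integrable_mul hb ((testL h).continuous.comp hu) hbc
  have hi' : Integrable fun t => ‖b t‖ * ‖u t‖ :=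
    (hb.norm.mul hu.norm).integrable_of_hasCompactSupport hbc.norm.mul_right
  rw [tendsto_iff_norm_sub_tendsto_zero]
  have h0 : Tendsto (fun n => ‖weightL2 (h n - h₀)‖ * ∫ t, ‖b t‖ * ‖u t‖) atTop
      (nhds 0) := by
    have h1 : Tendsto (fun n => h n - h₀) atTop (nhds 0) := by simpa using hh.sub_const h₀
    have h2 := ((weightL2.continuous.norm.tendsto 0).comp h1).mul_const (∫ t, ‖b t‖ * ‖u t‖)
    simpa using h2
  refine squeeze_zero (fun n => norm_nonneg _) (fun n => ?_) h0
  rw [← integral_sub (hi _) (hi _), ← integral_const_mul]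
  refine norm_integral_le_of_norm_le (hi'.const_mul _) (.of_forall fun t => ?_)
  rw [← mul_sub, ← testL_sub, norm_mul, testL_apply]
  calc ‖b t‖ * ‖∫ p, u t p * (h n - h₀) p‖ ≤ ‖b t‖ * (‖weightL2 (h n - h₀)‖ * ‖u t‖) :=
        mul_le_mul_of_nonneg_left (norm_integral_hNegTwo_mul_le _ _) (norm_nonneg _)
    _ = _ := by ring

lemma coeFn_freeEvolution (t : ℝ) (v : HNegTwo) :
    freeEvolution t v =ᵐ[volume] fun p => evolve t p * v p :=
  volume_absolutelyContinuous_sobolev.ae_eq (memLp_freeEvolution t v).coeFn_toLp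

lemma norm_freeEvolution_sub (t : ℝ) (v w : HNegTwo) :
    ‖freeEvolution t v - freeEvolution t w‖ = ‖v - w‖ := by
  rw [freeEvolution, freeEvolution, ← MemLp.toLp_sub, Lp.norm_toLp, Lp.norm_def]
  congr 1
  refine eLpNorm_congr_norm_ae ((Lp.coeFn_sub v w).mono fun p hp => ?_)
  rw [hp, Pi.sub_apply, ← mul_sub, norm_mul, norm_exp_I_mul, one_mul, Pi.sub_apply]

lemma measurable_evolve_left (t : ℝ) : Measurable (evolve t) :=
  measurable_evolve.comp (measurable_id.prodMk measurable_const)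

lemma continuous_evolve (p : Plane) : Continuous fun t => evolve t p := by unfold evolve; fun_prop

lemma continuous_freeEvolution (v : HNegTwo) : Continuous fun t => freeEvolution t v := by
  rw [continuous_iff_continuousAt]
  intro t₀
  refine (Lp.tendsto_Lp_iff_tendsto_eLpNorm'' _ (fun t => memLp_freeEvolution t v) _
    (memLp_freeEvolution t₀ v)).2 ?_
  have hm := (Lp.stronglyMeasurable v).measurable
  have h : Tendsto (fun t => ∫⁻ p, ‖(evolve t p - evolve t₀ p) * v p‖ₑ ^ 2 ∂sobolevMeasure)
      (nhds t₀) (nhds (∫⁻ _, 0 ∂sobolevMeasure)) := by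
    refine tendsto_lintegral_filter_of_dominated_convergence (fun p => 4 * ‖v p‖ₑ ^ 2)
      (.of_forall fun t => ?_) (.of_forall fun t =>
        .of_forall fun p => ?_) ?_ (.of_forall fun p => ?_)
    · exact ((((measurable_evolve_left t).sub (measurable_evolve_left t₀)).mul hm).enorm).pow_const 2
    · rw [enorm_mul, mul_pow]
      refine mul_le_mul' ?_ le_rfl
      rw [show (4 : ℝ≥0∞) = 2 ^ 2 by norm_num]
      refine pow_le_pow_left' ((enorm_sub_le).trans (le_of_eq ?_)) 2
      rw [← ofReal_norm, ← ofReal_norm, norm_evolve, norm_evolve]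
      norm_num
    · rw [lintegral_const_mul' _ _ (by simp), ← eLpNorm_two_sq]
      have := Lp.eLpNorm_ne_top v
      finiteness
    · have h1 : Continuous fun t => ‖(evolve t p - evolve t₀ p) * v p‖ₑ ^ 2 := by
        have := continuous_evolve p
        fun_prop
      have h2 := h1.tendsto t₀
      simpa using h2
  rw [lintegral_zero] at h
  have h3 := (ENNReal.continuous_rpow_const (y := ½)).tendsto 0 |>.comp h
  rw [zero_rpow_of_pos (by norm_num)] at h3
  refine h3.congr fun t => ?_
  rw [eLpNorm_two_eq]
  simp only [comp_apply, Pi.sub_apply, sub_mul]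
  rfl

lemma Continuous.freeEvolution {X : Type*} [TopologicalSpace X] {T : X → ℝ} {u : X → HNegTwo}
    (hT : Continuous T) (hu : Continuous u) : Continuous fun s => KPI.freeEvolution (T s) (u s) := by
  rw [continuous_iff_continuousAt]
  intro s₀
  have h1 : Tendsto (fun s => KPI.freeEvolution (T s) (u s₀)) (nhds s₀)
      (nhds (KPI.freeEvolution (T s₀) (u s₀))) :=
    ((continuous_freeEvolution (u s₀)).comp hT).tendsto s₀
  have h2 : Tendsto (fun s => KPI.freeEvolution (T s) (u s) - KPI.freeEvolution (T s) (u s₀))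
      (nhds s₀) (nhds 0) := by
    rw [tendsto_zero_iff_norm_tendsto_zero]
    simp_rw [norm_freeEvolution_sub]
    rw [← tendsto_iff_norm_sub_tendsto_zero]
    exact hu.tendsto s₀
  have h3 := h2.add h1
  simp only [sub_add_cancel, zero_add] at h3
  exact h3

/-- Test functions on the frequency plane, supported away from `{ξ = 0}`. -/
structure IsTest (h : Plane → ℂ) : Prop where
  smooth : ContDiff ℝ ∞ h
  compact : HasCompactSupport h
  subset : tsupport h ⊆ {p : Plane | p 0 ≠ 0}

lemma IsTest.mul {h m : Plane → ℂ} (hh : IsTest h)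
    (hm : ∀ p : Plane, p 0 ≠ 0 → ContDiffAt ℝ ∞ m p) : IsTest fun p => m p * h p where
  smooth := contDiff_iff_contDiffAt.2 fun p => by
    by_cases hp : p ∈ tsupport h
    · exact (hm p (hh.subset hp)).mul hh.smooth.contDiffAt
    · refine (contDiffAt_const (c := (0 : ℂ))).congr_of_eventuallyEq ?_
      filter_upwards [(isClosed_tsupport h).isOpen_compl.mem_nhds hp] with q hq
      rw [image_eq_zero_of_notMem_tsupport hq, mul_zero]
  compact := hh.compact.mul_left
  subset := (closure_mono (support_mul_subset_right m h)).trans hh.subset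

lemma IsTest.evolve {h : Plane → ℂ} (hh : IsTest h) (s : ℝ) :
    IsTest fun p => KPI.evolve s p * h p :=
  hh.mul fun _ hp => contDiffAt_evolve s hp

lemma contDiffAt_phase (hp : p 0 ≠ 0) : ContDiffAt ℝ ∞ (fun p => (phase p : ℂ)) p := by
  have h0 : ContDiff ℝ ∞ fun p : Plane => p 0 := by fun_prop
  have h1 : ContDiff ℝ ∞ fun p : Plane => p 1 := by fun_prop
  exact ofRealCLM.contDiff.contDiffAt.comp p
    ((h0.contDiffAt.pow 3).add ((h1.contDiffAt.pow 2).div h0.contDiffAt hp))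

lemma IsTest.phase {h : Plane → ℂ} (hh : IsTest h) :
    IsTest fun p => (KPI.phase p : ℂ) * h p :=
  hh.mul fun _ hp => contDiffAt_phase hp

def IsTest.schwartz {h : Plane → ℂ} (hh : IsTest h) : 𝓢(Plane, ℂ) :=
  hh.compact.toSchwartzMap hh.smooth

lemma IsTest.schwartz_apply {h : Plane → ℂ} (hh : IsTest h) (p : Plane) : hh.schwartz p = h p := rfl

lemma testL_freeEvolution {h : Plane → ℂ} (hh : IsTest h) (t : ℝ) (v : HNegTwo) :
    testL hh.schwartz (freeEvolution t v) = testL (hh.evolve t).schwartz v := by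
  rw [testL_apply, testL_apply]
  refine integral_congr_ae ((coeFn_freeEvolution t v).mono fun p hp => ?_)
  simp only [hp, IsTest.schwartz_apply]
  ring

end

attribute [fun_prop] continuous_schwartzFourierInv

/-! ### The distributional equation for the time slices -/

section

variable {h : Plane → ℂ} {β : ℝ → ℂ}

def invFt (β : ℝ → ℂ) (τ : ℝ) : ℂ := ((2 * π : ℝ) : ℂ)⁻¹ * ft β (-τ)

lemma continuous_invFt (hβ : Integrable β) : Continuous (invFt β) :=
  continuous_const.mul ((continuous_ft hβ).comp continuous_neg)

lemma norm_invFt_le (β : ℝ → ℂ) (τ : ℝ) : ‖invFt β τ‖ ≤ ‖((2 * π : ℝ) : ℂ)⁻¹‖ * ∫ t, ‖β t‖ := by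
  rw [invFt, norm_mul]
  refine mul_le_mul_of_nonneg_left ((norm_integral_le_integral_norm _).trans (le_of_eq ?_))
    (norm_nonneg _)
  refine integral_congr fun t => ?_
  simp only [norm_mul, norm_exp_neg_I_mul, one_mul]

lemma invFt_deriv (hβ : ContDiff ℝ ∞ β) (hc : HasCompactSupport β) (τ : ℝ) :
    invFt (fun t => I * deriv β t) τ = τ * invFt β τ := by
  have hd := hβ.continuous_deriv (by simp)
  have he : ∀ t : ℝ, HasDerivAt (fun t : ℝ => cexp (-(I * ((t * -τ : ℝ) : ℂ))))
      (I * τ * cexp (-(I * ((t * -τ : ℝ) : ℂ)))) t := fun t => by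
    have h1 : HasDerivAt (fun t : ℝ => (t : ℂ)) 1 t := ofRealCLM.hasDerivAt
    have h2 := (h1.const_mul (I * τ)).cexp
    convert h2 using 1
    · funext s
      congr 1
      push_cast
      ring
    · rw [mul_one, mul_comm (I * τ)]
      congr 2
      push_cast
      ring
  have hec : Continuous fun t : ℝ => cexp (-(I * ((t * -τ : ℝ) : ℂ))) := by fun_prop
  have h := integral_mul_deriv_eq_deriv_mul_of_integrable (fun t _ => he t)
    (fun t _ => (hβ.differentiable (by simp) t).hasDerivAt)
    ((hec.mul hd).integrable_of_hasCompactSupport hc.deriv.mul_left)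
    (((continuous_const.mul hec).mul hβ.continuous).integrable_of_hasCompactSupport hc.mul_left)
    ((hec.mul hβ.continuous).integrable_of_hasCompactSupport hc.mul_left)
  simp only [invFt, ft, mul_left_comm _ I, integral_const_mul, h]
  simp only [mul_assoc, integral_const_mul]
  linear_combination (-((2 * π : ℝ) : ℂ)⁻¹ * τ * ∫ t : ℝ,
    cexp (-(I * ((t * -τ : ℝ) : ℂ))) * β t) * I_mul_I

def invFtSchwartz (β : 𝓢(ℝ, ℂ)) : 𝓢(ℝ, ℂ) :=
  ((2 * π : ℝ) : ℂ)⁻¹ • SchwartzMap.compCLMOfContinuousLinearEquiv ℂ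
    (ContinuousLinearEquiv.neg ℝ) (ftSchwartz β)

lemma invFtSchwartz_apply (β : 𝓢(ℝ, ℂ)) (τ : ℝ) : invFtSchwartz β τ = invFt β τ := by
  rw [invFt, ← ftSchwartz_apply]
  rfl

lemma ft_invFtSchwartz (β : 𝓢(ℝ, ℂ)) (t : ℝ) : ft (invFtSchwartz β) t = β t := by
  rw [← integral_exp_mul_ft, ft, ← integral_const_mul, ← integral_neg_eq_self]
  refine integral_congr fun τ => ?_
  simp only [invFtSchwartz_apply, invFt, neg_neg]
  rw [show -(I * ((-τ * t : ℝ) : ℂ)) = I * ((τ * t : ℝ) : ℂ) by push_cast; ring]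
  ring

def sliceTest (f : Amp) (h : Plane → ℂ) (t : ℝ) : ℂ := ∫ p, timeSlice f t p * h p

lemma integral_mul_invFt {ψ : Plane → ℂ} (hi : Integrable fun z => f z * ψ (proj z))
    (hβ : Integrable β) :
    ∫ z, f z * (ψ (proj z) * invFt β (z 2)) = ∫ t, β t * sliceTest f ψ t := by
  have h1 : ∀ t, β t * sliceTest f ψ t = ∫ z, ((2 * π : ℝ) : ℂ)⁻¹ *
      (β t * (f z * (ψ (proj z) * cexp (I * ((t * z 2 : ℝ) : ℂ))))) := fun t => by
    rw [integral_const_mul, integral_const_mul, integral_mul_proj_mul_exp hi, sliceTest]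
    have : ((2 * π : ℝ) : ℂ) ≠ 0 := by exact_mod_cast two_pi_pos.ne'
    field_simp
  simp_rw [h1]
  rw [integral_integral_swap]
  · refine integral_congr fun z => ?_
    simp only [invFt, ft]
    rw [← integral_const_mul, ← integral_const_mul, ← integral_const_mul]
    refine integral_congr fun t => ?_
    rw [show -(I * ((t * -z 2 : ℝ) : ℂ)) = I * ((t * z 2 : ℝ) : ℂ) by push_cast; ring]
    ring
  · refine (((hβ.mul_prod hi).const_mul ((2 * π : ℝ) : ℂ)⁻¹).bdd_mul (c := 1)
      (f := fun q : ℝ × Spacetime => cexp (I * ((q.1 * q.2 2 : ℝ) : ℂ))) ?_ ?_).congr ?_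
    · fun_prop
    · exact .of_forall fun q => (norm_exp_I_mul _).le
    · refine .of_forall fun q => ?_; simp only [uncurry]; ring

lemma IsTest.memLp (hh : IsTest h) : MemLp h 2 :=
  hh.smooth.continuous.memLp_of_hasCompactSupport hh.compact

lemma integrable_fiberMass_mul (hf : Measurable f) (h1 : mixNorm f ≠ ⊤) {m : Plane → ℂ}
    (hm : MemLp m 2) : Integrable fun p => fiberMass f p * ‖m p‖ :=
  (memLp_fiberMass hf h1).integrable_mul hm.norm

lemma continuous_sliceTest (hf : Measurable f) (h1 : mixNorm f ≠ ⊤) (hh : IsTest h) :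
    Continuous (sliceTest f h) := by
  refine continuous_of_dominated (fun t => ?_) (fun t => .of_forall fun p => ?_)
    (integrable_fiberMass_mul hf h1 hh.memLp) ?_
  · exact ((measurable_timeSlice_right hf t).mul
      hh.smooth.continuous.measurable).aestronglyMeasurable
  · rw [norm_mul]; exact mul_le_mul_of_nonneg_right (norm_timeSlice_le f t p) (norm_nonneg _)
  · filter_upwards [fiberIntegrable_of_mixNorm hf h1] with p hp
    exact (continuous_timeSlice hp).mul continuous_const

lemma IsTest.tsupport_tensor (hh : IsTest h) (b : ℝ → ℂ) :
    tsupport (fun z : Spacetime => h (proj z) * b (z 2)) ⊆ {z : Spacetime | z 0 ≠ 0} := by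
  have hs : tsupport (fun z : Spacetime => h (proj z) * b (z 2)) ⊆ proj ⁻¹' tsupport h :=
    closure_minimal (fun z hz => subset_tsupport h fun h0 => hz (by simp only [h0, zero_mul]))
      ((isClosed_tsupport h).preimage continuous_proj)
  exact fun z hz => hh.subset (hs hz)

lemma exists_eq_zero_of_lt_abs (hc : HasCompactSupport β) : ∃ R : ℝ, ∀ t, R < |t| → β t = 0 := by
  obtain ⟨R, hR⟩ := hc.isCompact.isBounded.subset_closedBall 0
  refine ⟨R, fun t ht => image_eq_zero_of_notMem_tsupport fun h => ?_⟩
  have := hR h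
  rw [mem_closedBall_zero_iff, norm_eq_abs] at this
  linarith

lemma apply_schwartzFourier_tensor (hη : IsBump η) {u : ℝ → HNegTwo} (hu : Continuous u)
    {U : 𝓢'(Spacetime, ℂ)} (hU : IsPath u U) (hh : IsTest h) (β : 𝓢(ℝ, ℂ))
    (hβ : HasCompactSupport β) :
    U (schwartzFourier 3 (tensor hh.schwartz (invFtSchwartz β))) =
      ∫ t, β t * testL hh.schwartz (u t) := by
  set Ψ := schwartzFourier 3 (tensor hh.schwartz (invFtSchwartz β)) with hΨ
  have hΨa : ∀ z, Ψ z = schwartzFourier 2 hh.schwartz (proj z) * β (z 2) := fun z => by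
    rw [hΨ, schwartzFourier_tensor, ft_invFtSchwartz]
  have h1 : Tendsto (fun n => U (cutAt η projL n Ψ)) atTop (nhds (U Ψ)) :=
    ((map_continuous U).tendsto _).comp (tendsto_cutAt hη projL norm_projL_le Ψ)
  obtain ⟨R, hR⟩ := exists_eq_zero_of_lt_abs hβ
  have h2 : ∀ n, U (cutAt η projL n Ψ) = ∫ t, β t * testL (schwartzFourierInv 2
      (cutAt η (ContinuousLinearMap.id ℝ Plane) n (schwartzFourier 2 hh.schwartz))) (u t) := by
    intro n
    have ha : ∀ z, cutAt η projL n Ψ z = cutAt η (ContinuousLinearMap.id ℝ Plane) n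
        (schwartzFourier 2 hh.schwartz) (proj z) * β (z 2) := fun z => by
      rw [cutAt_apply hη, cutAt_apply hη, hΨa, mul_assoc]
      rfl
    rw [hU]
    · refine integral_congr fun t => ?_
      have hs : slice t (cutAt η projL n Ψ) = β t • cutAt η (ContinuousLinearMap.id ℝ Plane) n
          (schwartzFourier 2 hh.schwartz) := by
        ext p
        have e := ha (atTime t p)
        rw [proj_atTime, atTime_apply_two, mul_comm] at e
        exact e
      simp only [hs, pair_smul]
      rfl
    · rw [show ⇑(cutAt η projL n Ψ) = _ from funext ha]
      refine hasCompactSupport_tensor ?_ hR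
      have hc : HasCompactSupport fun p : Plane =>
          ballCut η (((n : ℝ) + 1)⁻¹ • ContinuousLinearMap.id ℝ Plane p) :=
        (hasCompactSupport_ballCut hη).comp_smul (by positivity)
      rw [show ⇑(cutAt η (ContinuousLinearMap.id ℝ Plane) n (schwartzFourier 2 hh.schwartz)) = _ from
        funext (cutAt_apply hη _ n _)]
      exact hc.mul_right
  simp_rw [h2] at h1
  refine tendsto_nhds_unique h1 (tendsto_integral_testL hu β.continuous hβ ?_)
  have h3 := ((continuous_schwartzFourierInv 2).tendsto _).comp
    (tendsto_cutAt hη (ContinuousLinearMap.id ℝ Plane) ContinuousLinearMap.norm_id_le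
      (schwartzFourier 2 hh.schwartz))
  rwa [schwartzFourierInv_schwartzFourier] at h3

lemma tendsto_integral_cutAt (hη : IsBump η) {Φ : 𝓢(Spacetime, ℂ)}
    (hi : Integrable fun z => G z * Φ z) :
    Tendsto (fun n => ∫ z, G z * cutAt η timeL n Φ z) atTop
      (nhds (∫ z, G z * Φ z)) := by
  have e : ∀ n z, G z * cutAt η timeL n Φ z =
      ballCut η (((n : ℝ) + 1)⁻¹ • timeL z) * (G z * Φ z) := fun n z => by
    rw [cutAt_apply hη, mul_left_comm]
  simp_rw [e]
  refine tendsto_integral_of_dominated_convergence _ (fun n => ?_) hi.norm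
    (fun n => .of_forall fun z => ?_) (.of_forall fun z => ?_)
  · have := (contDiff_ballCut (F := ℝ) hη).continuous
    exact (Continuous.aestronglyMeasurable (by fun_prop)).mul hi.aestronglyMeasurable
  · rw [norm_mul]; exact mul_le_of_le_one_left (norm_nonneg _) (hη.norm_ofReal_le _)
  · have h1 : Tendsto (fun n : ℕ => ballCut η (((n : ℝ) + 1)⁻¹ • timeL z)) atTop
        (nhds (ballCut η (0 : ℝ))) := by
      refine ((contDiff_ballCut (F := ℝ) hη).continuous.tendsto 0).comp ?_
      have := (tendsto_one_div_add_atTop_nhds_zero_nat (𝕜 := ℝ)).smul_const (timeL z)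
      simpa [one_div] using this
    rw [ballCut_eq_one hη (by simp)] at h1
    simpa using h1.mul_const (G z * Φ z)

variable {u : ℝ → HNegTwo}

lemma ballCut_smul_mul_eq_zero (hη : IsBump η) (n : ℕ) (b : ℝ → ℂ) (t : ℝ)
    (ht : 2 * ((n : ℝ) + 1) < |t|) : ballCut η (((n : ℝ) + 1)⁻¹ • t) * b t = 0 := by
  rw [ballCut_eq_zero hη, zero_mul]
  rw [norm_smul, norm_of_nonneg (by positivity), norm_eq_abs, inv_mul_eq_div,
    lt_div_iff₀ (by positivity)]
  exact ht

lemma integral_mul_tensor (hη : IsBump η) (hu : Continuous u) (hG : HasFourier u G)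
    (hh : IsTest h) (β : 𝓢(ℝ, ℂ)) (hβ : HasCompactSupport β)
    (hi : Integrable fun z => G z * (h (proj z) * invFt β (z 2))) :
    ∫ t, β t * testL hh.schwartz (u t) = ∫ z, G z * (h (proj z) * invFt β (z 2)) := by
  obtain ⟨-, U, hU, hUG⟩ := hG
  obtain ⟨Φ, hΦS⟩ : ∃ Φ, Φ = tensor hh.schwartz (invFtSchwartz β) := ⟨_, rfl⟩
  have hΦ : ∀ z, Φ z = h (proj z) * invFt β (z 2) := fun z => by
    rw [hΦS, tensor_apply, invFtSchwartz_apply, IsTest.schwartz_apply]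
  simp_rw [← hΦ] at hi ⊢
  rw [← apply_schwartzFourier_tensor hη hu hU hh β hβ, ← hΦS]
  have hlim : Tendsto (fun n => U (schwartzFourier 3 (cutAt η timeL n Φ))) atTop
      (nhds (U (schwartzFourier 3 Φ))) :=
    (((map_continuous U).comp (continuous_schwartzFourier 3)).tendsto _).comp
      (tendsto_cutAt hη timeL norm_timeL_le Φ)
  have hcut : ∀ n : ℕ, ⇑(cutAt η timeL n Φ) = fun z : Spacetime => h (proj z) *
      (fun t => ballCut η (((n : ℝ) + 1)⁻¹ • t) * invFt β t) (z 2) := fun n => by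
    funext z
    rw [cutAt_apply hη, hΦ, mul_left_comm]
    rfl
  have hkey : ∀ n, U (schwartzFourier 3 (cutAt η timeL n Φ)) = ∫ z, G z * cutAt η timeL n Φ z := by
    intro n
    refine hUG _ ?_ ?_
    · rw [hcut]
      exact hasCompactSupport_tensor hh.compact
        (h := fun t : ℝ => ballCut η (((n : ℝ) + 1)⁻¹ • t) * invFt β t)
        (ballCut_smul_mul_eq_zero hη n (invFt β))
    · rw [hcut]; exact hh.tsupport_tensor fun t : ℝ => ballCut η (((n : ℝ) + 1)⁻¹ • t) * invFt β t
  simp_rw [hkey] at hlim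
  exact tendsto_nhds_unique hlim (tendsto_integral_cutAt hη hi)

lemma integrable_mul_invFt {ψ : Plane → ℂ} (hi : Integrable fun z => f z * ψ (proj z))
    (hβ : Integrable β) : Integrable fun z => f z * (ψ (proj z) * invFt β (z 2)) := by
  have hm : AEStronglyMeasurable (fun z : Spacetime => invFt β (z 2)) :=
    Continuous.aestronglyMeasurable ((continuous_invFt hβ).comp (by fun_prop))
  refine (hi.bdd_mul hm (.of_forall fun z => norm_invFt_le β (z 2))).congr
    (.of_forall fun z => ?_)
  simp only
  ring

lemma forcing_mul_invFt {z : Spacetime} {g : ℂ} (hz : g = κ z * f z)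
    (hβ : ContDiff ℝ ∞ β) (hβc : HasCompactSupport β) (h : Plane → ℂ) :
    g * (h (proj z) * invFt β (z 2)) = f z * (h (proj z) * invFt (fun t => I * deriv β t) (z 2)) +
      (I * (f z * (h (proj z) * invFt β (z 2))) -
        f z * ((phase (proj z) * h (proj z)) * invFt β (z 2))) := by
  rw [hz, invFt_deriv hβ hβc, show modulation z = z 2 - phase (proj z) from rfl]
  push_cast
  ring

lemma integral_mul_sub {A P : ℝ → ℂ} (hβ : Continuous β) (hβc : HasCompactSupport β)
    (hA : Continuous A) (hP : Continuous P) :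
    I * ∫ t, β t * A t = (∫ t, β t * P t) + ∫ t, β t * (I * A t - P t) := by
  rw [← integral_const_mul, ← integral_add]
  · grind
  · exact integrable_mul hβ hP hβc
  · exact integrable_mul hβ ((continuous_const.mul hA).sub hP) hβc

/-- The distributional form of the equation for the time slices of `f`. -/
lemma integral_mul_testL (hη : IsBump η) (hu : Continuous u) (hG : HasFourier u G)
    (hf : Measurable f) (h1 : mixNorm f ≠ ⊤) (hfG : ∀ᵐ z, G z = κ z * f z) (hh : IsTest h)
    (hβ : ContDiff ℝ ∞ β) (hβc : HasCompactSupport β) :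
    ∫ t, β t * testL hh.schwartz (u t) = (∫ t, (I * deriv β t) * sliceTest f h t) +
      ∫ t, β t * (I * sliceTest f h t - sliceTest f (fun p => phase p * h p) t) := by
  have hd := hβ.continuous_deriv (by simp)
  have iβ : Integrable β := hβ.continuous.integrable_of_hasCompactSupport hβc
  have iβ' : Integrable fun t => I * deriv β t :=
    (continuous_const.mul hd).integrable_of_hasCompactSupport hβc.deriv.mul_left
  have ih := integrable_mul_proj hf h1 hh.smooth.continuous.measurable hh.memLp
  have ip := integrable_mul_proj hf h1 hh.phase.smooth.continuous.measurable hh.phase.memLp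
  have hGΦ := hfG.mono fun z hz => forcing_mul_invFt hz hβ hβc h
  have i1 := integrable_mul_invFt ih iβ'
  have i2 := (integrable_mul_invFt ih iβ).const_mul I
  have i3 := integrable_mul_invFt (ψ := fun p => phase p * h p) ip iβ
  refine (integral_mul_tensor hη hu hG hh (hβc.toSchwartzMap hβ) hβc
    ((i1.add (i2.sub i3)).congr (hGΦ.mono fun _ e => e.symm))).trans ((integral_congr_ae hGΦ).trans ?_)
  have cA := continuous_sliceTest hf h1 hh
  have cP := continuous_sliceTest hf h1 hh.phase
  have e := integral_mul_sub hβ.continuous hβc cA cP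
  rw [integral_add i1 (g := fun z => I * (f z * (h (proj z) * invFt β (z 2))) -
    f z * (phase (proj z) * h (proj z) * invFt β (z 2))) (i2.sub i3), integral_sub i2 i3, integral_const_mul,
    integral_mul_invFt ih iβ', integral_mul_invFt ih iβ,
    integral_mul_invFt (ψ := fun p => phase p * h p) ip iβ, e, add_sub_cancel_left]

end

attribute [fun_prop] continuous_invFt

/-! ### Identification of the Duhamel term -/

section

variable {h : Plane → ℂ} {u : ℝ → HNegTwo}

lemma contDiff_primitive {φ : ℝ → ℂ} (hφ : ContDiff ℝ ∞ φ) :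
    ContDiff ℝ ∞ fun t => ∫ s in (0 : ℝ)..t, φ s := by
  have hd : ∀ t, HasDerivAt (fun t => ∫ s in (0 : ℝ)..t, φ s) (φ t) t := fun t => by
    simpa using hasDerivAt_primitive hφ.continuous 0 t
  rw [contDiff_infty_iff_deriv]
  refine ⟨fun t => (hd t).differentiableAt, ?_⟩
  rwa [show deriv (fun t => ∫ s in (0 : ℝ)..t, φ s) = φ from funext fun t => (hd t).deriv]

/-- A continuous function with vanishing weak derivative is constant. -/
lemma eq_of_integral_deriv_mul_eq_zero {g : ℝ → ℂ} (hg : Continuous g)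
    (h : ∀ β : ℝ → ℂ, ContDiff ℝ ∞ β → HasCompactSupport β → ∫ t, deriv β t * g t = 0) (r : ℝ) :
    g r = g 0 := by
  have key : (fun t => g t - g (t + r)) = fun _ => 0 := by
    refine Continuous.ae_eq_iff_eq (volume : Measure ℝ) (by fun_prop) continuous_const |>.1 ?_
    refine ae_eq_zero_of_integral_contDiff_smul_eq_zero
      (Continuous.locallyIntegrable (by fun_prop)) fun c hc hcc => ?_
    let φ : ℝ → ℂ := ofRealCLM ∘ c
    have hφ : ContDiff ℝ ∞ φ := by fun_prop
    have hφc : HasCompactSupport φ := hcc.comp_left rfl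
    let β : ℝ → ℂ := fun t => (∫ s in (0 : ℝ)..t, φ s) - ∫ s in (0 : ℝ)..(t - r), φ s
    have hβ : ContDiff ℝ ∞ β := (contDiff_primitive hφ).sub
      ((contDiff_primitive hφ).comp (contDiff_id.sub contDiff_const))
    have hd : ∀ t, deriv β t = φ t - φ (t - r) := fun t => by
      have h1 := hasDerivAt_primitive hφ.continuous 0
      simp only [zero_add] at h1
      exact ((h1 t).sub ((h1 (t - r)).comp_sub_const t r)).deriv
    obtain ⟨R, hR⟩ := exists_eq_zero_of_lt_abs hφc
    have hβc : HasCompactSupport β := by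
      refine HasCompactSupport.of_support_subset_isCompact
        (isCompact_closedBall (0 : ℝ) (R + |r|)) fun t ht => ?_
      rw [mem_closedBall_zero_iff, norm_eq_abs]
      by_contra! hc'
      refine ht ?_
      change (∫ s in (0 : ℝ)..t, φ s) - ∫ s in (0 : ℝ)..(t - r), φ s = 0
      rw [intervalIntegral.integral_interval_sub_left (hφ.continuous.intervalIntegrable _ _)
        (hφ.continuous.intervalIntegrable _ _)]
      refine intervalIntegral.integral_zero_ae (.of_forall fun s hs => hR s ?_)
      have h1 := abs_sub_right_of_mem_uIcc (uIoc_subset_uIcc hs)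
      rw [sub_sub_cancel] at h1
      linarith [abs_sub_abs_le_abs_sub t s]
    have h0 := h β hβ hβc
    simp only [hd, sub_mul] at h0
    have hφr : HasCompactSupport fun t => φ (t - r) := hφc.comp_homeomorph (Homeomorph.subRight r)
    have i1 := integrable_mul hφ.continuous hg hφc
    have cφ := hφ.continuous
    have i2 := integrable_mul (a := fun t => φ (t - r)) (by fun_prop) hg hφr
    have i3 := integrable_mul (b := fun t => g (t + r)) cφ (by fun_prop) hφc
    have e := integral_add_right_eq_self (μ := (volume : Measure ℝ)) (fun t => φ (t - r) * g t) r
    simp only [add_sub_cancel_right] at e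
    rw [integral_sub i1 i2, ← e, ← integral_sub i1 i3] at h0
    rw [← h0]
    refine integral_congr fun t => ?_
    simp only [real_smul, mul_sub]
    rfl
  have := congrFun key 0
  simp only [zero_add] at this
  exact (sub_eq_zero.1 this).symm

lemma hasDerivAt_of_weak {A E : ℝ → ℂ} (hA : Continuous A) (hE : Continuous E)
    (h : ∀ β : ℝ → ℂ, ContDiff ℝ ∞ β → HasCompactSupport β →
      ∫ t, deriv β t * A t = -∫ t, β t * E t) (t : ℝ) : HasDerivAt A (E t) t := by
  have hP : ∀ t, HasDerivAt (fun t => ∫ s in (0 : ℝ)..t, E s) (E t) t := fun t => by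
    simpa using hasDerivAt_primitive hE 0 t
  have cP : Continuous fun t => ∫ s in (0 : ℝ)..t, E s := by fun_prop
  have h1 := eq_of_integral_deriv_mul_eq_zero (hA.sub cP) fun β hβ hβc => by
    have hd := hβ.continuous_deriv (by simp)
    have h2 := integral_mul_deriv_eq_deriv_mul_of_integrable
      (fun t _ => (hβ.differentiable (by simp) t).hasDerivAt) (fun t _ => hP t)
      (integrable_mul hβ.continuous hE hβc) (integrable_mul hd cP hβc.deriv)
      (integrable_mul hβ.continuous cP hβc)
    simp only [Pi.sub_apply, mul_sub]
    rw [integral_sub (integrable_mul hd hA hβc.deriv) (integrable_mul hd cP hβc.deriv), h β hβ hβc, h2]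
    ring
  have e : A = fun t => A 0 + ∫ s in (0 : ℝ)..t, E s := by
    funext t
    have := h1 t
    simp only [Pi.sub_apply, intervalIntegral.integral_same, sub_zero] at this
    rw [← this]
    ring
  rw [e]
  exact hasDerivAt_primitive hE (A 0) t

lemma norm_evolve_sub_le (s t : ℝ) (p : Plane) :
    ‖evolve s p - evolve t p‖ ≤ |s - t| * |phase p| := by
  have e : evolve s p - evolve t p =
      evolve t p * (cexp (I * (((s - t) * phase p : ℝ) : ℂ)) - 1) := by
    rw [evolve, evolve, mul_sub, mul_one, ← Complex.exp_add]
    congr 2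
    push_cast
    ring
  rw [e, norm_mul, norm_evolve, one_mul, ← abs_mul]
  exact norm_exp_I_mul_ofReal_sub_one_le

lemma hasDerivAt_evolve_neg (t : ℝ) (p : Plane) :
    HasDerivAt (fun t => evolve (-t) p) (-(I * phase p * evolve (-t) p)) t := by
  have e : (fun t => evolve (-t) p) = fun t : ℝ => cexp (-(I * phase p) * (t : ℂ)) := by
    funext t
    rw [evolve]
    congr 1
    push_cast
    ring
  have h1 : HasDerivAt (fun t : ℝ => (t : ℂ)) 1 t := ofRealCLM.hasDerivAt
  have h2 := (h1.const_mul (-(I * phase p))).cexp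
  rw [show evolve (-t) p = _ from congrFun e t, e]
  refine h2.congr_deriv ?_
  ring

lemma integrable_sliceTest (hf : Measurable f) (h1 : mixNorm f ≠ ⊤) (hh : IsTest h) (t : ℝ) :
    Integrable fun p => timeSlice f t p * h p :=
  (integrable_fiberMass_mul hf h1 hh.memLp).mono' ((measurable_timeSlice_right hf t).mul
    hh.smooth.continuous.measurable).aestronglyMeasurable (.of_forall fun p => by
      rw [norm_mul]
      exact mul_le_mul_of_nonneg_right (norm_timeSlice_le f t p) (norm_nonneg _))

lemma intervalIntegrable_freeEvolution (hu : Continuous u) (t : ℝ) :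
    IntervalIntegrable (fun s => freeEvolution (t - s) (u s)) volume 0 t :=
  (Continuous.freeEvolution (continuous_const.sub continuous_id) hu).intervalIntegrable _ _

lemma locallyIntegrable_hNegTwo (hη : IsBump η) (v : HNegTwo) : LocallyIntegrable v := by
  rw [locallyIntegrable_iff]
  intro K hK
  obtain ⟨R, hR⟩ := hK.isBounded.exists_norm_le
  obtain ⟨n, hn⟩ := exists_nat_gt R
  have hc : HasCompactSupport fun p : Plane => ballCut η (((n : ℝ) + 1)⁻¹ • p) :=
    (hasCompactSupport_ballCut hη).comp_smul (by positivity)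
  have hs : ContDiff ℝ ∞ fun p : Plane => ballCut η (((n : ℝ) + 1)⁻¹ • p) :=
    (contDiff_ballCut hη).comp (contDiff_const_smul _)
  refine (integrable_hNegTwo_mul v (hc.toSchwartzMap hs)).integrableOn.congr_fun (fun p hp => ?_)
    hK.measurableSet
  change v p * ballCut η (((n : ℝ) + 1)⁻¹ • p) = v p
  rw [ballCut_eq_one hη, mul_one]
  rw [norm_smul, norm_of_nonneg (by positivity), inv_mul_eq_div, div_lt_one (by positivity)]
  linarith [hR p hp]

lemma locallyIntegrable_duhamelFt (hf : Measurable f) (h1 : mixNorm f ≠ ⊤) (t : ℝ) :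
    LocallyIntegrable fun p => duhamelFt f t p := by
  have hm : Measurable fun p => duhamelFt f t p :=
    Measurable.comp (g := fun q : Plane × ℝ => duhamelFt f q.2 q.1)
      (f := fun p : Plane => (p, t)) (measurable_duhamelFt hf) (by fun_prop)
  have := (((memLp_fiberMass hf h1).const_mul (2 + |t|)).locallyIntegrable (by norm_num))
  exact this.mono hm.aestronglyMeasurable
    (.of_forall fun p => (norm_duhamelFt_le f t p).trans (le_abs_self _))

section

variable (hη : IsBump η) (hu : Continuous u) (hG : HasFourier u G) (hf : Measurable f)
  (h1 : mixNorm f ≠ ⊤) (hfG : ∀ᵐ z, G z = κ z * f z)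
include hη hu hG hf h1 hfG

lemma hasDerivAt_sliceTest (hh : IsTest h) (t : ℝ) :
    HasDerivAt (sliceTest f h) (I * testL hh.schwartz (u t) + sliceTest f h t +
      I * sliceTest f (fun p => phase p * h p) t) t := by
  have cA := continuous_sliceTest hf h1 hh
  have cP := continuous_sliceTest hf h1 hh.phase
  have cB := (testL hh.schwartz).continuous.comp hu
  refine hasDerivAt_of_weak cA (((continuous_const.mul cB).add cA).add (continuous_const.mul cP))
    (fun β hβ hβc => ?_) t
  have h2 := integral_mul_testL hη hu hG hf h1 hfG hh hβ hβc
  simp only [mul_assoc, integral_const_mul] at h2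
  have ii : ∀ {b : ℝ → ℂ}, Continuous b → Integrable fun t => β t * b t := fun hb =>
    integrable_mul hβ.continuous hb hβc
  have e1 : ∫ t, β t * (I * sliceTest f h t - sliceTest f (fun p => phase p * h p) t) =
      I * (∫ t, β t * sliceTest f h t) - ∫ t, β t * sliceTest f (fun p => phase p * h p) t := by
    rw [← integral_const_mul, ← integral_sub ((ii cA).const_mul _) (ii cP)]
    exact integral_congr fun t => by ring
  have e2 : ∫ t, β t * (I * testL hh.schwartz (u t) + sliceTest f h t +
      I * sliceTest f (fun p => phase p * h p) t) =
      I * (∫ t, β t * testL hh.schwartz (u t)) + (∫ t, β t * sliceTest f h t) +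
        I * ∫ t, β t * sliceTest f (fun p => phase p * h p) t := by
    have iB : Integrable fun t => I * (β t * testL hh.schwartz (u t)) := (ii cB).const_mul _
    have iBA : Integrable fun t => I * (β t * testL hh.schwartz (u t)) +
      β t * sliceTest f h t := iB.add (ii cA)
    rw [← integral_const_mul, ← integral_const_mul, ← integral_add iB (ii cA),
      ← integral_add iBA ((ii cP).const_mul _)]
    exact integral_congr fun t => by ring
  rw [e1] at h2
  refine Eq.trans ?_ (congrArg Neg.neg e2).symm
  rw [h2]
  linear_combination ((∫ t, deriv β t * sliceTest f h t) + ∫ t, β t * sliceTest f h t) * I_mul_I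

lemma hasDerivAt_sliceTest_evolve (hh : IsTest h) (t : ℝ) :
    HasDerivAt (fun s => sliceTest f (fun p => evolve (-s) p * h p) s)
      (I * testL (hh.evolve (-t)).schwartz (u t) +
        sliceTest f (fun p => evolve (-t) p * h p) t) t := by
  have hQ := hasDerivAt_sliceTest hη hu hG hf h1 hfG (hh.evolve (-t)) t
  have hR : HasDerivAt (fun s => ∫ p, (evolve (-s) p - evolve (-t) p) * (timeSlice f s p * h p))
      (∫ p, (-(I * phase p * evolve (-t) p)) * (timeSlice f t p * h p)) t := by
    rw [hasDerivAt_iff_tendsto_slope]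
    have e : slope (fun s => ∫ p, (evolve (-s) p - evolve (-t) p) * (timeSlice f s p * h p)) t =
        fun s => ∫ p, slope (fun s => evolve (-s) p) t s * (timeSlice f s p * h p) := by
      funext s
      rw [slope_def_module]
      simp only [sub_self, zero_mul, integral_zero, sub_zero]
      rw [← integral_smul]
      refine integral_congr fun p => ?_
      simp only [slope_def_module, smul_mul_assoc]
    rw [e]
    refine tendsto_integral_filter_of_dominated_convergence
      (fun p => fiberMass f p * ‖(phase p : ℂ) * h p‖) (.of_forall fun s => ?_)
      (.of_forall fun s => .of_forall fun p => ?_)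
      (integrable_fiberMass_mul hf h1 hh.phase.memLp) ?_
    · simp only [slope_def_module]
      exact ((((measurable_evolve_left _).sub (measurable_evolve_left _)).const_smul _).mul
        ((measurable_timeSlice_right hf s).mul
          hh.smooth.continuous.measurable)).aestronglyMeasurable
    · have h2 : ‖slope (fun s => evolve (-s) p) t s‖ ≤ |phase p| := by
        rw [slope_def_module, norm_smul, norm_inv, norm_eq_abs]
        refine inv_mul_le_of_le_mul₀ (abs_nonneg _) (abs_nonneg _)
          ((norm_evolve_sub_le _ _ _).trans (le_of_eq ?_))
        rw [neg_sub_neg, abs_sub_comm]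
      rw [norm_mul, norm_mul, norm_mul, norm_real, norm_eq_abs]
      calc _ ≤ |phase p| * (fiberMass f p * ‖h p‖) := by gcongr; exact norm_timeSlice_le f s p
        _ = _ := by ring
    · filter_upwards [fiberIntegrable_of_mixNorm hf h1] with p hp
      exact (hasDerivAt_iff_tendsto_slope.1 (hasDerivAt_evolve_neg t p)).mul
        ((((continuous_timeSlice hp).tendsto t).mul_const (h p)).mono_left nhdsWithin_le_nhds)
  have e : (fun s => sliceTest f (fun p => evolve (-s) p * h p) s) = fun s =>
      sliceTest f (fun p => evolve (-t) p * h p) s +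
        ∫ p, (evolve (-s) p - evolve (-t) p) * (timeSlice f s p * h p) := by
    funext s
    have i1 := integrable_sliceTest hf h1 (hh.evolve (-s)) s
    have i2 := integrable_sliceTest hf h1 (hh.evolve (-t)) s
    rw [← sub_eq_iff_eq_add', sliceTest, sliceTest, ← integral_sub i1 i2]
    exact integral_congr fun p => by ring
  rw [e]
  refine (hQ.add hR).congr_deriv ?_
  have e2 : ∫ p, (-(I * phase p * evolve (-t) p)) * (timeSlice f t p * h p) =
      -(I * sliceTest f (fun p => phase p * (evolve (-t) p * h p)) t) := by
    rw [sliceTest, ← integral_const_mul, ← integral_neg]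
    exact integral_congr fun p => by ring
  rw [e2]
  ring

lemma testL_duhamel (hh : IsTest h) (t : ℝ) :
    testL hh.schwartz (duhamel u t) = ∫ p, duhamelFt f t p * h p := by
  have hh' := hh.evolve t
  have hee : ∀ s p, evolve (-s) p * (evolve t p * h p) = evolve (t - s) p * h p := fun s p => by
    rw [evolve, evolve, evolve, ← mul_assoc, ← Complex.exp_add]
    congr 2
    push_cast
    ring
  let H : ℝ → ℂ := fun s => sliceTest f (fun p => evolve (t - s) p * h p) s
  let B : ℝ → ℂ := fun s => testL hh.schwartz (freeEvolution (t - s) (u s))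
  have hB : ∀ s, B s = testL (hh'.evolve (-s)).schwartz (u s) := fun s => by
    simp only [B, testL_freeEvolution]
    congr 2
    ext p
    exact (hee s p).symm
  have cB : Continuous B := (testL hh.schwartz).continuous.comp
    (Continuous.freeEvolution (continuous_const.sub continuous_id) hu)
  have hd : ∀ s, HasDerivAt H (I * B s + H s) s := fun s => by
    have := hasDerivAt_sliceTest_evolve hη hu hG hf h1 hfG hh' s
    rw [← hB] at this
    simpa only [hee] using this
  have cH : Continuous H := continuous_iff_continuousAt.2 fun s => (hd s).continuousAt
  have ftc := intervalIntegral.integral_eq_sub_of_hasDerivAt (a := 0) (b := t) (fun s _ => hd s)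
    (((continuous_const.mul cB).add cH).intervalIntegrable _ _)
  have iB : IntervalIntegrable (fun s => I * B s) volume 0 t :=
    (continuous_const.mul cB).intervalIntegrable _ _
  rw [intervalIntegral.integral_add iB (cH.intervalIntegrable _ _),
    intervalIntegral.integral_const_mul] at ftc
  have e1 : testL hh.schwartz (duhamel u t) = ∫ s in (0 : ℝ)..t, B s :=
    ((testL hh.schwartz).intervalIntegral_comp_comm (intervalIntegrable_freeEvolution hu t)).symm
  have i0 := (integrable_sliceTest hf h1 hh t)
  have i1 := integrable_sliceTest hf h1 (hh.evolve t) 0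
  have hc : Integrable (fun _ : ℝ => (1 : ℝ)) (volume.restrict (uIoc 0 t)) :=
    (continuous_const.integrableOn_uIcc (a := 0) (b := t)).mono_set uIoc_subset_uIcc
  have ip : Integrable (fun q : Plane × ℝ => evolve (t - q.2) q.1 * timeSlice f q.2 q.1 * h q.1)
      (volume.prod (volume.restrict (uIoc 0 t))) :=
    integrable_param_mul (measurable_evolve_mul_timeSlice hf t) hc
      ((memLp_fiberMass hf h1).locallyIntegrable (by norm_num)) (fun s p => by
        rw [norm_mul, norm_evolve]
        exact mul_le_mul_of_nonneg_left (norm_timeSlice_le f s p) zero_le_one)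
      hh.smooth.continuous hh.compact
  have e2 : ∫ s in (0 : ℝ)..t, H s =
      ∫ p, (∫ s in (0 : ℝ)..t, evolve (t - s) p * timeSlice f s p) * h p := by
    have := intervalIntegral_integral_swap (a := 0) (b := t) (μ := (volume : Measure Plane))
      (f := fun s p => evolve (t - s) p * timeSlice f s p * h p) ip.swap
    simp only [intervalIntegral.integral_mul_const] at this
    rw [← this]
    refine intervalIntegral.integral_congr fun s _ => ?_
    refine integral_congr fun p => ?_
    ring
  have i2 : Integrable fun p => (∫ s in (0 : ℝ)..t, evolve (t - s) p * timeSlice f s p) * h p := by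
    have h3 := ip.integral_prod_left.const_mul (if (0 : ℝ) ≤ t then 1 else -1 : ℂ)
    refine h3.congr (.of_forall fun p => ?_)
    simp only [intervalIntegral.intervalIntegral_eq_integral_uIoc, real_smul, integral_mul_const]
    split_ifs <;> simp
  have e3 : ∫ p, duhamelFt f t p * h p = -I * H t + I * H 0 + I * ∫ s in (0 : ℝ)..t, H s := by
    have e4 : H t = ∫ p, timeSlice f t p * h p := by simp [H, sliceTest, evolve]
    have e5 : H 0 = ∫ p, timeSlice f 0 p * (evolve t p * h p) := by
      simp only [H, sliceTest, sub_zero]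
    have i3 : Integrable fun p => -I * (timeSlice f t p * h p) +
        I * (timeSlice f 0 p * (evolve t p * h p)) := (i0.const_mul _).add (i1.const_mul _)
    rw [e2, e4, e5, ← integral_const_mul, ← integral_const_mul, ← integral_const_mul,
      ← integral_add (i0.const_mul _) (i1.const_mul _),
      ← integral_add i3 (i2.const_mul _)]
    refine integral_congr fun p => ?_
    simp only [duhamelFt_eq]
    ring
  rw [e1, e3]
  linear_combination -I * ftc + (∫ s in (0 : ℝ)..t, B s) * I_mul_I

lemma duhamel_ae_eq (t : ℝ) :
    duhamel u t =ᵐ[volume] fun p => duhamelFt f t p := by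
  have hU : IsOpen {p : Plane | p 0 ≠ 0} := isOpen_ne_fun (by fun_prop) continuous_const
  have l1 := locallyIntegrable_hNegTwo hη (duhamel u t)
  have l2 := locallyIntegrable_duhamelFt hf h1 t
  have h2 := hU.ae_eq_zero_of_integral_contDiff_smul_eq_zero ((l1.sub l2).locallyIntegrableOn _)
    fun c hc hcc hcs => by
      have hφ : IsTest (ofRealCLM ∘ c) := ⟨by fun_prop, hcc.comp_left rfl,
        (closure_mono (support_comp_subset (map_zero _) c)).trans hcs⟩
      have h3 := testL_duhamel hη hu hG hf h1 hfG hφ t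
      rw [testL_apply, ← sub_eq_zero, ← integral_sub (integrable_hNegTwo_mul _ _)
        (integrable_mul_of_compact l2 hφ.smooth.continuous hφ.compact)] at h3
      rw [← h3]
      refine integral_congr fun p => ?_
      simp only [Pi.sub_apply, real_smul, IsTest.schwartz_apply, comp_apply, ofRealCLM_apply]
      ring
  filter_upwards [h2, ae_fst_ne_zero] with p hp hp0
  exact sub_eq_zero.1 (hp hp0)

end

end

/-! ### The truncated Duhamel term as a function on space-time -/

section

variable {u : ℝ → HNegTwo}

/-- `F` is the partial Fourier transform of `a` in the last variable. -/
structure IsTimeFt (a F : Amp) : Prop where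
  left : Measurable a
  right : Measurable F
  memLp : MemLp F 2
  fiber : ∀ᵐ p : Plane, Continuous (fun t => a (atTime t p)) ∧
    HasCompactSupport (fun t => a (atTime t p)) ∧ ∀ τ, F (atTime τ p) = ft (fun t => a (atTime t p)) τ

lemma IsTimeFt.memLp_left {a : Amp} (h : IsTimeFt a F) : MemLp a 2 := by
  refine ⟨h.left.aestronglyMeasurable, ?_⟩
  have h1 : eLpNorm a 2 ^ 2 ≤ eLpNorm F 2 ^ 2 := by
    rw [eLpNorm_two_sq, eLpNorm_two_sq, lintegral_atTime (h.left.enorm.pow_const 2),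
      lintegral_atTime (h.right.enorm.pow_const 2)]
    refine lintegral_mono_ae ?_
    filter_upwards [h.fiber] with p ⟨h1, h2, h3⟩
    simp_rw [h3]
    rw [lintegral_ft_sq (h1.integrable_of_hasCompactSupport h2) (h1.memLp_of_hasCompactSupport h2)]
    refine le_mul_of_one_le_left' ?_
    rw [one_le_ofReal]
    linarith [pi_gt_three]
  exact (ennreal_le_of_sq_le h1).trans_lt h.memLp.2

lemma IsTimeFt.integral_mul_conj {a b K : Amp} (ha : IsTimeFt a F)
    (hb : IsTimeFt b K) : ∫ ζ, F ζ * conj (K ζ) = 2 * π * ∫ z, a z * conj (b z) := by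
  have i1 : Integrable fun ζ => F ζ * conj (K ζ) := ha.memLp.integrable_mul hb.memLp.star
  have i2 : Integrable fun z => a z * conj (b z) := ha.memLp_left.integrable_mul hb.memLp_left.star
  rw [integral_atTime i1, integral_atTime i2, ← integral_const_mul]
  refine integral_congr_ae ?_
  filter_upwards [ha.fiber, hb.fiber] with p ⟨a1, a2, a3⟩ ⟨b1, b2, b3⟩
  simp_rw [a3, b3]
  exact integral_ft_conj_ft (a1.integrable_of_hasCompactSupport a2)
    (a1.memLp_of_hasCompactSupport a2) (b1.integrable_of_hasCompactSupport b2)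
    (b1.memLp_of_hasCompactSupport b2)

lemma isTimeFt_duhamelOp (hη : IsBump η) (hf : Measurable f) (h1 : mixNorm f ≠ ⊤)
    (hT : MemLp (duhamelOp η f) 2) :
    IsTimeFt (fun z => (η (z 2) : ℂ) * duhamelFt f (z 2) (proj z)) (duhamelOp η f) where
  left := (measurable_bump_mul hη (measurable_duhamelFt hf)).comp
    (measurable_id.prodMk (by fun_prop : Measurable fun z : Spacetime => z 2))
  right := measurable_duhamelOp hη hf
  memLp := hT
  fiber := by
    filter_upwards [fiberIntegrable_of_mixNorm hf h1] with p hp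
    simp only [proj_atTime, atTime_apply_two, duhamelOp, implies_true, and_true]
    have hc := Complex.continuous_ofReal.comp hη.continuous
    exact ⟨hc.mul (continuous_duhamelFt hp),
      (hη.hasCompactSupport.comp_left Complex.ofReal_zero).mul_right⟩

/-- The partial inverse Fourier transform of a Schwartz function in the first two variables. -/
def planeFt (Φ : 𝓢(Spacetime, ℂ)) (z : Spacetime) : ℂ :=
  schwartzFourierInv 2 (slice (z 2) Φ) (proj z)

lemma planeFt_eq (Φ : 𝓢(Spacetime, ℂ)) (z : Spacetime) :
    planeFt Φ z = (((2 * π) ^ 2 : ℝ) : ℂ)⁻¹ *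
      ∫ x : Plane, cexp (I * (inner ℝ x (proj z) : ℝ)) * Φ (atTime (z 2) x) :=
  schwartzFourierInv_apply _ _ _

lemma continuous_planeFt {Φ : 𝓢(Spacetime, ℂ)} (hΦ : HasCompactSupport Φ) :
    Continuous (planeFt Φ) := by
  obtain ⟨M, hM⟩ := hΦ.exists_bound_of_continuous Φ.continuous
  obtain ⟨R, hR⟩ := hΦ.isCompact.isBounded.exists_norm_le
  rw [show planeFt Φ = _ from funext (planeFt_eq Φ)]
  refine continuous_const.mul (continuous_of_dominated
    (bound := (closedBall (0 : Plane) R).indicator fun _ => M) (fun z => ?_)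
    (fun z => .of_forall fun x => ?_) ?_ (.of_forall fun x => ?_))
  · fun_prop
  · rw [norm_mul, norm_exp_I_mul, one_mul]
    by_cases hx : x ∈ closedBall (0 : Plane) R
    · rw [indicator_of_mem hx]; exact hM _
    · refine (norm_eq_zero.2 (image_eq_zero_of_notMem_tsupport fun hc => ?_)).le.trans_eq
        (indicator_of_notMem hx _).symm
      refine hx (mem_closedBall_zero_iff.2 (le_trans ?_ (hR _ hc)))
      have := projL.le_of_opNorm_le norm_projL_le (atTime (z 2) x)
      rwa [one_mul, projL_apply, proj_atTime] at this
  · exact (integrable_indicator_iff isClosed_closedBall.measurableSet).2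
      (continuousOn_const.integrableOn_compact (isCompact_closedBall _ _))
  · have h1 : Continuous fun z : Spacetime => atTime (z 2) x :=
      continuous_atTime.comp ((by fun_prop : Continuous fun z : Spacetime => z 2).prodMk continuous_const)
    have h2 := Φ.continuous.comp h1
    have h3 := continuous_proj
    fun_prop

lemma schwartzFourierInv_atTime {Φ : 𝓢(Spacetime, ℂ)} (τ : ℝ) (p : Plane) :
    2 * π * schwartzFourierInv 3 Φ (atTime τ p) =
      ∫ t : ℝ, cexp (I * ((t * τ : ℝ) : ℂ)) * planeFt Φ (atTime t p) := by
  have hi : Integrable fun z : Spacetime => cexp (I * (inner ℝ z (atTime τ p) : ℝ)) * Φ z := by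
    refine Φ.integrable.norm.mono' (Continuous.aestronglyMeasurable (by fun_prop))
      (.of_forall fun z => ?_)
    rw [norm_mul, norm_exp_I_mul, one_mul]
  have hπ : (π : ℂ) ≠ 0 := by exact_mod_cast pi_ne_zero
  rw [schwartzFourierInv_apply, integral_atTime' hi, ← mul_assoc, ← integral_const_mul]
  refine integral_congr fun t => ?_
  simp only [inner_atTime, planeFt_eq, proj_atTime, atTime_apply_two]
  have e : ∀ x : Plane, cexp (I * ((inner ℝ x p + t * τ : ℝ) : ℂ)) * Φ (atTime t x) =
      cexp (I * ((t * τ : ℝ) : ℂ)) * (cexp (I * (inner ℝ x p : ℝ)) * Φ (atTime t x)) := fun x => by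
    rw [← mul_assoc, ← Complex.exp_add]
    congr 2
    push_cast
    ring
  simp_rw [e]
  rw [integral_const_mul]
  generalize (∫ x : Plane, cexp (I * (inner ℝ x p : ℝ)) * Φ (atTime t x)) = J
  generalize cexp (I * ((t * τ : ℝ) : ℂ)) = E
  push_cast
  field_simp

lemma isTimeFt_planeFt {Φ : 𝓢(Spacetime, ℂ)} (hΦ : HasCompactSupport Φ) :
    IsTimeFt (fun z => conj (planeFt Φ z))
      fun ζ => conj (2 * π * schwartzFourierInv 3 Φ ζ) where
  left := (continuous_conj.comp (continuous_planeFt hΦ)).measurable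
  right := (continuous_conj.comp
    (continuous_const.mul (schwartzFourierInv 3 Φ).continuous)).measurable
  memLp := by
    have h := ((schwartzFourierInv 3 Φ).memLp 2 volume).const_mul (2 * π : ℂ)
    exact h.star
  fiber := by
    refine .of_forall fun p => ⟨?_, ?_, fun τ => ?_⟩
    · exact continuous_conj.comp ((continuous_planeFt hΦ).comp
        (continuous_atTime.comp (continuous_id.prodMk continuous_const)))
    · obtain ⟨R, hR⟩ := hΦ.isCompact.isBounded.exists_norm_le
      refine HasCompactSupport.of_support_subset_isCompact (isCompact_closedBall (0 : ℝ) R)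
        fun t ht => ?_
      by_contra hc
      rw [mem_closedBall_zero_iff, not_le] at hc
      refine ht ?_
      have h0 : ∀ x, Φ (atTime t x) = 0 := fun x => image_eq_zero_of_notMem_tsupport fun h =>
        absurd ((PiLp.norm_apply_le (atTime t x) 2).trans (hR _ h)) (not_le.2 hc)
      simp only [planeFt_eq, atTime_apply_two, h0, mul_zero, integral_zero, map_zero]
    · simp only [schwartzFourierInv_atTime, ft]
      rw [← integral_conj]
      refine integral_congr fun t => ?_
      simp only [map_mul, ← exp_conj, conj_I, conj_ofReal, neg_mul]

lemma toTemperedDistribution_eq (w : L2) (Φ : 𝓢(Spacetime, ℂ)) :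
    Lp.toTemperedDistribution w Φ = ∫ z, w z * Φ z := by
  rw [Lp.toTemperedDistribution_apply]
  exact integral_congr fun z => mul_comm _ _

lemma pair_smul_duhamel (c : ℂ) (v : HNegTwo) (g : 𝓢(Plane, ℂ)) :
    HNegTwo.pair (c • v) g = c * v.pair g := by
  rw [pair_eq, map_smul, smul_eq_mul, pair_eq]

lemma isPath_of_l2FourierInv (hη : IsBump η) (hf : Measurable f) (h1 : mixNorm f ≠ ⊤)
    (hT : MemLp (duhamelOp η f) 2) (hd : ∀ t, duhamel u t =ᵐ[volume] fun p => duhamelFt f t p)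
    {w : L2} (hw : w =ᵐ[volume] l2FourierInv (hT.toLp _)) :
    IsPath (fun t => (η t : ℂ) • duhamel u t) (Lp.toTemperedDistribution w) := by
  intro Φ hΦ
  have hA := isTimeFt_duhamelOp hη hf h1 hT
  have hB := isTimeFt_planeFt hΦ
  have hAB := hA.integral_mul_conj hB
  simp only [conj_conj] at hAB
  have i2 : Integrable fun z => (η (z 2) : ℂ) * duhamelFt f (z 2) (proj z) * planeFt Φ z := by
    refine (hA.memLp_left.integrable_mul hB.memLp_left.star).congr
      (.of_forall fun z => ?_)
    simp only [Pi.mul_apply, Pi.star_apply, RCLike.star_def, conj_conj]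
  have e1 : Lp.toTemperedDistribution w Φ = ∫ ζ, duhamelOp η f ζ * schwartzFourierInv 3 Φ ζ := by
    rw [toTemperedDistribution_eq, integral_congr_ae (hw.mono fun z hz => congrArg (· * Φ z) hz), integral_l2FourierInv_mul]
    exact integral_congr_ae (hT.coeFn_toLp.mono fun z hz => by simp only [hz])
  have e2 : ∫ t : ℝ, HNegTwo.pair ((η t : ℂ) • duhamel u t) (slice t Φ) =
      ∫ z, (η (z 2) : ℂ) * duhamelFt f (z 2) (proj z) * planeFt Φ z := by
    rw [integral_atTime' i2]
    refine integral_congr fun t => ?_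
    refine (pair_smul_duhamel _ _ _).trans ?_
    rw [HNegTwo.pair, ← integral_const_mul]
    refine integral_congr_ae ((hd t).mono fun p hp => ?_)
    simp only [hp, planeFt, proj_atTime, atTime_apply_two, mul_assoc]
  have hπ : (2 * π : ℂ) ≠ 0 := by exact_mod_cast two_pi_pos.ne'
  refine mul_left_cancel₀ hπ ?_
  rw [e1, e2, ← hAB, ← integral_const_mul]
  exact integral_congr fun ζ => by ring

lemma IsPath.support (hη : IsBump η) {v : ℝ → HNegTwo} {w : L2}
    (h : IsPath (fun t => (η t : ℂ) • v t) (Lp.toTemperedDistribution w)) :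
    ∀ᵐ z : Spacetime, z 2 ∉ Icc (-2 : ℝ) 2 → w z = 0 := by
  have hU : IsOpen {z : Spacetime | z 2 ∉ Icc (-2 : ℝ) 2} :=
    (isClosed_Icc.preimage (by fun_prop : Continuous fun z : Spacetime => z 2)).isOpen_compl
  refine hU.ae_eq_zero_of_integral_contDiff_smul_eq_zero
    (((Lp.memLp w).locallyIntegrable (by norm_num)).locallyIntegrableOn _) fun c hc hcc hcs => ?_
  have hcc' : HasCompactSupport (ofRealCLM ∘ c) := hcc.comp_left rfl
  have hc' : ContDiff ℝ ∞ (ofRealCLM ∘ c) := by fun_prop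
  have h1 := h (hcc'.toSchwartzMap hc') hcc'
  rw [toTemperedDistribution_eq] at h1
  have e : ∫ z, c z • w z = ∫ z, w z * hcc'.toSchwartzMap hc' z := integral_congr fun z => by
      change c z • w z = w z * (c z : ℂ)
      rw [real_smul, mul_comm]
  rw [e, h1]
  refine integral_eq_zero_of_ae (.of_forall fun t => ?_)
  simp only [pair_smul_duhamel, Pi.zero_apply]
  by_cases ht : 2 < |t|
  · rw [hη.eq_zero_of_two_lt ht, Complex.ofReal_zero, zero_mul]
  · have hs : slice t (hcc'.toSchwartzMap hc') = 0 := by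
      ext p
      change ((c (atTime t p) : ℝ) : ℂ) = 0
      rw [image_eq_zero_of_notMem_tsupport fun hm => hcs hm (abs_le.1 (not_lt.1 ht)),
        Complex.ofReal_zero]
    have h0 := pair_smul (v t) 0 (slice t (hcc'.toSchwartzMap hc'))
    rw [zero_smul, zero_mul] at h0
    rw [hs, h0, mul_zero]

lemma IsPath.unique {v : ℝ → HNegTwo} {w w' : L2}
    (h : IsPath v (Lp.toTemperedDistribution w)) (h' : IsPath v (Lp.toTemperedDistribution w')) :
    w = w' := by
  refine Lp.ext (ae_eq_of_integral_mul_schwartz ((Lp.memLp w).locallyIntegrable (by norm_num))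
    ((Lp.memLp w').locallyIntegrable (by norm_num)) fun φ hφ => ?_)
  rw [← toTemperedDistribution_eq, ← toTemperedDistribution_eq, h φ hφ, h' φ hφ]

lemma HasFourier.aestronglyMeasurable (hG : HasFourier u G) : AEStronglyMeasurable G volume := by
  have h0 : ∀ᵐ z : Spacetime, z ∈ {z : Spacetime | z 0 ≠ 0} := ae_of_ae_atTime ae_fst_ne_zero
  have h := hG.1.aestronglyMeasurable
  rwa [Measure.restrict_eq_self_of_ae_mem h0] at h

lemma exists_isPath_of_hasFourier (hη : IsBump η) {C : ℝ≥0}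
    (hC : ∀ f : Amp, Measurable f → vwSum η f ≠ ⊤ → vwSum η (duhamelOp η f) ^ ½ ≤ C * vwSum η f ^ ½)
    (hu : Continuous u) (hG : HasFourier u G) (hfin : vwSum η (fun z => (κ z)⁻¹ * G z) ≠ ⊤) :
    ∃ w : L2, IsPath (fun t => (η t : ℂ) • duhamel u t) (Lp.toTemperedDistribution w) ∧
      fNorm η w ≤ C * vwSum η (fun z => (κ z)⁻¹ * G z) ^ ½ := by
  have hm : AEStronglyMeasurable (fun z => (κ z)⁻¹ * G z) volume :=
    measurable_resolvent.aestronglyMeasurable.mul hG.aestronglyMeasurable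
  obtain ⟨f, hfs, hfe⟩ := hm
  have hf := hfs.measurable
  rw [vwSum_congr hfe] at hfin ⊢
  have h1 := mixNorm_ne_top_of_vwSum hη hf hfin
  have hfG : ∀ᵐ z, G z = κ z * f z := hfe.mono fun z hz => by
    have h0 : (modulation z : ℂ) + I ≠ 0 := fun h => by have := congrArg im h; simp at this
    rw [← hz, mul_inv_cancel_left₀ h0]
  have hCf := hC f hf hfin
  have hT2 : vwSum η (duhamelOp η f) ≠ ⊤ := fun h => by
    rw [h, top_rpow_of_pos (by norm_num), top_le_iff] at hCf
    exact mul_ne_top (by simp) (rpow_ne_top_of_nonneg (by norm_num) hfin) hCf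
  have hTm := measurable_duhamelOp hη hf
  have hT : MemLp (duhamelOp η f) 2 :=
    ⟨hTm.aestronglyMeasurable, (eLpNorm_ne_top_of_vwSum hη hTm hT2).lt_top⟩
  have hw := (memLp_l2FourierInv (hT.toLp _)).coeFn_toLp
  refine ⟨(memLp_l2FourierInv (hT.toLp _)).toLp _,
    isPath_of_l2FourierInv hη hf h1 hT (duhamel_ae_eq hη hu hG hf h1 hfG) hw, ?_⟩
  have e := (l2Fourier_l2FourierInv _ _ hw).trans hT.coeFn_toLp
  exact (congrArg (· ^ ½) (vwSum_congr (η := η) e)).le.trans hCf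

lemma nNorm_eq (η : ℝ → ℝ) (u : ℝ → HNegTwo) : nNorm η u = ⨅ (G : Amp)
    (_ : HasFourier u G), vwSum η (fun z => (κ z)⁻¹ * G z) ^ ½ := by
  simp only [nNorm, vwSum, mul_assoc]

end

attribute [fun_prop] continuous_planeFt

end KPI

end

theorem proposition3p2 (η : ℝ → ℝ) (hη : KPI.IsBump η) :
    ∃ C : ℝ≥0, ∀ u : ℝ → KPI.HNegTwo, KPI.MemN η u →
      (∀ t : ℝ, IntervalIntegrable (fun s => KPI.freeEvolution (t - s) (u s)) volume 0 t) ∧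
      ∃ w : Lp ℂ 2 (volume : Measure KPI.Spacetime),
        KPI.IsPath (fun t => (η t : ℂ) • KPI.duhamel u t) (Lp.toTemperedDistribution w) ∧
        KPI.MemF η w ∧ KPI.fNorm η w ≤ C * KPI.nNorm η u := by
  obtain ⟨C, hC0, hC⟩ := KPI.exists_vwSum_duhamelOp_le hη
  have hC1 : (C : ℝ≥0∞) ≠ 0 := by simpa using hC0.ne'
  refine ⟨C, fun u ⟨hu, hfin⟩ => ⟨KPI.intervalIntegrable_freeEvolution hu, ?_⟩⟩
  have hlt := hfin
  rw [KPI.nNorm_eq] at hlt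
  obtain ⟨G, hlt⟩ := iInf_lt_iff.1 hlt
  obtain ⟨hG, hlt⟩ := iInf_lt_iff.1 hlt
  have hsum : ∀ {a : ℝ≥0∞}, a ^ (1 / 2 : ℝ) ≠ ⊤ → a ≠ ⊤ := fun h ha =>
    h (by rw [ha, ENNReal.top_rpow_of_pos (by norm_num)])
  obtain ⟨w, hw, -⟩ := KPI.exists_isPath_of_hasFourier hη hC hu hG (hsum hlt.ne)
  have hle : KPI.fNorm η w ≤ C * KPI.nNorm η u := by
    rw [← ENNReal.div_le_iff' hC1 (by simp), KPI.nNorm_eq]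
    refine le_iInf fun G' => le_iInf fun hG' => ?_
    rw [ENNReal.div_le_iff' hC1 (by simp)]
    by_cases hs : KPI.vwSum η (fun ζ => ((KPI.modulation ζ : ℂ) + Complex.I)⁻¹ * G' ζ) = ⊤
    · rw [hs, ENNReal.top_rpow_of_pos (by norm_num), ENNReal.mul_top hC1]
      exact le_top
    · obtain ⟨w', hw', hle'⟩ := KPI.exists_isPath_of_hasFourier hη hC hu hG' hs
      rwa [hw.unique hw']
  exact ⟨w, hw, ⟨hw.support hη, hle.trans_lt (ENNReal.mul_lt_top (by simp) hfin)⟩, hle⟩
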